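/- Let $M$ be a smooth supermanifold and $E\to M$ a smooth super vector bundle of finite rank. Let $\Pi E^*$ be the total space of the parity-reversed dual bundle, with local coordinates $(x^A,\eta_\alpha)$, where the fibre coordinates $\eta_\alpha$ correspond to a local frame $s_\alpha$ of $E$ and have the opposite parity. On a cotangent bundle, with coordinates $z^A$ and conjugate momenta $p_A$ of the same parity, use the canonical Poisson bracket $$\{F,G\}=(-1)^{\tilde A\tilde F+\tilde A}\frac{\partial F}{\partial p_A}\frac{\partial G}{\partial z^A}-(-1)^{\tilde A\tilde F}\frac{\partial F}{\partial z^A}\frac{\partial G}{\partial p_A}.$$ Assign weight $0$ to $x^A$, weight $1$ to $\eta_\alpha$, and opposite weights to the conjugate momenta. Suppose that $E$ is a Jacobi algebroid. This means that $\Pi E^*$ carries an odd Jacobi structure of weight $-1$: an odd function $S$ on $T^*(\Pi E^*)$ of degree two in the momenta, and an odd vector field $Q$ on $\Pi E^*$ with principal symbol $\mathcal Q=Q^Ap_A$, both $S$ and $\mathcal Q$ of weight $-1$, such that $$\{\mathcal Q,\mathcal Q\}=0,\qquad \{\mathcal Q,S\}=0,\qquad \{S,S\}=-2\mathcal Q S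 .$$ Let $t$ be the (even) coordinate on $\mathbb R$ and $p$ its conjugate momentum, both of weight $0$. Then $$\bar S=e^{-t}(S-\mathcal Q\,p)$$ is a Schouten structure of weight $-1$ on $\Pi E^*\times\mathbb R$; that is, $\bar S$ is an odd function on $T^*(\Pi E^*\times\mathbb R)$, of degree two in the momenta and of weight $-1$, with $\{\bar S,\bar S\}=0$. Consequently the pullback bundle $\mathrm{proj}^*E\to M\times\mathbb R$ along $\mathrm{proj}:M\times\mathbb R\to M$ is a Lie algebroid: identify a section $u=u^\alpha s_\alpha$ of $\mathrm{proj}^*E$ with the function $\iota_u=u^\alpha\eta_\alpha$ on $\Pi E^*\times\mathbb R$, and let $[\![f,g]\!]=(-1)^{\tilde f+1}\{\{\bar S,f\},g\}$ be the Schouten bracket of $\bar S$. Then there are a Lie (super)bracket $[\cdot,\cdot]$ on the sections of $\mathrm{proj}^*E$ and an anchor $a$, with values in the vector fields on $M\times\mathbb R$ and linear over functions, such that $$\iota_{[u,v]}=[\![\iota_u,\iota_v]\!],\qquad a(u)f=[\![\iota_u,f]\!],\qquad [u,fv]=a(u)(f)\,v+(-1)^{\tilde u\tilde f}f\,[u,v]$$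 for all sections $u,v$ and all functions $f$ on $M\times\mathbb R$ (homogeneous ones in the last identity). -/

import Mathlib

open scoped ContDiff Topology

noncomputable section

namespace SuperGeom

/-! ### Superdomains: superfunctions, derivatives and substitution -/

/-- A finite list of coordinates, `ev` of them even (commuting) and `od` of them odd
(anticommuting). -/
structure SuperDim where
  ev : Type
  od : Type
  [fintypeEv : Fintype ev]
  [fintypeOd : Fintype od]

attribute [instance] SuperDim.fintypeEv SuperDim.fintypeOd

/-- The coordinates: `Sum.inl` the even ones, `Sum.inr` the odd ones. -/
abbrev SuperDim.Coord (D : SuperDim) : Type := D.ev ⊕ D.od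

/-- The Grassmann parity of a coordinate. -/
def SuperDim.par (D : SuperDim) : D.Coord → ZMod 2
  | .inl _ => 0
  | .inr _ => 1

/-- The real Grassmann algebra on the odd coordinates. -/
abbrev SuperDim.Gr (D : SuperDim) : Type := ExteriorAlgebra ℝ (D.od →₀ ℝ)

/-- Superfunctions of the coordinates `D`: Grassmann-algebra-valued functions of the even
coordinates, with pointwise (graded commutative) multiplication. -/
abbrev SuperDim.Fn (D : SuperDim) : Type := (D.ev → ℝ) → D.Gr

instance finite_gr (D : SuperDim) : Module.Finite ℝ D.Gr := by
  classical
  let _ : LinearOrder D.od := linearOrderOfSTO WellOrderingRel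
  exact Module.Finite.of_basis
    (Module.Basis.ExteriorAlgebra (Finsupp.basisSingleOne (R := ℝ) (ι := D.od)))

instance free_gr (D : SuperDim) : Module.Free ℝ D.Gr := Module.Free.of_divisionRing ℝ D.Gr

/-- The subspace of elements of parity `ε` of the Grassmann algebra. -/
def grPart (D : SuperDim) (ε : ZMod 2) : Submodule ℝ D.Gr :=
  CliffordAlgebra.evenOdd (0 : QuadraticForm ℝ (D.od →₀ ℝ)) ε

/-- The sign `(-1) ^ ε`. -/
def sgn (ε : ZMod 2) : ℝ := if ε = 0 then 1 else -1

/-- Smoothness on a set, that is, smoothness of all components. -/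
def SmoothOn {D : SuperDim} (f : D.Fn) (U : Set (D.ev → ℝ)) : Prop :=
  ∀ l : Module.Dual ℝ D.Gr, ContDiffOn ℝ ∞ (fun x => l (f x)) U

/-- A coordinate, as a superfunction. -/
def coord {D : SuperDim} : D.Coord → D.Fn
  | .inl i => fun x => algebraMap ℝ D.Gr (x i)
  | .inr j => fun _ => ExteriorAlgebra.ι ℝ (Finsupp.single j 1)

open Classical in
/-- The (left) partial derivative `∂ / ∂ x ^ A`: componentwise for an even coordinate, and the
left derivative (contraction) of the Grassmann algebra for an odd one. -/
def pd {D : SuperDim} : D.Coord → D.Fn → D.Fn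
  | .inl i, f => fun x => ∑ k, lineDeriv ℝ
      (fun y => (Module.finBasis ℝ D.Gr).repr (f y) k) x (Pi.single i 1) •
        Module.finBasis ℝ D.Gr k
  | .inr j, f => fun x => CliffordAlgebra.contractLeft
      (Q := (0 : QuadraticForm ℝ (D.od →₀ ℝ))) (Finsupp.lapply j) (f x)

/-- The automorphism `f ↦ (-1) ^ (ε * parity of f) f`. -/
def twist {D : SuperDim} (ε : ZMod 2) (f : D.Fn) : D.Fn :=
  if ε = 0 then f else fun x => CliffordAlgebra.involute (f x)

/-- For superfunctions `φ` (one for every coordinate of `D'`): the point of the underlying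
ordinary domain of `D'` at which the even components of `φ` are based. -/
def body {D D' : SuperDim} (φ : D'.Coord → D.Fn) (x : D.ev → ℝ) : D'.ev → ℝ :=
  fun i => ExteriorAlgebra.algebraMapInv (φ (.inl i) x)

/-- The nilpotent part of an even component of `φ`. -/
def soul {D D' : SuperDim} (φ : D'.Coord → D.Fn) (i : D'.ev) (x : D.ev → ℝ) : D.Gr :=
  φ (.inl i) x - algebraMap ℝ D.Gr (body φ x i)

open Classical in
/-- Substitution of the odd components of `φ` for the odd coordinates of `D'`. It is the
homomorphism of algebras with the given values on generators; these square to zero because they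
are odd (otherwise the definition takes an irrelevant value). -/
def oddSubst {D D' : SuperDim} (φ : D'.Coord → D.Fn) (x : D.ev → ℝ) : D'.Gr →ₐ[ℝ] D.Gr :=
  let F : (D'.od →₀ ℝ) →ₗ[ℝ] D.Gr :=
    Finsupp.linearCombination ℝ (fun j => φ (.inr j) x)
  if h : ∀ m, F m * F m = 0 then ExteriorAlgebra.lift ℝ ⟨F, h⟩
  else (Algebra.ofId ℝ D.Gr).comp ExteriorAlgebra.algebraMapInv

/-- The substitution (pullback) `g(φ)` of superfunctions into a superfunction: the even
components are substituted through the Taylor expansion at their body, which is a finite sum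
because the souls are nilpotent. -/
def subst {D D' : SuperDim} (φ : D'.Coord → D.Fn) (g : D'.Fn) : D.Fn := fun x =>
  ∑ k ∈ Finset.range (Fintype.card D.od + 1), ((k.factorial : ℝ)⁻¹) •
    ∑ s : Fin k → D'.ev,
      oddSubst φ x ((List.ofFn s).foldr (fun i h => pd (.inl i) h) g (body φ x)) *
        (List.ofFn fun m => soul φ (s m) x).prod

/-- A superfunction of the coordinates `D`, viewed as a superfunction of a larger set of
coordinates `D'`. -/
def ext {D D' : SuperDim} (e : D.ev → D'.ev) (o : D.od → D'.od) (f : D.Fn) : D'.Fn :=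
  fun x => ExteriorAlgebra.map (Finsupp.lmapDomain ℝ ℝ o) (f (x ∘ e))

/-! ### Supermanifolds by charts and transition functions -/

/-- The data from which a supermanifold is glued: charts with domains `dom a` in the even
coordinates, the part `ovl a b` of the chart `a` that is identified with a part of the chart `b`,
and the coordinates `trans a b` of the chart `b` as superfunctions of those of the chart `a`. -/
structure Gluing (D : SuperDim) where
  Idx : Type
  dom : Idx → Set (D.ev → ℝ)
  ovl : Idx → Idx → Set (D.ev → ℝ)
  trans : Idx → Idx → D.Coord → D.Fn

/-- The gluing data define a smooth supermanifold (Hausdorff and second countable). -/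
structure Gluing.IsSupermanifold {D : SuperDim} (M : Gluing D) : Prop where
  isOpen_dom : ∀ a, IsOpen (M.dom a)
  isOpen_ovl : ∀ a b, IsOpen (M.ovl a b)
  ovl_subset : ∀ a b, M.ovl a b ⊆ M.dom a
  ovl_self : ∀ a, M.ovl a a = M.dom a
  smooth : ∀ a b A, SmoothOn (M.trans a b A) (M.ovl a b)
  parity : ∀ a b A, ∀ x ∈ M.ovl a b, M.trans a b A x ∈ grPart D (D.par A)
  maps : ∀ a b, ∀ x ∈ M.ovl a b, body (M.trans a b) x ∈ M.ovl b a
  trans_self : ∀ a A, ∀ x ∈ M.dom a, M.trans a a A x = coord A x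
  ovl_comp : ∀ a b c, ∀ x ∈ M.ovl a b, body (M.trans a b) x ∈ M.ovl b c → x ∈ M.ovl a c
  cocycle : ∀ a b c A, ∀ x ∈ M.ovl a b, body (M.trans a b) x ∈ M.ovl b c →
    M.trans a c A x = subst (M.trans a b) (M.trans b c A) x
  hausdorff : ∀ a b, ∀ x ∈ M.dom a, ∀ y ∈ M.dom b,
    (∀ U ∈ 𝓝 x, ∀ V ∈ 𝓝 y, ∃ z ∈ U ∩ M.ovl a b, body (M.trans a b) z ∈ V) →
      x ∈ M.ovl a b ∧ body (M.trans a b) x = y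
  secondCountable : ∃ C : Set M.Idx, C.Countable ∧ ∀ a, ∀ x ∈ M.dom a, ∃ b ∈ C, x ∈ M.ovl a b

/-- Families of local superfunctions, one in every chart. -/
abbrev Gluing.Fam {D : SuperDim} (M : Gluing D) : Type := M.Idx → D.Fn

/-- Families of local components of vector fields, one in every chart. -/
abbrev Gluing.VFam {D : SuperDim} (M : Gluing D) : Type := M.Idx → D.Coord → D.Fn

/-- The family `f` is a global smooth function. Its local representatives are extended by zero
outside of the chart domains, so that equal functions are equal families. -/
structure Gluing.IsFunction {D : SuperDim} (M : Gluing D) (f : M.Fam) : Prop where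
  smooth : ∀ a, SmoothOn (f a) (M.dom a)
  compat : ∀ a b, ∀ x ∈ M.ovl a b, f a x = subst (M.trans a b) (f b) x
  zero_off : ∀ a, ∀ x ∉ M.dom a, f a x = 0

/-- The function `f` has parity `ε`. -/
def Gluing.HasParity {D : SuperDim} (M : Gluing D) (ε : ZMod 2) (f : M.Fam) : Prop :=
  ∀ a x, f a x ∈ grPart D ε

/-- The components `X a A` define a global smooth vector field `X ^ A ∂ / ∂ x ^ A`. -/
structure Gluing.IsVectorField {D : SuperDim} (M : Gluing D) (X : M.VFam) : Prop where
  smooth : ∀ a A, SmoothOn (X a A) (M.dom a)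
  compat : ∀ a b A, ∀ x ∈ M.ovl a b,
    subst (M.trans a b) (X b A) x = ∑ B, X a B x * pd B (M.trans a b A) x
  zero_off : ∀ a A, ∀ x ∉ M.dom a, X a A x = 0

/-- The vector field `X` has parity `ε`. -/
def Gluing.VHasParity {D : SuperDim} (M : Gluing D) (ε : ZMod 2) (X : M.VFam) : Prop :=
  ∀ a A x, X a A x ∈ grPart D (ε + D.par A)

/-- The vector field `X` applied to the function `f`. -/
def Gluing.act {D : SuperDim} (M : Gluing D) (X : M.VFam) (f : M.Fam) : M.Fam :=
  fun a => ∑ A, X a A * pd A (f a)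

/-! ### The product with the real line -/

/-- The coordinates `D` together with one more even coordinate `t`. -/
abbrev SuperDim.line (D : SuperDim) : SuperDim where
  ev := D.ev ⊕ Unit
  od := D.od

/-- A function of `x`, as a function of `(x, t)`. -/
def extLine {D : SuperDim} : D.Fn → D.line.Fn := ext (D' := D.line) Sum.inl id

/-- The coordinate `x ^ A` among the coordinates `(x, t)`. -/
def lineBase {D : SuperDim} : D.Coord → D.line.Coord
  | .inl i => .inl (.inl i)
  | .inr j => .inr j

/-- The coordinate `t` among the coordinates `(x, t)`. -/
def lineTime {D : SuperDim} : D.line.Coord := .inl (.inr ())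

/-- The product `M × ℝ`. -/
def Gluing.line {D : SuperDim} (M : Gluing D) : Gluing D.line where
  Idx := M.Idx
  dom a := {x | (fun i => x (.inl i)) ∈ M.dom a}
  ovl a b := {x | (fun i => x (.inl i)) ∈ M.ovl a b}
  trans a b
    | .inl (.inl i) => extLine (M.trans a b (.inl i))
    | .inl (.inr ()) => coord lineTime
    | .inr j => extLine (M.trans a b (.inr j))

/-! ### The cotangent bundle and its canonical Poisson bracket -/

/-- The coordinates `(x, p)` of the cotangent bundle; `p_A` has the parity of `x ^ A`. -/
abbrev SuperDim.cot (D : SuperDim) : SuperDim where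
  ev := D.ev ⊕ D.ev
  od := D.od ⊕ D.od

/-- A function of `x`, as a function of `(x, p)`. -/
def extCot {D : SuperDim} : D.Fn → D.cot.Fn := ext (D' := D.cot) Sum.inl Sum.inl

/-- The coordinate `x ^ A` on the cotangent bundle. -/
def pos {D : SuperDim} : D.Coord → D.cot.Coord
  | .inl i => .inl (.inl i)
  | .inr j => .inr (.inl j)

/-- The momentum `p_A` conjugate to `x ^ A`. -/
def mom {D : SuperDim} : D.Coord → D.cot.Coord
  | .inl i => .inl (.inr i)
  | .inr j => .inr (.inr j)

/-- The momenta of the chart `b` in terms of the coordinates of the chart `a`: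
`p̄_A = (∂ x ^ B / ∂ x̄ ^ A) p_B`. -/
def momTrans {D : SuperDim} (M : Gluing D) (a b : M.Idx) (A : D.Coord) : D.cot.Fn :=
  ∑ B, extCot (subst (M.trans a b) (pd A (M.trans b a B))) * coord (mom B)

/-- The cotangent bundle `T*M`. -/
def Gluing.cot {D : SuperDim} (M : Gluing D) : Gluing D.cot where
  Idx := M.Idx
  dom a := {x | (fun i => x (.inl i)) ∈ M.dom a}
  ovl a b := {x | (fun i => x (.inl i)) ∈ M.ovl a b}
  trans a b
    | .inl (.inl i) => extCot (M.trans a b (.inl i))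
    | .inl (.inr i) => momTrans M a b (.inl i)
    | .inr (.inl j) => extCot (M.trans a b (.inr j))
    | .inr (.inr j) => momTrans M a b (.inr j)

/-- The canonical Poisson bracket on the cotangent bundle,
`{F, G} = (-1) ^ (Ã F̃ + Ã) ∂F/∂p_A ∂G/∂x^A - (-1) ^ (Ã F̃) ∂F/∂x^A ∂G/∂p_A`. -/
def poisson {D : SuperDim} (F G : D.cot.Fn) : D.cot.Fn :=
  ∑ A : D.Coord,
    (sgn (D.par A) • (pd (mom A) (twist (D.par A) F) * pd (pos A) G)
      - pd (pos A) (twist (D.par A) F) * pd (mom A) G)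

/-- The principal symbol `X ^ A p_A` of a vector field `X`, a function on `T*M`. -/
def Gluing.symbol {D : SuperDim} (M : Gluing D) (X : M.VFam) : M.cot.Fam :=
  fun a => ∑ A, extCot (X a A) * coord (mom A)

/-- `F` is homogeneous of weight `k`, when the coordinate `x ^ A` is assigned the weight `w A`:
`∑ A, w A x ^ A ∂F/∂x^A = k F`. -/
def Gluing.HasWeight {D : SuperDim} (M : Gluing D) (w : D.Coord → ℤ) (k : ℤ) (F : M.Fam) : Prop :=
  ∀ a, ∀ x ∈ M.dom a, (∑ A, (w A : ℝ) • (coord A x * pd A (F a) x)) = (k : ℝ) • F a x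

/-- The degree in the fibre coordinates (momenta) of the cotangent bundle. -/
def momDegree {D : SuperDim} : D.cot.Coord → ℤ
  | .inl (.inl _) => 0
  | .inl (.inr _) => 1
  | .inr (.inl _) => 0
  | .inr (.inr _) => 1

/-- The weights on the cotangent bundle of a graded manifold whose coordinate `x ^ A` has weight
`w A`: the conjugate momentum has the opposite weight. -/
def cotWeight {D : SuperDim} (w : D.Coord → ℤ) : D.cot.Coord → ℤ
  | .inl (.inl i) => w (.inl i)
  | .inl (.inr i) => -w (.inl i)
  | .inr (.inl j) => w (.inr j)
  | .inr (.inr j) => -w (.inr j)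

/-- The weights on the product with the real line, on which `t` has weight zero. -/
def lineWeight {D : SuperDim} (w : D.Coord → ℤ) : D.line.Coord → ℤ
  | .inl (.inl i) => w (.inl i)
  | .inl (.inr _) => 0
  | .inr j => w (.inr j)

/-! ### Odd Jacobi structures and Schouten structures -/

/-- An odd Jacobi structure on `M`: an odd function `S` on `T*M` of degree two in the momenta and
an odd vector field `Q` with symbol `𝒬` such that `{𝒬, 𝒬} = 0` (that is, `Q ^ 2 = 0`),
`{𝒬, S} = 0` (that is, `L_Q S = 0`) and `{S, S} = -2 𝒬 S`. -/
structure Gluing.IsOddJacobi {D : SuperDim} (M : Gluing D) (S : M.cot.Fam) (Q : M.VFam) :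
    Prop where
  isFunction : M.cot.IsFunction S
  odd : M.cot.HasParity 1 S
  quadratic : M.cot.HasWeight momDegree 2 S
  isVectorField : M.IsVectorField Q
  vector_odd : M.VHasParity 1 Q
  homological : ∀ a, ∀ x ∈ M.cot.dom a, poisson (M.symbol Q a) (M.symbol Q a) x = 0
  invariant : ∀ a, ∀ x ∈ M.cot.dom a, poisson (M.symbol Q a) (S a) x = 0
  compatible : ∀ a, ∀ x ∈ M.cot.dom a,
    poisson (S a) (S a) x = -((2 : ℝ) • (M.symbol Q a x * S a x))

/-- A Schouten structure on `M`: an odd function `S` on `T*M`, of degree two in the momenta, such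
that `{S, S} = 0`. -/
structure Gluing.IsSchouten {D : SuperDim} (M : Gluing D) (S : M.cot.Fam) : Prop where
  isFunction : M.cot.IsFunction S
  odd : M.cot.HasParity 1 S
  quadratic : M.cot.HasWeight momDegree 2 S
  self_commutes : ∀ a, ∀ x ∈ M.cot.dom a, poisson (S a) (S a) x = 0

/-- The Schouten bracket `(-1) ^ (f̃ + 1) {{S, f}, g}` of local functions `f` and `g` on `M`, a
function on `T*M` (that does not depend on the momenta when `S` is quadratic in them). -/
def schoutenBracket {D : SuperDim} (S : D.cot.Fn) (f g : D.Fn) : D.cot.Fn :=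
  -poisson (poisson S (extCot (twist 1 f))) (extCot g)

/-- The function `exp (-t) (S - 𝒬 p)` on `T*(M × ℝ)`, where `p` is the momentum conjugate
to `t`. -/
def Gluing.schoutenization {D : SuperDim} (M : Gluing D) (S : M.cot.Fam) (Q : M.VFam) :
    M.line.cot.Fam :=
  let up : D.cot.Fn → D.line.cot.Fn :=
    ext (D' := D.line.cot) (Sum.map Sum.inl Sum.inl) (Sum.map id id)
  fun a => (fun x => algebraMap ℝ D.line.cot.Gr (Real.exp (-(x (.inl (.inr ())))))) *
    (up (S a) - up (M.symbol Q a) * coord (mom lineTime))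

/-! ### Super vector bundles and Lie algebroids -/

/-- The data from which a super vector bundle of rank `R` over `M` is glued: in the chart `a`,
the local frame `s_{b, α}` of the chart `b` is `∑ β, G a b α β s_{a, β}`. The parity of `s_α` is
that of `α` as a coordinate of `R`. -/
structure BundleGluing {D : SuperDim} (M : Gluing D) (R : SuperDim) where
  G : M.Idx → M.Idx → R.Coord → R.Coord → D.Fn

variable {D R : SuperDim} {M : Gluing D}

open Classical in
/-- The gluing data define a smooth super vector bundle over a supermanifold. -/
structure BundleGluing.IsBundle (E : BundleGluing M R) : Prop where
  base : M.IsSupermanifold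
  smooth : ∀ a b α β, SmoothOn (E.G a b α β) (M.ovl a b)
  parity : ∀ a b α β, ∀ x ∈ M.ovl a b, E.G a b α β x ∈ grPart D (R.par α + R.par β)
  self : ∀ a α β, ∀ x ∈ M.dom a, E.G a a α β x = if α = β then 1 else 0
  cocycle : ∀ a b c α β, ∀ x ∈ M.ovl a b, body (M.trans a b) x ∈ M.ovl b c →
    E.G a c α β x = ∑ γ, subst (M.trans a b) (E.G b c α γ) x * E.G a b γ β x

/-- Families of local components of sections, one in every chart. -/
abbrev BundleGluing.SFam (_E : BundleGluing M R) : Type := M.Idx → R.Coord → D.Fn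

/-- The components `u a α` define a global smooth section `u ^ α s_α`. -/
structure BundleGluing.IsSection (E : BundleGluing M R) (u : E.SFam) : Prop where
  smooth : ∀ a α, SmoothOn (u a α) (M.dom a)
  compat : ∀ a b β, ∀ x ∈ M.ovl a b,
    u a β x = ∑ α, subst (M.trans a b) (u b α) x * E.G a b α β x
  zero_off : ∀ a α, ∀ x ∉ M.dom a, u a α x = 0

/-- The section `u` has parity `ε`. -/
def BundleGluing.SHasParity (E : BundleGluing M R) (ε : ZMod 2) (u : E.SFam) : Prop :=
  ∀ a α x, u a α x ∈ grPart D (ε + R.par α)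

/-- The product of a function and a section. -/
def BundleGluing.fsmul (E : BundleGluing M R) (f : M.Fam) (u : E.SFam) : E.SFam :=
  fun a α => f a * u a α

/-- The product of a function and a vector field. -/
def Gluing.vsmul (M : Gluing D) (f : M.Fam) (X : M.VFam) : M.VFam :=
  fun a A => f a * X a A

/-- A Lie algebroid structure on a super vector bundle `E`: a Lie (super)bracket `br` on global
sections and an anchor `an` with values in vector fields, linear over functions, which satisfy
the Leibniz rule. -/
structure BundleGluing.IsLieAlgebroid (E : BundleGluing M R) (br : E.SFam → E.SFam → E.SFam)
    (an : E.SFam → M.VFam) : Prop where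
  isBundle : E.IsBundle
  isSection : ∀ u v, E.IsSection u → E.IsSection v → E.IsSection (br u v)
  isVectorField : ∀ u, E.IsSection u → M.IsVectorField (an u)
  br_parity : ∀ ε δ u v, E.IsSection u → E.IsSection v → E.SHasParity ε u → E.SHasParity δ v →
    E.SHasParity (ε + δ) (br u v)
  an_parity : ∀ ε u, E.IsSection u → E.SHasParity ε u → M.VHasParity ε (an u)
  br_add_left : ∀ u v w, E.IsSection u → E.IsSection v → E.IsSection w →
    br (u + v) w = br u w + br v w
  br_add_right : ∀ u v w, E.IsSection u → E.IsSection v → E.IsSection w →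
    br u (v + w) = br u v + br u w
  br_smul_left : ∀ (c : ℝ) u v, E.IsSection u → E.IsSection v → br (c • u) v = c • br u v
  br_smul_right : ∀ (c : ℝ) u v, E.IsSection u → E.IsSection v → br u (c • v) = c • br u v
  an_add : ∀ u v, E.IsSection u → E.IsSection v → an (u + v) = an u + an v
  an_smul : ∀ f u, M.IsFunction f → E.IsSection u → an (E.fsmul f u) = M.vsmul f (an u)
  skew : ∀ ε δ u v, E.IsSection u → E.IsSection v → E.SHasParity ε u → E.SHasParity δ v →
    br u v = -(sgn (ε * δ) • br v u)
  jacobi : ∀ ε δ κ u v w, E.IsSection u → E.IsSection v → E.IsSection w →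
    E.SHasParity ε u → E.SHasParity δ v → E.SHasParity κ w →
    sgn (ε * κ) • br u (br v w) + sgn (δ * ε) • br v (br w u) + sgn (κ * δ) • br w (br u v) = 0
  leibniz : ∀ ε δ u f v, E.IsSection u → M.IsFunction f → E.IsSection v →
    E.SHasParity ε u → M.HasParity δ f →
    br u (E.fsmul f v) = E.fsmul (M.act (an u) f) v + sgn (ε * δ) • E.fsmul f (br u v)

/-- The pullback bundle `proj* E` over `M × ℝ` along `proj : M × ℝ → M`. -/
def BundleGluing.pullbackLine (E : BundleGluing M R) : BundleGluing M.line R where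
  G a b α β := extLine (E.G a b α β)

/-! ### The total space of the parity-reversed dual bundle -/

/-- The coordinates `(x, η)` on the total space of `ΠE*`, where `η_α` has the parity opposite to
that of `s_α`. -/
abbrev SuperDim.antidual (D R : SuperDim) : SuperDim where
  ev := D.ev ⊕ R.od
  od := D.od ⊕ R.ev

/-- A function on the base, as a function on the total space of `ΠE*`. -/
def extFib (R : SuperDim) {D : SuperDim} : D.Fn → (D.antidual R).Fn :=
  ext (D' := D.antidual R) Sum.inl Sum.inl

/-- The fibre coordinate `η_α`. -/
def eta (D : SuperDim) {R : SuperDim} : R.Coord → (D.antidual R).Coord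
  | .inl i => .inr (.inr i)
  | .inr j => .inl (.inr j)

/-- The fibre coordinates of the chart `b` in terms of the coordinates of the chart `a`. -/
def etaTrans (E : BundleGluing M R) (a b : M.Idx) (α : R.Coord) : (D.antidual R).Fn :=
  ∑ β, extFib R (E.G a b α β) * coord (eta D β)

/-- The total space of `ΠE*`. Its fibre coordinates `η_α` transform as the local frame of `E`,
because a section of `E` is a linear function on the fibres of the dual bundle. -/
def BundleGluing.antidual (E : BundleGluing M R) : Gluing (D.antidual R) where
  Idx := M.Idx
  dom a := {x | (fun i => x (.inl i)) ∈ M.dom a}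
  ovl a b := {x | (fun i => x (.inl i)) ∈ M.ovl a b}
  trans a b
    | .inl (.inl i) => extFib R (M.trans a b (.inl i))
    | .inl (.inr r) => etaTrans E a b (.inr r)
    | .inr (.inl j) => extFib R (M.trans a b (.inr j))
    | .inr (.inr r) => etaTrans E a b (.inl r)

/-- The natural weights on `ΠE*`: base coordinates have weight zero, fibre coordinates have
weight one. -/
def etaWeight (D R : SuperDim) : (D.antidual R).Coord → ℤ
  | .inl (.inl _) => 0
  | .inl (.inr _) => 1
  | .inr (.inl _) => 0
  | .inr (.inr _) => 1

/-- A Jacobi algebroid structure on `E`: an odd Jacobi structure of weight minus one on the total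
space of `ΠE*`. -/
structure BundleGluing.IsJacobiAlgebroid (E : BundleGluing M R) (S : E.antidual.cot.Fam)
    (Q : E.antidual.VFam) : Prop where
  isBundle : E.IsBundle
  isOddJacobi : E.antidual.IsOddJacobi S Q
  weight_S : E.antidual.cot.HasWeight (cotWeight (etaWeight D R)) (-1) S
  weight_Q : E.antidual.cot.HasWeight (cotWeight (etaWeight D R)) (-1) (E.antidual.symbol Q)

/-- A function of the coordinates `(x, t)` of `M × ℝ`, as a function of the coordinates
`(x, η, t)` of `ΠE* × ℝ`. -/
def extFibLine (R : SuperDim) {D : SuperDim} : D.line.Fn → (D.antidual R).line.Fn :=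
  ext (D := D.line) (D' := (D.antidual R).line) (Sum.map Sum.inl id) Sum.inl

/-- The function `u ^ α η_α` on `ΠE* × ℝ`, linear in the fibre coordinates, that corresponds to
the section `u` of `proj* E`. -/
def BundleGluing.linearFn (E : BundleGluing M R) (u : E.pullbackLine.SFam) :
    E.antidual.line.Fam :=
  fun a => ∑ α, extFibLine R (u a α) * coord (lineBase (eta D α))

/-- The pullback to `ΠE* × ℝ` of a function on `M × ℝ`. -/
def BundleGluing.pullFn (E : BundleGluing M R) (f : M.line.Fam) : E.antidual.line.Fam :=
  fun a => extFibLine R (f a)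

end SuperGeom

end

open SuperGeom

noncomputable section
namespace SuperGeom

/-! ### Signs -/

/-! The Schouten property is a short computation. Put T = S - 𝒬p. Since {𝒬,𝒬} = {𝒬,S} = 0 and p
commutes with every function on T*(ΠE*), {T,T} = {S,S} = -2𝒬S. The exponential pairs only with p:
{p,e^{-t}} = -e^{-t}, hence {T,e^{-t}} = 𝒬e^{-t}. Expanding {e^{-t}T,e^{-t}T} by the Leibniz rule
gives e^{-2t}{T,T} + 2e^{-2t}𝒬T. As 𝒬 is odd, 𝒬² = 0 and 𝒬T = 𝒬S, so the two terms cancel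
(`schoutenization_self_commutes`). Both gradings are additive on products, which settles degree and
weight (`schoutenization_weight`).

For the Lie algebroid, a function quadratic in the momenta has a momentum Hessian that lives on the
base, and the Schouten bracket is a biderivation built from this Hessian
(`IsQuadratic.schoutenBracket_eq`). Its Jacobi identity is that of a derived bracket: {S̄,S̄} = 0
makes {S̄,-} square to zero, and the rest is the Jacobi identity of the Poisson bracket
(`poisson_jacobi`, `IsQuadratic.bracket_jacobi`). Weight -1 means that functions of weights l and m
have a bracket of weight l + m - 1. Smooth functions of weight 1 are linear in the fibre
coordinates, those of weight 0 come from the base, and those of weight -1 vanish (`eq_linear_coeff`,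
`eq_ext_res`, `eq_zero_of_weightNear`), because F(x,sη) satisfies an ordinary differential equation
in s on all of [0,1]. So two linear functions have a linear bracket, which defines the bracket of
sections; a linear and a basic function have a basic bracket, which defines the anchor; two basic
functions commute, which makes the anchor linear over functions.

The remaining work is to glue the charts. Substitution of superfunctions is a Taylor expansion in
nilpotent parts. It is an algebra homomorphism (`subst_mul`), obeys the chain rule (`pd_subst`) and
is compatible with adding coordinates (`subst_ext`). With these, momentum Hessians transform as
tensors (`hess_compat`), the local brackets agree on overlaps (`bracket_compat`), and the
coefficients of linear functions transform exactly as components of sections (`subst_linear`). -/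

@[simp] theorem sgn_zero : sgn 0 = 1 := by simp [sgn]

@[simp] theorem sgn_one : sgn 1 = -1 := by simp [sgn]

theorem zmod_two_cases (a : ZMod 2) : a = 0 ∨ a = 1 := by
  revert a; decide

theorem sgn_add (a b : ZMod 2) : sgn (a + b) = sgn a * sgn b := by
  have h : (1 : ZMod 2) + 1 = 0 := by decide
  rcases zmod_two_cases a with rfl | rfl <;> rcases zmod_two_cases b with rfl | rfl <;> simp [h]

@[simp] theorem sgn_mul_self (a : ZMod 2) : sgn a * sgn a = 1 := by
  rcases zmod_two_cases a with rfl | rfl <;> simp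

theorem sgn_smul_sgn_smul {V : Type*} [AddCommGroup V] [Module ℝ V] (a b : ZMod 2) (v : V) :
    sgn a • sgn b • v = sgn (a + b) • v := by
  rw [smul_smul, sgn_add]

theorem neg_eq_sgn_one_smul {V : Type*} [AddCommGroup V] [Module ℝ V] (v : V) :
    -v = sgn 1 • v := by simp

theorem zmod_two_add_self (a : ZMod 2) : a + a = 0 := by revert a; decide

/-! ### The Grassmann algebra -/

section Grassmann

variable {D D' : SuperDim}

open CliffordAlgebra in
/-- The automorphism `a ↦ (-1) ^ (ε * parity of a) a` of the Grassmann algebra. -/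
def tw (ε : ZMod 2) : D.Gr →ₐ[ℝ] D.Gr :=
  if ε = 0 then AlgHom.id ℝ D.Gr else involute

@[simp] theorem tw_zero (a : D.Gr) : tw 0 a = a := by simp [tw]

theorem tw_one (a : D.Gr) : tw 1 a = CliffordAlgebra.involute a := by simp [tw]

theorem twist_apply (ε : ZMod 2) (f : D.Fn) (x : D.ev → ℝ) : twist ε f x = tw ε (f x) := by
  rcases zmod_two_cases ε with rfl | rfl <;> simp [twist, tw]

@[simp] theorem tw_tw_self (ε : ZMod 2) (a : D.Gr) : tw ε (tw ε a) = a := by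
  rcases zmod_two_cases ε with rfl | rfl <;> simp [tw_one]

theorem tw_tw (ε δ : ZMod 2) (a : D.Gr) : tw ε (tw δ a) = tw (ε + δ) a := by
  have h : (1 : ZMod 2) + 1 = 0 := by decide
  rcases zmod_two_cases ε with rfl | rfl <;> rcases zmod_two_cases δ with rfl | rfl <;>
    simp [tw_one, h]

theorem tw_ι (ε : ZMod 2) (v : D.od →₀ ℝ) :
    tw ε (ExteriorAlgebra.ι ℝ v : D.Gr) = sgn ε • ExteriorAlgebra.ι ℝ v := by
  rcases zmod_two_cases ε with rfl | rfl
  · simp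
  · rw [tw_one]
    simp only [sgn_one, neg_smul, one_smul]
    exact CliffordAlgebra.involute_ι v

theorem ι_mem_grPart (v : D.od →₀ ℝ) : (ExteriorAlgebra.ι ℝ v : D.Gr) ∈ grPart D 1 :=
  CliffordAlgebra.ι_mem_evenOdd_one _ v

theorem algebraMap_mem_grPart (r : ℝ) : algebraMap ℝ D.Gr r ∈ grPart D 0 := by
  have := Submodule.algebraMap_mem (R := ℝ) (A := D.Gr) r
  exact CliffordAlgebra.one_le_evenOdd_zero (0 : QuadraticForm ℝ (D.od →₀ ℝ)) this

theorem mul_mem_grPart {ε δ κ : ZMod 2} {a b : D.Gr} (ha : a ∈ grPart D ε) (hb : b ∈ grPart D δ)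
    (h : κ = ε + δ := by rfl) : a * b ∈ grPart D κ :=
  h ▸ CliffordAlgebra.evenOdd_mul_le _ _ _ (Submodule.mul_mem_mul ha hb)

theorem tw_mem_grPart (κ : ZMod 2) {ε : ZMod 2} {a : D.Gr} (ha : a ∈ grPart D ε) :
    tw κ a ∈ grPart D ε := by
  rcases zmod_two_cases κ with rfl | rfl
  · simpa
  · rw [tw_one]
    exact (CliffordAlgebra.involute_mem_evenOdd_iff _).2 ha

theorem tw_of_mem {ε : ZMod 2} {a : D.Gr} (ha : a ∈ grPart D ε) (κ : ZMod 2) :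
    tw κ a = sgn (κ * ε) • a := by
  rcases zmod_two_cases κ with rfl | rfl
  · simp
  · rw [tw_one]
    rcases zmod_two_cases ε with rfl | rfl
    · simpa using CliffordAlgebra.involute_eq_of_mem_even ha
    · simpa using CliffordAlgebra.involute_eq_of_mem_odd ha

/-- Each generator that the odd vector passes costs one sign, and the grading automorphism counts
these signs without asking `a` to be homogeneous. -/
theorem ι_mul_eq (v : D.od →₀ ℝ) (a : D.Gr) :
    ExteriorAlgebra.ι ℝ v * a = tw 1 a * ExteriorAlgebra.ι ℝ v := by
  induction a using CliffordAlgebra.left_induction with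
  | algebraMap r =>
    rw [AlgHom.commutes]; exact (Algebra.commutes r _).symm
  | add x y hx hy => rw [mul_add, hx, hy, map_add, add_mul]
  | ι_mul x m hx =>
    have h := ExteriorAlgebra.ι_add_mul_swap (R := ℝ) v m
    have h2 : ExteriorAlgebra.ι ℝ v * ExteriorAlgebra.ι ℝ m =
      -((ExteriorAlgebra.ι ℝ m : D.Gr) * ExteriorAlgebra.ι ℝ v) := eq_neg_of_add_eq_zero_left h
    change ExteriorAlgebra.ι ℝ v * (ExteriorAlgebra.ι ℝ m * x) =
      tw 1 (ExteriorAlgebra.ι ℝ m * x) * _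
    rw [← mul_assoc, h2, map_mul, tw_ι, neg_mul, mul_assoc, hx]
    simp [mul_assoc]

/-- Only one factor has to be homogeneous: the sign that depends on `b` is carried by `tw ε`. This
form allows commutations with arbitrary functions later on. -/
theorem mul_comm_tw {ε : ZMod 2} {a : D.Gr} (ha : a ∈ grPart D ε) (b : D.Gr) :
    a * b = tw ε b * a := by
  -- The induction on a parity component adjoins two generators at a time, and the two signs they
  -- produce cancel.
  have key : ∀ (m₁ m₂ : D.od →₀ ℝ) (x : D.Gr), (∀ b, x * b = tw ε b * x) →
      ∀ b, (ExteriorAlgebra.ι ℝ m₁ * ExteriorAlgebra.ι ℝ m₂ * x) * b =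
        tw ε b * (ExteriorAlgebra.ι ℝ m₁ * ExteriorAlgebra.ι ℝ m₂ * x) := by
    intro m₁ m₂ x hx b
    rw [mul_assoc, hx, mul_assoc, ← mul_assoc (ExteriorAlgebra.ι ℝ m₂) (tw ε b),
      ι_mul_eq m₂ (tw ε b), mul_assoc (tw 1 _), ← mul_assoc (ExteriorAlgebra.ι ℝ m₁) (tw 1 _),
      ι_mul_eq m₁ (tw 1 _), tw_tw_self]
    simp only [mul_assoc]
  revert b
  induction a, ha using CliffordAlgebra.evenOdd_induction with
  | range_ι_pow v h =>
    intro b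
    rcases zmod_two_cases ε with rfl | rfl
    · obtain ⟨r, rfl⟩ : ∃ r, algebraMap ℝ D.Gr r = v := by
        have : v ∈ (1 : Submodule ℝ D.Gr) := by simpa using h
        exact Submodule.mem_one.1 this
      rw [tw_zero]; exact Algebra.commutes r _
    · obtain ⟨m, rfl⟩ : ∃ m, ExteriorAlgebra.ι ℝ m = v := by
        have : v ∈ LinearMap.range (ExteriorAlgebra.ι ℝ (M := D.od →₀ ℝ)) := by
          have h1 : (1 : ZMod 2).val = 1 := rfl
          rw [h1, pow_one] at h; exact h
        exact this
      exact ι_mul_eq m b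
  | add x y hx hy h1 h2 => intro b; rw [add_mul, h1, h2, mul_add]
  | ι_mul_ι_mul m₁ m₂ x hx h => exact key m₁ m₂ x h

theorem mul_comm_sgn {ε δ : ZMod 2} {a b : D.Gr} (ha : a ∈ grPart D ε) (hb : b ∈ grPart D δ) :
    a * b = sgn (ε * δ) • (b * a) := by
  rw [mul_comm_tw ha, tw_of_mem hb, smul_mul_assoc]

theorem even_commute {a : D.Gr} (ha : a ∈ grPart D 0) (b : D.Gr) : a * b = b * a := by
  rw [mul_comm_tw ha, tw_zero]

/-- Graded commutativity gives `a * a = -(a * a)`. This makes the substitution of odd functions for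
odd coordinates legitimate, and it removes 𝒬² in the main computation. -/
theorem odd_mul_self {a : D.Gr} (ha : a ∈ grPart D 1) : a * a = 0 := by
  have h := mul_comm_sgn ha ha
  simp only [mul_one, sgn_one, neg_smul, one_smul] at h
  have h2 : (2 : ℝ) • (a * a) = 0 := by rw [two_smul]; nth_rw 1 [h]; exact neg_add_cancel _
  exact (smul_eq_zero.1 h2).resolve_left (by norm_num)

/-- The component of parity `ε`. -/
def part (ε : ZMod 2) : D.Gr →ₗ[ℝ] D.Gr :=
  (2 : ℝ)⁻¹ • (LinearMap.id + sgn ε • (tw 1).toLinearMap)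

theorem part_apply (ε : ZMod 2) (a : D.Gr) : part ε a = (2 : ℝ)⁻¹ • (a + sgn ε • tw 1 a) := rfl

theorem exists_part (a : D.Gr) : ∃ b ∈ grPart D 0, ∃ c ∈ grPart D 1, b + c = a := by
  induction a using CliffordAlgebra.left_induction with
  | algebraMap r => exact ⟨_, algebraMap_mem_grPart r, 0, Submodule.zero_mem _, add_zero _⟩
  | add x y hx hy =>
    obtain ⟨b, hb, c, hc, rfl⟩ := hx
    obtain ⟨b', hb', c', hc', rfl⟩ := hy
    exact ⟨b + b', add_mem hb hb', c + c', add_mem hc hc', by abel⟩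
  | ι_mul x m hx =>
    obtain ⟨b, hb, c, hc, rfl⟩ := hx
    exact ⟨_, mul_mem_grPart (ι_mem_grPart m) hc, _, mul_mem_grPart (ι_mem_grPart m) hb, by
      rw [mul_add, add_comm]⟩

theorem part_mem (ε : ZMod 2) (a : D.Gr) : part ε a ∈ grPart D ε := by
  obtain ⟨b, hb, c, hc, rfl⟩ := exists_part a
  have hb' : tw 1 b = b := by simpa using tw_of_mem hb 1
  have hc' : tw 1 c = -c := by simpa using tw_of_mem hc 1
  rw [part_apply, map_add, hb', hc']
  apply Submodule.smul_mem
  rcases zmod_two_cases ε with rfl | rfl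
  · convert Submodule.smul_mem _ (2 : ℝ) hb using 1; simp [two_smul]; abel
  · convert Submodule.smul_mem _ (2 : ℝ) hc using 1; simp [two_smul]; abel

/-- The parity components are the eigenspaces of `tw 1`, so a parity claim about an operation
reduces to the fact that the operation commutes with `tw` up to sign. -/
theorem mem_grPart_of_tw {ε : ZMod 2} {a : D.Gr} (h : tw 1 a = sgn ε • a) : a ∈ grPart D ε := by
  have h2 := part_mem ε a
  rw [part_apply, h, smul_smul, sgn_mul_self, one_smul, ← two_smul ℝ, smul_smul] at h2
  norm_num at h2
  exact h2

/-! ### The left derivative and the functoriality of the Grassmann algebra -/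

/-- The left derivative of the Grassmann algebra. -/
def contr (j : D.od) : D.Gr →ₗ[ℝ] D.Gr :=
  CliffordAlgebra.contractLeft (Q := (0 : QuadraticForm ℝ (D.od →₀ ℝ))) (Finsupp.lapply j)

theorem contr_ι_mul (j : D.od) (v : D.od →₀ ℝ) (b : D.Gr) :
    contr j (ExteriorAlgebra.ι ℝ v * b) = v j • b - ExteriorAlgebra.ι ℝ v * contr j b :=
  CliffordAlgebra.contractLeft_ι_mul _ _ _

@[simp] theorem contr_algebraMap (j : D.od) (r : ℝ) : contr j (algebraMap ℝ D.Gr r) = 0 :=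
  CliffordAlgebra.contractLeft_algebraMap (0 : QuadraticForm ℝ (D.od →₀ ℝ)) (Finsupp.lapply j) r

@[simp] theorem contr_one (j : D.od) : contr j (1 : D.Gr) = 0 :=
  CliffordAlgebra.contractLeft_one (0 : QuadraticForm ℝ (D.od →₀ ℝ)) (Finsupp.lapply j)

theorem contr_ι (j : D.od) (v : D.od →₀ ℝ) :
    contr j (ExteriorAlgebra.ι ℝ v : D.Gr) = algebraMap ℝ _ (v j) :=
  CliffordAlgebra.contractLeft_ι (0 : QuadraticForm ℝ (D.od →₀ ℝ)) (Finsupp.lapply j) v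

/-- The product rule for one generator extends to products by induction: every generator on the left
contributes one sign, collected in `tw 1 a`. -/
theorem contr_mul (j : D.od) (a b : D.Gr) :
    contr j (a * b) = contr j a * b + tw 1 a * contr j b := by
  induction a using CliffordAlgebra.left_induction with
  | algebraMap r =>
    simp [Algebra.algebraMap_eq_smul_one]
  | add x y hx hy => simp only [add_mul, map_add, hx, hy]; abel
  | ι_mul x m hx =>
    change contr j (ExteriorAlgebra.ι ℝ m * x * b) = contr j (ExteriorAlgebra.ι ℝ m * x) * b +
      tw 1 (ExteriorAlgebra.ι ℝ m * x) * contr j b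
    rw [mul_assoc, contr_ι_mul, hx, contr_ι_mul, map_mul, tw_ι]
    simp only [sgn_one, neg_smul, one_smul, mul_add, sub_mul, smul_mul_assoc, neg_mul, mul_assoc]
    abel

theorem contr_contr (i j : D.od) (a : D.Gr) : contr i (contr j a) = -contr j (contr i a) :=
  CliffordAlgebra.contractLeft_comm _ _ _

theorem contr_tw (j : D.od) (ε : ZMod 2) (a : D.Gr) :
    contr j (tw ε a) = sgn ε • tw ε (contr j a) := by
  rcases zmod_two_cases ε with rfl | rfl
  · simp
  induction a using CliffordAlgebra.left_induction with
  | algebraMap r => simp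
  | add x y hx hy => simp only [map_add, hx, hy, smul_add]
  | ι_mul x m hx =>
    change contr j (tw 1 (ExteriorAlgebra.ι ℝ m * x)) =
      sgn 1 • tw 1 (contr j (ExteriorAlgebra.ι ℝ m * x))
    rw [map_mul, tw_ι, contr_ι_mul]
    simp only [sgn_one, neg_smul, one_smul, neg_mul, map_neg, contr_ι_mul, map_sub, map_smul,
      map_mul, tw_ι, hx]
    simp

theorem map_ι' (f : (D.od →₀ ℝ) →ₗ[ℝ] (D'.od →₀ ℝ)) (v : D.od →₀ ℝ) :
    ExteriorAlgebra.map f (ExteriorAlgebra.ι ℝ v : D.Gr) = (ExteriorAlgebra.ι ℝ (f v) : D'.Gr) :=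
  ExteriorAlgebra.map_apply_ι f v

theorem map_tw (f : (D.od →₀ ℝ) →ₗ[ℝ] (D'.od →₀ ℝ)) (ε : ZMod 2) (a : D.Gr) :
    (ExteriorAlgebra.map f (tw ε a) : D'.Gr) = tw ε (ExteriorAlgebra.map f a : D'.Gr) := by
  induction a using CliffordAlgebra.left_induction with
  | algebraMap r => simp
  | add x y hx hy => simp only [map_add, hx, hy]
  | ι_mul x m hx =>
    change ExteriorAlgebra.map f (tw ε (ExteriorAlgebra.ι ℝ m * x)) =
      tw ε (ExteriorAlgebra.map f (ExteriorAlgebra.ι ℝ m * x) : D'.Gr)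
    rw [map_mul, map_mul, map_mul, map_mul, hx, tw_ι, map_ι', tw_ι, map_smul, map_ι']

theorem map_mem_grPart (f : (D.od →₀ ℝ) →ₗ[ℝ] (D'.od →₀ ℝ)) {ε : ZMod 2} {a : D.Gr}
    (ha : a ∈ grPart D ε) : (ExteriorAlgebra.map f a : D'.Gr) ∈ grPart D' ε := by
  apply mem_grPart_of_tw
  rw [← map_tw, tw_of_mem ha, map_smul, one_mul]

/-- Injectivity of `o` makes the coefficient of the pushed-forward vector at `o j` equal to the
single coefficient at `j`, instead of a sum over a fibre of `o`. -/
theorem contr_map_lmapDomain {o : D.od → D'.od} (ho : Function.Injective o) (j : D.od)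
    (a : D.Gr) : (contr (o j) (ExteriorAlgebra.map (Finsupp.lmapDomain ℝ ℝ o) a : D'.Gr)) =
      ExteriorAlgebra.map (Finsupp.lmapDomain ℝ ℝ o) (contr j a) := by
  induction a using CliffordAlgebra.left_induction with
  | algebraMap r => simp
  | add x y hx hy => simp only [map_add, hx, hy]
  | ι_mul x m hx =>
    change contr (o j) (ExteriorAlgebra.map _ (ExteriorAlgebra.ι ℝ m * x) : D'.Gr) =
      ExteriorAlgebra.map _ (contr j (ExteriorAlgebra.ι ℝ m * x))
    rw [map_mul, map_ι', contr_ι_mul, contr_ι_mul, map_sub, map_mul, map_smul, hx, map_ι']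
    congr 2
    simp [Finsupp.mapDomain_apply ho]

theorem contr_map_lmapDomain_of_notMem {o : D.od → D'.od} {j : D'.od} (hj : j ∉ Set.range o)
    (a : D.Gr) :
    (contr j (ExteriorAlgebra.map (Finsupp.lmapDomain ℝ ℝ o) a : D'.Gr)) = 0 := by
  induction a using CliffordAlgebra.left_induction with
  | algebraMap r => simp
  | add x y hx hy => simp only [map_add, hx, hy, add_zero]
  | ι_mul x m hx =>
    change contr j (ExteriorAlgebra.map _ (ExteriorAlgebra.ι ℝ m * x) : D'.Gr) = 0
    rw [map_mul, map_ι', contr_ι_mul, hx, mul_zero, sub_zero, Finsupp.lmapDomain_apply,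
      Finsupp.mapDomain_of_notMem_range _ _ hj, zero_smul]

/-! ### Nilpotency -/

/-- The filtration of the Grassmann algebra by powers of the augmentation ideal. -/
def filt (D : SuperDim) (k : ℕ) : Submodule ℝ D.Gr :=
  LinearMap.range (ExteriorAlgebra.ι ℝ (M := D.od →₀ ℝ)) ^ k * ⊤

theorem filt_zero (a : D.Gr) : a ∈ filt D 0 := by
  rw [filt, pow_zero, one_mul]; trivial

/-- A generator on the right moves to the left at the price of `tw 1`; hence the left-handed
definition of the filtration consists of two-sided ideals. -/
theorem top_mul_range_le : (⊤ : Submodule ℝ D.Gr) *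
    LinearMap.range (ExteriorAlgebra.ι ℝ (M := D.od →₀ ℝ)) ≤
    LinearMap.range (ExteriorAlgebra.ι ℝ (M := D.od →₀ ℝ)) * ⊤ := by
  rw [Submodule.mul_le]
  rintro a - _ ⟨v, rfl⟩
  have h := ι_mul_eq v (tw 1 a)
  rw [tw_tw_self] at h
  rw [← h]
  exact Submodule.mul_mem_mul ⟨v, rfl⟩ trivial

theorem top_mul_pow_range_le (k : ℕ) : (⊤ : Submodule ℝ D.Gr) *
    LinearMap.range (ExteriorAlgebra.ι ℝ (M := D.od →₀ ℝ)) ^ k ≤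
    LinearMap.range (ExteriorAlgebra.ι ℝ (M := D.od →₀ ℝ)) ^ k * ⊤ := by
  induction k with
  | zero => simp
  | succ k ih =>
    rw [pow_succ, ← mul_assoc]
    calc _ ≤ _ := mul_le_mul' ih le_rfl
      _ = LinearMap.range (ExteriorAlgebra.ι ℝ (M := D.od →₀ ℝ)) ^ k *
          (⊤ * LinearMap.range (ExteriorAlgebra.ι ℝ (M := D.od →₀ ℝ))) := mul_assoc _ _ _
      _ ≤ _ := mul_le_mul' le_rfl top_mul_range_le
      _ = _ := (mul_assoc _ _ _).symm

/-- The generators of the second factor are moved to the left through the arbitrary part of the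
first, where they join the generators already present. -/
theorem mul_mem_filt {k l : ℕ} {a b : D.Gr} (ha : a ∈ filt D k) (hb : b ∈ filt D l) :
    a * b ∈ filt D (k + l) := by
  have h : filt D k * filt D l ≤ filt D (k + l) := by
    unfold filt
    rw [pow_add]
    set V := LinearMap.range (ExteriorAlgebra.ι ℝ (M := D.od →₀ ℝ))
    calc V ^ k * ⊤ * (V ^ l * ⊤) = V ^ k * (⊤ * V ^ l) * ⊤ := by simp only [mul_assoc]
      _ ≤ V ^ k * (V ^ l * ⊤) * ⊤ :=
        mul_le_mul' (mul_le_mul' le_rfl (top_mul_pow_range_le l)) le_rfl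
      _ = V ^ k * V ^ l * (⊤ * ⊤) := by simp only [mul_assoc]
      _ ≤ _ := mul_le_mul' le_rfl le_top
  exact h (Submodule.mul_mem_mul ha hb)

/-- The `k`-th power of the span of the generators is the `k`-th exterior power, of dimension
`n.choose k`, which is zero once `k` exceeds the number `n` of odd coordinates. -/
theorem filt_eq_bot {k : ℕ} (hk : Fintype.card D.od < k) : filt D k = ⊥ := by
  have h : LinearMap.range (ExteriorAlgebra.ι ℝ (M := D.od →₀ ℝ)) ^ k = ⊥ := by
    have h := exteriorPower.finrank_eq ℝ (M := D.od →₀ ℝ) k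
    rw [Module.finrank_finsupp_self, Nat.choose_eq_zero_of_lt hk] at h
    exact Submodule.finrank_eq_zero.1 h
  rw [filt, h, Submodule.bot_mul]

theorem eq_zero_of_mem_filt {k : ℕ} (hk : Fintype.card D.od < k) {a : D.Gr} (ha : a ∈ filt D k) :
    a = 0 := by
  rw [filt_eq_bot hk] at ha; exact ha

/-- A product that starts with a generator has no scalar part and lies in the first step of the
filtration. This is the source of all nilpotency below. -/
theorem sub_algebraMapInv_mem_filt (a : D.Gr) :
    a - algebraMap ℝ D.Gr (ExteriorAlgebra.algebraMapInv a) ∈ filt D 1 := by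
  induction a using CliffordAlgebra.left_induction with
  | algebraMap r =>
    change (algebraMap ℝ D.Gr r) - algebraMap ℝ D.Gr
      (ExteriorAlgebra.algebraMapInv (algebraMap ℝ D.Gr r)) ∈ _
    rw [AlgHom.commutes, Algebra.algebraMap_self, RingHom.id_apply, sub_self]
    exact Submodule.zero_mem _
  | add x y hx hy =>
    rw [map_add, map_add, add_sub_add_comm]; exact add_mem hx hy
  | ι_mul x m hx =>
    have : ExteriorAlgebra.algebraMapInv (ExteriorAlgebra.ι ℝ m * x : D.Gr) = 0 := by
      simp [ExteriorAlgebra.algebraMapInv]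
    change (ExteriorAlgebra.ι ℝ m * x : D.Gr) - algebraMap ℝ D.Gr
      (ExteriorAlgebra.algebraMapInv (ExteriorAlgebra.ι ℝ m * x : D.Gr)) ∈ _
    rw [this, map_zero, sub_zero, filt, pow_one]
    exact Submodule.mul_mem_mul ⟨m, rfl⟩ trivial

end Grassmann

end SuperGeom

end
noncomputable section
namespace SuperGeom

/-! ### Smooth superfunctions and their derivatives -/

section Analysis

variable {D D' : SuperDim}

/-- Smoothness in a neighbourhood of a point. -/
def SmoothAt (f : D.Fn) (x : D.ev → ℝ) : Prop :=
  ∀ᶠ y in 𝓝 x, ∀ l : Module.Dual ℝ D.Gr, ContDiffAt ℝ ∞ (fun z => l (f z)) y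

theorem SmoothAt.eventually {f : D.Fn} {x : D.ev → ℝ} (hf : SmoothAt f x) :
    ∀ᶠ y in 𝓝 x, SmoothAt f y :=
  eventually_eventually_nhds.2 hf

theorem SmoothAt.congr {f g : D.Fn} {x : D.ev → ℝ} (hf : SmoothAt f x) (h : f =ᶠ[𝓝 x] g) :
    SmoothAt g x := by
  filter_upwards [hf, eventually_eventually_nhds.2 h] with y hy hy' l
  exact (hy l).congr_of_eventuallyEq (by filter_upwards [hy'] with z hz; rw [hz])

theorem SmoothOn.smoothAt {f : D.Fn} {U : Set (D.ev → ℝ)} (hf : SmoothOn f U) (hU : IsOpen U)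
    {x : D.ev → ℝ} (hx : x ∈ U) : SmoothAt f x := by
  filter_upwards [hU.mem_nhds hx] with y hy l
  exact (hf l).contDiffAt (hU.mem_nhds hy)

theorem smoothOn_of_smoothAt {f : D.Fn} {U : Set (D.ev → ℝ)} (h : ∀ x ∈ U, SmoothAt f x) :
    SmoothOn f U :=
  fun l x hx => ((h x hx).self_of_nhds l).contDiffWithinAt

/-- A norm on the Grassmann algebra. -/
abbrev grNorm (D : SuperDim) : NormedAddCommGroup D.Gr :=
  NormedAddCommGroup.induced D.Gr (Fin (Module.finrank ℝ D.Gr) → ℝ)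
    (Module.finBasis ℝ D.Gr).equivFun (Module.finBasis ℝ D.Gr).equivFun.injective

attribute [local instance] grNorm

/-- The Grassmann algebra is a normed space. -/
abbrev grNormedSpace (D : SuperDim) : NormedSpace ℝ D.Gr :=
  NormedSpace.induced ℝ D.Gr (Fin (Module.finrank ℝ D.Gr) → ℝ)
    (Module.finBasis ℝ D.Gr).equivFun

attribute [local instance] grNormedSpace

/-- The Grassmann algebra is finite dimensional, so smoothness against all functionals is Fréchet
smoothness for any norm. The norm is auxiliary; this equivalence gives access to `fderiv`. -/
theorem smoothAt_iff {f : D.Fn} {x : D.ev → ℝ} :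
    SmoothAt f x ↔ ∀ᶠ y in 𝓝 x, ContDiffAt ℝ ∞ f y := by
  refine Filter.eventually_congr (.of_forall fun y => ⟨fun h => ?_, fun h l => ?_⟩)
  · have h1 : ContDiffAt ℝ ∞ (fun z => (Module.finBasis ℝ D.Gr).equivFun (f z)) y :=
      contDiffAt_pi.2 fun k => h ((Module.finBasis ℝ D.Gr).coord k)
    have h2 := (LinearMap.toContinuousLinearMap
      (Module.finBasis ℝ D.Gr).equivFun.symm.toLinearMap).contDiff.contDiffAt.comp y h1
    refine h2.congr_of_eventuallyEq (.of_forall fun z => ?_)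
    simp
  · exact (LinearMap.toContinuousLinearMap l).contDiff.contDiffAt.comp y h

theorem SmoothAt.contDiffAt {f : D.Fn} {x : D.ev → ℝ} (hf : SmoothAt f x) : ContDiffAt ℝ ∞ f x :=
  (smoothAt_iff.1 hf).self_of_nhds

theorem SmoothAt.differentiableAt {f : D.Fn} {x : D.ev → ℝ} (hf : SmoothAt f x) :
    DifferentiableAt ℝ f x := hf.contDiffAt.differentiableAt (by simp)

-- The basis sum that defines the even derivative reassembles into the Fréchet derivative, so for
-- differentiable functions the chosen basis plays no role.
open Classical in
theorem pd_inl_eq_fderiv {f : D.Fn} {x : D.ev → ℝ} (hf : DifferentiableAt ℝ f x) (i : D.ev) :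
    pd (.inl i) f x = fderiv ℝ f x (Pi.single i 1) := by
  have h : ∀ k, lineDeriv ℝ (fun y => (Module.finBasis ℝ D.Gr).repr (f y) k) x (Pi.single i 1) =
      (Module.finBasis ℝ D.Gr).repr (fderiv ℝ f x (Pi.single i 1)) k := by
    intro k
    have hl := (LinearMap.toContinuousLinearMap
      ((Module.finBasis ℝ D.Gr).coord k)).hasFDerivAt.comp x hf.hasFDerivAt
    have h2 : HasFDerivAt (fun y => (Module.finBasis ℝ D.Gr).repr (f y) k) _ x := hl
    rw [h2.differentiableAt.lineDeriv_eq_fderiv, h2.fderiv]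
    rfl
  simp only [pd, h]
  exact (Module.finBasis ℝ D.Gr).sum_repr _

theorem pd_inr (j : D.od) (f : D.Fn) (x : D.ev → ℝ) : pd (.inr j) f x = contr j (f x) := rfl

theorem pd_congr (A : D.Coord) {f g : D.Fn} {x : D.ev → ℝ} (h : f =ᶠ[𝓝 x] g) :
    pd A f x = pd A g x := by
  rcases A with i | j
  · simp only [pd]
    refine Finset.sum_congr rfl fun k _ => ?_
    congr 1
    refine Filter.EventuallyEq.lineDeriv_eq ?_
    filter_upwards [h] with y hy; rw [hy]
  · rw [pd_inr, pd_inr, h.self_of_nhds]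

theorem pd_eventuallyEq (A : D.Coord) {f g : D.Fn} {x : D.ev → ℝ} (h : f =ᶠ[𝓝 x] g) :
    pd A f =ᶠ[𝓝 x] pd A g := by
  filter_upwards [eventually_eventually_nhds.2 h] with y hy
  exact pd_congr A hy

/-- Post-composition with a linear map and precomposition with a smooth map. -/
theorem SmoothAt.comp_linear (L : D'.Gr →ₗ[ℝ] D.Gr) {f : D'.Fn} {β : (D.ev → ℝ) → D'.ev → ℝ}
    {x : D.ev → ℝ} (hf : SmoothAt f (β x)) (hβ : ∀ᶠ y in 𝓝 x, ContDiffAt ℝ ∞ β y) :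
    SmoothAt (fun y => L (f (β y))) x := by
  rw [smoothAt_iff] at hf ⊢
  filter_upwards [hβ.self_of_nhds.continuousAt.eventually hf, hβ] with y hy hy'
  exact (LinearMap.toContinuousLinearMap L).contDiff.contDiffAt.comp y (hy.comp y hy')

theorem SmoothAt.linear (L : D.Gr →ₗ[ℝ] D.Gr) {f : D.Fn} {x : D.ev → ℝ} (hf : SmoothAt f x) :
    SmoothAt (fun y => L (f y)) x :=
  SmoothAt.comp_linear (β := fun y => y) L hf (.of_forall fun _ => contDiffAt_id)

theorem smoothAt_const (c : D.Gr) (x : D.ev → ℝ) : SmoothAt (fun _ => c) x :=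
  .of_forall fun _ _ => contDiffAt_const

theorem SmoothAt.add {f g : D.Fn} {x : D.ev → ℝ} (hf : SmoothAt f x) (hg : SmoothAt g x) :
    SmoothAt (f + g) x := by
  filter_upwards [hf, hg] with y h1 h2 l
  simpa using (h1 l).add (h2 l)

theorem SmoothAt.neg {f : D.Fn} {x : D.ev → ℝ} (hf : SmoothAt f x) : SmoothAt (-f) x := by
  filter_upwards [hf] with y h1 l
  simpa using (h1 l).neg

theorem SmoothAt.sub {f g : D.Fn} {x : D.ev → ℝ} (hf : SmoothAt f x) (hg : SmoothAt g x) :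
    SmoothAt (f - g) x := by
  rw [sub_eq_add_neg]; exact hf.add hg.neg

theorem SmoothAt.smul (c : ℝ) {f : D.Fn} {x : D.ev → ℝ} (hf : SmoothAt f x) :
    SmoothAt (c • f) x := by
  filter_upwards [hf] with y h1 l
  simpa using contDiffAt_const.mul (h1 l)

theorem smoothAt_zero (x : D.ev → ℝ) : SmoothAt (0 : D.Fn) x := smoothAt_const 0 x

theorem SmoothAt.sum {ι : Type*} (s : Finset ι) {f : ι → D.Fn} {x : D.ev → ℝ}
    (hf : ∀ i ∈ s, SmoothAt (f i) x) : SmoothAt (∑ i ∈ s, f i) x := by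
  classical
  induction s using Finset.induction_on with
  | empty => exact smoothAt_zero x
  | insert a s ha ih =>
    rw [Finset.sum_insert ha]
    exact (hf a (by simp)).add (ih fun i hi => hf i (by simp [hi]))

theorem smoothAt_algebraMap {r : (D.ev → ℝ) → ℝ} {x : D.ev → ℝ}
    (hr : ∀ᶠ y in 𝓝 x, ContDiffAt ℝ ∞ r y) : SmoothAt (fun y => algebraMap ℝ D.Gr (r y)) x := by
  filter_upwards [hr] with y hy l
  simp only [Algebra.algebraMap_eq_smul_one, map_smul, smul_eq_mul]
  exact hy.mul contDiffAt_const

/-- Multiplication of the Grassmann algebra, as a continuous bilinear map. -/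
def grMul (D : SuperDim) : D.Gr →L[ℝ] D.Gr →L[ℝ] D.Gr :=
  LinearMap.toContinuousLinearMap
    ((LinearMap.toContinuousLinearMap : (D.Gr →ₗ[ℝ] D.Gr) ≃ₗ[ℝ] (D.Gr →L[ℝ] D.Gr)).toLinearMap ∘ₗ
      LinearMap.mul ℝ D.Gr)

theorem grMul_apply (a b : D.Gr) : grMul D a b = a * b := rfl

theorem SmoothAt.mul {f g : D.Fn} {x : D.ev → ℝ} (hf : SmoothAt f x) (hg : SmoothAt g x) :
    SmoothAt (f * g) x := by
  rw [smoothAt_iff] at hf hg ⊢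
  filter_upwards [hf, hg] with y h1 h2
  exact (((grMul D).contDiff.contDiffAt.comp y h1).clm_apply h2 : _)

theorem SmoothAt.twist (ε : ZMod 2) {f : D.Fn} {x : D.ev → ℝ} (hf : SmoothAt f x) :
    SmoothAt (twist ε f) x := by
  have := hf.linear (tw ε).toLinearMap
  refine this.congr (.of_forall fun y => ?_)
  rw [twist_apply]; rfl

theorem smoothAt_coord (A : D.Coord) (x : D.ev → ℝ) : SmoothAt (coord A) x := by
  rcases A with i | j
  · exact smoothAt_algebraMap (.of_forall fun y => contDiffAt_apply ℝ ℝ i y)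
  · exact smoothAt_const _ x

theorem SmoothAt.pd {f : D.Fn} {x : D.ev → ℝ} (hf : SmoothAt f x) (A : D.Coord) :
    SmoothAt (pd A f) x := by
  rcases A with i | j
  · classical
    have h1 : SmoothAt (fun y => fderiv ℝ f y (Pi.single i 1)) x := by
      rw [smoothAt_iff]
      filter_upwards [smoothAt_iff.1 hf] with y hy
      have : ContDiffAt ℝ ∞ (fderiv ℝ f) y := hy.fderiv_right (by simp)
      exact this.clm_apply contDiffAt_const
    refine h1.congr ?_
    filter_upwards [hf.eventually] with y hy
    rw [pd_inl_eq_fderiv hy.differentiableAt]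
  · exact hf.linear (contr j)

theorem pd_add (A : D.Coord) {f g : D.Fn} {x : D.ev → ℝ} (hf : SmoothAt f x) (hg : SmoothAt g x) :
    pd A (f + g) x = pd A f x + pd A g x := by
  rcases A with i | j
  · rw [pd_inl_eq_fderiv hf.differentiableAt, pd_inl_eq_fderiv hg.differentiableAt,
      pd_inl_eq_fderiv (hf.add hg).differentiableAt,
      fderiv_add hf.differentiableAt hg.differentiableAt]
    rfl
  · simp only [pd_inr, Pi.add_apply, map_add]

theorem pd_smul (A : D.Coord) (c : ℝ) {f : D.Fn} {x : D.ev → ℝ} (hf : SmoothAt f x) :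
    pd A (c • f) x = c • pd A f x := by
  rcases A with i | j
  · rw [pd_inl_eq_fderiv hf.differentiableAt, pd_inl_eq_fderiv (hf.smul c).differentiableAt,
      fderiv_const_smul hf.differentiableAt]
    rfl
  · simp only [pd_inr, Pi.smul_apply, map_smul]

theorem pd_const (A : D.Coord) (r : ℝ) (x : D.ev → ℝ) :
    pd A (fun _ => algebraMap ℝ D.Gr r) x = 0 := by
  rcases A with i | j
  · rw [pd_inl_eq_fderiv (by fun_prop)]; simp
  · simp [pd_inr]

theorem pd_inl_const (i : D.ev) (c : D.Gr) (x : D.ev → ℝ) :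
    pd (.inl i) (fun _ => c) x = 0 := by
  rw [pd_inl_eq_fderiv (by fun_prop)]; simp

theorem pd_zero (A : D.Coord) (x : D.ev → ℝ) : pd A (0 : D.Fn) x = 0 := by
  have h := pd_const A 0 x; simp only [map_zero] at h; exact h

theorem pd_sum (A : D.Coord) {ι : Type*} (s : Finset ι) {f : ι → D.Fn} {x : D.ev → ℝ}
    (hf : ∀ i ∈ s, SmoothAt (f i) x) : pd A (∑ i ∈ s, f i) x = ∑ i ∈ s, pd A (f i) x := by
  classical
  induction s using Finset.induction_on with
  | empty => exact pd_zero A x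
  | insert a s ha ih =>
    rw [Finset.sum_insert ha, Finset.sum_insert ha, pd_add A (hf a (by simp))
      (SmoothAt.sum s fun i hi => hf i (by simp [hi])), ih fun i hi => hf i (by simp [hi])]

/-- Even derivatives use that multiplication is a bounded bilinear map, odd ones the antiderivation
property of contraction; `tw (D.par A)` states both rules at once. -/
theorem pd_mul (A : D.Coord) {f g : D.Fn} {x : D.ev → ℝ} (hf : SmoothAt f x) (hg : SmoothAt g x) :
    pd A (f * g) x = pd A f x * g x + tw (D.par A) (f x) * pd A g x := by
  rcases A with i | j
  · rw [pd_inl_eq_fderiv hf.differentiableAt, pd_inl_eq_fderiv hg.differentiableAt,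
      pd_inl_eq_fderiv (hf.mul hg).differentiableAt]
    have h := (((grMul D).hasFDerivAt.comp x hf.differentiableAt.hasFDerivAt).clm_apply
      hg.differentiableAt.hasFDerivAt)
    have h2 : HasFDerivAt (f * g) _ x := h
    rw [h2.fderiv]
    simp [SuperDim.par, grMul_apply, add_comm]
  · simp only [pd_inr, Pi.mul_apply, contr_mul, SuperDim.par]

theorem pd_inl_linear (i : D.ev) (L : D.Gr →ₗ[ℝ] D.Gr) {f : D.Fn} {x : D.ev → ℝ}
    (hf : SmoothAt f x) : pd (.inl i) (fun y => L (f y)) x = L (pd (.inl i) f x) := by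
  rw [pd_inl_eq_fderiv hf.differentiableAt, pd_inl_eq_fderiv (hf.linear L).differentiableAt]
  have h := (LinearMap.toContinuousLinearMap L).hasFDerivAt.comp x
    hf.differentiableAt.hasFDerivAt
  have h2 : HasFDerivAt (fun y => L (f y)) _ x := h
  rw [h2.fderiv]; rfl

open Classical in
/-- The chain rule for even derivatives of a superfunction composed with a map of the underlying
domains. -/
theorem pd_inl_comp_linear (i : D.ev) (L : D'.Gr →ₗ[ℝ] D.Gr) {f : D'.Fn}
    {β : (D.ev → ℝ) → D'.ev → ℝ} {x : D.ev → ℝ} (hf : SmoothAt f (β x))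
    (hβ : ∀ᶠ y in 𝓝 x, ContDiffAt ℝ ∞ β y) :
    pd (.inl i) (fun y => L (f (β y))) x =
      ∑ k, fderiv ℝ β x (Pi.single i 1) k • L (pd (.inl k) f (β x)) := by
  rw [pd_inl_eq_fderiv (hf.comp_linear L hβ).differentiableAt]
  have h := ((LinearMap.toContinuousLinearMap L).hasFDerivAt.comp x
    (hf.differentiableAt.hasFDerivAt.comp x
      (hβ.self_of_nhds.differentiableAt (by simp)).hasFDerivAt))
  have h2 : HasFDerivAt (fun y => L (f (β y))) _ x := h
  rw [h2.fderiv]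
  simp only [pd_inl_eq_fderiv hf.differentiableAt]
  set v := fderiv ℝ β x (Pi.single i 1) with hv
  change L (fderiv ℝ f (β x) v) = _
  conv_lhs => rw [← Finset.univ_sum_single v]
  rw [map_sum, map_sum]
  refine Finset.sum_congr rfl fun k _ => ?_
  rw [← map_smul, ← map_smul, ← Pi.single_smul]
  simp

open Classical in
theorem pd_inl_algebraMap (i : D.ev) {r : (D.ev → ℝ) → ℝ} {x : D.ev → ℝ}
    (hr : ∀ᶠ y in 𝓝 x, ContDiffAt ℝ ∞ r y) :
    pd (.inl i) (fun y => algebraMap ℝ D.Gr (r y)) x =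
      algebraMap ℝ D.Gr (fderiv ℝ r x (Pi.single i 1)) := by
  rw [pd_inl_eq_fderiv (smoothAt_algebraMap hr).differentiableAt]
  have h := (LinearMap.toContinuousLinearMap (Algebra.linearMap ℝ D.Gr)).hasFDerivAt.comp x
    (hr.self_of_nhds.differentiableAt (by simp)).hasFDerivAt
  have h2 : HasFDerivAt (fun y => algebraMap ℝ D.Gr (r y)) _ x := h
  rw [h2.fderiv]; rfl

theorem pd_coord [DecidableEq D.Coord] (A B : D.Coord) (x : D.ev → ℝ) :
    pd A (coord B) x = if A = B then 1 else 0 := by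
  classical
  rcases A with i | i <;> rcases B with j | j
  · have h : (coord (Sum.inl j) : D.Fn) = fun y => algebraMap ℝ D.Gr (y j) := rfl
    rw [h, pd_inl_algebraMap i (.of_forall fun y => contDiffAt_apply ℝ ℝ j y)]
    have : HasFDerivAt (fun y : D.ev → ℝ => y j) (ContinuousLinearMap.proj j) x :=
      hasFDerivAt_apply (𝕜 := ℝ) j x
    rw [this.fderiv]
    by_cases hij : i = j
    · subst hij; simp
    · simp [hij, Ne.symm hij]
  · rw [show (coord (Sum.inr j) : D.Fn) = fun _ => ExteriorAlgebra.ι ℝ (Finsupp.single j 1)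
      from rfl, pd_inl_const]
    simp
  · simp [pd_inr, coord]
  · simp only [pd_inr, coord, contr_ι, Finsupp.single_apply, Sum.inr.injEq]
    by_cases hij : i = j
    · subst hij; simp
    · simp [hij, Ne.symm hij]

/-- Two even derivatives commute by symmetry of the second derivative, an even and an odd one
because contraction is a constant linear map, and two odd ones anticommute as contractions do. -/
theorem pd_comm (A B : D.Coord) {f : D.Fn} {x : D.ev → ℝ} (hf : SmoothAt f x) :
    pd A (pd B f) x = sgn (D.par A * D.par B) • pd B (pd A f) x := by
  classical
  rcases A with i | i <;> rcases B with j | j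
  · have key : ∀ i j : D.ev, pd (.inl i) (pd (.inl j) f) x =
        fderiv ℝ (fderiv ℝ f) x (Pi.single i 1) (Pi.single j 1) := by
      intro i j
      have he : pd (.inl j) f =ᶠ[𝓝 x] fun y => fderiv ℝ f y (Pi.single j 1) := by
        filter_upwards [hf.eventually] with y hy
        rw [pd_inl_eq_fderiv hy.differentiableAt]
      have hd : DifferentiableAt ℝ (fderiv ℝ f) x :=
        (hf.contDiffAt.fderiv_right (m := 1) (by norm_cast)).differentiableAt (by simp)
      rw [pd_inl_eq_fderiv (hf.pd _).differentiableAt, he.fderiv_eq,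
        fderiv_clm_apply hd (by fun_prop)]
      simp
    rw [key, key]
    have := hf.contDiffAt.isSymmSndFDerivAt (by simp; norm_cast)
    rw [this.eq]
    simp [SuperDim.par]
  · simp only [SuperDim.par, zero_mul, sgn_zero, one_smul]
    exact pd_inl_linear i (contr j) hf
  · simp only [SuperDim.par, mul_zero, sgn_zero, one_smul]
    exact (pd_inl_linear j (contr i) hf).symm
  · simp only [SuperDim.par, mul_one, sgn_one, neg_smul, one_smul, pd_inr]
    exact contr_contr i j (f x)

theorem pd_twist (A : D.Coord) (ε : ZMod 2) {f : D.Fn} {x : D.ev → ℝ} (hf : SmoothAt f x) :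
    pd A (twist ε f) x = sgn (ε * D.par A) • tw ε (pd A f x) := by
  have h : twist ε f = fun y => (tw ε).toLinearMap (f y) := by
    ext1 y; rw [twist_apply]; rfl
  rcases A with i | j
  · rw [h, pd_inl_linear i _ hf]; simp [SuperDim.par]
  · rw [pd_inr, twist_apply, contr_tw]; simp [SuperDim.par, pd_inr]

/-- The derivative of `twist 1 f` is computed twice, from the parity of `f` near the point and from
the commutation rule of derivative and twist; the comparison identifies the eigenvalue of `tw 1`. -/
theorem pd_mem {A : D.Coord} {f : D.Fn} {x : D.ev → ℝ} {ε : ZMod 2} (hf : SmoothAt f x)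
    (h : ∀ᶠ y in 𝓝 x, f y ∈ grPart D ε) : pd A f x ∈ grPart D (ε + D.par A) := by
  apply mem_grPart_of_tw
  have h1 := pd_twist A 1 hf
  have h2 : twist 1 f =ᶠ[𝓝 x] sgn ε • f := by
    filter_upwards [h] with y hy
    rw [twist_apply, tw_of_mem hy, one_mul]; rfl
  rw [pd_congr A h2, pd_smul A _ hf] at h1
  have h3 := congrArg (fun z => sgn (D.par A) • z) h1
  simp only [one_mul, sgn_smul_sgn_smul] at h3
  rw [zmod_two_add_self, sgn_zero, one_smul] at h3
  rw [← h3, add_comm]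

theorem eventually_pd_mem {A : D.Coord} {f : D.Fn} {x : D.ev → ℝ} {ε : ZMod 2}
    (hf : SmoothAt f x) (h : ∀ᶠ y in 𝓝 x, f y ∈ grPart D ε) :
    ∀ᶠ y in 𝓝 x, pd A f y ∈ grPart D (ε + D.par A) := by
  filter_upwards [hf.eventually, eventually_eventually_nhds.2 h] with y h1 h2
  exact pd_mem h1 h2

theorem coord_mem (A : D.Coord) (x : D.ev → ℝ) : coord A x ∈ grPart D (D.par A) := by
  rcases A with i | j
  · exact algebraMap_mem_grPart _
  · exact ι_mem_grPart _

/-! ### Extension to a larger set of coordinates -/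

theorem par_map (e : D.ev → D'.ev) (o : D.od → D'.od) (A : D.Coord) :
    D'.par (Sum.map e o A) = D.par A := by
  rcases A with i | j <;> rfl

theorem ext_coord (e : D.ev → D'.ev) (o : D.od → D'.od) (A : D.Coord) :
    ext e o (coord A) = (coord (Sum.map e o A) : D'.Fn) := by
  ext1 x
  rcases A with i | j
  · simp [ext, coord]
  · simp only [ext, coord, Sum.map_inr, map_ι', Finsupp.lmapDomain_apply, Finsupp.mapDomain_single]

theorem ext_add (e : D.ev → D'.ev) (o : D.od → D'.od) (f g : D.Fn) :
    (ext e o (f + g) : D'.Fn) = ext e o f + ext e o g := by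
  ext1 x; simp [ext]

theorem ext_mul (e : D.ev → D'.ev) (o : D.od → D'.od) (f g : D.Fn) :
    (ext e o (f * g) : D'.Fn) = ext e o f * ext e o g := by
  ext1 x; simp [ext]

theorem ext_smul (e : D.ev → D'.ev) (o : D.od → D'.od) (c : ℝ) (f : D.Fn) :
    (ext e o (c • f) : D'.Fn) = c • ext e o f := by
  ext1 x; simp [ext]

theorem ext_neg (e : D.ev → D'.ev) (o : D.od → D'.od) (f : D.Fn) :
    (ext e o (-f) : D'.Fn) = -ext e o f := by
  ext1 x; simp [ext]

theorem ext_zero (e : D.ev → D'.ev) (o : D.od → D'.od) : (ext e o (0 : D.Fn) : D'.Fn) = 0 := by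
  ext1 x; simp [ext]

theorem ext_one (e : D.ev → D'.ev) (o : D.od → D'.od) : (ext e o (1 : D.Fn) : D'.Fn) = 1 := by
  ext1 x; simp [ext]

theorem ext_sum (e : D.ev → D'.ev) (o : D.od → D'.od) {ι : Type*} (s : Finset ι) (f : ι → D.Fn) :
    (ext e o (∑ i ∈ s, f i) : D'.Fn) = ∑ i ∈ s, ext e o (f i) := by
  ext1 x; simp [ext, Finset.sum_apply]

theorem ext_twist (e : D.ev → D'.ev) (o : D.od → D'.od) (ε : ZMod 2) (f : D.Fn) :
    (ext e o (twist ε f) : D'.Fn) = twist ε (ext e o f) := by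
  ext1 x
  rw [twist_apply]
  simp only [ext, twist_apply, map_tw]

theorem ext_ext {D'' : SuperDim} (e : D.ev → D'.ev) (o : D.od → D'.od) (e' : D'.ev → D''.ev)
    (o' : D'.od → D''.od) (f : D.Fn) :
    (ext e' o' (ext e o f : D'.Fn) : D''.Fn) = ext (e' ∘ e) (o' ∘ o) f := by
  ext1 x
  simp only [ext, Finsupp.lmapDomain_comp]
  rw [← AlgHom.comp_apply, ExteriorAlgebra.map_comp_map]
  rfl

theorem ext_apply_congr (e : D.ev → D'.ev) (o : D.od → D'.od) {f g : D.Fn} {x : D'.ev → ℝ}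
    (h : f (x ∘ e) = g (x ∘ e)) : (ext e o f : D'.Fn) x = ext e o g x := by
  simp only [ext, h]

theorem continuous_comp_left (e : D.ev → D'.ev) :
    Continuous fun x : D'.ev → ℝ => (x ∘ e : D.ev → ℝ) := by
  refine continuous_pi fun i => continuous_apply _

theorem contDiff_comp_left (e : D.ev → D'.ev) :
    ContDiff ℝ ∞ fun x : D'.ev → ℝ => (x ∘ e : D.ev → ℝ) :=
  contDiff_pi.2 fun i => contDiff_apply ℝ ℝ (e i)

theorem ext_eventuallyEq (e : D.ev → D'.ev) (o : D.od → D'.od) {f g : D.Fn} {x : D'.ev → ℝ}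
    (h : f =ᶠ[𝓝 (x ∘ e)] g) : (ext e o f : D'.Fn) =ᶠ[𝓝 x] ext e o g := by
  filter_upwards [(continuous_comp_left e).continuousAt.eventually h] with y hy
  exact ext_apply_congr e o hy

theorem SmoothAt.ext {e : D.ev → D'.ev} {o : D.od → D'.od} {f : D.Fn} {x : D'.ev → ℝ}
    (hf : SmoothAt f (x ∘ e)) : SmoothAt (ext e o f : D'.Fn) x :=
  SmoothAt.comp_linear (D := D') (D' := D)
    (ExteriorAlgebra.map (Finsupp.lmapDomain ℝ ℝ o)).toLinearMap (β := fun y => y ∘ e) hf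
    (.of_forall fun _ => (contDiff_comp_left e).contDiffAt)

theorem ext_mem {e : D.ev → D'.ev} {o : D.od → D'.od} {f : D.Fn} {x : D'.ev → ℝ} {ε : ZMod 2}
    (h : f (x ∘ e) ∈ grPart D ε) : (ext e o f : D'.Fn) x ∈ grPart D' ε :=
  map_mem_grPart _ h

open Classical in
theorem fderiv_comp_left (e : D.ev → D'.ev) (x : D'.ev → ℝ) (i : D'.ev) (k : D.ev) :
    fderiv ℝ (fun x : D'.ev → ℝ => (x ∘ e : D.ev → ℝ)) x (Pi.single i 1) k =
      if e k = i then 1 else 0 := by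
  have : HasFDerivAt (fun x : D'.ev → ℝ => (x ∘ e : D.ev → ℝ))
      (ContinuousLinearMap.pi fun k => ContinuousLinearMap.proj (R := ℝ) (e k)) x :=
    hasFDerivAt_pi.2 fun k => hasFDerivAt_apply (e k) x
  rw [this.fderiv]
  simp [Pi.single_apply]

/-- The base map only selects coordinates, so the chain rule has a single nonzero term; injectivity
of `e` excludes a second one. -/
theorem pd_ext {e : D.ev → D'.ev} {o : D.od → D'.od} (he : Function.Injective e)
    (ho : Function.Injective o) (A : D.Coord) {f : D.Fn} {x : D'.ev → ℝ}
    (hf : SmoothAt f (x ∘ e)) :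
    pd (Sum.map e o A) (ext e o f : D'.Fn) x = ext e o (pd A f) x := by
  classical
  rcases A with i | j
  · have := pd_inl_comp_linear (D := D') (D' := D) (e i)
      (ExteriorAlgebra.map (Finsupp.lmapDomain ℝ ℝ o)).toLinearMap (β := fun y => y ∘ e) hf
      (.of_forall fun _ => (contDiff_comp_left e).contDiffAt)
    refine this.trans ?_
    rw [Finset.sum_eq_single i]
    · rw [fderiv_comp_left]; simp [ext]
    · intro k _ hk
      rw [fderiv_comp_left, if_neg fun h => hk (he h), zero_smul]
    · simp
  · simp only [Sum.map_inr, pd_inr]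
    exact contr_map_lmapDomain ho j _

theorem pd_ext_of_notMem {e : D.ev → D'.ev} {o : D.od → D'.od} {A : D'.Coord}
    (hA : A ∉ Set.range (Sum.map e o)) {f : D.Fn} {x : D'.ev → ℝ}
    (hf : SmoothAt f (x ∘ e)) :
    pd A (ext e o f : D'.Fn) x = 0 := by
  classical
  rcases A with i | j
  · have := pd_inl_comp_linear (D := D') (D' := D) i
      (ExteriorAlgebra.map (Finsupp.lmapDomain ℝ ℝ o)).toLinearMap (β := fun y => y ∘ e) hf
      (.of_forall fun _ => (contDiff_comp_left e).contDiffAt)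
    refine this.trans (Finset.sum_eq_zero fun k _ => ?_)
    rw [fderiv_comp_left, if_neg, zero_smul]
    intro h; exact hA ⟨.inl k, by simp [h]⟩
  · rw [pd_inr]
    refine contr_map_lmapDomain_of_notMem (fun ⟨k, hk⟩ => hA ⟨.inr k, by simp [hk]⟩) _

/-- Over a field an injective linear map has a linear left inverse, and functoriality of the
exterior algebra turns it into a left inverse of the algebra map. -/
theorem map_lmapDomain_injective {o : D.od → D'.od} (ho : Function.Injective o) :
    Function.Injective (fun a : D.Gr =>
      (ExteriorAlgebra.map (Finsupp.lmapDomain ℝ ℝ o) a : D'.Gr)) := by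
  have h : (Finsupp.lmapDomain ℝ ℝ o : (D.od →₀ ℝ) →ₗ[ℝ] (D'.od →₀ ℝ)).ker = ⊥ :=
    LinearMap.ker_eq_bot.2 (Finsupp.mapDomain_injective ho)
  obtain ⟨g, hg⟩ := LinearMap.exists_leftInverse_of_injective _ h
  intro a b hab
  have := congrArg (ExteriorAlgebra.map g) hab
  simp only [← AlgHom.comp_apply, ExteriorAlgebra.map_comp_map, hg, ExteriorAlgebra.map_id] at this
  exact this

theorem ext_injective_at {e : D.ev → D'.ev} {o : D.od → D'.od} (ho : Function.Injective o)
    {f g : D.Fn} {x : D'.ev → ℝ} (h : (ext e o f : D'.Fn) x = ext e o g x) :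
    f (x ∘ e) = g (x ∘ e) :=
  map_lmapDomain_injective ho h

end Analysis

end SuperGeom

end
noncomputable section
namespace SuperGeom

/-! ### Substitution -/

section Substitution

variable {D D' : SuperDim}

/-- The superfunctions `φ` have the parities of the coordinates. -/
def ParAt (φ : D'.Coord → D.Fn) (x : D.ev → ℝ) : Prop :=
  ∀ A, φ A x ∈ grPart D (D'.par A)

/-- The superfunctions `φ` define a morphism of superdomains near `x`. -/
structure MorAt (φ : D'.Coord → D.Fn) (x : D.ev → ℝ) : Prop where
  smooth : ∀ A, SmoothAt (φ A) x
  parity : ∀ᶠ y in 𝓝 x, ParAt φ y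

theorem MorAt.parAt {φ : D'.Coord → D.Fn} {x : D.ev → ℝ} (h : MorAt φ x) : ParAt φ x :=
  h.parity.self_of_nhds

theorem linearCombination_mem {φ : D'.Coord → D.Fn} {x : D.ev → ℝ} (h : ParAt φ x)
    (v : D'.od →₀ ℝ) :
    Finsupp.linearCombination ℝ (fun j => φ (.inr j) x) v ∈ grPart D 1 := by
  rw [Finsupp.linearCombination_apply]
  exact Submodule.sum_mem _ fun j _ => Submodule.smul_mem _ _ (h (.inr j))

/-- Odd elements square to zero, so under the parity hypothesis the definition takes its meaningful
branch. -/
theorem oddSubst_ι {φ : D'.Coord → D.Fn} {x : D.ev → ℝ} (h : ParAt φ x) (v : D'.od →₀ ℝ) :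
    oddSubst φ x (ExteriorAlgebra.ι ℝ v) =
      Finsupp.linearCombination ℝ (fun j => φ (.inr j) x) v := by
  have h' : ∀ m, Finsupp.linearCombination ℝ (fun j => φ (.inr j) x) m *
      Finsupp.linearCombination ℝ (fun j => φ (.inr j) x) m = 0 :=
    fun m => odd_mul_self (linearCombination_mem h m)
  unfold oddSubst
  simp only
  rw [dif_pos h', ExteriorAlgebra.lift_ι_apply]

theorem oddSubst_ι_mem {φ : D'.Coord → D.Fn} {x : D.ev → ℝ} (h : ParAt φ x) (v : D'.od →₀ ℝ) :
    oddSubst φ x (ExteriorAlgebra.ι ℝ v) ∈ grPart D 1 := by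
  rw [oddSubst_ι h]; exact linearCombination_mem h v

theorem oddSubst_tw {φ : D'.Coord → D.Fn} {x : D.ev → ℝ} (h : ParAt φ x) (ε : ZMod 2)
    (a : D'.Gr) : oddSubst φ x (tw ε a) = tw ε (oddSubst φ x a) := by
  induction a using CliffordAlgebra.left_induction with
  | algebraMap r => simp
  | add x y hx hy => simp only [map_add, hx, hy]
  | ι_mul b m hx =>
    change oddSubst φ x (tw ε (ExteriorAlgebra.ι ℝ m * b)) =
      tw ε (oddSubst φ x (ExteriorAlgebra.ι ℝ m * b))
    rw [map_mul, map_mul, map_mul, map_mul, hx, tw_ι, map_smul, tw_of_mem (oddSubst_ι_mem h m),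
      mul_one]

theorem algebraMapInv_map (f : (D.od →₀ ℝ) →ₗ[ℝ] (D'.od →₀ ℝ)) (a : D.Gr) :
    ExteriorAlgebra.algebraMapInv (ExteriorAlgebra.map f a) =
      (ExteriorAlgebra.algebraMapInv a : ℝ) := by
  induction a using CliffordAlgebra.left_induction with
  | algebraMap r => simp
  | add x y hx hy => simp only [map_add, hx, hy]
  | ι_mul b m hx =>
    change ExteriorAlgebra.algebraMapInv (ExteriorAlgebra.map f (ExteriorAlgebra.ι ℝ m * b)) =
      ExteriorAlgebra.algebraMapInv (ExteriorAlgebra.ι ℝ m * b)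
    rw [map_mul, map_ι']
    simp [ExteriorAlgebra.algebraMapInv]

/-- The even components of `φ` at the underlying point. -/
def bodyFn (φ : D'.Coord → D.Fn) (i : D'.ev) : D.Fn :=
  fun x => algebraMap ℝ D.Gr (body φ x i)

theorem bodyFn_add_soul (φ : D'.Coord → D.Fn) (i : D'.ev) :
    bodyFn φ i + soul φ i = φ (.inl i) := by
  ext1 x; simp [bodyFn, soul]

theorem soul_mem_filt (φ : D'.Coord → D.Fn) (i : D'.ev) (x : D.ev → ℝ) :
    soul φ i x ∈ filt D 1 :=
  sub_algebraMapInv_mem_filt _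

theorem soul_mem {φ : D'.Coord → D.Fn} {x : D.ev → ℝ} (h : ParAt φ x) (i : D'.ev) :
    soul φ i x ∈ grPart D 0 :=
  Submodule.sub_mem _ (h (.inl i)) (algebraMap_mem_grPart _)

/-! ### Taylor expansion along the nilpotent parts -/

/-- The term of degree `k` of the Taylor expansion, multiplied by `k!`. -/
def taylor (φ : D'.Coord → D.Fn) (k : ℕ) (g : D'.Fn) (x : D.ev → ℝ) : D.Gr :=
  ∑ s : Fin k → D'.ev,
    oddSubst φ x ((List.ofFn s).foldr (fun i h => pd (.inl i) h) g (body φ x)) *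
      (List.ofFn fun m => soul φ (s m) x).prod

theorem taylor_zero (φ : D'.Coord → D.Fn) (g : D'.Fn) (x : D.ev → ℝ) :
    taylor φ 0 g x = oddSubst φ x (g (body φ x)) := by
  simp [taylor]

/-- Splitting off the last index isolates the derivative applied first to `g` and the last soul in
the product. This recursion, which replaces `g` by its derivatives, drives every induction on the
degree. -/
theorem taylor_succ (φ : D'.Coord → D.Fn) (k : ℕ) (g : D'.Fn) (x : D.ev → ℝ) :
    taylor φ (k + 1) g x = ∑ j, taylor φ k (pd (.inl j) g) x * soul φ j x := by
  unfold taylor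
  rw [← (Fin.snocEquiv (fun _ => D'.ev)).sum_comp, Fintype.sum_prod_type]
  refine Finset.sum_congr rfl fun j _ => ?_
  rw [Finset.sum_mul]
  refine Finset.sum_congr rfl fun s _ => ?_
  simp only [Fin.snocEquiv, Equiv.coe_fn_mk, List.ofFn_succ', Fin.snoc_castSucc, Fin.snoc_last,
    List.concat_eq_append, List.foldr_append, List.foldr_cons, List.foldr_nil, List.prod_append,
    List.prod_singleton, mul_assoc]

theorem taylor_mem_filt (φ : D'.Coord → D.Fn) (k : ℕ) (g : D'.Fn) (x : D.ev → ℝ) :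
    taylor φ k g x ∈ filt D k := by
  induction k generalizing g with
  | zero => exact filt_zero _
  | succ k ih =>
    rw [taylor_succ]
    exact Submodule.sum_mem _ fun j _ => mul_mem_filt (ih _) (soul_mem_filt _ _ _)

theorem taylor_eq_zero (φ : D'.Coord → D.Fn) {k : ℕ} (hk : Fintype.card D.od < k) (g : D'.Fn)
    (x : D.ev → ℝ) : taylor φ k g x = 0 :=
  eq_zero_of_mem_filt hk (taylor_mem_filt φ k g x)

/-- The degree `k` term contains `k` souls, hence vanishes when `k` exceeds the number of odd
coordinates. The truncation order may therefore be raised freely to fit a computation. -/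
theorem subst_eq_sum (φ : D'.Coord → D.Fn) (g : D'.Fn) (x : D.ev → ℝ) {N : ℕ}
    (hN : Fintype.card D.od + 1 ≤ N) :
    subst φ g x = ∑ k ∈ Finset.range N, ((k.factorial : ℝ)⁻¹) • taylor φ k g x := by
  rw [← Finset.sum_subset (Finset.range_mono hN)]
  · rfl
  · intro k _ hk
    rw [taylor_eq_zero, smul_zero]
    simpa using hk

theorem taylor_congr {φ : D'.Coord → D.Fn} {k : ℕ} {g g' : D'.Fn} {x : D.ev → ℝ}
    (h : g =ᶠ[𝓝 (body φ x)] g') : taylor φ k g x = taylor φ k g' x := by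
  induction k generalizing g g' with
  | zero => rw [taylor_zero, taylor_zero, h.self_of_nhds]
  | succ k ih =>
    rw [taylor_succ, taylor_succ]
    exact Finset.sum_congr rfl fun j _ => by rw [ih (pd_eventuallyEq _ h)]

theorem subst_congr {φ : D'.Coord → D.Fn} {g g' : D'.Fn} {x : D.ev → ℝ}
    (h : g =ᶠ[𝓝 (body φ x)] g') : subst φ g x = subst φ g' x := by
  rw [subst_eq_sum _ _ _ le_rfl, subst_eq_sum _ _ _ le_rfl]
  exact Finset.sum_congr rfl fun k _ => by rw [taylor_congr h]

theorem pd_add_eventually (A : D.Coord) {f g : D.Fn} {x : D.ev → ℝ} (hf : SmoothAt f x)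
    (hg : SmoothAt g x) : pd A (f + g) =ᶠ[𝓝 x] pd A f + pd A g := by
  filter_upwards [hf.eventually, hg.eventually] with y h1 h2
  exact pd_add A h1 h2

theorem pd_mul_eventually (A : D.Coord) {f g : D.Fn} {x : D.ev → ℝ} (hf : SmoothAt f x)
    (hg : SmoothAt g x) :
    pd A (f * g) =ᶠ[𝓝 x] pd A f * g + twist (D.par A) f * pd A g := by
  filter_upwards [hf.eventually, hg.eventually] with y h1 h2
  rw [pd_mul A h1 h2, Pi.add_apply, Pi.mul_apply, Pi.mul_apply, twist_apply]

theorem twist_zero (f : D.Fn) : twist 0 f = f := by simp [twist]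

theorem taylor_add {φ : D'.Coord → D.Fn} {k : ℕ} {g h : D'.Fn} {x : D.ev → ℝ}
    (hg : SmoothAt g (body φ x)) (hh : SmoothAt h (body φ x)) :
    taylor φ k (g + h) x = taylor φ k g x + taylor φ k h x := by
  induction k generalizing g h with
  | zero => simp only [taylor_zero, Pi.add_apply, map_add]
  | succ k ih =>
    simp only [taylor_succ, ← Finset.sum_add_distrib, ← add_mul]
    refine Finset.sum_congr rfl fun j _ => ?_
    rw [taylor_congr (pd_add_eventually _ hg hh), ih (hg.pd _) (hh.pd _)]

theorem taylor_smul {φ : D'.Coord → D.Fn} {k : ℕ} (c : ℝ) {g : D'.Fn} {x : D.ev → ℝ}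
    (hg : SmoothAt g (body φ x)) : taylor φ k (c • g) x = c • taylor φ k g x := by
  induction k generalizing g with
  | zero => simp only [taylor_zero, Pi.smul_apply, map_smul]
  | succ k ih =>
    simp only [taylor_succ, Finset.smul_sum, ← smul_mul_assoc]
    refine Finset.sum_congr rfl fun j _ => ?_
    have : pd (.inl j) (c • g) =ᶠ[𝓝 (body φ x)] c • pd (.inl j) g := by
      filter_upwards [hg.eventually] with y hy
      exact pd_smul _ _ hy
    rw [taylor_congr this, ih (hg.pd _)]

theorem taylor_const {φ : D'.Coord → D.Fn} {k : ℕ} {g : D'.Fn} {x : D.ev → ℝ}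
    (hg : ∀ j, pd (.inl j) g =ᶠ[𝓝 (body φ x)] 0) : taylor φ (k + 1) g x = 0 := by
  induction k generalizing g with
  | zero =>
    rw [taylor_succ]
    refine Finset.sum_eq_zero fun j _ => ?_
    rw [taylor_zero, (hg j).self_of_nhds]
    simp
  | succ k ih =>
    rw [taylor_succ]
    refine Finset.sum_eq_zero fun j _ => ?_
    rw [ih, zero_mul]
    intro i
    refine (pd_eventuallyEq _ (hg j)).trans (.of_forall fun y => pd_zero _ _)

theorem pd_inl_eventually_zero_const (c : D.Gr) (j : D.ev) (x : D.ev → ℝ) :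
    pd (.inl j) (fun _ => c) =ᶠ[𝓝 x] 0 :=
  .of_forall fun _ => pd_inl_const _ _ _

theorem subst_const (φ : D'.Coord → D.Fn) (c : D'.Gr) (x : D.ev → ℝ) :
    subst φ (fun _ => c) x = oddSubst φ x c := by
  rw [subst_eq_sum _ _ _ le_rfl, Finset.sum_range_succ', Finset.sum_eq_zero, taylor_zero]
  · simp
  · intro k _
    rw [taylor_const fun j => pd_inl_eventually_zero_const _ _ _, smul_zero]

theorem subst_zero (φ : D'.Coord → D.Fn) (x : D.ev → ℝ) : subst φ 0 x = 0 :=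
  (subst_const φ 0 x).trans (map_zero _)

theorem subst_one (φ : D'.Coord → D.Fn) (x : D.ev → ℝ) : subst φ 1 x = 1 :=
  (subst_const φ 1 x).trans (map_one _)

/-- For an even coordinate the expansion stops after two terms, the body and the soul, which add up
to the component. For an odd one only degree zero is present. -/
theorem subst_coord {φ : D'.Coord → D.Fn} {x : D.ev → ℝ} (h : ParAt φ x) (A : D'.Coord) :
    subst φ (coord A) x = φ A x := by
  classical
  rcases A with i | j
  · have hp : ∀ j, pd (.inl j) (coord (.inl i) : D'.Fn) =
        fun _ => if j = i then 1 else 0 := by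
      intro j; ext1 y
      rw [pd_coord]; simp
    have h0 : taylor φ 0 (coord (.inl i)) x = bodyFn φ i x := by
      rw [taylor_zero]; simp [coord, bodyFn]
    have h1 : taylor φ 1 (coord (.inl i)) x = soul φ i x := by
      rw [taylor_succ, Finset.sum_eq_single i]
      · rw [hp, taylor_zero]; simp
      · intro j _ hj
        rw [hp, taylor_zero, if_neg hj]; simp
      · simp
    have h2 : ∀ k, taylor φ (k + 1 + 1) (coord (.inl i)) x = 0 := by
      intro k
      rw [taylor_succ]
      refine Finset.sum_eq_zero fun j _ => ?_
      rw [taylor_const, zero_mul]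
      intro l
      rw [hp]
      exact pd_inl_eventually_zero_const _ _ _
    -- One extra term guarantees that degrees 0 and 1 can both be split off, even if there are no
    -- odd coordinates.
    rw [subst_eq_sum _ _ _ (Nat.le_succ _), Finset.sum_range_succ', Finset.sum_range_succ',
      Finset.sum_eq_zero (fun k _ => by rw [h2, smul_zero]), h0, h1, ← bodyFn_add_soul φ i]
    simp [add_comm]
  · rw [show (coord (.inr j) : D'.Fn) = fun _ => ExteriorAlgebra.ι ℝ (Finsupp.single j 1) from rfl,
      subst_const, oddSubst_ι h]
    simp

theorem subst_add {φ : D'.Coord → D.Fn} {g h : D'.Fn} {x : D.ev → ℝ}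
    (hg : SmoothAt g (body φ x)) (hh : SmoothAt h (body φ x)) :
    subst φ (g + h) x = subst φ g x + subst φ h x := by
  simp only [subst_eq_sum _ _ _ le_rfl, taylor_add hg hh, smul_add, Finset.sum_add_distrib]

theorem subst_smul {φ : D'.Coord → D.Fn} (c : ℝ) {g : D'.Fn} {x : D.ev → ℝ}
    (hg : SmoothAt g (body φ x)) : subst φ (c • g) x = c • subst φ g x := by
  simp only [subst_eq_sum _ _ _ le_rfl, taylor_smul c hg, Finset.smul_sum]
  exact Finset.sum_congr rfl fun k _ => smul_comm _ _ _

theorem subst_neg {φ : D'.Coord → D.Fn} {g : D'.Fn} {x : D.ev → ℝ}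
    (hg : SmoothAt g (body φ x)) : subst φ (-g) x = -subst φ g x := by
  simpa using subst_smul (-1) hg

theorem subst_sub {φ : D'.Coord → D.Fn} {g h : D'.Fn} {x : D.ev → ℝ}
    (hg : SmoothAt g (body φ x)) (hh : SmoothAt h (body φ x)) :
    subst φ (g - h) x = subst φ g x - subst φ h x := by
  rw [sub_eq_add_neg, subst_add hg hh.neg, subst_neg hh, sub_eq_add_neg]

theorem subst_sum {φ : D'.Coord → D.Fn} {ι : Type*} (s : Finset ι) {g : ι → D'.Fn}
    {x : D.ev → ℝ} (hg : ∀ i ∈ s, SmoothAt (g i) (body φ x)) :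
    subst φ (∑ i ∈ s, g i) x = ∑ i ∈ s, subst φ (g i) x := by
  classical
  induction s using Finset.induction_on with
  | empty => exact subst_zero φ x
  | insert a s ha ih =>
    rw [Finset.sum_insert ha, Finset.sum_insert ha, subst_add (hg a (by simp))
      (SmoothAt.sum s fun i hi => hg i (by simp [hi])), ih fun i hi => hg i (by simp [hi])]

/-- This is the binomial Leibniz rule for iterated derivatives. Souls are even, so those belonging
to `g` can be carried past the Taylor term of `h` without a sign. -/
theorem taylor_mul {φ : D'.Coord → D.Fn} {g h : D'.Fn} {x : D.ev → ℝ} (hφ : ParAt φ x) (n : ℕ)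
    (hg : SmoothAt g (body φ x)) (hh : SmoothAt h (body φ x)) :
    taylor φ n (g * h) x = ∑ p ∈ Finset.HasAntidiagonal.antidiagonal n,
      n.choose p.1 • (taylor φ p.1 g x * taylor φ p.2 h x) := by
  induction n generalizing g h with
  | zero => simp [taylor_zero]
  | succ n ih =>
    rw [taylor_succ, Finset.sum_antidiagonal_choose_succ_nsmul
      (fun i j => taylor φ i g x * taylor φ j h x)]
    have key : ∀ j, taylor φ n (pd (.inl j) (g * h)) x * soul φ j x =
        ∑ p ∈ Finset.HasAntidiagonal.antidiagonal n, n.choose p.1 •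
          (taylor φ p.1 g x * (taylor φ p.2 (pd (.inl j) h) x * soul φ j x)) +
        ∑ p ∈ Finset.HasAntidiagonal.antidiagonal n, n.choose p.2 •
          ((taylor φ p.1 (pd (.inl j) g) x * soul φ j x) * taylor φ p.2 h x) := by
      intro j
      rw [taylor_congr (pd_mul_eventually _ hg hh), SuperDim.par, twist_zero,
        taylor_add ((hg.pd _).mul hh) (hg.mul (hh.pd _)), ih (hg.pd _) hh, ih hg (hh.pd _),
        add_mul, add_comm, Finset.sum_mul, Finset.sum_mul]
      congr 1
      · refine Finset.sum_congr rfl fun p _ => ?_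
        rw [smul_mul_assoc, mul_assoc]
      · refine Finset.sum_congr rfl fun p hp => ?_
        rw [smul_mul_assoc, mul_assoc, mul_assoc, even_commute (soul_mem hφ j),
          Nat.choose_symm_of_eq_add (Finset.HasAntidiagonal.mem_antidiagonal.1 hp).symm]
    simp only [key, Finset.sum_add_distrib]
    congr 1 <;> rw [Finset.sum_comm] <;> refine Finset.sum_congr rfl fun p _ => ?_ <;>
      simp only [← Finset.smul_sum, ← Finset.mul_sum, ← Finset.sum_mul, ← taylor_succ]

/-- With the factorials included, the expansion of a product is the Cauchy product of the
expansions. Triangle and square of indices give the same sum because products of total degree `N` or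
more are zero by nilpotency. -/
theorem subst_mul {φ : D'.Coord → D.Fn} {g h : D'.Fn} {x : D.ev → ℝ} (hφ : ParAt φ x)
    (hg : SmoothAt g (body φ x)) (hh : SmoothAt h (body φ x)) :
    subst φ (g * h) x = subst φ g x * subst φ h x := by
  set N := Fintype.card D.od + 1 with hN
  -- The left side is summed up to degree `2N`, so that every pair of indices below `N` occurs in
  -- it.
  have hNN : N ≤ N + N := Nat.le_add_left _ _
  rw [subst_eq_sum φ (g * h) x hNN, subst_eq_sum φ g x le_rfl, subst_eq_sum φ h x le_rfl,
    Finset.sum_mul_sum, ← Finset.sum_product']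
  set a : ℕ → ℕ → D.Gr := fun i j =>
    (((i.factorial : ℝ)⁻¹) • taylor φ i g x) * (((j.factorial : ℝ)⁻¹) • taylor φ j h x) with ha
  have h1 : ∀ n, ((n.factorial : ℝ)⁻¹) • taylor φ n (g * h) x =
      ∑ p ∈ Finset.HasAntidiagonal.antidiagonal n, a p.1 p.2 := by
    intro n
    rw [taylor_mul hφ n hg hh, Finset.smul_sum]
    refine Finset.sum_congr rfl fun p hp => ?_
    rw [ha]
    simp only
    rw [smul_mul_smul_comm, ← Nat.cast_smul_eq_nsmul ℝ, smul_smul]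
    congr 1
    rw [← Finset.HasAntidiagonal.mem_antidiagonal.1 hp, Nat.choose_symm_add, Nat.add_choose]
    have h0 := Nat.factorial_mul_factorial_dvd_factorial_add p.1 p.2
    have hne : ((p.1.factorial * p.2.factorial : ℕ) : ℝ) ≠ 0 := by positivity
    rw [Nat.cast_div h0 hne]
    push_cast
    have := Nat.factorial_ne_zero (p.1 + p.2)
    have h3 : ((p.1 + p.2).factorial : ℝ) ≠ 0 := by exact_mod_cast this
    field_simp
  simp only [h1]
  rw [Finset.sum_sigma']
  have hz : ∀ p : ℕ × ℕ, N ≤ p.1 + p.2 → a p.1 p.2 = 0 := by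
    intro p hp
    rw [ha]
    simp only [smul_mul_smul_comm]
    rw [eq_zero_of_mem_filt (k := p.1 + p.2) (by omega)
      (mul_mem_filt (taylor_mem_filt φ _ _ _) (taylor_mem_filt φ _ _ _)), smul_zero]
  have hz1 : ∀ i j, N ≤ i → a i j = 0 := fun i j hi => hz (i, j) (by simp; omega)
  have hz2 : ∀ i j, N ≤ j → a i j = 0 := fun i j hi => hz (i, j) (by simp; omega)
  -- Only nonzero terms are matched: these have both indices below `N`, and their degree is
  -- recovered as the sum of the indices.
  refine Finset.sum_bij_ne_zero (fun p _ _ => p.2) ?_ ?_ ?_ ?_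
  · intro p _ hp
    simp only [Finset.mem_product, Finset.mem_range]
    constructor
    · by_contra hlt; exact hp (hz1 _ _ (not_lt.1 hlt))
    · by_contra hlt; exact hp (hz2 _ _ (not_lt.1 hlt))
  · rintro ⟨n, p⟩ hp _ ⟨m, q⟩ hq _ h
    simp only [Finset.mem_sigma, Finset.HasAntidiagonal.mem_antidiagonal] at hp hq
    simp only at h
    subst h
    obtain rfl : n = m := hp.2.symm.trans hq.2
    rfl
  · rintro p hp hne
    simp only [Finset.mem_product, Finset.mem_range] at hp
    exact ⟨⟨p.1 + p.2, p⟩, by simp; omega, hne, rfl⟩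
  · intros; rfl

theorem pd_twist_eventually (A : D.Coord) (ε : ZMod 2) {f : D.Fn} {x : D.ev → ℝ}
    (hf : SmoothAt f x) : pd A (twist ε f) =ᶠ[𝓝 x] sgn (ε * D.par A) • twist ε (pd A f) := by
  filter_upwards [hf.eventually] with y hy
  rw [pd_twist A ε hy, Pi.smul_apply, twist_apply]

theorem taylor_twist {φ : D'.Coord → D.Fn} {g : D'.Fn} {x : D.ev → ℝ} (hφ : ParAt φ x)
    (ε : ZMod 2) (k : ℕ) (hg : SmoothAt g (body φ x)) :
    taylor φ k (twist ε g) x = tw ε (taylor φ k g x) := by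
  induction k generalizing g with
  | zero => rw [taylor_zero, taylor_zero, twist_apply, oddSubst_tw hφ]
  | succ k ih =>
    rw [taylor_succ, taylor_succ, map_sum]
    refine Finset.sum_congr rfl fun j _ => ?_
    have h1 := pd_twist_eventually (.inl j) ε hg
    simp only [SuperDim.par, mul_zero, sgn_zero, one_smul] at h1
    rw [taylor_congr h1, ih (hg.pd _), map_mul, tw_of_mem (soul_mem hφ j), mul_zero, sgn_zero,
      one_smul]

theorem subst_twist {φ : D'.Coord → D.Fn} {g : D'.Fn} {x : D.ev → ℝ} (hφ : ParAt φ x)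
    (ε : ZMod 2) (hg : SmoothAt g (body φ x)) :
    subst φ (twist ε g) x = tw ε (subst φ g x) := by
  simp only [subst_eq_sum _ _ _ le_rfl, taylor_twist hφ ε _ hg, map_sum, map_smul]

/-- Substitution commutes with the grading automorphism, and parity is detected by that
automorphism. -/
theorem subst_mem {φ : D'.Coord → D.Fn} {g : D'.Fn} {x : D.ev → ℝ} (hφ : ParAt φ x)
    {ε : ZMod 2} (hg : SmoothAt g (body φ x)) (h : ∀ᶠ y in 𝓝 (body φ x), g y ∈ grPart D' ε) :
    subst φ g x ∈ grPart D ε := by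
  apply mem_grPart_of_tw
  rw [← subst_twist hφ 1 hg, ← subst_smul _ hg]
  refine subst_congr ?_
  filter_upwards [h] with y hy
  rw [twist_apply, tw_of_mem hy, one_mul]; rfl

/-! ### The chain rule -/

theorem contDiffAt_body {φ : D'.Coord → D.Fn} {x : D.ev → ℝ}
    (h : ∀ A, SmoothAt (φ A) x) : ∀ᶠ y in 𝓝 x, ContDiffAt ℝ ∞ (body φ) y := by
  have := Filter.eventually_all.2 fun i : D'.ev => h (.inl i)
  filter_upwards [this] with y hy
  exact contDiffAt_pi.2 fun i => hy i ExteriorAlgebra.algebraMapInv.toLinearMap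

theorem continuousAt_body {φ : D'.Coord → D.Fn} {x : D.ev → ℝ}
    (h : ∀ A, SmoothAt (φ A) x) : ContinuousAt (body φ) x :=
  (contDiffAt_body h).self_of_nhds.continuousAt

theorem contDiffAt_body_apply {φ : D'.Coord → D.Fn} {x : D.ev → ℝ}
    (h : ∀ A, SmoothAt (φ A) x) (i : D'.ev) :
    ∀ᶠ y in 𝓝 x, ContDiffAt ℝ ∞ (fun z => body φ z i) y := by
  filter_upwards [contDiffAt_body h] with y hy
  exact contDiffAt_pi.1 hy i

theorem smoothAt_bodyFn {φ : D'.Coord → D.Fn} {x : D.ev → ℝ}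
    (h : ∀ A, SmoothAt (φ A) x) (i : D'.ev) : SmoothAt (bodyFn φ i) x :=
  smoothAt_algebraMap (contDiffAt_body_apply h i)

theorem smoothAt_soul {φ : D'.Coord → D.Fn} {x : D.ev → ℝ}
    (h : ∀ A, SmoothAt (φ A) x) (i : D'.ev) : SmoothAt (soul φ i) x := by
  have : soul φ i = φ (.inl i) - bodyFn φ i := by rw [← bodyFn_add_soul φ i]; simp
  rw [this]
  exact (h _).sub (smoothAt_bodyFn h i)

/-- Smoothness and derivative are proved in one induction, because the product rule for a longer
monomial needs the smoothness of the shorter one. -/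
theorem oddSubst_smooth_and_pd {φ : D'.Coord → D.Fn} {x : D.ev → ℝ} (h : MorAt φ x)
    (a : D'.Gr) : SmoothAt (fun y => oddSubst φ y a) x ∧
      ∀ A, pd A (fun y => oddSubst φ y a) x =
        ∑ b, pd A (φ (.inr b)) x * oddSubst φ x (contr b a) := by
  induction a using CliffordAlgebra.left_induction with
  | algebraMap r =>
    change SmoothAt (fun y => oddSubst φ y (algebraMap ℝ D'.Gr r)) x ∧ ∀ A,
      pd A (fun y => oddSubst φ y (algebraMap ℝ D'.Gr r)) x =
        ∑ b, pd A (φ (.inr b)) x * oddSubst φ x (contr b (algebraMap ℝ D'.Gr r))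
    simp only [AlgHom.commutes]
    refine ⟨smoothAt_const _ _, fun A => ?_⟩
    rw [pd_const]; simp
  | add c d hc hd =>
    have e : (fun y => oddSubst φ y (c + d)) =
        (fun y => oddSubst φ y c) + fun y => oddSubst φ y d := by ext1 y; simp
    rw [e]
    refine ⟨hc.1.add hd.1, fun A => ?_⟩
    rw [pd_add A hc.1 hd.1, hc.2, hd.2, ← Finset.sum_add_distrib]
    simp only [map_add, mul_add]
  | ι_mul c m hc =>
    change SmoothAt (fun y => oddSubst φ y (ExteriorAlgebra.ι ℝ m * c)) x ∧ ∀ A,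
      pd A (fun y => oddSubst φ y (ExteriorAlgebra.ι ℝ m * c)) x =
        ∑ b, pd A (φ (.inr b)) x * oddSubst φ x (contr b (ExteriorAlgebra.ι ℝ m * c))
    set F : D.Fn := ∑ j, m j • φ (.inr j) with hF
    have hFs : SmoothAt F x := SmoothAt.sum _ fun j _ => (h.smooth _).smul _
    have hFe : ∀ y, ParAt φ y → oddSubst φ y (ExteriorAlgebra.ι ℝ m) = F y := by
      intro y hy
      rw [oddSubst_ι hy, Finsupp.linearCombination_apply, Finsupp.sum_fintype _ _ (by simp)]
      simp [hF]
    -- The factorization is asserted only near `x`: where the parities of `φ` fail, `oddSubst` may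
    -- take its default value.
    have e : (F * fun y => oddSubst φ y c) =ᶠ[𝓝 x]
        (fun y => oddSubst φ y (ExteriorAlgebra.ι ℝ m * c)) := by
      filter_upwards [h.parity] with y hy
      rw [map_mul, hFe y hy]; rfl
    refine ⟨(hFs.mul hc.1).congr e, fun A => ?_⟩
    have hFx : F x ∈ grPart D 1 := by
      rw [← hFe x h.parAt]; exact oddSubst_ι_mem h.parAt m
    rw [← pd_congr A e, pd_mul A hFs hc.1, hc.2]
    have hF' : pd A F x = ∑ b, m b • pd A (φ (.inr b)) x := by
      rw [hF, pd_sum A _ fun j _ => (h.smooth _).smul _]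
      exact Finset.sum_congr rfl fun j _ => pd_smul A _ (h.smooth _)
    rw [hF', Finset.sum_mul, Finset.mul_sum, ← Finset.sum_add_distrib]
    refine Finset.sum_congr rfl fun b _ => ?_
    have hp : pd A (φ (.inr b)) x ∈ grPart D (1 + D.par A) :=
      pd_mem (h.smooth _) (h.parity.mono fun y hy => hy (.inr b))
    rw [contr_ι_mul, map_sub, map_smul, map_mul, hFe x h.parAt, mul_sub, mul_smul_comm,
      smul_mul_assoc, sub_eq_add_neg, tw_of_mem hFx]
    congr 1
    rw [smul_mul_assoc, ← mul_assoc, ← mul_assoc, mul_comm_sgn hFx hp, ← neg_mul,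
      ← smul_mul_assoc, sgn_smul_sgn_smul, neg_eq_sgn_one_smul]
    congr 3
    linear_combination (norm := ring_nf) zmod_two_add_self (D.par A)

theorem smoothAt_oddSubst {φ : D'.Coord → D.Fn} {x : D.ev → ℝ} (h : MorAt φ x) (a : D'.Gr) :
    SmoothAt (fun y => oddSubst φ y a) x := (oddSubst_smooth_and_pd h a).1

theorem pd_oddSubst {φ : D'.Coord → D.Fn} {x : D.ev → ℝ} (h : MorAt φ x) (a : D'.Gr)
    (A : D.Coord) : pd A (fun y => oddSubst φ y a) x =
      ∑ b, pd A (φ (.inr b)) x * oddSubst φ x (contr b a) := (oddSubst_smooth_and_pd h a).2 A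

/-- The linear map that takes an element of the Grassmann algebra of `D'` to its `k`-th component,
as a constant of the Grassmann algebra of `D`. -/
def component (D : SuperDim) {D' : SuperDim} (k : Fin (Module.finrank ℝ D'.Gr)) :
    D'.Gr →ₗ[ℝ] D.Gr :=
  Algebra.linearMap ℝ D.Gr ∘ₗ (Module.finBasis ℝ D'.Gr).coord k

theorem sum_component_mul (f : D'.Gr →ₗ[ℝ] D.Gr) (a : D'.Gr) :
    f a = ∑ k, component D k a * f (Module.finBasis ℝ D'.Gr k) := by
  conv_lhs => rw [← (Module.finBasis ℝ D'.Gr).sum_repr a]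
  rw [map_sum]
  refine Finset.sum_congr rfl fun k _ => ?_
  rw [map_smul, Algebra.smul_def]; rfl

/-- Expansion in a basis of the Grassmann algebra separates the dependence on the point through the
body from the dependence through the odd components, so the product rule applies to each term. -/
theorem taylor_zero_eq (φ : D'.Coord → D.Fn) (g : D'.Fn) :
    taylor φ 0 g = ∑ k, (fun y => component D k (g (body φ y))) *
      fun y => oddSubst φ y (Module.finBasis ℝ D'.Gr k) := by
  ext1 y
  rw [taylor_zero]
  refine (sum_component_mul (oddSubst φ y).toLinearMap _).trans ?_
  simp [Finset.sum_apply]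

theorem smoothAt_component {φ : D'.Coord → D.Fn} {g : D'.Fn} {x : D.ev → ℝ} (h : MorAt φ x)
    (hg : SmoothAt g (body φ x)) (k) : SmoothAt (fun y => component D k (g (body φ y))) x :=
  SmoothAt.comp_linear _ hg (contDiffAt_body h.smooth)

theorem smoothAt_taylor {φ : D'.Coord → D.Fn} {g : D'.Fn} {x : D.ev → ℝ} (h : MorAt φ x) (k : ℕ)
    (hg : SmoothAt g (body φ x)) : SmoothAt (taylor φ k g) x := by
  induction k generalizing g with
  | zero =>
    rw [taylor_zero_eq]
    exact SmoothAt.sum _ fun k _ => (smoothAt_component h hg k).mul (smoothAt_oddSubst h _)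
  | succ k ih =>
    have : taylor φ (k + 1) g = ∑ j, taylor φ k (pd (.inl j) g) * soul φ j := by
      ext1 y; rw [taylor_succ]; simp [Finset.sum_apply]
    rw [this]
    exact SmoothAt.sum _ fun j _ => (ih (hg.pd _)).mul (smoothAt_soul h.smooth j)

/-- The components are scalars that depend on the point only through the body: even derivatives
follow the ordinary chain rule, and contractions annihilate both sides. -/
theorem pd_component {φ : D'.Coord → D.Fn} {g : D'.Fn} {x : D.ev → ℝ} (h : MorAt φ x)
    (hg : SmoothAt g (body φ x)) (k) (A : D.Coord) :
    pd A (fun y => component D k (g (body φ y))) x =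
      ∑ l, pd A (bodyFn φ l) x * component D k (pd (.inl l) g (body φ x)) := by
  classical
  rcases A with i | j
  · rw [pd_inl_comp_linear i _ hg (contDiffAt_body h.smooth)]
    refine Finset.sum_congr rfl fun l _ => ?_
    rw [show bodyFn φ l = fun y => algebraMap ℝ D.Gr (body φ y l) from rfl,
      pd_inl_algebraMap i (contDiffAt_body_apply h.smooth l), Algebra.smul_def]
    congr 2
    have hd := ((contDiffAt_body h.smooth).self_of_nhds.differentiableAt (by simp)).hasFDerivAt
    rw [((hasFDerivAt_pi'.1 hd) l).fderiv]
    rfl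
  · simp [pd_inr, component, bodyFn]

theorem pd_taylor_zero {φ : D'.Coord → D.Fn} {g : D'.Fn} {x : D.ev → ℝ} (h : MorAt φ x)
    (hg : SmoothAt g (body φ x)) (A : D.Coord) :
    pd A (taylor φ 0 g) x = ∑ l, pd A (bodyFn φ l) x * taylor φ 0 (pd (.inl l) g) x +
      ∑ b, pd A (φ (.inr b)) x * taylor φ 0 (pd (.inr b) g) x := by
  rw [taylor_zero_eq, pd_sum A _ fun k _ => (smoothAt_component h hg k).mul (smoothAt_oddSubst h _)]
  simp only [pd_mul A (smoothAt_component h hg _) (smoothAt_oddSubst h _), pd_component h hg,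
    Finset.sum_add_distrib, pd_oddSubst h]
  congr 1
  · simp only [Finset.sum_mul]
    rw [Finset.sum_comm]
    refine Finset.sum_congr rfl fun l _ => ?_
    rw [taylor_zero]
    refine Eq.trans ?_ (congrArg _ (sum_component_mul (oddSubst φ x).toLinearMap _).symm)
    rw [Finset.mul_sum]
    simp only [mul_assoc]
    rfl
  · simp only [Finset.mul_sum]
    rw [Finset.sum_comm]
    refine Finset.sum_congr rfl fun b _ => ?_
    rw [taylor_zero, pd_inr]
    refine Eq.trans ?_ (congrArg _
      (sum_component_mul ((oddSubst φ x).toLinearMap ∘ₗ contr b) _).symm)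
    rw [Finset.mul_sum]
    refine Finset.sum_congr rfl fun k _ => ?_
    have hc : component D k (g (body φ x)) ∈ grPart D 0 := algebraMap_mem_grPart _
    rw [tw_of_mem hc, mul_zero, sgn_zero, one_smul, ← mul_assoc, ← mul_assoc, even_commute hc]
    rfl

/-- The three sums differentiate the base point, one of the `k` souls, and the odd components.
Evenness of the souls makes their `k` contributions equal. For `k = 0` the truncated `k - 1` is
harmless, as it is multiplied by zero. -/
theorem pd_taylor {φ : D'.Coord → D.Fn} {g : D'.Fn} {x : D.ev → ℝ} (h : MorAt φ x)
    (hg : SmoothAt g (body φ x)) (A : D.Coord) (k : ℕ) :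
    pd A (taylor φ k g) x = ∑ l, pd A (bodyFn φ l) x * taylor φ k (pd (.inl l) g) x +
      k • ∑ l, pd A (soul φ l) x * taylor φ (k - 1) (pd (.inl l) g) x +
      ∑ b, pd A (φ (.inr b)) x * taylor φ k (pd (.inr b) g) x := by
  induction k generalizing g with
  | zero => rw [pd_taylor_zero h hg A]; simp
  | succ k ih =>
    have e : taylor φ (k + 1) g = ∑ j, taylor φ k (pd (.inl j) g) * soul φ j := by
      ext1 y; rw [taylor_succ]; simp [Finset.sum_apply]
    have hcomm : ∀ (B : D'.Coord) (j : D'.ev) (m : ℕ),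
        taylor φ m (pd B (pd (.inl j) g)) x = taylor φ m (pd (.inl j) (pd B g)) x := by
      intro B j m
      refine taylor_congr ?_
      filter_upwards [hg.eventually] with y hy
      rw [pd_comm _ _ hy]; simp [SuperDim.par]
    have hs : ∀ j, pd A (soul φ j) x ∈ grPart D (D.par A) := by
      intro j
      have := pd_mem (A := A) (ε := 0) (smoothAt_soul h.smooth j)
        (h.parity.mono fun y hy => soul_mem hy j)
      rwa [zero_add] at this
    have hterm : ∀ j, pd A (taylor φ k (pd (.inl j) g) * soul φ j) x =
        (∑ l, pd A (bodyFn φ l) x * (taylor φ k (pd (.inl j) (pd (.inl l) g)) x * soul φ j x) +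
        k • ∑ l, pd A (soul φ l) x *
          (taylor φ (k - 1) (pd (.inl j) (pd (.inl l) g)) x * soul φ j x) +
        ∑ b, pd A (φ (.inr b)) x *
          (taylor φ k (pd (.inl j) (pd (.inr b) g)) x * soul φ j x)) +
        pd A (soul φ j) x * taylor φ k (pd (.inl j) g) x := by
      intro j
      rw [pd_mul A (smoothAt_taylor h k (hg.pd _)) (smoothAt_soul h.smooth j), ih (hg.pd _),
        mul_comm_tw (hs j)]
      simp only [add_mul, Finset.sum_mul, smul_mul_assoc, mul_assoc]
      refine congrArg₂ _ (congrArg₂ _ (congrArg₂ _ ?_ (congrArg _ ?_)) ?_) rfl <;>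
        exact Finset.sum_congr rfl fun l _ => by rw [hcomm]
    rw [e, pd_sum A _ fun j _ => (smoothAt_taylor h k (hg.pd _)).mul (smoothAt_soul h.smooth j)]
    simp only [hterm, Finset.sum_add_distrib, ← Finset.smul_sum]
    have hswap : ∀ {ι : Type} [Fintype ι] (c : ι → D.Gr) (G : ι → D'.Fn) (m : ℕ),
        ∑ j, ∑ l, c l * (taylor φ m (pd (.inl j) (G l)) x * soul φ j x) =
          ∑ l, c l * taylor φ (m + 1) (G l) x := by
      intro ι _ c G m
      rw [Finset.sum_comm]
      refine Finset.sum_congr rfl fun l _ => ?_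
      rw [taylor_succ, Finset.mul_sum]
    rw [hswap, hswap, hswap, Nat.add_sub_cancel, succ_nsmul]
    rcases k with _ | k
    · simp only [zero_smul]; abel
    · rw [Nat.add_sub_cancel]; abel

theorem smoothAt_subst {φ : D'.Coord → D.Fn} {g : D'.Fn} {x : D.ev → ℝ} (h : MorAt φ x)
    (hg : SmoothAt g (body φ x)) : SmoothAt (subst φ g) x := by
  have : subst φ g = ∑ k ∈ Finset.range (Fintype.card D.od + 1),
      ((k.factorial : ℝ)⁻¹) • taylor φ k g := by
    ext1 y; rw [subst_eq_sum _ _ _ le_rfl]; simp [Finset.sum_apply]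
  rw [this]
  exact SmoothAt.sum _ fun k _ => (smoothAt_taylor h k hg).smul _

/-- The chain rule. -/
theorem pd_subst {φ : D'.Coord → D.Fn} {g : D'.Fn} {x : D.ev → ℝ} (h : MorAt φ x)
    (hg : SmoothAt g (body φ x)) (A : D.Coord) :
    pd A (subst φ g) x = ∑ B, pd A (φ B) x * subst φ (pd B g) x := by
  set N := Fintype.card D.od + 1 with hN
  -- One more term than necessary: the soul derivatives lower the degree by one, and `N` terms must
  -- remain after the shift.
  have e : subst φ g = ∑ k ∈ Finset.range (N + 1), ((k.factorial : ℝ)⁻¹) • taylor φ k g := by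
    ext1 y; rw [subst_eq_sum _ _ _ (Nat.le_succ N)]; simp [Finset.sum_apply]
  rw [e, pd_sum A _ fun k _ => (smoothAt_taylor h k hg).smul _]
  simp only [pd_smul A _ (smoothAt_taylor h _ hg), pd_taylor h hg A, smul_add,
    Finset.sum_add_distrib]
  have h1 : ∀ {ι : Type} [Fintype ι] (c : ι → D.Gr) (G : ι → D'.Fn),
      ∑ k ∈ Finset.range (N + 1), ((k.factorial : ℝ)⁻¹) • ∑ l, c l * taylor φ k (G l) x =
        ∑ l, c l * subst φ (G l) x := by
    intro ι _ c G
    simp only [subst_eq_sum φ _ x (Nat.le_succ N), Finset.mul_sum, Finset.smul_sum, mul_smul_comm]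
    rw [Finset.sum_comm]
  -- Since `k / k! = 1 / (k - 1)!`, the derivatives of the souls form the expansion of the
  -- differentiated function, one degree lower.
  have h2 : ∑ k ∈ Finset.range (N + 1), ((k.factorial : ℝ)⁻¹) • k •
      ∑ l, pd A (soul φ l) x * taylor φ (k - 1) (pd (.inl l) g) x =
        ∑ l, pd A (soul φ l) x * subst φ (pd (.inl l) g) x := by
    simp only [subst_eq_sum φ _ x le_rfl, Finset.mul_sum, mul_smul_comm]
    rw [Finset.sum_range_succ', Finset.sum_comm (s := Finset.univ)]
    simp only [zero_smul, smul_zero, add_zero, Nat.add_sub_cancel]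
    refine Finset.sum_congr rfl fun k _ => ?_
    rw [← Finset.smul_sum, ← Nat.cast_smul_eq_nsmul ℝ, smul_smul]
    congr 1
    have hk : ((k.factorial : ℕ) : ℝ) ≠ 0 := by exact_mod_cast k.factorial_ne_zero
    rw [Nat.factorial_succ]
    push_cast
    field_simp
  -- Body and soul derivatives now multiply the same expansion and add up to the derivative of the
  -- even component.
  rw [h1, h1, h2, Fintype.sum_sum_type, ← Finset.sum_add_distrib]
  congr 1
  refine Finset.sum_congr rfl fun l _ => ?_
  rw [← add_mul, ← bodyFn_add_soul φ l, pd_add A (smoothAt_bodyFn h.smooth l)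
    (smoothAt_soul h.smooth l)]

/-! ### Naturality of substitution -/

theorem coord_morAt (x : D.ev → ℝ) : MorAt (coord : D.Coord → D.Fn) x :=
  ⟨fun A => smoothAt_coord A x, .of_forall fun y A => coord_mem A y⟩

theorem soul_eq_zero {φ : D'.Coord → D.Fn} {x : D.ev → ℝ} {i : D'.ev} {r : ℝ}
    (h : φ (.inl i) x = algebraMap ℝ D.Gr r) : soul φ i x = 0 := by
  simp [soul, body, h]

theorem subst_of_soul_eq_zero {φ : D'.Coord → D.Fn} {x : D.ev → ℝ} (h : ∀ i, soul φ i x = 0)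
    (g : D'.Fn) : subst φ g x = oddSubst φ x (g (body φ x)) := by
  rw [subst_eq_sum _ _ _ le_rfl, Finset.sum_range_succ', Finset.sum_eq_zero, taylor_zero]
  · simp
  · intro k _
    rw [taylor_succ]
    simp [h]

variable {D₁ D₁' : SuperDim}

/-- An algebra map induced by a linear map of the generators preserves the scalar part, so agreement
of the components at the one point `x` is enough. -/
theorem body_ext {e : D.ev → D₁.ev} {o : D.od → D₁.od} {e' : D'.ev → D₁'.ev}
    {o' : D'.od → D₁'.od} {φ : D'.Coord → D.Fn} {Φ : D₁'.Coord → D₁.Fn} {x : D₁.ev → ℝ}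
    (h : ∀ A, Φ (Sum.map e' o' A) x = ext e o (φ A) x) : body Φ x ∘ e' = body φ (x ∘ e) := by
  ext1 i
  have := h (.inl i)
  simp only [Sum.map_inl] at this
  simp only [body, Function.comp_apply, this, ext, algebraMapInv_map]

theorem soul_ext {e : D.ev → D₁.ev} {o : D.od → D₁.od} {e' : D'.ev → D₁'.ev}
    {o' : D'.od → D₁'.od} {φ : D'.Coord → D.Fn} {Φ : D₁'.Coord → D₁.Fn} {x : D₁.ev → ℝ}
    (h : ∀ A, Φ (Sum.map e' o' A) x = ext e o (φ A) x) (i : D'.ev) :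
    soul Φ (e' i) x = ext e o (soul φ i) x := by
  have h1 := h (.inl i)
  simp only [Sum.map_inl] at h1
  have h2 := congrFun (body_ext h) i
  simp only [Function.comp_apply] at h2
  simp only [soul, h1, h2, ext, map_sub, AlgHom.commutes]

theorem oddSubst_ext {e : D.ev → D₁.ev} {o : D.od → D₁.od} {e' : D'.ev → D₁'.ev}
    {o' : D'.od → D₁'.od} {φ : D'.Coord → D.Fn} {Φ : D₁'.Coord → D₁.Fn} {x : D₁.ev → ℝ}
    (h : ∀ A, Φ (Sum.map e' o' A) x = ext e o (φ A) x) (hΦ : ParAt Φ x)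
    (hφ : ParAt φ (x ∘ e)) (a : D'.Gr) :
    oddSubst Φ x (ExteriorAlgebra.map (Finsupp.lmapDomain ℝ ℝ o') a) =
      ExteriorAlgebra.map (Finsupp.lmapDomain ℝ ℝ o) (oddSubst φ (x ∘ e) a) := by
  induction a using CliffordAlgebra.left_induction with
  | algebraMap r => simp
  | add x y hx hy => simp only [map_add, hx, hy]
  | ι_mul b m hx =>
    change oddSubst Φ x (ExteriorAlgebra.map _ (ExteriorAlgebra.ι ℝ m * b)) =
      ExteriorAlgebra.map _ (oddSubst φ (x ∘ e) (ExteriorAlgebra.ι ℝ m * b))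
    rw [map_mul, map_mul, map_mul, map_mul, hx, map_ι', oddSubst_ι hΦ, oddSubst_ι hφ]
    congr 1
    rw [Finsupp.lmapDomain_apply, Finsupp.linearCombination_mapDomain,
      ← AlgHom.toLinearMap_apply,
      Finsupp.apply_linearCombination]
    congr 2
    ext1 j
    exact h (.inr j)

/-- Substitution commutes with the extension to more coordinates. -/
theorem subst_ext {e : D.ev → D₁.ev} {o : D.od → D₁.od} {e' : D'.ev → D₁'.ev}
    {o' : D'.od → D₁'.od} (he' : Function.Injective e') (ho' : Function.Injective o')
    {φ : D'.Coord → D.Fn} {Φ : D₁'.Coord → D₁.Fn} {x : D₁.ev → ℝ}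
    (h : ∀ A, Φ (Sum.map e' o' A) x = ext e o (φ A) x) (hΦ : ParAt Φ x)
    (hφ : ParAt φ (x ∘ e)) {g : D'.Fn} (hg : SmoothAt g (body φ (x ∘ e))) :
    subst Φ (ext e' o' g) x = ext e o (subst φ g) x := by
  have key : ∀ k (g : D'.Fn), SmoothAt g (body φ (x ∘ e)) →
      taylor Φ k (ext e' o' g) x = ext e o (taylor φ k g) x := by
    intro k
    induction k with
    | zero =>
      intro g hg
      simp only [taylor_zero, ext, body_ext h, oddSubst_ext h hΦ hφ]
    | succ k ih =>
      intro g hg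
      have hg' : SmoothAt g (body Φ x ∘ e') := by rwa [body_ext h]
      have hr : ext e o (taylor φ (k + 1) g) x =
          ∑ j, (ext e o (taylor φ k (pd (.inl j) g)) x * ext e o (soul φ j) x : D₁.Gr) := by
        simp only [ext, taylor_succ, map_sum, map_mul]
      rw [taylor_succ, hr]
      symm
      -- The additional even coordinates contribute nothing, since the extended function does not
      -- depend on them.
      refine Fintype.sum_of_injective e' he' _ _ ?_ ?_
      · intro j hj
        have hz : pd (.inl j) (ext e' o' g) =ᶠ[𝓝 (body Φ x)] 0 := by
          filter_upwards [(continuous_comp_left e').continuousAt.eventually hg'.eventually] with y hy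
          refine pd_ext_of_notMem ?_ hy
          rintro ⟨B, hB⟩
          rcases B with i | i
          · exact hj ⟨i, by simpa using hB⟩
          · simp at hB
        rw [taylor_congr hz]
        have h0 : taylor Φ k 0 x = 0 := by
          have := taylor_smul (φ := Φ) (k := k) 0 (smoothAt_zero (body Φ x))
          simpa using this
        rw [h0, zero_mul]
      · intro j
        rw [soul_ext h, ← ih _ (hg.pd _)]
        congr 1
        refine taylor_congr ?_
        filter_upwards [(continuous_comp_left e').continuousAt.eventually hg'.eventually] with y hy
        exact (pd_ext he' ho' (.inl j) hy).symm
  -- The two substitutions are truncated at different orders; this bound serves both.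
  set N := Fintype.card D.od + Fintype.card D₁.od + 1
  rw [subst_eq_sum Φ _ x (N := N) (by omega)]
  have : (ext e o (subst φ g) : D₁.Fn) x =
      ∑ k ∈ Finset.range N, ((k.factorial : ℝ)⁻¹) • ext e o (taylor φ k g) x := by
    simp only [ext, subst_eq_sum φ g (x ∘ e) (N := N) (by omega), map_sum, map_smul]
  rw [this]
  exact Finset.sum_congr rfl fun k _ => by rw [key k g hg]

end Substitution

end SuperGeom

end
noncomputable section
namespace SuperGeom

/-! ### The canonical Poisson bracket -/

section Poisson

variable {D : SuperDim}

/-- The function `f` has parity `ε` near `x`. -/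
def ParNear (ε : ZMod 2) (f : D.Fn) (x : D.ev → ℝ) : Prop := ∀ᶠ y in 𝓝 x, f y ∈ grPart D ε

theorem ParNear.self {ε : ZMod 2} {f : D.Fn} {x : D.ev → ℝ} (h : ParNear ε f x) :
    f x ∈ grPart D ε := h.self_of_nhds

theorem ParNear.eventually {ε : ZMod 2} {f : D.Fn} {x : D.ev → ℝ} (h : ParNear ε f x) :
    ∀ᶠ y in 𝓝 x, ParNear ε f y := eventually_eventually_nhds.2 h

theorem ParNear.pd {ε κ : ZMod 2} {f : D.Fn} {x : D.ev → ℝ} (h : ParNear ε f x)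
    (hf : SmoothAt f x) (A : D.Coord) (hκ : κ = ε + D.par A := by rfl) : ParNear κ (pd A f) x :=
  hκ ▸ eventually_pd_mem hf h

theorem ParNear.mul {ε δ κ : ZMod 2} {f g : D.Fn} {x : D.ev → ℝ} (hf : ParNear ε f x)
    (hg : ParNear δ g x) (hκ : κ = ε + δ := by rfl) : ParNear κ (f * g) x := by
  filter_upwards [hf, hg] with y h1 h2
  exact mul_mem_grPart h1 h2 hκ

theorem ParNear.sub {ε : ZMod 2} {f g : D.Fn} {x : D.ev → ℝ} (hf : ParNear ε f x)
    (hg : ParNear ε g x) : ParNear ε (f - g) x := by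
  filter_upwards [hf, hg] with y h1 h2
  exact sub_mem h1 h2

theorem ParNear.neg {ε : ZMod 2} {f : D.Fn} {x : D.ev → ℝ} (hf : ParNear ε f x) :
    ParNear ε (-f) x := by
  filter_upwards [hf] with y h1
  exact neg_mem h1

theorem ParNear.smul {ε : ZMod 2} (c : ℝ) {f : D.Fn} {x : D.ev → ℝ} (hf : ParNear ε f x) :
    ParNear ε (c • f) x := by
  filter_upwards [hf] with y h1
  exact Submodule.smul_mem _ _ h1

theorem ParNear.sum {ε : ZMod 2} {ι : Type*} (s : Finset ι) {f : ι → D.Fn} {x : D.ev → ℝ}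
    (hf : ∀ i ∈ s, ParNear ε (f i) x) : ParNear ε (∑ i ∈ s, f i) x := by
  filter_upwards [(Finset.eventually_all s).2 hf] with y h1
  rw [Finset.sum_apply]
  exact Submodule.sum_mem _ h1

theorem ParNear.congr {ε : ZMod 2} {f g : D.Fn} {x : D.ev → ℝ} (hf : ParNear ε f x)
    (h : f =ᶠ[𝓝 x] g) : ParNear ε g x := by
  filter_upwards [hf, h] with y h1 h2
  rwa [← h2]

theorem par_pos (A : D.Coord) : D.cot.par (pos A) = D.par A := by
  rcases A with i | i <;> rfl

theorem par_mom (A : D.Coord) : D.cot.par (mom A) = D.par A := by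
  rcases A with i | i <;> rfl

theorem pos_eq_map (A : D.Coord) : (pos A : D.cot.Coord) = Sum.map Sum.inl Sum.inl A := by
  rcases A with i | i <;> rfl

theorem mom_ne_pos (A B : D.Coord) : (mom A : D.cot.Coord) ≠ pos B := by
  rcases A with i | i <;> rcases B with j | j <;> simp [mom, pos]

theorem mom_injective : Function.Injective (mom : D.Coord → D.cot.Coord) := by
  rintro (i | i) (j | j) h <;> simp_all [mom]

theorem pos_injective : Function.Injective (pos : D.Coord → D.cot.Coord) := by
  rintro (i | i) (j | j) h <;> simp_all [pos]

/-! ### The bracket as one sum over phase coordinates -/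

/-- The positions (`false`) and momenta (`true`). -/
def phase (I : D.Coord × Bool) : D.cot.Coord := bif I.2 then mom I.1 else pos I.1

/-- The conjugate coordinate. -/
def conjugate (I : D.Coord × Bool) : D.Coord × Bool := (I.1, !I.2)

theorem par_phase (I : D.Coord × Bool) : D.cot.par (phase I) = D.par I.1 := by
  rcases I with ⟨A, _ | _⟩
  · exact par_pos A
  · exact par_mom A

/-- The sign of a term of the Poisson bracket. -/
def phaseSign (I : D.Coord × Bool) : ℝ := bif I.2 then 1 else -sgn (D.par I.1)

theorem phaseSign_conjugate (I : D.Coord × Bool) :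
    phaseSign (conjugate I) = -sgn (D.par I.1) * phaseSign I := by
  rcases I with ⟨A, _ | _⟩ <;> simp [phaseSign, conjugate]

theorem conjugate_conjugate (I : D.Coord × Bool) : conjugate (conjugate I) = I := by
  simp [conjugate]

/-- Passage to the conjugate coordinate, as a permutation. -/
def conjugateEquiv : Equiv.Perm (D.Coord × Bool) :=
  ⟨conjugate, conjugate, conjugate_conjugate, conjugate_conjugate⟩

variable {F G H : D.cot.Fn} {x : D.cot.ev → ℝ} {ε δ κ : ZMod 2}

/-- Writing the bracket over positions and momenta together turns its antisymmetry into a reindexing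
by the conjugation of coordinates. -/
theorem poisson_apply (hF : SmoothAt F x) (G : D.cot.Fn) :
    poisson F G x = ∑ I, phaseSign I •
      (tw (D.par I.1) (pd (phase I) F x) * pd (phase (conjugate I)) G x) := by
  rw [Fintype.sum_prod_type, poisson, Finset.sum_apply]
  refine Finset.sum_congr rfl fun A _ => ?_
  rw [Fintype.sum_bool]
  simp only [Pi.sub_apply, Pi.smul_apply, Pi.mul_apply, phaseSign, phase, conjugate, Bool.not_true,
    Bool.not_false, cond_true, cond_false, pd_twist _ _ hF, par_mom, par_pos, smul_mul_assoc,
    smul_smul, one_smul, neg_smul, ← sgn_add]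
  rw [show D.par A + D.par A * D.par A = 0 by generalize D.par A = a; revert a; decide,
    show D.par A * D.par A = D.par A by generalize D.par A = a; revert a; decide, sgn_zero,
    one_smul, sub_eq_add_neg]

/-- The coefficient of a term of the Poisson bracket with a function of parity `ε`. -/
def phaseCoeff (ε : ZMod 2) (I : D.Coord × Bool) : ℝ :=
  phaseSign I * sgn (D.par I.1 * ε + D.par I.1)

theorem poisson_apply_of_mem (hF : SmoothAt F x) (h : ParNear ε F x) (G : D.cot.Fn) :
    poisson F G x = ∑ I, phaseCoeff ε I •
      (pd (phase I) F x * pd (phase (conjugate I)) G x) := by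
  rw [poisson_apply hF]
  refine Finset.sum_congr rfl fun I _ => ?_
  rw [tw_of_mem (pd_mem hF h), smul_mul_assoc, smul_smul, phaseCoeff, par_phase]
  congr 3
  -- Signs are compared as exponents modulo two; once the parities are free variables, the identity
  -- is checked on all their values. All later sign identities are handled in this way.
  generalize D.par I.1 = a; clear h; revert a ε; decide

theorem poisson_eventually (hF : SmoothAt F x) (h : ParNear ε F x) (G : D.cot.Fn) :
    poisson F G =ᶠ[𝓝 x] ∑ I, phaseCoeff ε I •
      (pd (phase I) F * pd (phase (conjugate I)) G) := by
  filter_upwards [hF.eventually, h.eventually] with y h1 h2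
  rw [poisson_apply_of_mem h1 h2, Finset.sum_apply]
  rfl

theorem poisson_congr {F' G' : D.cot.Fn} (hF : F =ᶠ[𝓝 x] F') (hG : G =ᶠ[𝓝 x] G') :
    poisson F G x = poisson F' G' x := by
  simp only [poisson, Finset.sum_apply, Pi.sub_apply, Pi.smul_apply, Pi.mul_apply]
  have : ∀ A : D.Coord, twist (D.par A) F =ᶠ[𝓝 x] twist (D.par A) F' := by
    intro A
    filter_upwards [hF] with y hy
    rw [twist_apply, twist_apply, hy]
  refine Finset.sum_congr rfl fun A _ => ?_
  rw [pd_congr _ (this A), pd_congr _ hG, pd_congr _ (this A), pd_congr _ hG]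

theorem SmoothAt.poisson (hF : SmoothAt F x) (hG : SmoothAt G x) :
    SmoothAt (poisson F G) x :=
  SmoothAt.sum _ fun _ _ => ((((hF.twist _).pd _).mul (hG.pd _)).smul _).sub
    (((hF.twist _).pd _).mul (hG.pd _))

theorem ParNear.poisson (hF : SmoothAt F x) (hG : SmoothAt G x) (h : ParNear ε F x)
    (h' : ParNear δ G x) (hκ : κ = ε + δ := by rfl) : ParNear κ (poisson F G) x := by
  refine ParNear.congr ?_ (poisson_eventually hF h G).symm
  refine ParNear.sum _ fun I _ => ParNear.smul _ ((h.pd hF _).mul (h'.pd hG _) ?_)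
  rw [par_phase, par_phase, hκ]
  simp only [conjugate]
  generalize D.par I.1 = a; clear h h' hκ; revert a δ ε; decide

theorem poisson_add_right (hG : SmoothAt G x) (hH : SmoothAt H x) :
    poisson F (G + H) x = poisson F G x + poisson F H x := by
  simp only [poisson, Finset.sum_apply, Pi.sub_apply, Pi.smul_apply, Pi.mul_apply,
    ← Finset.sum_add_distrib, pd_add _ hG hH]
  refine Finset.sum_congr rfl fun A _ => ?_
  rw [mul_add, mul_add, smul_add]; abel

theorem poisson_smul_right (c : ℝ) (hG : SmoothAt G x) :
    poisson F (c • G) x = c • poisson F G x := by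
  simp only [poisson, Finset.sum_apply, Pi.sub_apply, Pi.smul_apply, Pi.mul_apply,
    Finset.smul_sum, pd_smul _ c hG]
  refine Finset.sum_congr rfl fun A _ => ?_
  rw [mul_smul_comm, mul_smul_comm, smul_sub, smul_comm]

theorem poisson_add_left (hF : SmoothAt F x) (hG : SmoothAt G x) :
    poisson (F + G) H x = poisson F H x + poisson G H x := by
  simp only [poisson_apply hF, poisson_apply hG, poisson_apply (hF.add hG),
    ← Finset.sum_add_distrib, pd_add _ hF hG, map_add, add_mul, smul_add]

theorem poisson_smul_left (c : ℝ) (hF : SmoothAt F x) :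
    poisson (c • F) H x = c • poisson F H x := by
  simp only [poisson_apply hF, poisson_apply (hF.smul c),
    Finset.smul_sum, pd_smul _ c hF, map_smul, smul_mul_assoc]
  exact Finset.sum_congr rfl fun A _ => smul_comm _ _ _

theorem poisson_neg_right (hG : SmoothAt G x) : poisson F (-G) x = -poisson F G x := by
  simpa using poisson_smul_right (F := F) (-1) hG

theorem poisson_neg_left (hF : SmoothAt F x) : poisson (-F) H x = -poisson F H x := by
  simpa using poisson_smul_left (H := H) (-1) hF

theorem poisson_sub_right (hG : SmoothAt G x) (hH : SmoothAt H x) :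
    poisson F (G - H) x = poisson F G x - poisson F H x := by
  rw [sub_eq_add_neg, poisson_add_right hG hH.neg, poisson_neg_right hH, sub_eq_add_neg]

theorem poisson_sub_left (hF : SmoothAt F x) (hG : SmoothAt G x) :
    poisson (F - G) H x = poisson F H x - poisson G H x := by
  rw [sub_eq_add_neg, poisson_add_left hF hG.neg, poisson_neg_left hG, sub_eq_add_neg]

/-- Exchanging each coordinate with its conjugate interchanges the roles of `F` and `G`; graded
commutativity of the two derivatives and `phaseSign_conjugate` account for the sign. -/
theorem poisson_skew (hF : SmoothAt F x) (hG : SmoothAt G x) (h : ParNear ε F x)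
    (h' : ParNear δ G x) : poisson F G x = -(sgn (ε * δ) • poisson G F x) := by
  rw [poisson_apply_of_mem hF h, poisson_apply_of_mem hG h', ← Equiv.sum_comp conjugateEquiv,
    Finset.smul_sum, ← Finset.sum_neg_distrib]
  refine Finset.sum_congr rfl fun I _ => ?_
  simp only [conjugateEquiv, Equiv.coe_fn_mk, conjugate_conjugate]
  rw [mul_comm_sgn (pd_mem hF h) (pd_mem hG h'), smul_smul, smul_smul, ← neg_smul, phaseCoeff,
    phaseSign_conjugate, par_phase, par_phase, phaseCoeff]
  congr 1
  simp only [conjugate]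
  generalize D.par I.1 = a
  rcases zmod_two_cases a with rfl | rfl <;> rcases zmod_two_cases ε with rfl | rfl <;>
    rcases zmod_two_cases δ with rfl | rfl <;>
    simp [show (1 : ZMod 2) + 1 = 0 by decide]

theorem poisson_mul_right (hF : SmoothAt F x) (hG : SmoothAt G x) (hH : SmoothAt H x)
    (h : ParNear ε F x) (h' : ParNear δ G x) :
    poisson F (G * H) x = poisson F G x * H x + sgn (ε * δ) • (G x * poisson F H x) := by
  simp only [poisson_apply_of_mem hF h, pd_mul _ hG hH, Finset.sum_mul, Finset.mul_sum,
    Finset.smul_sum, ← Finset.sum_add_distrib]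
  refine Finset.sum_congr rfl fun I _ => ?_
  rw [mul_add, smul_add, smul_mul_assoc, mul_assoc]
  congr 1
  rw [tw_of_mem h'.self, smul_mul_assoc, mul_smul_comm, ← mul_assoc, mul_smul_comm, ← mul_assoc,
    mul_comm_sgn (pd_mem hF h) h'.self]
  simp only [smul_mul_assoc, smul_smul, par_phase]
  congr 1
  simp only [conjugate]
  generalize D.par I.1 = a
  rcases zmod_two_cases a with rfl | rfl <;> rcases zmod_two_cases ε with rfl | rfl <;>
    rcases zmod_two_cases δ with rfl | rfl <;>
    simp [show (1 : ZMod 2) + 1 = 0 by decide]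

/-- Antisymmetry transports the rule from the right argument to the left one; all three parities are
needed to bring the signs back. -/
theorem poisson_mul_left (hF : SmoothAt F x) (hG : SmoothAt G x) (hH : SmoothAt H x)
    (h : ParNear ε F x) (h' : ParNear δ G x) (h'' : ParNear κ H x) :
    poisson (F * G) H x = F x * poisson G H x + sgn (δ * κ) • (poisson F H x * G x) := by
  rw [poisson_skew (hF.mul hG) hH (h.mul h') h'', poisson_mul_right hH hF hG h'' h,
    poisson_skew hG hH h' h'', poisson_skew hF hH h h'', mul_neg, mul_smul_comm,
    mul_comm_sgn h.self ((h''.poisson hH hG h').self)]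
  simp only [smul_add, smul_smul, neg_add, smul_neg, neg_mul, smul_mul_assoc, ← sgn_add]
  rw [add_comm]
  congr 3 <;> congr 1 <;> clear h h' h'' <;> revert ε δ κ <;> decide

/-- Full expansion leaves terms with second derivatives of exactly one of the three functions. Those
of `G` agree on the two sides, those of `H` agree after exchanging the two summation indices, and
those of `F` cancel through conjugation of an index. -/
theorem poisson_jacobi (hF : SmoothAt F x) (hG : SmoothAt G x) (hH : SmoothAt H x)
    (h : ParNear ε F x) (h' : ParNear δ G x) :
    poisson F (poisson G H) x =
      poisson (poisson F G) H x + sgn (ε * δ) • poisson G (poisson F H) x := by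
  have expand : ∀ {F G H : D.cot.Fn} {ε δ : ZMod 2}, SmoothAt F x → SmoothAt G x →
      SmoothAt H x → ParNear ε F x → ParNear δ G x →
      poisson F (poisson G H) x = (∑ I, ∑ J, (phaseCoeff ε I * phaseCoeff δ J) •
        (pd (phase I) F x * pd (phase (conjugate I)) (pd (phase J) G) x *
          pd (phase (conjugate J)) H x)) +
        ∑ I, ∑ J, (phaseCoeff ε I * phaseCoeff δ J * sgn (D.par I.1 * (δ + D.par J.1))) •
          (pd (phase I) F x * pd (phase J) G x *
            pd (phase (conjugate I)) (pd (phase (conjugate J)) H) x) := by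
    intro F G H ε δ hF hG hH h h'
    rw [poisson_apply_of_mem hF h, ← Finset.sum_add_distrib]
    refine Finset.sum_congr rfl fun I _ => ?_
    rw [pd_congr _ (poisson_eventually hG h' H),
      pd_sum _ _ fun J _ => ((hG.pd _).mul (hH.pd _)).smul _, Finset.mul_sum, Finset.smul_sum,
      ← Finset.sum_add_distrib]
    refine Finset.sum_congr rfl fun J _ => ?_
    rw [pd_smul _ _ ((hG.pd _).mul (hH.pd _)), pd_mul _ (hG.pd _) (hH.pd _),
      tw_of_mem (pd_mem hG h'), mul_smul_comm, mul_add, smul_add, smul_add, smul_mul_assoc,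
      mul_smul_comm]
    simp only [smul_smul, mul_assoc, par_phase, conjugate]
  have expand' : poisson (poisson F G) H x =
      (∑ I, ∑ J, (phaseCoeff ε I * phaseCoeff (ε + δ) J) •
        (pd (phase J) (pd (phase I) F) x * pd (phase (conjugate I)) G x *
          pd (phase (conjugate J)) H x)) +
        ∑ I, ∑ J, (phaseCoeff ε I * phaseCoeff (ε + δ) J * sgn (D.par J.1 * ε)) •
          (pd (phase I) F x * pd (phase (conjugate I)) (pd (phase J) G) x *
            pd (phase (conjugate J)) H x) := by
    rw [poisson_apply_of_mem (hF.poisson hG) (h.poisson hF hG h'), Finset.sum_comm,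
      Finset.sum_comm (f := fun I J => (phaseCoeff ε I * phaseCoeff (ε + δ) J *
        sgn (D.par J.1 * ε)) • _), ← Finset.sum_add_distrib]
    refine Finset.sum_congr rfl fun J _ => ?_
    rw [pd_congr _ (poisson_eventually hF h G),
      pd_sum _ _ fun J _ => ((hF.pd _).mul (hG.pd _)).smul _, Finset.sum_mul, Finset.smul_sum,
      ← Finset.sum_add_distrib]
    refine Finset.sum_congr rfl fun I _ => ?_
    rw [pd_smul _ _ ((hF.pd _).mul (hG.pd _)), pd_mul _ (hF.pd _) (hG.pd _),
      tw_of_mem (pd_mem hF h), pd_comm (phase J) (phase (conjugate I)) hG]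
    simp only [smul_smul, mul_assoc, smul_mul_assoc, add_mul, mul_smul_comm, smul_add]
    congr 2
    · ring
    · simp only [← sgn_add]
      rw [mul_left_comm, par_phase, par_phase, par_phase]
      congr 3
      simp only [conjugate]
      generalize D.par I.1 = a
      generalize D.par J.1 = b
      clear h h'
      revert a b ε; decide
  rw [expand hF hG hH h h', expand', expand hG hF hH h' h, smul_add]
  -- Terms with second derivatives of `G`: the summands coincide up to the parity exponent.
  have e1 : (∑ I, ∑ J, (phaseCoeff ε I * phaseCoeff (ε + δ) J * sgn (D.par J.1 * ε)) •
      (pd (phase I) F x * pd (phase (conjugate I)) (pd (phase J) G) x *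
        pd (phase (conjugate J)) H x)) = ∑ I, ∑ J, (phaseCoeff ε I * phaseCoeff δ J) •
      (pd (phase I) F x * pd (phase (conjugate I)) (pd (phase J) G) x *
        pd (phase (conjugate J)) H x) := by
    refine Finset.sum_congr rfl fun I _ => Finset.sum_congr rfl fun J _ => ?_
    congr 1
    simp only [phaseCoeff, mul_assoc, ← sgn_add]
    congr 4
    generalize D.par J.1 = b
    clear expand expand' h h'
    revert b ε δ; decide
  -- Terms with second derivatives of `H`: graded symmetry of the second derivatives compensates the
  -- exchange of `I` and `J`.
  have e2 : sgn (ε * δ) • (∑ I, ∑ J,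
      (phaseCoeff δ I * phaseCoeff ε J * sgn (D.par I.1 * (ε + D.par J.1))) •
        (pd (phase I) G x * pd (phase J) F x *
          pd (phase (conjugate I)) (pd (phase (conjugate J)) H) x)) =
      ∑ I, ∑ J, (phaseCoeff ε I * phaseCoeff δ J * sgn (D.par I.1 * (δ + D.par J.1))) •
        (pd (phase I) F x * pd (phase J) G x *
          pd (phase (conjugate I)) (pd (phase (conjugate J)) H) x) := by
    rw [Finset.sum_comm, Finset.smul_sum]
    refine Finset.sum_congr rfl fun I _ => ?_
    rw [Finset.smul_sum]
    refine Finset.sum_congr rfl fun J _ => ?_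
    rw [mul_comm_sgn (pd_mem hG h') (pd_mem hF h),
      pd_comm (phase (conjugate J)) (phase (conjugate I)) hH]
    simp only [smul_smul, smul_mul_assoc, mul_smul_comm, par_phase]
    congr 1
    simp only [phaseCoeff, conjugate]
    generalize D.par I.1 = a
    generalize D.par J.1 = b
    rw [show ∀ s t : ℝ, sgn (ε * δ) * (t * sgn (b * δ + b) * (s * sgn (a * ε + a)) *
      sgn (b * (ε + a)) * (sgn (b * a) * sgn ((δ + b) * (ε + a)))) = s * t * (sgn (ε * δ) *
      sgn (b * δ + b) * sgn (a * ε + a) * sgn (b * (ε + a)) * sgn ((δ + b) * (ε + a)) *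
      sgn (b * a)) by intros; ring,
      show ∀ s t : ℝ, s * sgn (a * ε + a) * (t * sgn (b * δ + b)) * sgn (a * (δ + b)) =
      s * t * (sgn (a * ε + a) * sgn (b * δ + b) * sgn (a * (δ + b))) by intros; ring]
    simp only [← sgn_add]
    congr 2
    clear expand expand' e1 h h'
    revert a b ε δ; decide
  -- Terms with second derivatives of `F`: conjugating `I` produces the minus sign of the canonical
  -- form, so the two occurrences cancel.
  have e3 : sgn (ε * δ) • (∑ I, ∑ J, (phaseCoeff δ I * phaseCoeff ε J) •
      (pd (phase I) G x * pd (phase (conjugate I)) (pd (phase J) F) x *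
        pd (phase (conjugate J)) H x)) =
      -∑ I, ∑ J, (phaseCoeff ε I * phaseCoeff (ε + δ) J) •
        (pd (phase J) (pd (phase I) F) x * pd (phase (conjugate I)) G x *
          pd (phase (conjugate J)) H x) := by
    rw [← Equiv.sum_comp conjugateEquiv, Finset.smul_sum, ← Finset.sum_neg_distrib]
    refine Finset.sum_congr rfl fun I _ => ?_
    rw [Finset.smul_sum, ← Finset.sum_neg_distrib]
    refine Finset.sum_congr rfl fun J _ => ?_
    simp only [conjugateEquiv, Equiv.coe_fn_mk, conjugate_conjugate]
    rw [pd_comm (phase I) (phase J) hF, mul_smul_comm, 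
      mul_comm_sgn (pd_mem hG h') (pd_mem (hF.pd _) (h.pd hF _))]
    simp only [smul_smul, smul_mul_assoc, par_phase, ← neg_smul]
    congr 1
    simp only [phaseCoeff, phaseSign_conjugate]
    simp only [conjugate]
    generalize D.par I.1 = a
    generalize D.par J.1 = b
    rw [show ∀ s t : ℝ, sgn (ε * δ) * (-sgn a * s * sgn (a * δ + a) * (t * sgn (b * ε + b)) *
      (sgn (a * b) * sgn ((δ + a) * (ε + a + b)))) = -(s * t * (sgn (ε * δ) *
      sgn a * sgn (a * δ + a) * sgn (b * ε + b) * sgn (a * b) * sgn ((δ + a) * (ε + a + b)))) by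
      intros; ring,
      show ∀ s t : ℝ, -(s * sgn (a * ε + a) * (t * sgn (b * (ε + δ) + b))) =
      -(s * t * (sgn (a * ε + a) * sgn (b * (ε + δ) + b))) by intros; ring]
    simp only [← sgn_add]
    congr 3
    clear expand expand' e1 e2 h h'
    revert a b ε δ; decide
  rw [e1, e2, e3]
  abel

end Poisson

end SuperGeom

end
noncomputable section
namespace SuperGeom

/-! ### Euler vector fields -/

section Euler

variable {D D' : SuperDim}

/-- The Euler vector field of the weights `w`. -/
def euler (w : D.Coord → ℤ) (f : D.Fn) : D.Fn := ∑ A, (w A : ℝ) • (coord A * pd A f)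

theorem euler_apply (w : D.Coord → ℤ) (f : D.Fn) (x : D.ev → ℝ) :
    euler w f x = ∑ A, (w A : ℝ) • (coord A x * pd A f x) := by
  simp [euler, Finset.sum_apply]

theorem euler_congr (w : D.Coord → ℤ) {f g : D.Fn} {x : D.ev → ℝ} (h : f =ᶠ[𝓝 x] g) :
    euler w f x = euler w g x := by
  simp only [euler_apply, pd_congr _ h]

theorem euler_add (w : D.Coord → ℤ) {f g : D.Fn} {x : D.ev → ℝ} (hf : SmoothAt f x)
    (hg : SmoothAt g x) : euler w (f + g) x = euler w f x + euler w g x := by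
  simp only [euler_apply, pd_add _ hf hg, mul_add, smul_add, Finset.sum_add_distrib]

theorem euler_smul (w : D.Coord → ℤ) (c : ℝ) {f : D.Fn} {x : D.ev → ℝ} (hf : SmoothAt f x) :
    euler w (c • f) x = c • euler w f x := by
  simp only [euler_apply, pd_smul _ c hf, mul_smul_comm, Finset.smul_sum]
  exact Finset.sum_congr rfl fun A _ => smul_comm _ _ _

theorem euler_neg (w : D.Coord → ℤ) {f : D.Fn} {x : D.ev → ℝ} (hf : SmoothAt f x) :
    euler w (-f) x = -euler w f x := by
  simpa using euler_smul w (-1) hf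

theorem euler_sub (w : D.Coord → ℤ) {f g : D.Fn} {x : D.ev → ℝ} (hf : SmoothAt f x)
    (hg : SmoothAt g x) : euler w (f - g) x = euler w f x - euler w g x := by
  rw [sub_eq_add_neg, euler_add w hf hg.neg, euler_neg w hg, sub_eq_add_neg]

theorem euler_sum (w : D.Coord → ℤ) {ι : Type*} (s : Finset ι) {f : ι → D.Fn} {x : D.ev → ℝ}
    (hf : ∀ i ∈ s, SmoothAt (f i) x) : euler w (∑ i ∈ s, f i) x = ∑ i ∈ s, euler w (f i) x := by
  simp only [euler_apply, pd_sum _ s hf, Finset.mul_sum, Finset.smul_sum]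
  exact Finset.sum_comm

/-- In each summand the parity of the coordinate cancels that of the derivative, so the Euler field
is an even derivation and no sign appears. -/
theorem euler_mul (w : D.Coord → ℤ) {f g : D.Fn} {x : D.ev → ℝ} (hf : SmoothAt f x)
    (hg : SmoothAt g x) : euler w (f * g) x = euler w f x * g x + f x * euler w g x := by
  simp only [euler_apply, pd_mul _ hf hg, Finset.sum_mul, Finset.mul_sum,
    ← Finset.sum_add_distrib]
  refine Finset.sum_congr rfl fun A _ => ?_
  rw [mul_add, smul_add, smul_mul_assoc, mul_assoc, mul_smul_comm, ← mul_assoc (f x),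
    ← mul_assoc, ← mul_assoc _ (tw _ _), mul_comm_tw (coord_mem A x) (tw _ _), tw_tw_self]

theorem euler_coord (w : D.Coord → ℤ) (A : D.Coord) (x : D.ev → ℝ) :
    euler w (coord A) x = (w A : ℝ) • coord A x := by
  classical
  rw [euler_apply, Finset.sum_eq_single A]
  · simp [pd_coord]
  · intro B _ hB
    simp [pd_coord, hB]
  · simp

theorem euler_ext {e : D.ev → D'.ev} {o : D.od → D'.od} (he : Function.Injective e)
    (ho : Function.Injective o) {w : D.Coord → ℤ} {w' : D'.Coord → ℤ}
    (hw : ∀ A, w' (Sum.map e o A) = w A) {f : D.Fn} {x : D'.ev → ℝ}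
    (hf : SmoothAt f (x ∘ e)) : euler w' (ext e o f : D'.Fn) x = ext e o (euler w f) x := by
  have : (ext e o (euler w f) : D'.Fn) x =
      ∑ A, (w A : ℝ) • ((coord (Sum.map e o A) : D'.Fn) x * ext e o (pd A f) x) := by
    simp only [euler, ext_sum, ext_smul, ext_mul, ext_coord, Finset.sum_apply, Pi.smul_apply,
      Pi.mul_apply]
  rw [this, euler_apply]
  symm
  refine Fintype.sum_of_injective (Sum.map e o) (Sum.map_injective.2 ⟨he, ho⟩) _ _ ?_ ?_
  · intro A hA
    rw [pd_ext_of_notMem hA hf, mul_zero, smul_zero]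
  · intro A
    rw [hw, pd_ext he ho A hf]

theorem euler_zero_weight (f : D.Fn) : euler (0 : D.Coord → ℤ) f = 0 := by
  simp [euler]

/-- The commutator of the Euler field with `∂_B` comes from the single term in which `∂_B` hits the
coordinate coefficient; hence a derivative lowers the weight by that of its coordinate. -/
theorem euler_pd (w : D.Coord → ℤ) (B : D.Coord) {f : D.Fn} {x : D.ev → ℝ} (hf : SmoothAt f x) :
    euler w (pd B f) x = pd B (euler w f) x - (w B : ℝ) • pd B f x := by
  classical
  have h : ∀ A, SmoothAt ((w A : ℝ) • (coord A * pd A f)) x :=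
    fun A => ((smoothAt_coord A x).mul (hf.pd A)).smul _
  have h2 : ∀ A, pd B ((w A : ℝ) • (coord A * pd A f)) x =
      (if B = A then (w A : ℝ) • pd A f x else 0) + (w A : ℝ) • (coord A x * pd A (pd B f) x) := by
    intro A
    rw [pd_smul _ _ ((smoothAt_coord A x).mul (hf.pd A)), pd_mul _ (smoothAt_coord A x) (hf.pd A),
      pd_coord, tw_of_mem (coord_mem A x), pd_comm A B hf, smul_add]
    congr 1
    · split <;> simp
    · rw [mul_smul_comm, smul_mul_assoc, mul_comm (D.par A)]
  have h3 : pd B (euler w f) x = ∑ A, pd B ((w A : ℝ) • (coord A * pd A f)) x :=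
    pd_sum B _ fun A _ => h A
  rw [h3, Finset.sum_congr rfl fun A _ => h2 A,
    Finset.sum_add_distrib, Finset.sum_ite_eq, if_pos (Finset.mem_univ _), ← euler_apply]
  abel

/-! ### Calculus of weights -/

/-- The function `f` has weight `k` near `x`. -/
def WeightNear (w : D.Coord → ℤ) (k : ℤ) (f : D.Fn) (x : D.ev → ℝ) : Prop :=
  ∀ᶠ y in 𝓝 x, euler w f y = (k : ℝ) • f y

theorem WeightNear.eventually {w : D.Coord → ℤ} {k : ℤ} {f : D.Fn} {x : D.ev → ℝ}
    (h : WeightNear w k f x) : ∀ᶠ y in 𝓝 x, WeightNear w k f y :=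
  eventually_eventually_nhds.2 h

theorem WeightNear.mul {w : D.Coord → ℤ} {k l m : ℤ} {f g : D.Fn} {x : D.ev → ℝ}
    (hf : SmoothAt f x) (hg : SmoothAt g x) (h : WeightNear w k f x) (h' : WeightNear w l g x)
    (hm : m = k + l := by rfl) : WeightNear w m (f * g) x := by
  filter_upwards [hf.eventually, hg.eventually, h, h'] with y h1 h2 h3 h4
  rw [euler_mul w h1 h2, h3, h4, hm, smul_mul_assoc, mul_smul_comm, ← add_smul]
  push_cast; rfl

theorem WeightNear.sub {w : D.Coord → ℤ} {k : ℤ} {f g : D.Fn} {x : D.ev → ℝ}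
    (hf : SmoothAt f x) (hg : SmoothAt g x) (h : WeightNear w k f x) (h' : WeightNear w k g x) :
    WeightNear w k (f - g) x := by
  filter_upwards [hf.eventually, hg.eventually, h, h'] with y h1 h2 h3 h4
  rw [euler_sub w h1 h2, h3, h4, ← smul_sub]; rfl

theorem WeightNear.smul {w : D.Coord → ℤ} {k : ℤ} (c : ℝ) {f : D.Fn} {x : D.ev → ℝ}
    (hf : SmoothAt f x) (h : WeightNear w k f x) : WeightNear w k (c • f) x := by
  filter_upwards [hf.eventually, h] with y h1 h3
  rw [euler_smul w c h1, h3, smul_comm]; rfl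

theorem WeightNear.neg {w : D.Coord → ℤ} {k : ℤ} {f : D.Fn} {x : D.ev → ℝ}
    (hf : SmoothAt f x) (h : WeightNear w k f x) : WeightNear w k (-f) x := by
  simpa using h.smul (-1) hf

theorem WeightNear.sum {w : D.Coord → ℤ} {k : ℤ} {ι : Type*} (s : Finset ι) {f : ι → D.Fn}
    {x : D.ev → ℝ} (hf : ∀ i ∈ s, SmoothAt (f i) x) (h : ∀ i ∈ s, WeightNear w k (f i) x) :
    WeightNear w k (∑ i ∈ s, f i) x := by
  filter_upwards [(Finset.eventually_all s).2 fun i hi => (hf i hi).eventually,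
    (Finset.eventually_all s).2 h] with y h1 h2
  rw [euler_sum w s h1, Finset.sum_congr rfl h2, Finset.sum_apply, Finset.smul_sum]

theorem WeightNear.pd {w : D.Coord → ℤ} {k l : ℤ} {f : D.Fn} {x : D.ev → ℝ}
    (hf : SmoothAt f x) (h : WeightNear w k f x) (B : D.Coord) (hl : l = k - w B := by rfl) :
    WeightNear w l (pd B f) x := by
  filter_upwards [hf.eventually, h.eventually] with y h1 h2
  have : euler w f =ᶠ[𝓝 y] (k : ℝ) • f := h2
  rw [euler_pd w B h1, pd_congr B this, pd_smul B _ h1, ← sub_smul, hl]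
  push_cast; rfl

theorem weightNear_coord (w : D.Coord → ℤ) (A : D.Coord) (x : D.ev → ℝ) :
    WeightNear w (w A) (coord A) x := .of_forall fun y => euler_coord w A y

theorem WeightNear.ext {e : D.ev → D'.ev} {o : D.od → D'.od} (he : Function.Injective e)
    (ho : Function.Injective o) {w : D.Coord → ℤ} {w' : D'.Coord → ℤ}
    (hw : ∀ A, w' (Sum.map e o A) = w A) {k : ℤ} {f : D.Fn} {x : D'.ev → ℝ}
    (hf : SmoothAt f (x ∘ e)) (h : WeightNear w k f (x ∘ e)) :
    WeightNear w' k (SuperGeom.ext e o f : D'.Fn) x := by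
  filter_upwards [(continuous_comp_left e).continuousAt.eventually hf.eventually,
    (continuous_comp_left e).continuousAt.eventually h] with y h1 h2
  rw [euler_ext he ho hw h1]
  simp only [SuperGeom.ext, h2, map_smul]

theorem weightNear_ext_zero {e : D.ev → D'.ev} {o : D.od → D'.od} (he : Function.Injective e)
    (ho : Function.Injective o) {w' : D'.Coord → ℤ}
    (hw : ∀ A, w' (Sum.map e o A) = 0) {f : D.Fn} {x : D'.ev → ℝ}
    (hf : SmoothAt f (x ∘ e)) : WeightNear w' 0 (SuperGeom.ext e o f : D'.Fn) x := by
  refine WeightNear.ext he ho (w := 0) hw hf (.of_forall fun y => ?_)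
  rw [euler_zero_weight]; simp

theorem WeightNear.twist {w : D.Coord → ℤ} {k : ℤ} (ε : ZMod 2) {f : D.Fn} {x : D.ev → ℝ}
    (hf : SmoothAt f x) (h : WeightNear w k f x) : WeightNear w k (twist ε f) x := by
  filter_upwards [hf.eventually, h] with y h1 h2
  rw [twist_apply, ← map_smul, ← h2, euler_apply, euler_apply, map_sum]
  refine Finset.sum_congr rfl fun A _ => ?_
  rw [pd_twist A ε h1, map_smul, map_mul, tw_of_mem (coord_mem A y), mul_smul_comm,
    smul_mul_assoc]

theorem Gluing.HasWeight.weightNear {M : Gluing D} {w : D.Coord → ℤ} {k : ℤ} {F : M.Fam}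
    (h : M.HasWeight w k F) {a : M.Idx} (ho : IsOpen (M.dom a)) {x : D.ev → ℝ}
    (hx : x ∈ M.dom a) : WeightNear w k (F a) x := by
  filter_upwards [ho.mem_nhds hx] with y hy
  rw [euler_apply]; exact h a y hy

theorem Gluing.hasWeight_of_weightNear {M : Gluing D} {w : D.Coord → ℤ} {k : ℤ} {F : M.Fam}
    (h : ∀ a, ∀ x ∈ M.dom a, WeightNear w k (F a) x) : M.HasWeight w k F := by
  intro a x hx
  rw [← euler_apply]; exact (h a x hx).self_of_nhds

end Euler

/-! ### The exponential function of a coordinate -/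

section Exponential

variable {D D' : SuperDim}

/-- The function `exp (-x ^ i)`. -/
def expNeg (i : D.ev) : D.Fn := fun x => algebraMap ℝ D.Gr (Real.exp (-(x i)))

theorem contDiff_expNeg (i : D.ev) : ContDiff ℝ ∞ fun x : D.ev → ℝ => Real.exp (-(x i)) := by
  fun_prop

theorem smoothAt_expNeg (i : D.ev) (x : D.ev → ℝ) : SmoothAt (expNeg i) x :=
  smoothAt_algebraMap (.of_forall fun _ => (contDiff_expNeg i).contDiffAt)

theorem expNeg_mem (i : D.ev) (x : D.ev → ℝ) : expNeg i x ∈ grPart D 0 :=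
  algebraMap_mem_grPart _

theorem pd_expNeg_self (i : D.ev) (x : D.ev → ℝ) : pd (.inl i) (expNeg i) x = -expNeg i x := by
  classical
  rw [show (expNeg i : D.Fn) = fun x => algebraMap ℝ D.Gr (Real.exp (-(x i))) from rfl,
    pd_inl_algebraMap i (.of_forall fun _ => (contDiff_expNeg i).contDiffAt)]
  have h1 : HasFDerivAt (fun y : D.ev → ℝ => y i) (ContinuousLinearMap.proj (R := ℝ) i) x :=
    hasFDerivAt_apply (𝕜 := ℝ) i x
  have h2 : HasFDerivAt (fun y : D.ev → ℝ => Real.exp (-(y i))) _ x := h1.neg.exp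
  rw [h2.fderiv]
  simp

theorem ext_expNeg (e : D.ev → D'.ev) (o : D.od → D'.od) (i : D.ev) :
    (ext e o (expNeg i) : D'.Fn) = expNeg (e i) := by
  ext1 x; simp [ext, expNeg]

/-- The line. -/
abbrev lineDim : SuperDim := ⟨Unit, Empty⟩

/-- Viewing the exponential as pulled back from a one-dimensional domain makes both its vanishing
derivatives and its behaviour under substitution instances of facts about `ext`. -/
theorem expNeg_eq_ext (i : D.ev) :
    (expNeg i : D.Fn) = ext (D := lineDim) (fun _ => i) Empty.elim (expNeg ()) := by
  rw [ext_expNeg]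

theorem pd_expNeg_of_ne {i : D.ev} {A : D.Coord} (hA : A ≠ .inl i) (x : D.ev → ℝ) :
    pd A (expNeg i) x = 0 := by
  rw [expNeg_eq_ext]
  refine pd_ext_of_notMem ?_ (smoothAt_expNeg _ _)
  rintro ⟨B | B, rfl⟩
  · exact hA rfl
  · exact B.elim

theorem oddSubst_coord (x : D.ev → ℝ) (a : D.Gr) : oddSubst (coord : D.Coord → D.Fn) x a = a := by
  induction a using CliffordAlgebra.left_induction with
  | algebraMap r => simp
  | add x y hx hy => simp only [map_add, hx, hy]
  | ι_mul b m hx =>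
    change oddSubst coord x (ExteriorAlgebra.ι ℝ m * b) = ExteriorAlgebra.ι ℝ m * b
    rw [map_mul, hx, oddSubst_ι (coord_morAt x).parAt]
    congr 1
    simp only [coord]
    rw [Finsupp.linearCombination_apply, Finsupp.sum_fintype _ _ (by simp)]
    simp only [← map_smul, ← map_sum]
    congr 1
    ext j
    simp

theorem subst_coord_left (g : D.Fn) (x : D.ev → ℝ) : subst coord g x = g x := by
  have h : ∀ i : D.ev, (coord (.inl i) : D.Fn) x = algebraMap ℝ D.Gr (x i) := fun i => rfl
  rw [subst_of_soul_eq_zero fun i => soul_eq_zero (h i), oddSubst_coord]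
  congr 1
  ext1 i
  simp [body, h]

/-- Naturality of substitution reduces the claim to the line, where the identity is substituted; no
Taylor series of the exponential has to be summed. -/
theorem subst_expNeg {φ : D'.Coord → D.Fn} {x : D.ev → ℝ} (hφ : ParAt φ x) {i : D.ev}
    {i' : D'.ev} (h : φ (.inl i') x = coord (.inl i) x) :
    subst φ (expNeg i') x = expNeg i x := by
  rw [expNeg_eq_ext i', expNeg_eq_ext i]
  refine (subst_ext (D' := lineDim) (D := lineDim) (e := fun _ => i) (o := Empty.elim)
    (φ := coord) (fun _ _ _ => rfl) (fun j => j.elim) ?_ hφ (coord_morAt _).parAt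
    (smoothAt_expNeg _ _)).trans ?_
  · rintro (j | j)
    · rw [ext_coord]; exact h
    · exact j.elim
  · exact ext_apply_congr _ _ (subst_coord_left _ _)

end Exponential

/-! ### Atlases -/

section Atlas

variable {D : SuperDim}

/-- The properties of the transition functions of a supermanifold that do not concern three
charts or the topology. -/
structure Gluing.IsAtlas (M : Gluing D) : Prop where
  isOpen_dom : ∀ a, IsOpen (M.dom a)
  isOpen_ovl : ∀ a b, IsOpen (M.ovl a b)
  ovl_subset : ∀ a b, M.ovl a b ⊆ M.dom a
  smooth : ∀ a b A, SmoothOn (M.trans a b A) (M.ovl a b)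
  parity : ∀ a b A, ∀ x ∈ M.ovl a b, M.trans a b A x ∈ grPart D (D.par A)
  maps : ∀ a b, ∀ x ∈ M.ovl a b, body (M.trans a b) x ∈ M.ovl b a
  inverse : ∀ a b A, ∀ x ∈ M.ovl a b, subst (M.trans a b) (M.trans b a A) x = coord A x

/-- The cocycle condition for the charts `a`, `b`, `a` says that the two transition maps are
inverse. For the bracket computations nothing more is needed of cotangent bundles and total spaces.
-/
theorem Gluing.IsSupermanifold.isAtlas {M : Gluing D} (h : M.IsSupermanifold) : M.IsAtlas where
  isOpen_dom := h.isOpen_dom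
  isOpen_ovl := h.isOpen_ovl
  ovl_subset := h.ovl_subset
  smooth := h.smooth
  parity := h.parity
  maps := h.maps
  inverse a b A x hx := by
    rw [← h.cocycle a b a A x hx (h.maps a b x hx),
      h.trans_self a A x (h.ovl_subset a b hx)]

variable {M : Gluing D}

theorem Gluing.IsAtlas.smoothAt (h : M.IsAtlas) {a b : M.Idx} {x : D.ev → ℝ}
    (hx : x ∈ M.ovl a b) (A : D.Coord) : SmoothAt (M.trans a b A) x :=
  (h.smooth a b A).smoothAt (h.isOpen_ovl a b) hx

theorem Gluing.IsAtlas.morAt (h : M.IsAtlas) {a b : M.Idx} {x : D.ev → ℝ}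
    (hx : x ∈ M.ovl a b) : MorAt (M.trans a b) x where
  smooth := h.smoothAt hx
  parity := by
    filter_upwards [(h.isOpen_ovl a b).mem_nhds hx] with y hy A
    exact h.parity a b A y hy

theorem Gluing.IsAtlas.body_mem_dom (h : M.IsAtlas) {a b : M.Idx} {x : D.ev → ℝ}
    (hx : x ∈ M.ovl a b) : body (M.trans a b) x ∈ M.dom b :=
  h.ovl_subset b a (h.maps a b x hx)

/-- The derivatives of the coordinates of the chart `a` by those of the chart `b`, as functions
in the chart `a`. -/
def Gluing.jacInv (M : Gluing D) (a b : M.Idx) (A B : D.Coord) : D.Fn :=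
  subst (M.trans a b) (pd A (M.trans b a B))

theorem Gluing.IsAtlas.smoothAt_jacInv (h : M.IsAtlas) {a b : M.Idx} {x : D.ev → ℝ}
    (hx : x ∈ M.ovl a b) (A B : D.Coord) : SmoothAt (M.jacInv a b A B) x :=
  smoothAt_subst (h.morAt hx) ((h.smoothAt (h.maps a b x hx) B).pd A)

theorem Gluing.IsAtlas.jacInv_mem (h : M.IsAtlas) {a b : M.Idx} {x : D.ev → ℝ}
    (hx : x ∈ M.ovl a b) (A B : D.Coord) :
    M.jacInv a b A B x ∈ grPart D (D.par A + D.par B) := by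
  have hm := h.maps a b x hx
  refine subst_mem (h.morAt hx).parAt ((h.smoothAt hm B).pd A) ?_
  rw [add_comm]
  exact eventually_pd_mem (h.smoothAt hm B) ((h.morAt hm).parity.mono fun y hy => hy B)

/-- This is the chain rule applied to the identity that the two transition maps compose to the
identity. -/
theorem Gluing.IsAtlas.sum_jac_mul_jacInv [DecidableEq D.Coord] (h : M.IsAtlas) {a b : M.Idx}
    {x : D.ev → ℝ} (hx : x ∈ M.ovl a b) (A C : D.Coord) :
    ∑ B, pd A (M.trans a b B) x * M.jacInv a b B C x = if A = C then 1 else 0 := by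
  have hm := h.maps a b x hx
  rw [← pd_coord A C x]
  have e : subst (M.trans a b) (M.trans b a C) =ᶠ[𝓝 x] coord C := by
    filter_upwards [(h.isOpen_ovl a b).mem_nhds hx] with y hy
    exact h.inverse a b C y hy
  rw [← pd_congr A e, pd_subst (h.morAt hx) (h.smoothAt hm C)]
  rfl

/-- The Jacobian has entries in a noncommutative ring, so a right inverse being a left inverse needs
an argument: over a noetherian ring one-sided inverses of square matrices are two-sided. -/
theorem Gluing.IsAtlas.sum_jacInv_mul_jac [DecidableEq D.Coord] (h : M.IsAtlas) {a b : M.Idx}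
    {x : D.ev → ℝ} (hx : x ∈ M.ovl a b) (A C : D.Coord) :
    ∑ B, M.jacInv a b A B x * pd B (M.trans a b C) x = if A = C then 1 else 0 := by
  -- The Grassmann algebra is finite dimensional over the reals.
  have : IsNoetherianRing D.Gr := isNoetherian_of_tower ℝ inferInstance
  have h1 : (Matrix.of fun A B => pd A (M.trans a b B) x) *
      (Matrix.of fun A B => M.jacInv a b A B x) = (1 : Matrix D.Coord D.Coord D.Gr) := by
    ext A C
    rw [Matrix.mul_apply, Matrix.one_apply]
    exact h.sum_jac_mul_jacInv hx A C
  have h2 := mul_eq_one_symm h1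
  have h3 := congrFun (congrFun h2 A) C
  rw [Matrix.mul_apply, Matrix.one_apply] at h3
  exact h3

/-- The derivatives of a function in the chart `b`, in terms of the coordinates of the
chart `a`. -/
theorem Gluing.IsAtlas.subst_pd (h : M.IsAtlas) {a b : M.Idx} {x : D.ev → ℝ}
    (hx : x ∈ M.ovl a b) {f : D.Fn} (hf : SmoothAt f (body (M.trans a b) x)) (A : D.Coord) :
    subst (M.trans a b) (pd A f) x =
      ∑ B, M.jacInv a b A B x * pd B (subst (M.trans a b) f) x := by
  classical
  simp only [pd_subst (h.morAt hx) hf, Finset.mul_sum, ← mul_assoc]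
  rw [Finset.sum_comm]
  simp only [← Finset.sum_mul, h.sum_jacInv_mul_jac hx]
  simp

end Atlas

end SuperGeom

end
noncomputable section
namespace SuperGeom

/-! ### The atlas of the product with the real line -/

section Line

variable {D : SuperDim} {M : Gluing D}

theorem lineBase_eq_map (A : D.Coord) : lineBase A = Sum.map Sum.inl id A := by
  rcases A with i | i <;> rfl

theorem lineBase_injective : Function.Injective (lineBase : D.Coord → D.line.Coord) := by
  rintro (i | i) (j | j) h <;> simp_all [lineBase]

theorem line_coord_cases (B : D.line.Coord) : (∃ A, B = lineBase A) ∨ B = lineTime := by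
  rcases B with (i | i) | j
  · exact .inl ⟨.inl i, rfl⟩
  · exact .inr rfl
  · exact .inl ⟨.inr j, rfl⟩

theorem lineTime_ne_lineBase (A : D.Coord) : lineTime ≠ lineBase A := by
  rcases A with i | i <;> simp [lineTime, lineBase]

theorem lineTime_notMem_range : (lineTime : D.line.Coord) ∉ Set.range (Sum.map Sum.inl id) := by
  rintro ⟨A, hA⟩
  exact lineTime_ne_lineBase A (by rw [lineBase_eq_map]; exact hA.symm)

theorem par_lineBase (A : D.Coord) : D.line.par (lineBase A) = D.par A := by
  rcases A with i | i <;> rfl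

theorem line_trans_lineBase (a b : M.Idx) (A : D.Coord) :
    M.line.trans a b (lineBase A) = extLine (M.trans a b A) := by
  rcases A with i | i <;> rfl

theorem line_trans_lineTime (a b : M.Idx) :
    M.line.trans a b lineTime = coord lineTime := rfl

theorem extLine_coord (A : D.Coord) : extLine (coord A) = (coord (lineBase A) : D.line.Fn) := by
  rw [lineBase_eq_map]; exact ext_coord _ _ A

theorem line_trans_map (a b : M.Idx) (A : D.Coord) (x : D.line.ev → ℝ) :
    M.line.trans a b (Sum.map Sum.inl id A) x =
      ext (D' := D.line) Sum.inl id (M.trans a b A) x := by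
  rw [← lineBase_eq_map, line_trans_lineBase]; rfl

theorem body_line (a b : M.Idx) (x : D.line.ev → ℝ) :
    body (M.line.trans a b) x ∘ Sum.inl = body (M.trans a b) (x ∘ Sum.inl) :=
  body_ext (D := D) (D' := D) (D₁ := D.line) (D₁' := D.line) (o := id) (o' := id)
    fun A => line_trans_map a b A x

theorem line_parAt (h : M.IsAtlas) {a b : M.Idx} {x : D.line.ev → ℝ}
    (hx : x ∈ M.line.ovl a b) : ParAt (M.line.trans a b) x := by
  intro B
  rcases line_coord_cases B with ⟨A, rfl⟩ | rfl
  · rw [line_trans_lineBase, par_lineBase]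
    exact ext_mem (h.parity a b A _ hx)
  · exact coord_mem _ _

theorem subst_extLine (h : M.IsAtlas) {a b : M.Idx} {x : D.line.ev → ℝ}
    (hx : x ∈ M.line.ovl a b) {g : D.Fn} (hg : SmoothAt g (body (M.trans a b) (x ∘ Sum.inl))) :
    subst (M.line.trans a b) (extLine g) x = extLine (subst (M.trans a b) g) x :=
  subst_ext (D := D) (D' := D) (D₁ := D.line) (D₁' := D.line) (o := id) (o' := id)
    Sum.inl_injective Function.injective_id (fun A => line_trans_map a b A x) (line_parAt h hx)
    (h.morAt hx).parAt hg

theorem Gluing.IsAtlas.line (h : M.IsAtlas) : M.line.IsAtlas where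
  isOpen_dom a := (h.isOpen_dom a).preimage
    (continuous_comp_left (D := D) (D' := D.line) Sum.inl)
  isOpen_ovl a b := (h.isOpen_ovl a b).preimage
    (continuous_comp_left (D := D) (D' := D.line) Sum.inl)
  ovl_subset a b x hx := h.ovl_subset a b hx
  smooth := fun (a b : M.Idx) B => by
    refine smoothOn_of_smoothAt fun x hx => ?_
    rcases line_coord_cases B with ⟨A, rfl⟩ | rfl
    · rw [line_trans_lineBase]
      exact SmoothAt.ext (h.smoothAt hx A)
    · rw [line_trans_lineTime]
      exact smoothAt_coord _ _
  parity a b B x hx := line_parAt h hx B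
  maps := fun (a b : M.Idx) x hx => by
    have := h.maps a b _ hx
    change body (M.line.trans a b) x ∘ Sum.inl ∈ M.ovl b a
    rwa [body_line]
  inverse := fun (a b : M.Idx) B x hx => by
    rcases line_coord_cases B with ⟨A, rfl⟩ | rfl
    · rw [line_trans_lineBase, subst_extLine h hx (h.smoothAt (h.maps a b _ hx) A),
        ← extLine_coord]
      exact ext_apply_congr _ _ (h.inverse a b A _ hx)
    · rw [line_trans_lineTime, subst_coord (line_parAt h hx), line_trans_lineTime]

end Line

/-! ### The cotangent bundle -/

section Cotangent

variable {D : SuperDim} {M : Gluing D}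

theorem cot_coord_cases (Z : D.cot.Coord) : ∃ A : D.Coord, Z = pos A ∨ Z = mom A := by
  rcases Z with (i | i) | (j | j)
  · exact ⟨.inl i, .inl rfl⟩
  · exact ⟨.inl i, .inr rfl⟩
  · exact ⟨.inr j, .inl rfl⟩
  · exact ⟨.inr j, .inr rfl⟩

theorem cot_trans_pos (a b : M.Idx) (A : D.Coord) :
    M.cot.trans a b (pos A) = extCot (M.trans a b A) := by
  rcases A with i | i <;> rfl

theorem cot_trans_mom (a b : M.Idx) (A : D.Coord) :
    M.cot.trans a b (mom A) = momTrans M a b A := by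
  rcases A with i | i <;> rfl

theorem momTrans_eq (a b : M.Idx) (A : D.Coord) :
    momTrans M a b A = ∑ B, extCot (M.jacInv a b A B) * coord (mom B) := rfl

theorem extCot_coord (A : D.Coord) : extCot (coord A) = (coord (pos A) : D.cot.Fn) := by
  rw [pos_eq_map]; exact ext_coord _ _ A

theorem cot_trans_map (a b : M.Idx) (A : D.Coord) (x : D.cot.ev → ℝ) :
    M.cot.trans a b (Sum.map Sum.inl Sum.inl A) x =
      ext (D' := D.cot) Sum.inl Sum.inl (M.trans a b A) x := by
  rw [← pos_eq_map, cot_trans_pos]; rfl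

theorem body_cot (a b : M.Idx) (x : D.cot.ev → ℝ) :
    body (M.cot.trans a b) x ∘ Sum.inl = body (M.trans a b) (x ∘ Sum.inl) :=
  body_ext (D := D) (D' := D) (D₁ := D.cot) (D₁' := D.cot) (o := Sum.inl) (o' := Sum.inl)
    fun A => cot_trans_map a b A x

theorem mom_notMem_range (A : D.Coord) :
    (mom A : D.cot.Coord) ∉ Set.range (Sum.map Sum.inl Sum.inl) := by
  rintro ⟨B, hB⟩
  exact mom_ne_pos A B (by rw [pos_eq_map]; exact hB.symm)

theorem pd_pos_extCot {f : D.Fn} {x : D.cot.ev → ℝ} (hf : SmoothAt f (x ∘ Sum.inl))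
    (A : D.Coord) : pd (pos A) (extCot f) x = extCot (pd A f) x := by
  rw [pos_eq_map]
  exact pd_ext Sum.inl_injective Sum.inl_injective A hf

theorem pd_mom_extCot {f : D.Fn} {x : D.cot.ev → ℝ} (hf : SmoothAt f (x ∘ Sum.inl))
    (A : D.Coord) : pd (mom A) (extCot f) x = 0 :=
  pd_ext_of_notMem (mom_notMem_range A) hf

theorem SmoothAt.extCot {f : D.Fn} {x : D.cot.ev → ℝ} (hf : SmoothAt f (x ∘ Sum.inl)) :
    SmoothAt (extCot f) x := SmoothAt.ext hf

theorem smoothAt_momTrans (h : M.IsAtlas) {a b : M.Idx} {x : D.cot.ev → ℝ}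
    (hx : x ∈ M.cot.ovl a b) (A : D.Coord) : SmoothAt (momTrans M a b A) x :=
  SmoothAt.sum _ fun B _ => (SmoothAt.extCot (h.smoothAt_jacInv hx A B)).mul (smoothAt_coord _ _)

theorem momTrans_mem (h : M.IsAtlas) {a b : M.Idx} {x : D.cot.ev → ℝ}
    (hx : x ∈ M.cot.ovl a b) (A : D.Coord) : momTrans M a b A x ∈ grPart D.cot (D.par A) := by
  rw [momTrans_eq, Finset.sum_apply]
  refine Submodule.sum_mem _ fun B _ => mul_mem_grPart (ext_mem (h.jacInv_mem hx A B))
    (coord_mem (mom B) x) ?_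
  rw [par_mom, add_assoc, zmod_two_add_self, add_zero]

theorem isOpen_cot_ovl (h : M.IsAtlas) (a b : M.Idx) : IsOpen (M.cot.ovl a b) :=
  (h.isOpen_ovl a b).preimage (continuous_comp_left (D := D) (D' := D.cot) Sum.inl)

theorem isOpen_cot_dom (h : M.IsAtlas) (a : M.Idx) : IsOpen (M.cot.dom a) :=
  (h.isOpen_dom a).preimage (continuous_comp_left (D := D) (D' := D.cot) Sum.inl)

theorem cot_parAt (h : M.IsAtlas) {a b : M.Idx} {x : D.cot.ev → ℝ}
    (hx : x ∈ M.cot.ovl a b) : ParAt (M.cot.trans a b) x := by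
  intro Z
  obtain ⟨A, rfl | rfl⟩ := cot_coord_cases Z
  · rw [cot_trans_pos, par_pos]
    exact ext_mem (h.parity a b A _ hx)
  · rw [cot_trans_mom, par_mom]
    exact momTrans_mem h hx A

theorem cot_morAt (h : M.IsAtlas) {a b : M.Idx} {x : D.cot.ev → ℝ}
    (hx : x ∈ M.cot.ovl a b) : MorAt (M.cot.trans a b) x where
  smooth Z := by
    obtain ⟨A, rfl | rfl⟩ := cot_coord_cases Z
    · rw [cot_trans_pos]
      exact SmoothAt.extCot (h.smoothAt hx A)
    · rw [cot_trans_mom]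
      exact smoothAt_momTrans h hx A
  parity := by
    filter_upwards [(isOpen_cot_ovl h a b).mem_nhds hx] with y hy
    exact cot_parAt h hy

theorem body_cot_mem_dom (h : M.IsAtlas) {a b : M.Idx} {x : D.cot.ev → ℝ}
    (hx : x ∈ M.cot.ovl a b) : body (M.cot.trans a b) x ∈ M.cot.dom b := by
  change body (M.cot.trans a b) x ∘ Sum.inl ∈ M.dom b
  rw [body_cot]
  exact h.body_mem_dom hx

theorem subst_extCot (h : M.IsAtlas) {a b : M.Idx} {x : D.cot.ev → ℝ}
    (hx : x ∈ M.cot.ovl a b) {g : D.Fn} (hg : SmoothAt g (body (M.trans a b) (x ∘ Sum.inl))) :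
    subst (M.cot.trans a b) (extCot g) x = extCot (subst (M.trans a b) g) x :=
  subst_ext (D := D) (D' := D) (D₁ := D.cot) (D₁' := D.cot) (o := Sum.inl) (o' := Sum.inl)
    Sum.inl_injective Sum.inl_injective (fun A => cot_trans_map a b A x) (cot_parAt h hx)
    (h.morAt hx).parAt hg

/-! ### The principal symbol -/

theorem symbol_eq (X : M.VFam) (a : M.Idx) :
    M.symbol X a = ∑ A, extCot (X a A) * coord (mom A) := rfl

theorem smoothAt_symbol {X : M.VFam} {a : M.Idx} {x : D.cot.ev → ℝ}
    (hX : ∀ A, SmoothAt (X a A) (x ∘ Sum.inl)) : SmoothAt (M.symbol X a) x :=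
  SmoothAt.sum _ fun A _ => (SmoothAt.extCot (hX A)).mul (smoothAt_coord _ _)

theorem symbol_mem {X : M.VFam} {ε : ZMod 2} (hX : M.VHasParity ε X) (a : M.Idx)
    (x : D.cot.ev → ℝ) : M.symbol X a x ∈ grPart D.cot ε := by
  rw [symbol_eq, Finset.sum_apply]
  refine Submodule.sum_mem _ fun A _ => mul_mem_grPart (ext_mem (hX a A _))
    (coord_mem (mom A) x) ?_
  rw [par_mom, add_assoc, zmod_two_add_self, add_zero]

theorem Gluing.IsVectorField.smoothAt (h : M.IsAtlas) {X : M.VFam} (hX : M.IsVectorField X)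
    {a : M.Idx} {x : D.ev → ℝ} (hx : x ∈ M.dom a) (A : D.Coord) : SmoothAt (X a A) x :=
  (hX.smooth a A).smoothAt (h.isOpen_dom a) hx

/-- The Jacobian from the components of the vector field meets the inverse Jacobian from the
momenta; summing over the intermediate coordinate leaves a Kronecker delta. -/
theorem symbol_compat (h : M.IsAtlas) {X : M.VFam} (hX : M.IsVectorField X) {a b : M.Idx}
    {x : D.cot.ev → ℝ} (hx : x ∈ M.cot.ovl a b) :
    M.symbol X a x = subst (M.cot.trans a b) (M.symbol X b) x := by
  classical
  have hs : ∀ A, SmoothAt (X b A) (body (M.trans a b) (x ∘ Sum.inl)) :=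
    hX.smoothAt h (h.body_mem_dom hx)
  have hs' : ∀ A, SmoothAt (extCot (X b A)) (body (M.cot.trans a b) x) := by
    intro A
    refine SmoothAt.extCot ?_
    rw [body_cot]; exact hs A
  have hp := cot_parAt h hx
  rw [symbol_eq, symbol_eq,
    subst_sum Finset.univ fun A _ => (hs' A).mul (smoothAt_coord (mom A) _), Finset.sum_apply]
  have hterm : ∀ A, subst (M.cot.trans a b) (extCot (X b A) * coord (mom A)) x =
      ∑ B, ∑ C, extCot (X a C * (pd C (M.trans a b A) * M.jacInv a b A B)) x *
        coord (mom B) x := by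
    intro A
    rw [subst_mul hp (hs' A) (smoothAt_coord _ _), subst_coord hp, subst_extCot h hx (hs A),
      cot_trans_mom, momTrans_eq, Finset.sum_apply, Finset.mul_sum]
    refine Finset.sum_congr rfl fun B _ => ?_
    rw [← Finset.sum_mul, Pi.mul_apply, ← mul_assoc]
    congr 1
    have : subst (M.trans a b) (X b A) (x ∘ Sum.inl) =
        (∑ C, X a C * pd C (M.trans a b A)) (x ∘ Sum.inl) := by
      refine (hX.compat a b A _ hx).trans ?_
      rw [Finset.sum_apply]; rfl
    unfold extCot
    rw [ext_apply_congr _ _ this, ← Pi.mul_apply, ← ext_mul, Finset.sum_mul, ext_sum,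
      Finset.sum_apply]
    simp only [mul_assoc]
  simp only [hterm]
  rw [Finset.sum_comm]
  refine Finset.sum_congr rfl fun B _ => ?_
  rw [Finset.sum_comm]
  simp only [← Finset.sum_mul, Pi.mul_apply]
  congr 1
  have h2 : ∀ C, ∑ A, pd C (M.trans a b A) (x ∘ Sum.inl) * M.jacInv a b A B (x ∘ Sum.inl) =
    if C = B then 1 else 0 := fun C => h.sum_jac_mul_jacInv hx C B
  unfold extCot
  refine Eq.trans (ext_apply_congr
    (g := ∑ C, ∑ A, X a C * (pd C (M.trans a b A) * M.jacInv a b A B)) _ _ ?_)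
    (by simp only [ext_sum, Finset.sum_apply])
  simp only [Finset.sum_apply, Pi.mul_apply, ← Finset.mul_sum, h2]
  simp

end Cotangent

end SuperGeom

end
noncomputable section
namespace SuperGeom

/-! ### The Schouten structure of an odd Jacobi structure -/

section Schoutenization

variable {D : SuperDim} {M : Gluing D}

/-- A function on `T*M`, as a function on `T*(M × ℝ)`. -/
def cotUp (F : D.cot.Fn) : D.line.cot.Fn :=
  ext (D' := D.line.cot) (Sum.map Sum.inl Sum.inl) (Sum.map id id) F

/-- The underlying point of `T*M`. -/
def cotDown (x : D.line.cot.ev → ℝ) : D.cot.ev → ℝ :=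
  x ∘ Sum.map Sum.inl Sum.inl

/-- The coordinates of `T*M` among those of `T*(M × ℝ)`. -/
def cotLine (Z : D.cot.Coord) : D.line.cot.Coord :=
  Sum.map (Sum.map Sum.inl Sum.inl) (Sum.map id id) Z

theorem cotLine_pos (A : D.Coord) : cotLine (pos A) = pos (lineBase A) := by
  rcases A with i | i <;> rfl

theorem cotLine_mom (A : D.Coord) : cotLine (mom A) = mom (lineBase A) := by
  rcases A with i | i <;> rfl

theorem sumMap_inl_inl_injective : Function.Injective
    (Sum.map Sum.inl Sum.inl : D.cot.ev → D.line.cot.ev) :=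
  Sum.map_injective.2 ⟨Sum.inl_injective, Sum.inl_injective⟩

theorem sumMap_id_id_injective : Function.Injective
    (Sum.map id id : D.cot.od → D.line.cot.od) :=
  Sum.map_injective.2 ⟨Function.injective_id, Function.injective_id⟩

theorem SmoothAt.cotUp {F : D.cot.Fn} {x : D.line.cot.ev → ℝ} (hF : SmoothAt F (cotDown x)) :
    SmoothAt (cotUp F) x := SmoothAt.ext hF

theorem pd_cotLine_cotUp {F : D.cot.Fn} {x : D.line.cot.ev → ℝ} (hF : SmoothAt F (cotDown x))
    (Z : D.cot.Coord) : pd (cotLine Z) (cotUp F) x = cotUp (pd Z F) x :=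
  pd_ext sumMap_inl_inl_injective sumMap_id_id_injective Z hF

theorem posTime_notMem_range : (pos lineTime : D.line.cot.Coord) ∉ Set.range cotLine := by
  rintro ⟨Z, hZ⟩
  obtain ⟨A, rfl | rfl⟩ := cot_coord_cases Z
  · rw [cotLine_pos] at hZ
    exact lineTime_ne_lineBase A (pos_injective hZ).symm
  · rw [cotLine_mom] at hZ
    exact mom_ne_pos _ _ hZ

theorem momTime_notMem_range : (mom lineTime : D.line.cot.Coord) ∉ Set.range cotLine := by
  rintro ⟨Z, hZ⟩
  obtain ⟨A, rfl | rfl⟩ := cot_coord_cases Z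
  · rw [cotLine_pos] at hZ
    exact mom_ne_pos _ _ hZ.symm
  · rw [cotLine_mom] at hZ
    exact lineTime_ne_lineBase A (mom_injective hZ).symm

theorem pd_posTime_cotUp {F : D.cot.Fn} {x : D.line.cot.ev → ℝ} (hF : SmoothAt F (cotDown x)) :
    pd (pos lineTime) (cotUp F) x = 0 := pd_ext_of_notMem posTime_notMem_range hF

theorem pd_momTime_cotUp {F : D.cot.Fn} {x : D.line.cot.ev → ℝ} (hF : SmoothAt F (cotDown x)) :
    pd (mom lineTime) (cotUp F) x = 0 := pd_ext_of_notMem momTime_notMem_range hF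

theorem cotUp_extCot (f : D.Fn) : cotUp (extCot f) = extCot (extLine f) := by
  unfold cotUp extCot extLine
  rw [ext_ext, ext_ext]
  rfl

theorem cotUp_coord (Z : D.cot.Coord) : cotUp (coord Z) = coord (cotLine Z) := ext_coord _ _ Z

/-- Transition maps of the product act separately on the two factors, so the inverse Jacobian is
block diagonal. This is the block of the manifold; the next lemmas give the others. -/
theorem jacInv_line (h : M.IsAtlas) {a b : M.Idx} {x : D.line.ev → ℝ}
    (hx : x ∈ M.line.ovl a b) (A B : D.Coord) :
    M.line.jacInv a b (lineBase A) (lineBase B) x = extLine (M.jacInv a b A B) x := by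
  have hs := h.smoothAt (h.maps a b _ hx) B
  refine Eq.trans ?_ (subst_extLine h hx (hs.pd A))
  refine subst_congr ?_
  have hs' : SmoothAt (M.trans b a B) (body (M.line.trans a b) x ∘ Sum.inl) := by
    rw [body_line]; exact hs
  filter_upwards [(continuous_comp_left (D := D) (D' := D.line) Sum.inl).continuousAt.eventually
    hs'.eventually] with y hy
  refine (congrArg (fun g => pd (lineBase A) g y) (line_trans_lineBase b a B)).trans ?_
  rw [lineBase_eq_map]
  exact pd_ext (D := D) (D' := D.line) Sum.inl_injective Function.injective_id A hy

theorem jacInv_line_base_time (a b : M.Idx) (x : D.line.ev → ℝ) (A : D.Coord) :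
    M.line.jacInv a b (lineBase A) lineTime x = 0 := by
  classical
  have : pd (lineBase A) (M.line.trans b a lineTime) = 0 := by
    ext1 y
    rw [line_trans_lineTime, pd_coord, if_neg (lineTime_ne_lineBase A).symm]; rfl
  exact (congrArg (fun g => subst (M.line.trans a b) g x) this).trans (subst_zero _ _)

theorem jacInv_line_time_time (a b : M.Idx) (x : D.line.ev → ℝ) :
    M.line.jacInv a b lineTime lineTime x = 1 := by
  classical
  have : pd lineTime (M.line.trans b a lineTime) = 1 := by
    ext1 y
    rw [line_trans_lineTime, pd_coord, if_pos rfl]; rfl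
  exact (congrArg (fun g => subst (M.line.trans a b) g x) this).trans (subst_one _ _)

theorem jacInv_line_time_base (h : M.IsAtlas) {a b : M.Idx} {x : D.line.ev → ℝ}
    (hx : x ∈ M.line.ovl a b) (B : D.Coord) :
    M.line.jacInv a b lineTime (lineBase B) x = 0 := by
  refine Eq.trans (subst_congr ?_) (subst_zero (M.line.trans a b) x)
  have hs' : SmoothAt (M.trans b a B) (body (M.line.trans a b) x ∘ Sum.inl) := by
    rw [body_line]; exact h.smoothAt (h.maps a b _ hx) B
  filter_upwards [(continuous_comp_left (D := D) (D' := D.line) Sum.inl).continuousAt.eventually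
    hs'.eventually] with y hy
  refine (congrArg (fun g => pd lineTime g y) (line_trans_lineBase b a B)).trans ?_
  exact pd_ext_of_notMem (D := D) (D' := D.line) lineTime_notMem_range hy

/-- In the sum for a base momentum the term with the momentum of `t` drops out, because the mixed
block of the Jacobian is zero. -/
theorem line_cot_trans_cotLine (h : M.IsAtlas) {a b : M.Idx} {x : D.line.cot.ev → ℝ}
    (hx : x ∈ M.line.cot.ovl a b) (Z : D.cot.Coord) :
    M.line.cot.trans a b (cotLine Z) x = cotUp (M.cot.trans a b Z) x := by
  obtain ⟨A, rfl | rfl⟩ := cot_coord_cases Z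
  · rw [cotLine_pos, cot_trans_pos, cotUp_extCot, ← line_trans_lineBase]
    exact congrFun (cot_trans_pos (M := M.line) a b (lineBase A)) x
  · rw [cotLine_mom, cot_trans_mom, momTrans_eq]
    refine (congrFun ((cot_trans_mom (M := M.line) a b (lineBase A)).trans
      (momTrans_eq (M := M.line) a b (lineBase A))) x).trans ?_
    have hr : cotUp (∑ B, extCot (M.jacInv a b A B) * coord (mom B)) x =
        ∑ B, extCot (extLine (M.jacInv a b A B)) x * (coord (mom (lineBase B)) : D.line.cot.Fn) x := by
      unfold cotUp
      rw [ext_sum, Finset.sum_apply]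
      refine Finset.sum_congr rfl fun B _ => ?_
      rw [ext_mul, Pi.mul_apply, ← cotLine_mom, ← cotUp_coord, ← cotUp_extCot]
      rfl
    rw [hr, Finset.sum_apply]
    symm
    refine Fintype.sum_of_injective lineBase lineBase_injective _ _ ?_ ?_
    · intro B hB
      rcases line_coord_cases B with ⟨C, rfl⟩ | rfl
      · exact absurd ⟨C, rfl⟩ hB
      · rw [Pi.mul_apply]
        have := ext_apply_congr (D := D.line) (D' := D.line.cot) Sum.inl Sum.inl (x := x)
          (g := 0) (jacInv_line_base_time a b (x ∘ Sum.inl) A)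
        unfold extCot
        rw [this, ext_zero]
        exact zero_mul _
    · intro B
      rw [Pi.mul_apply]
      congr 1
      exact ext_apply_congr (D := D.line) (D' := D.line.cot) Sum.inl Sum.inl (x := x)
        (jacInv_line h hx A B).symm

/-- Only the entry `∂t/∂t = 1` of the inverse Jacobian survives; thus `p` is a global function on
the cotangent bundle of the product. -/
theorem line_cot_trans_momTime (h : M.IsAtlas) {a b : M.Idx} {x : D.line.cot.ev → ℝ}
    (hx : x ∈ M.line.cot.ovl a b) :
    M.line.cot.trans a b (mom lineTime) x = coord (mom lineTime) x := by
  refine (congrFun ((cot_trans_mom (M := M.line) a b lineTime).trans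
    (momTrans_eq (M := M.line) a b lineTime)) x).trans ?_
  rw [Finset.sum_apply, Finset.sum_eq_single lineTime]
  · have := ext_apply_congr (D := D.line) (D' := D.line.cot) Sum.inl Sum.inl (x := x)
      (g := 1) (jacInv_line_time_time a b (x ∘ Sum.inl))
    rw [Pi.mul_apply]
    unfold extCot
    rw [this, ext_one]
    exact one_mul _
  · intro B _ hB
    rcases line_coord_cases B with ⟨C, rfl⟩ | rfl
    · have := ext_apply_congr (D := D.line) (D' := D.line.cot) Sum.inl Sum.inl (x := x)
        (g := 0) (jacInv_line_time_base h hx C)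
      rw [Pi.mul_apply]
      unfold extCot
      rw [this, ext_zero]
      exact zero_mul _
    · exact absurd rfl hB
  · simp

theorem cotDown_mem_ovl {a b : M.Idx} {x : D.line.cot.ev → ℝ} (hx : x ∈ M.line.cot.ovl a b) :
    cotDown x ∈ M.cot.ovl a b := hx

theorem cotDown_mem_dom {a : M.Idx} {x : D.line.cot.ev → ℝ} (hx : x ∈ M.line.cot.dom a) :
    cotDown x ∈ M.cot.dom a := hx

theorem cotDown_body (h : M.IsAtlas) {a b : M.Idx} {x : D.line.cot.ev → ℝ}
    (hx : x ∈ M.line.cot.ovl a b) :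
    cotDown (body (M.line.cot.trans a b) x) = body (M.cot.trans a b) (cotDown x) :=
  body_ext (D := D.cot) (D' := D.cot) (D₁ := D.line.cot) (D₁' := D.line.cot)
    (o := Sum.map id id) (o' := Sum.map id id) (line_cot_trans_cotLine h hx)

theorem subst_cotUp (h : M.IsAtlas) {a b : M.Idx} {x : D.line.cot.ev → ℝ}
    (hx : x ∈ M.line.cot.ovl a b) {F : D.cot.Fn}
    (hF : SmoothAt F (body (M.cot.trans a b) (cotDown x))) :
    subst (M.line.cot.trans a b) (cotUp F) x = cotUp (subst (M.cot.trans a b) F) x :=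
  subst_ext (D := D.cot) (D' := D.cot) (D₁ := D.line.cot) (D₁' := D.line.cot)
    (o := Sum.map id id) (o' := Sum.map id id) sumMap_inl_inl_injective sumMap_id_id_injective
    (line_cot_trans_cotLine h hx) (cot_parAt h.line hx)
    (cot_parAt h (cotDown_mem_ovl hx)) hF

/-- The function `exp (-t)` on `T*(M × ℝ)`. -/
abbrev expTime : D.line.cot.Fn := expNeg (D := D.line.cot) (Sum.inl (Sum.inr ()))

theorem schoutenization_eq (S : M.cot.Fam) (Q : M.VFam) (a : M.Idx) :
    M.schoutenization S Q a = expTime *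
      (cotUp (S a) - cotUp (M.symbol Q a) * coord (mom lineTime)) := rfl

section

variable {S : M.cot.Fam} {Q : M.VFam}

theorem Gluing.IsFunction.smoothAt {F : M.Fam} (hF : M.IsFunction F) {a : M.Idx}
    (ho : IsOpen (M.dom a)) {x : D.ev → ℝ} (hx : x ∈ M.dom a) : SmoothAt (F a) x :=
  (hF.smooth a).smoothAt ho hx

theorem isOddJacobi_smoothAt (h : M.IsAtlas) (hS : M.IsOddJacobi S Q) {a : M.Idx}
    {x : D.cot.ev → ℝ} (hx : x ∈ M.cot.dom a) : SmoothAt (S a) x :=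
  hS.isFunction.smoothAt (isOpen_cot_dom h a) hx

theorem isOddJacobi_smoothAt_symbol (h : M.IsAtlas) (hS : M.IsOddJacobi S Q) {a : M.Idx}
    {x : D.cot.ev → ℝ} (hx : x ∈ M.cot.dom a) : SmoothAt (M.symbol Q a) x :=
  smoothAt_symbol (hS.isVectorField.smoothAt h hx)

/-- Each constituent is global: `S` by hypothesis, the symbol of `Q` by `symbol_compat`, and `p` and
`t` because chart changes fix them. Substitution respects their sums and products. -/
theorem schoutenization_isFunction (h : M.IsAtlas) (hS : M.IsOddJacobi S Q) :
    M.line.cot.IsFunction (M.schoutenization S Q) where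
  smooth := fun (a : M.Idx) => by
    refine smoothOn_of_smoothAt fun x hx => ?_
    have hx' := cotDown_mem_dom hx
    rw [schoutenization_eq]
    exact (smoothAt_expNeg _ _).mul ((SmoothAt.cotUp (isOddJacobi_smoothAt h hS hx')).sub
      ((SmoothAt.cotUp (isOddJacobi_smoothAt_symbol h hS hx')).mul (smoothAt_coord _ _)))
  compat := fun (a b : M.Idx) x hx => by
    have hx' := cotDown_mem_ovl hx
    have hb := body_cot_mem_dom h hx'
    have hp := cot_parAt h.line hx
    have h1 := isOddJacobi_smoothAt h hS hb
    have h2 := isOddJacobi_smoothAt_symbol h hS hb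
    have h1' : SmoothAt (cotUp (S b)) (body (M.line.cot.trans a b) x) := by
      refine SmoothAt.cotUp ?_
      rw [cotDown_body h hx]; exact h1
    have h2' : SmoothAt (cotUp (M.symbol Q b)) (body (M.line.cot.trans a b) x) := by
      refine SmoothAt.cotUp ?_
      rw [cotDown_body h hx]; exact h2
    rw [schoutenization_eq, schoutenization_eq, subst_mul hp (smoothAt_expNeg _ _)
      (h1'.sub (h2'.mul (smoothAt_coord _ _))), subst_sub h1' (h2'.mul (smoothAt_coord _ _)),
      subst_mul hp h2' (smoothAt_coord _ _), subst_coord hp, line_cot_trans_momTime h hx,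
      subst_cotUp h hx h1, subst_cotUp h hx h2]
    have e1 : cotUp (S a) x = cotUp (subst (M.cot.trans a b) (S b)) x :=
      ext_apply_congr _ _ (hS.isFunction.compat a b _ hx')
    have e2 : cotUp (M.symbol Q a) x = cotUp (subst (M.cot.trans a b) (M.symbol Q b)) x :=
      ext_apply_congr _ _ (symbol_compat h hS.isVectorField hx')
    have e3 : subst (M.line.cot.trans a b) expTime x =
        expTime x := by
      refine subst_expNeg hp ?_
      have := cot_trans_pos (M := M.line) a b lineTime
      rw [line_trans_lineTime, extCot_coord] at this
      exact congrFun this x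
    rw [e3, ← e1, ← e2]
    rfl
  zero_off := fun (a : M.Idx) x hx => by
    have hx' : cotDown x ∉ M.cot.dom a := hx
    have e1 : cotUp (S a) x = 0 := by
      simp only [cotUp, ext]
      exact (congrArg _ (hS.isFunction.zero_off a _ hx')).trans (map_zero _)
    have e2 : cotUp (M.symbol Q a) x = 0 := by
      simp only [cotUp, ext]
      refine (congrArg _ ?_).trans (map_zero _)
      rw [symbol_eq, Finset.sum_apply]
      refine Finset.sum_eq_zero fun A _ => ?_
      have : extCot (Q a A) (cotDown x) = 0 := by
        simp only [extCot, ext]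
        exact (congrArg _ (hS.isVectorField.zero_off a A _ hx')).trans (map_zero _)
      exact (congrArg (· * _) this).trans (zero_mul _)
    rw [schoutenization_eq, Pi.mul_apply, Pi.sub_apply, Pi.mul_apply, e1, e2]
    simp

theorem schoutenization_mem (hS : M.IsOddJacobi S Q) :
    M.line.cot.HasParity 1 (M.schoutenization S Q) := by
  intro (a : M.Idx) x
  rw [schoutenization_eq]
  refine mul_mem_grPart (expNeg_mem _ _) (sub_mem (ext_mem (hS.odd a _))
    (mul_mem_grPart (ext_mem (symbol_mem hS.vector_odd a _)) (coord_mem _ x) ?_)) ?_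
  · rw [par_mom]; rfl
  · simp

theorem weightNear_expNeg {D : SuperDim} {w : D.Coord → ℤ} {i : D.ev} (hw : w (.inl i) = 0)
    (x : D.ev → ℝ) : WeightNear w 0 (expNeg i) x := by
  refine .of_forall fun y => ?_
  rw [euler_apply, Finset.sum_eq_zero]
  · simp
  · intro A _
    by_cases hA : A = .inl i
    · subst hA; simp [hw]
    · rw [pd_expNeg_of_ne hA]; simp

/-- The weights are left general in order to serve twice: for the degree in the momenta, where `p`
has weight 1, and for the natural grading, where `p` has weight 0. In both cases `S` and `𝒬 p` have
the same weight. -/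
theorem schoutenization_weight (h : M.IsAtlas) (hS : M.IsOddJacobi S Q)
    {w : D.cot.Coord → ℤ} {w' : D.line.cot.Coord → ℤ} {k l m : ℤ}
    (hw : ∀ Z, w' (cotLine Z) = w Z) (ht : w' (pos lineTime) = 0) (hm : w' (mom lineTime) = m)
    (hwS : M.cot.HasWeight w k S)
    (hwQ : M.cot.HasWeight w l (M.symbol Q)) (hk : k = l + m) :
    M.line.cot.HasWeight w' k (M.schoutenization S Q) := by
  refine Gluing.hasWeight_of_weightNear fun (a : M.Idx) x hx => ?_
  have hx' := cotDown_mem_dom hx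
  have h1 := isOddJacobi_smoothAt h hS hx'
  have h2 := isOddJacobi_smoothAt_symbol h hS hx'
  have ho := isOpen_cot_dom h a
  have h1' : WeightNear w' k (cotUp (S a)) x := WeightNear.ext sumMap_inl_inl_injective
    sumMap_id_id_injective hw h1 (hwS.weightNear ho hx')
  have h2' : WeightNear w' l (cotUp (M.symbol Q a)) x := WeightNear.ext sumMap_inl_inl_injective
    sumMap_id_id_injective hw h2 (hwQ.weightNear ho hx')
  have h3 := (SmoothAt.cotUp h2).mul (smoothAt_coord (mom lineTime) x)
  rw [schoutenization_eq]
  refine WeightNear.mul (smoothAt_expNeg _ _) ((SmoothAt.cotUp h1).sub h3)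
    (weightNear_expNeg ht x) (WeightNear.sub (SmoothAt.cotUp h1) h3 h1' ?_) (zero_add k).symm
  exact WeightNear.mul (SmoothAt.cotUp h2) (smoothAt_coord _ _) h2' (weightNear_coord _ _ _)
    (by rw [hm, hk])

theorem momDegree_pos (A : D.Coord) : momDegree (pos A) = 0 := by rcases A with i | i <;> rfl

theorem momDegree_mom (A : D.Coord) : momDegree (mom A) = 1 := by rcases A with i | i <;> rfl

theorem weightNear_extCot {f : D.Fn} {x : D.cot.ev → ℝ} (hf : SmoothAt f (x ∘ Sum.inl)) :
    WeightNear momDegree 0 (extCot f) x :=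
  weightNear_ext_zero Sum.inl_injective Sum.inl_injective
    (fun A => by rw [← pos_eq_map]; exact momDegree_pos A) hf

theorem symbol_momDegree (h : M.IsAtlas) (hQ : M.IsVectorField Q) :
    M.cot.HasWeight momDegree 1 (M.symbol Q) := by
  refine Gluing.hasWeight_of_weightNear fun (a : M.Idx) x hx => ?_
  have hs : ∀ A, SmoothAt (Q a A) (x ∘ Sum.inl) := hQ.smoothAt h hx
  rw [symbol_eq]
  refine WeightNear.sum _ (fun A _ => (SmoothAt.extCot (hs A)).mul (smoothAt_coord _ _))
    fun A _ => ?_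
  exact WeightNear.mul (SmoothAt.extCot (hs A)) (smoothAt_coord _ _) (weightNear_extCot (hs A))
    (weightNear_coord _ _ _) (by rw [momDegree_mom]; rfl)

/-! The Poisson brackets of the constituents. -/

theorem poisson_eq_zero {F G : D.cot.Fn} {x : D.cot.ev → ℝ} (hF : SmoothAt F x)
    (h : ∀ A : D.Coord, (pd (mom A) F x = 0 ∨ pd (pos A) G x = 0) ∧
      (pd (pos A) F x = 0 ∨ pd (mom A) G x = 0)) : poisson F G x = 0 := by
  rw [poisson_apply hF]
  refine Finset.sum_eq_zero fun I _ => ?_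
  rcases I with ⟨A, _ | _⟩
  · simp only [phase, conjugate, Bool.not_false, cond_true, cond_false]
    rcases (h A).2 with h | h <;> rw [h] <;> simp
  · simp only [phase, conjugate, Bool.not_true, cond_true, cond_false]
    rcases (h A).1 with h | h <;> rw [h] <;> simp

/-- The additional conjugate pair `(t, p)` contributes nothing, since neither function depends on
it. -/
theorem poisson_cotUp {F G : D.cot.Fn} {x : D.line.cot.ev → ℝ} (hF : SmoothAt F (cotDown x))
    (hG : SmoothAt G (cotDown x)) :
    poisson (cotUp F) (cotUp G) x = cotUp (poisson F G) x := by
  have hph : ∀ I : D.Coord × Bool, phase (Prod.map lineBase id I) = cotLine (phase I) := by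
    rintro ⟨A, _ | _⟩
    · exact (cotLine_pos A).symm
    · exact (cotLine_mom A).symm
  have hr : cotUp (poisson F G) x = ∑ I : D.Coord × Bool, phaseSign I •
      (tw (D.par I.1) (cotUp (pd (phase I) F) x) * cotUp (pd (phase (conjugate I)) G) x) := by
    refine (ext_apply_congr (g := ∑ I : D.Coord × Bool, phaseSign I •
      (twist (D.par I.1) (pd (phase I) F) * pd (phase (conjugate I)) G)) _ _ ?_).trans ?_
    · refine (poisson_apply hF G).trans ?_
      simp only [Finset.sum_apply, Pi.smul_apply, Pi.mul_apply, twist_apply]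
      rfl
    · simp only [ext_sum, ext_smul, ext_mul, ext_twist, Finset.sum_apply, Pi.smul_apply,
        Pi.mul_apply, twist_apply]
      rfl
  rw [hr, poisson_apply (SmoothAt.cotUp hF)]
  symm
  refine Fintype.sum_of_injective (Prod.map lineBase id)
    (lineBase_injective.prodMap Function.injective_id) _ _ ?_ ?_
  · rintro ⟨B, c⟩ hB
    rcases line_coord_cases B with ⟨A, rfl⟩ | rfl
    · exact absurd ⟨(A, c), rfl⟩ hB
    · have : pd (phase (lineTime, c)) (cotUp F) x = 0 := by
        cases c
        · exact pd_posTime_cotUp hF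
        · exact pd_momTime_cotUp hF
      rw [this]; simp
  · intro I
    have hc : conjugate (Prod.map lineBase id I) = Prod.map lineBase id (conjugate I) := rfl
    rw [hc, hph, hph, pd_cotLine_cotUp hF, pd_cotLine_cotUp hG]
    have : phaseSign (Prod.map lineBase id I) = phaseSign I := by
      simp [phaseSign, par_lineBase]
    rw [this]
    simp [par_lineBase]

/-- In every conjugate pair one of the two functions is constant: `cotUp F` in the pair `(t, p)`,
and `G` in all the others. -/
theorem poisson_cotUp_eq_zero {F : D.cot.Fn} {G : D.line.cot.Fn} {x : D.line.cot.ev → ℝ}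
    (hF : SmoothAt F (cotDown x)) (hG : ∀ Z : D.cot.Coord, pd (cotLine Z) G x = 0) :
    poisson (cotUp F) G x = 0 := by
  refine poisson_eq_zero (SmoothAt.cotUp hF) fun B => ?_
  rcases line_coord_cases B with ⟨A, rfl⟩ | rfl
  · exact ⟨.inr (by rw [← cotLine_pos]; exact hG _), .inr (by rw [← cotLine_mom]; exact hG _)⟩
  · exact ⟨.inl (pd_momTime_cotUp hF), .inl (pd_posTime_cotUp hF)⟩

theorem poisson_eq_zero_cotUp {F : D.cot.Fn} {G : D.line.cot.Fn} {x : D.line.cot.ev → ℝ}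
    (hG' : SmoothAt G x)
    (hF : SmoothAt F (cotDown x)) (hG : ∀ Z : D.cot.Coord, pd (cotLine Z) G x = 0) :
    poisson G (cotUp F) x = 0 := by
  refine poisson_eq_zero hG' fun B => ?_
  rcases line_coord_cases B with ⟨A, rfl⟩ | rfl
  · exact ⟨.inl (by rw [← cotLine_mom]; exact hG _), .inl (by rw [← cotLine_pos]; exact hG _)⟩
  · exact ⟨.inr (pd_posTime_cotUp hF), .inr (pd_momTime_cotUp hF)⟩

theorem pd_cotLine_momTime (Z : D.cot.Coord) (x : D.line.cot.ev → ℝ) :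
    pd (cotLine Z) (coord (mom lineTime)) x = 0 := by
  classical
  rw [pd_coord, if_neg fun h => momTime_notMem_range ⟨Z, h⟩]

theorem pd_cotLine_exp (Z : D.cot.Coord) (x : D.line.cot.ev → ℝ) :
    pd (cotLine Z) expTime x = 0 :=
  pd_expNeg_of_ne (fun h => posTime_notMem_range ⟨Z, h⟩) x

/-- Only the pair `(t, p)` occurs, with `∂p/∂p = 1`, so the bracket is the `t`-derivative of the
exponential. It is the sole nonzero bracket that involves `t` or `p`. -/
theorem poisson_momTime_exp (x : D.line.cot.ev → ℝ) :
    poisson (coord (mom lineTime)) expTime x =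
      -expTime x := by
  classical
  rw [poisson_apply (smoothAt_coord _ _), Finset.sum_eq_single (lineTime, true)]
  · simp only [phase, conjugate, Bool.not_true, cond_true, cond_false, phaseSign, pd_coord,
      if_pos, one_smul, map_one, one_mul]
    exact pd_expNeg_self _ x
  · rintro ⟨B, c⟩ _ hB
    rw [pd_coord, if_neg]
    · simp
    · intro h
      cases c
      · exact mom_ne_pos _ _ h.symm
      · exact hB (congrArg (·, true) (mom_injective h))
  · simp

theorem poisson_momTime_self (x : D.line.cot.ev → ℝ) :
    poisson (coord (mom lineTime)) (coord (mom lineTime) : D.line.cot.Fn) x = 0 := by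
  classical
  refine poisson_eq_zero (smoothAt_coord _ _) fun A => ⟨.inr ?_, .inl ?_⟩ <;>
  · rw [pd_coord, if_neg (mom_ne_pos _ _).symm]

theorem poisson_exp_self (x : D.line.cot.ev → ℝ) :
    poisson expTime expTime x = 0 := by
  have : ∀ A : D.line.Coord, pd (mom A) expTime x = 0 :=
    fun A => pd_expNeg_of_ne (mom_ne_pos A lineTime) x
  exact poisson_eq_zero (smoothAt_expNeg _ _) fun A => ⟨.inl (this A), .inr (this A)⟩

/-- All brackets between `S`, `𝒬`, `p` and the exponential are collected first; after that only the
two Leibniz rules and `𝒬² = 0` are used. -/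
theorem schoutenization_self_commutes (h : M.IsAtlas) (hS : M.IsOddJacobi S Q) {a : M.Idx}
    {x : D.line.cot.ev → ℝ} (hx : x ∈ M.line.cot.dom a) :
    poisson (M.schoutenization S Q a) (M.schoutenization S Q a) x = 0 := by
  have hx' := cotDown_mem_dom hx
  have sA : SmoothAt (S a) (cotDown x) := isOddJacobi_smoothAt h hS hx'
  have sB : SmoothAt (M.symbol Q a) (cotDown x) := isOddJacobi_smoothAt_symbol h hS hx'
  have pA' : ParNear 1 (S a) (cotDown x) := .of_forall fun y => hS.odd a y
  have pB' : ParNear 1 (M.symbol Q a) (cotDown x) :=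
    .of_forall fun y => symbol_mem hS.vector_odd a y
  have zAA : cotUp (poisson (S a) (S a)) x =
      -((2 : ℝ) • (cotUp (M.symbol Q a) x * cotUp (S a) x)) := by
    simp only [cotUp, ext]
    refine (congrArg _ (hS.compatible a _ hx')).trans ?_
    simp only [map_neg, map_smul, map_mul]
    rfl
  have zBB : cotUp (poisson (M.symbol Q a) (M.symbol Q a)) x = 0 := by
    simp only [cotUp, ext]
    exact (congrArg _ (hS.homological a _ hx')).trans (map_zero _)
  have zBA : cotUp (poisson (M.symbol Q a) (S a)) x = 0 := by
    simp only [cotUp, ext]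
    exact (congrArg _ (hS.invariant a _ hx')).trans (map_zero _)
  have zAB : cotUp (poisson (S a) (M.symbol Q a)) x = 0 := by
    simp only [cotUp, ext]
    refine (congrArg _ ?_).trans (map_zero _)
    refine (poisson_skew sA sB pA' pB').trans ?_
    rw [hS.invariant a _ hx', smul_zero, neg_zero]
  rw [← poisson_cotUp sA sA] at zAA
  rw [← poisson_cotUp sB sB] at zBB
  rw [← poisson_cotUp sB sA] at zBA
  rw [← poisson_cotUp sA sB] at zAB
  rw [schoutenization_eq]
  set p : D.line.cot.Fn := coord (mom lineTime) with hp
  set e : D.line.cot.Fn := expTime with he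
  have zAp : poisson (cotUp (S a)) p x = 0 :=
    poisson_cotUp_eq_zero sA fun Z => pd_cotLine_momTime Z x
  have zBp : poisson (cotUp (M.symbol Q a)) p x = 0 :=
    poisson_cotUp_eq_zero sB fun Z => pd_cotLine_momTime Z x
  have zpA : poisson p (cotUp (S a)) x = 0 :=
    poisson_eq_zero_cotUp (smoothAt_coord _ _) sA fun Z => pd_cotLine_momTime Z x
  have zpB : poisson p (cotUp (M.symbol Q a)) x = 0 :=
    poisson_eq_zero_cotUp (smoothAt_coord _ _) sB fun Z => pd_cotLine_momTime Z x
  have zAe : poisson (cotUp (S a)) e x = 0 :=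
    poisson_cotUp_eq_zero sA fun Z => pd_cotLine_exp Z x
  have zBe : poisson (cotUp (M.symbol Q a)) e x = 0 :=
    poisson_cotUp_eq_zero sB fun Z => pd_cotLine_exp Z x
  have zpe : poisson p e x = -e x := poisson_momTime_exp x
  have zpp : poisson p p x = 0 := poisson_momTime_self x
  have zee : poisson e e x = 0 := poisson_exp_self x
  have sA1 := SmoothAt.cotUp sA
  have sB1 := SmoothAt.cotUp sB
  have pA : ParNear 1 (cotUp (S a)) x := .of_forall fun y => ext_mem (hS.odd a _)
  have pB : ParNear 1 (cotUp (M.symbol Q a)) x :=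
    .of_forall fun y => ext_mem (symbol_mem hS.vector_odd a _)
  have pp : ParNear 0 p x := .of_forall fun y => coord_mem (mom lineTime) y
  have pe : ParNear 0 e x := .of_forall fun y => expNeg_mem _ y
  have sp : SmoothAt p x := smoothAt_coord _ _
  have se : SmoothAt e x := smoothAt_expNeg _ _
  generalize cotUp (S a) = A at *
  generalize cotUp (M.symbol Q a) = B at *
  clear_value p e
  have sBp := sB1.mul sp
  have pBp : ParNear 1 (B * p) x := pB.mul pp
  have sT := sA1.sub sBp
  have pT : ParNear 1 (A - B * p) x := pA.sub pBp
  have seT := se.mul sT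
  have peT : ParNear 1 (e * (A - B * p)) x := pe.mul pT
  -- Every mixed term contains one of the vanishing brackets, so `{S, S}` alone remains.
  have zTT : poisson (A - B * p) (A - B * p) x = -((2 : ℝ) • (B x * A x)) := by
    rw [poisson_sub_left sA1 sBp, poisson_sub_right sA1 sBp, poisson_sub_right sA1 sBp, zAA,
      poisson_mul_right sA1 sB1 sp pA pB, zAB, zAp, poisson_mul_left sB1 sp sA1 pB pp pA, zpA, zBA,
      poisson_mul_left sB1 sp sBp pB pp pBp, poisson_mul_right sp sB1 sp pp pB, zpB, zpp,
      poisson_mul_right sB1 sB1 sp pB pB, zBB, zBp]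
    simp
  -- The sign of `-𝒬p` and that of `{p, e^{-t}} = -e^{-t}` combine to a plus.
  have zTe : poisson (A - B * p) e x = B x * e x := by
    rw [poisson_sub_left sA1 sBp, zAe, poisson_mul_left sB1 sp se pB pp pe, zpe, zBe]
    simp
  have zeT : poisson e (A - B * p) x = -(B x * e x) := by
    rw [poisson_skew se sT pe pT, zTe]; simp
  rw [poisson_mul_left se sT seT pe pT peT, poisson_mul_right sT se sT pT pe, zTT, zTe,
    poisson_mul_right se se sT pe pe, zee, zeT]
  -- This removes the `𝒬 p` part of `𝒬 T`, so that exactly `2𝒬S` stands against `{S, S}`.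
  have hBB : B x * B x = 0 := odd_mul_self pB.self
  have heB : B x * e x = e x * B x := (even_commute pe.self _).symm
  have hBB' : ∀ z, B x * (B x * z) = 0 := fun z => by rw [← mul_assoc, hBB, zero_mul]
  simp only [mul_one, zero_mul, mul_zero, sgn_zero, sgn_one, one_smul, heB, Pi.sub_apply,
    Pi.mul_apply, mul_sub, mul_add, mul_assoc, hBB', zero_add, sub_zero, mul_neg, neg_mul,
    neg_smul, two_smul]
  abel

theorem schoutenization_isSchouten (h : M.IsAtlas) (hS : M.IsOddJacobi S Q) :
    M.line.IsSchouten (M.schoutenization S Q) where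
  isFunction := schoutenization_isFunction h hS
  odd := schoutenization_mem hS
  quadratic := by
    -- Degrees in the momenta: `2` for `S`, and `1 + 1` for the product of the symbol with `p`.
    refine schoutenization_weight h hS (w := momDegree) (m := 1) (l := 1) ?_ (momDegree_pos _)
      (momDegree_mom _) hS.quadratic (symbol_momDegree h hS.isVectorField) (by norm_num)
    intro Z
    obtain ⟨A, rfl | rfl⟩ := cot_coord_cases Z
    · rw [cotLine_pos, momDegree_pos, momDegree_pos]
    · rw [cotLine_mom, momDegree_mom, momDegree_mom]
  self_commutes := fun (_ : M.Idx) _ hx => schoutenization_self_commutes h hS hx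

theorem cotWeight_pos (w : D.Coord → ℤ) (A : D.Coord) : cotWeight w (pos A) = w A := by
  rcases A with i | i <;> rfl

theorem cotWeight_mom (w : D.Coord → ℤ) (A : D.Coord) : cotWeight w (mom A) = -w A := by
  rcases A with i | i <;> rfl

theorem lineWeight_lineBase (w : D.Coord → ℤ) (A : D.Coord) :
    lineWeight w (lineBase A) = w A := by
  rcases A with i | i <;> rfl

theorem lineWeight_lineTime (w : D.Coord → ℤ) : lineWeight w lineTime = 0 := rfl

theorem schoutenization_cotWeight (h : M.IsAtlas) (hS : M.IsOddJacobi S Q) {w : D.Coord → ℤ}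
    {k : ℤ} (hwS : M.cot.HasWeight (cotWeight w) k S)
    (hwQ : M.cot.HasWeight (cotWeight w) k (M.symbol Q)) :
    M.line.cot.HasWeight (cotWeight (lineWeight w)) k (M.schoutenization S Q) := by
  refine schoutenization_weight h hS (m := 0) ?_ ?_ ?_ hwS hwQ (add_zero k).symm
  · intro Z
    obtain ⟨A, rfl | rfl⟩ := cot_coord_cases Z
    · rw [cotLine_pos, cotWeight_pos, cotWeight_pos, lineWeight_lineBase]
    · rw [cotLine_mom, cotWeight_mom, cotWeight_mom, lineWeight_lineBase]
  · rw [cotWeight_pos, lineWeight_lineTime]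
  · rw [cotWeight_mom, lineWeight_lineTime, neg_zero]

end

end Schoutenization

end SuperGeom

end
noncomputable section
namespace SuperGeom

/-! ### Homogeneous functions on bundles -/

section Fibres

variable {D D' : SuperDim}

theorem ext_id (f : D.Fn) : (ext id id f : D.Fn) = f := by
  ext1 x
  have : (Finsupp.lmapDomain ℝ ℝ (id : D.od → D.od)) = LinearMap.id := Finsupp.lmapDomain_id ℝ ℝ
  simp only [ext, this, ExteriorAlgebra.map_id, AlgHom.coe_id, id_eq, Function.comp_id]

open Classical in
/-- The zero section of a bundle whose base coordinates are embedded by `e` and `o` among all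
coordinates. -/
def zeroSection (e : D.ev → D'.ev) (o : D.od → D'.od) (Z : D'.Coord) : D.Fn :=
  if h : Z ∈ Set.range (Sum.map e o) then coord h.choose else 0

/-- The restriction to the zero section. -/
def res (e : D.ev → D'.ev) (o : D.od → D'.od) (F : D'.Fn) : D.Fn := subst (zeroSection e o) F

open Classical in
/-- The multiplication of the fibre coordinates by the parameter `t`. -/
def scaling (e : D.ev → D'.ev) (o : D.od → D'.od) (Z : D'.Coord) : D'.line.Fn :=
  if Z ∈ Set.range (Sum.map e o) then coord (lineBase Z) else coord lineTime * coord (lineBase Z)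

variable {e : D.ev → D'.ev} {o : D.od → D'.od}

theorem zeroSection_map (he : Function.Injective e) (ho : Function.Injective o) (A : D.Coord) :
    zeroSection e o (Sum.map e o A) = coord A := by
  have h : Sum.map e o A ∈ Set.range (Sum.map e o) := ⟨A, rfl⟩
  rw [zeroSection, dif_pos h, Sum.map_injective.2 ⟨he, ho⟩ h.choose_spec]

theorem zeroSection_of_notMem {Z : D'.Coord} (hZ : Z ∉ Set.range (Sum.map e o)) :
    zeroSection e o Z = 0 := dif_neg hZ

theorem zeroSection_mem (Z : D'.Coord) (y : D.ev → ℝ) :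
    zeroSection e o Z y ∈ grPart D (D'.par Z) := by
  by_cases h : Z ∈ Set.range (Sum.map e o)
  · rw [zeroSection, dif_pos h]
    have h1 := par_map e o h.choose
    rw [h.choose_spec] at h1
    rw [h1]
    exact coord_mem _ _
  · rw [zeroSection_of_notMem h]
    exact Submodule.zero_mem _

theorem zeroSection_morAt (y : D.ev → ℝ) : MorAt (zeroSection e o) y where
  smooth Z := by
    by_cases h : Z ∈ Set.range (Sum.map e o)
    · rw [zeroSection, dif_pos h]
      exact smoothAt_coord _ _
    · rw [zeroSection_of_notMem h]
      exact smoothAt_zero _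
  parity := .of_forall fun z Z => zeroSection_mem Z z

theorem body_zeroSection (he : Function.Injective e) (ho : Function.Injective o) (y : D.ev → ℝ) :
    body (zeroSection e o) y ∘ e = y := by
  ext i
  have := zeroSection_map he ho (.inl i)
  rw [Sum.map_inl] at this
  simp [body, this, coord]

theorem scaling_map (A : D.Coord) :
    scaling e o (Sum.map e o A) = coord (lineBase (Sum.map e o A)) := if_pos ⟨A, rfl⟩

theorem scaling_of_notMem {Z : D'.Coord} (hZ : Z ∉ Set.range (Sum.map e o)) :
    scaling e o Z = coord lineTime * coord (lineBase Z) := if_neg hZ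

theorem scaling_morAt (X : D'.line.ev → ℝ) : MorAt (scaling e o) X where
  smooth Z := by
    by_cases h : Z ∈ Set.range (Sum.map e o)
    · rw [scaling, if_pos h]
      exact smoothAt_coord _ _
    · rw [scaling, if_neg h]
      exact (smoothAt_coord _ _).mul (smoothAt_coord _ _)
  parity := .of_forall fun Y Z => by
    have h1 : (coord (lineBase Z) : D'.line.Fn) Y ∈ grPart D'.line (D'.par Z) := by
      rw [← par_lineBase]; exact coord_mem _ _
    by_cases h : Z ∈ Set.range (Sum.map e o)
    · rw [scaling, if_pos h]
      exact h1
    · rw [scaling, if_neg h]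
      exact mul_mem_grPart (coord_mem lineTime Y) h1 (zero_add _).symm

theorem body_scaling (X : D'.line.ev → ℝ) : body (scaling e o) X ∘ e = X ∘ Sum.inl ∘ e := by
  ext i
  have := scaling_map (e := e) (o := o) (.inl i)
  rw [Sum.map_inl] at this
  simp [body, this, coord, lineBase]

/-- At parameter 1 the scaling has the same components at this point as the projection, and
substitution depends on `φ` only through its values at the point. -/
theorem subst_scaling_one {F : D'.Fn} {X : D'.line.ev → ℝ} (hX : X (.inr ()) = 1)
    (hF : SmoothAt F (X ∘ Sum.inl)) : subst (scaling e o) F X = extLine F X := by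
  have h1 : (coord lineTime : D'.line.Fn) X = 1 := by
    simp [coord, lineTime, hX]
  have := subst_ext (D := D') (D' := D') (D₁ := D'.line) (D₁' := D') (e := Sum.inl) (o := id)
    (e' := id) (o' := id) Function.injective_id Function.injective_id (φ := coord)
    (Φ := scaling e o) (x := X) (g := F) (fun A => ?_) (scaling_morAt X).parAt
    (coord_morAt _).parAt ?_
  · rw [ext_id] at this
    refine this.trans (ext_apply_congr _ _ ?_)
    exact subst_coord_left _ _
  · rw [Sum.map_id_id, id_eq, ext_coord, ← lineBase_eq_map]
    by_cases h : A ∈ Set.range (Sum.map e o)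
    · rw [scaling, if_pos h]
    · rw [scaling, if_neg h, Pi.mul_apply, h1, one_mul]
  · convert hF
    ext i
    simp [body, coord]

theorem subst_scaling_zero (he : Function.Injective e) (ho : Function.Injective o) {F : D'.Fn}
    {X : D'.line.ev → ℝ} (hX : X (.inr ()) = 0)
    (hF : SmoothAt F (body (zeroSection e o) (X ∘ Sum.inl ∘ e))) :
    subst (scaling e o) F X = extLine (ext e o (res e o F)) X := by
  have h1 : (coord lineTime : D'.line.Fn) X = 0 := by
    simp [coord, lineTime, hX]
  have := subst_ext (D := D) (D' := D') (D₁ := D'.line) (D₁' := D') (e := Sum.inl ∘ e)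
    (o := id ∘ o)
    (e' := id) (o' := id) Function.injective_id Function.injective_id (φ := zeroSection e o)
    (Φ := scaling e o) (x := X) (g := F) (fun A => ?_) (scaling_morAt X).parAt
    (zeroSection_morAt _).parAt hF
  · rw [ext_id] at this
    rw [this, extLine, ext_ext]
    rfl
  · rw [Sum.map_id_id, id_eq]
    by_cases h : A ∈ Set.range (Sum.map e o)
    · obtain ⟨B, rfl⟩ := h
      rw [zeroSection_map he ho, scaling_map, ext_coord, lineBase_eq_map, Sum.map_map]
    · rw [scaling_of_notMem h, zeroSection_of_notMem h, ext_zero, Pi.mul_apply, h1, zero_mul]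
      rfl

/-- By the chain rule `t ∂/∂t` of `F(x, tη)` is the Euler field of `F` evaluated at `(x, tη)`: base
coordinates have weight 0 and do not move, fibre coordinates have weight 1 and are multiplied by
`t`. -/
theorem smul_pd_subst_scaling {w : D'.Coord → ℤ} (hw : ∀ A, w (Sum.map e o A) = 0)
    (hw' : ∀ Z ∉ Set.range (Sum.map e o), w Z = 1) {k : ℤ} {F : D'.Fn} {X : D'.line.ev → ℝ}
    (hF : SmoothAt F (body (scaling e o) X)) (hk : WeightNear w k F (body (scaling e o) X)) :
    X (.inr ()) • pd lineTime (subst (scaling e o) F) X =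
      (k : ℝ) • subst (scaling e o) F X := by
  classical
  have hφ := scaling_morAt (e := e) (o := o) X
  have hk' : subst (scaling e o) (euler w F) X = (k : ℝ) • subst (scaling e o) F X :=
    (subst_congr hk).trans (subst_smul _ hF)
  rw [← hk', pd_subst hφ hF, euler, subst_sum _ fun A _ =>
    ((smoothAt_coord A _).mul (hF.pd A)).smul _, Finset.smul_sum]
  refine Finset.sum_congr rfl fun Z _ => ?_
  rw [subst_smul _ ((smoothAt_coord Z _).mul (hF.pd Z)),
    subst_mul hφ.parAt (smoothAt_coord Z _) (hF.pd Z), subst_coord hφ.parAt]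
  have hne : (lineTime : D'.line.Coord) ≠ lineBase Z := lineTime_ne_lineBase Z
  by_cases h : Z ∈ Set.range (Sum.map e o)
  · obtain ⟨B, rfl⟩ := h
    rw [scaling_map, pd_coord, if_neg hne, hw]
    simp
  · rw [scaling_of_notMem h, pd_mul _ (smoothAt_coord _ _) (smoothAt_coord _ _), pd_coord,
      pd_coord, if_pos rfl, if_neg hne, hw' Z h]
    have h1 : (coord lineTime : D'.line.Fn) X = algebraMap ℝ _ (X (.inr ())) := rfl
    rw [Pi.mul_apply, h1, one_mul, mul_zero, add_zero, Int.cast_one, one_smul, mul_assoc,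
      Algebra.smul_def]

/-- The functional followed by the inclusion of the scalars is a linear endomorphism and commutes
with the derivative; the injective inclusion is then cancelled. -/
theorem dual_pd_inl [DecidableEq D.ev] (l : Module.Dual ℝ D.Gr) (i : D.ev) {f : D.Fn}
    {x : D.ev → ℝ} (hf : SmoothAt f x) :
    l (pd (.inl i) f x) = fderiv ℝ (fun y => l (f y)) x (Pi.single i 1) := by
  have h1 := pd_inl_linear i (Algebra.linearMap ℝ D.Gr ∘ₗ l) hf
  have h2 := pd_inl_algebraMap (D := D) i (r := fun y => l (f y)) (x := x)
    (hf.mono fun y hy => hy l)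
  refine (algebraMap ℝ D.Gr).injective ((h1.symm.trans h2).trans ?_)
  congr!

theorem hasDerivAt_sumElim (x : D.ev → ℝ) (t : ℝ) [DecidableEq D.line.ev] :
    HasDerivAt (fun s : ℝ => (Sum.elim x (fun _ => s) : D.line.ev → ℝ))
      (Pi.single (.inr ()) 1) t := by
  rw [hasDerivAt_pi]
  rintro (i | i)
  · simpa using hasDerivAt_const t (x i)
  · simpa using hasDerivAt_id' t

theorem hasDerivAt_dual_line {H : D.line.Fn} {x : D.ev → ℝ} {t : ℝ}
    (hH : SmoothAt H (Sum.elim x (fun _ => t))) (l : Module.Dual ℝ D.line.Gr) :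
    HasDerivAt (fun s : ℝ => l (H (Sum.elim x (fun _ => s))))
      (l (pd lineTime H (Sum.elim x (fun _ => t)))) t := by
  classical
  have h1 : DifferentiableAt ℝ (fun y => l (H y)) (Sum.elim x (fun _ => t)) :=
    (hH.self_of_nhds l).differentiableAt (by simp)
  have h2 := dual_pd_inl (D := D.line) l (.inr ()) hH
  rw [lineTime, h2]
  exact h1.hasFDerivAt.comp_hasDerivAt t (hasDerivAt_sumElim x t)

/-- A function of weight zero does not depend on the fibre coordinates. -/
theorem eq_ext_res (he : Function.Injective e) (ho : Function.Injective o) {w : D'.Coord → ℤ}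
    (hw : ∀ A, w (Sum.map e o A) = 0) (hw' : ∀ Z ∉ Set.range (Sum.map e o), w Z = 1) {F : D'.Fn}
    {x : D'.ev → ℝ} (hF : ∀ x', x' ∘ e = x ∘ e → SmoothAt F x')
    (hk : ∀ x', x' ∘ e = x ∘ e → WeightNear w 0 F x') : F x = ext e o (res e o F) x := by
  set H := subst (scaling e o) F with hH
  have hb : ∀ t : ℝ, body (scaling e o) (Sum.elim x fun _ => t : D'.line.ev → ℝ) ∘ e = x ∘ e :=
    fun t => body_scaling _
  have hs : ∀ t : ℝ, SmoothAt H (Sum.elim x fun _ => t) := fun t =>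
    smoothAt_subst (scaling_morAt _) (hF _ (hb t))
  have h1 := subst_scaling_one (e := e) (o := o) (F := F)
    (X := (Sum.elim x fun _ => 1 : D'.line.ev → ℝ)) rfl (hF x rfl)
  have h0 := subst_scaling_zero he ho (F := F)
    (X := (Sum.elim x fun _ => 0 : D'.line.ev → ℝ)) rfl (hF _ (body_zeroSection he ho _))
  -- The whole segment of scalings lies in one fibre, where smoothness and weight are assumed. The
  -- mean value theorem is applied to each linear functional separately.
  have key : H (Sum.elim x fun _ => 1) = H (Sum.elim x fun _ => 0) := by
    rw [← sub_eq_zero, ← Module.forall_dual_apply_eq_zero_iff ℝ]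
    intro l
    have hd := fun t => hasDerivAt_dual_line (hs t) l
    obtain ⟨c, hc, hc'⟩ := exists_deriv_eq_slope _ one_pos
      (fun t _ => (hd t).continuousAt.continuousWithinAt)
      (fun t _ => (hd t).differentiableAt.differentiableWithinAt)
    -- The intermediate point is positive, so the factor `t` in the Euler equation can be cancelled.
    have hz := smul_pd_subst_scaling hw hw' (hF _ (hb c)) (hk _ (hb c))
    rw [Int.cast_zero, zero_smul] at hz
    have hz' := (smul_eq_zero.1 hz).resolve_left hc.1.ne'
    rw [(hd c).deriv, hz', map_zero] at hc'
    rw [map_sub]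
    simpa using hc'.symm
  have hinj : ∀ G G' : D'.Fn, extLine G (Sum.elim x fun _ => 1) =
      extLine G' (Sum.elim x fun _ => 0) → G x = G' x := fun G G' h =>
    map_lmapDomain_injective Function.injective_id h
  exact hinj _ _ (h1.symm.trans (key.trans h0))

/-- There are no functions of weight minus one. -/
theorem eq_zero_of_weightNear {w : D'.Coord → ℤ}
    (hw : ∀ A, w (Sum.map e o A) = 0) (hw' : ∀ Z ∉ Set.range (Sum.map e o), w Z = 1) {F : D'.Fn}
    {x : D'.ev → ℝ} (hF : ∀ x', x' ∘ e = x ∘ e → SmoothAt F x')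
    (hk : ∀ x', x' ∘ e = x ∘ e → WeightNear w (-1) F x') : F x = 0 := by
  set H := subst (scaling e o) F with hH
  have hb : ∀ t : ℝ, body (scaling e o) (Sum.elim x fun _ => t : D'.line.ev → ℝ) ∘ e = x ∘ e :=
    fun t => body_scaling _
  have hs : ∀ t : ℝ, SmoothAt H (Sum.elim x fun _ => t) := fun t =>
    smoothAt_subst (scaling_morAt _) (hF _ (hb t))
  have h1 := subst_scaling_one (e := e) (o := o) (F := F)
    (X := (Sum.elim x fun _ => 1 : D'.line.ev → ℝ)) rfl (hF x rfl)
  have key : H (Sum.elim x fun _ => 1) = 0 := by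
    rw [← Module.forall_dual_apply_eq_zero_iff ℝ]
    intro l
    -- For weight -1 the product `t H(t)` has derivative `H + t H' = 0` and vanishes at `t = 0`,
    -- hence `H(1) = 0`. The argument uses that `H` is smooth up to `t = 0`.
    have hd := fun t => (hasDerivAt_id t).mul (hasDerivAt_dual_line (hs t) l)
    obtain ⟨c, hc, hc'⟩ := exists_deriv_eq_slope _ one_pos
      (fun t _ => (hd t).continuousAt.continuousWithinAt)
      (fun t _ => (hd t).differentiableAt.differentiableWithinAt)
    have hz := congrArg l (smul_pd_subst_scaling hw hw' (hF _ (hb c)) (hk _ (hb c)))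
    rw [map_smul, map_smul] at hz
    rw [(hd c).deriv] at hc'
    simp only [smul_eq_mul, Sum.elim_inr, Int.cast_neg, Int.cast_one] at hz
    simp only [Pi.mul_apply, id_eq, ← hH] at hc' hz
    rw [hz] at hc'
    simpa using hc'.symm
  have hinj : ∀ G : D'.Fn, extLine G (Sum.elim x fun _ => 1) = 0 → G x = 0 := fun G h =>
    map_lmapDomain_injective Function.injective_id (h.trans (map_zero _).symm)
  exact hinj _ (h1.symm.trans key)

/-! Restriction to the zero section. -/

theorem SmoothAt.res {F : D'.Fn} {y : D.ev → ℝ} (hF : SmoothAt F (body (zeroSection e o) y)) :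
    SmoothAt (res e o F) y := smoothAt_subst (zeroSection_morAt y) hF

theorem res_mem {F : D'.Fn} {y : D.ev → ℝ} {ε : ZMod 2}
    (hF : SmoothAt F (body (zeroSection e o) y))
    (h : ParNear ε F (body (zeroSection e o) y)) : SuperGeom.res e o F y ∈ grPart D ε :=
  subst_mem (zeroSection_morAt y).parAt hF h

theorem res_ext (he : Function.Injective e) (ho : Function.Injective o) {f : D.Fn} {y : D.ev → ℝ}
    (hf : SmoothAt f y) : SuperGeom.res e o (SuperGeom.ext e o f) y = f y := by
  have := subst_ext (D := D) (D' := D) (D₁ := D) (D₁' := D') (e := id) (o := id)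
    (e' := e) (o' := o) he ho (φ := coord) (Φ := zeroSection e o) (x := y) (g := f)
    (fun A => by rw [zeroSection_map he ho, ext_id]) (zeroSection_morAt _).parAt
    (coord_morAt _).parAt (by convert hf; ext i; simp [body, coord])
  refine this.trans ?_
  rw [ext_id]
  exact subst_coord_left _ _

end Fibres

end SuperGeom

end
noncomputable section
namespace SuperGeom

/-! ### The Schouten bracket in coordinates -/

section Bracket

variable {D : SuperDim}

/-- The function `S` on the cotangent bundle over `U` is odd and of degree two in the momenta. -/
structure IsQuadratic (S : D.cot.Fn) (U : Set (D.ev → ℝ)) : Prop where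
  isOpen : IsOpen U
  smooth : ∀ x : D.cot.ev → ℝ, x ∘ Sum.inl ∈ U → SmoothAt S x
  odd : ∀ x, S x ∈ grPart D.cot 1
  weight : ∀ x : D.cot.ev → ℝ, x ∘ Sum.inl ∈ U → WeightNear momDegree 2 S x

/-- The second derivative of `S` by the momenta, a function on the base if `S` is quadratic. -/
def hess (S : D.cot.Fn) (A B : D.Coord) : D.Fn :=
  res Sum.inl Sum.inl (pd (mom B) (pd (mom A) S))

/-- The components of the derivation `⟦f, -⟧`. -/
def hamVec (S : D.cot.Fn) (f : D.Fn) (B : D.Coord) : D.Fn :=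
  -∑ A, hess S A B * pd A (twist (D.par B + 1) f)

/-- The Schouten bracket, as a function on the base. -/
def bracket (S : D.cot.Fn) (f g : D.Fn) : D.Fn := ∑ B, hamVec S f B * pd B g

variable {S : D.cot.Fn} {U : Set (D.ev → ℝ)}

theorem momDegree_map (A : D.Coord) :
    momDegree (Sum.map (Sum.inl : D.ev → D.cot.ev) (Sum.inl : D.od → D.cot.od) A) = 0 := by
  rw [← pos_eq_map]; exact momDegree_pos A

theorem momDegree_of_notMem (Z : D.cot.Coord)
    (hZ : Z ∉ Set.range (Sum.map (Sum.inl : D.ev → D.cot.ev) (Sum.inl : D.od → D.cot.od))) :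
    momDegree Z = 1 := by
  obtain ⟨A, rfl | rfl⟩ := cot_coord_cases Z
  · exact absurd ⟨A, (pos_eq_map A).symm⟩ hZ
  · exact momDegree_mom A


theorem IsQuadratic.smooth_hess (hS : IsQuadratic S U) {x : D.cot.ev → ℝ} (hx : x ∘ Sum.inl ∈ U)
    (A B : D.Coord) : SmoothAt (pd (mom B) (pd (mom A) S)) x := ((hS.smooth x hx).pd _).pd _

theorem IsQuadratic.zeroSection_mem (_ : IsQuadratic S U) {y : D.ev → ℝ} (hy : y ∈ U) :
    (body (zeroSection Sum.inl Sum.inl : D.cot.Coord → D.Fn) y) ∘ Sum.inl ∈ U := by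
  rw [body_zeroSection Sum.inl_injective Sum.inl_injective]
  exact hy

/-- Two momentum derivatives lower the degree from two to zero, and a smooth function of degree zero
is constant along the full fibres of the cotangent bundle. -/
theorem IsQuadratic.extCot_hess (hS : IsQuadratic S U) {x : D.cot.ev → ℝ} (hx : x ∘ Sum.inl ∈ U)
    (A B : D.Coord) : extCot (hess S A B) x = pd (mom B) (pd (mom A) S) x := by
  refine (eq_ext_res Sum.inl_injective Sum.inl_injective momDegree_map momDegree_of_notMem
    (fun x' hx' => hS.smooth_hess (hx' ▸ hx) A B) fun x' hx' => ?_).symm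
  have hs := hS.smooth x' (hx' ▸ hx)
  exact WeightNear.pd (hs.pd _) (WeightNear.pd hs (hS.weight x' (hx' ▸ hx)) (mom A)
    (l := 1) (by rw [momDegree_mom]; rfl)) (mom B) (by rw [momDegree_mom]; rfl)

theorem IsQuadratic.smoothAt_hess (hS : IsQuadratic S U) {y : D.ev → ℝ} (hy : y ∈ U)
    (A B : D.Coord) : SmoothAt (hess S A B) y :=
  SmoothAt.res (hS.smooth_hess (hS.zeroSection_mem hy) A B)

theorem IsQuadratic.hess_parNear (hS : IsQuadratic S U) {y : D.ev → ℝ} (hy : y ∈ U)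
    (A B : D.Coord) : ParNear (1 + D.par A + D.par B) (hess S A B) y := by
  filter_upwards [hS.isOpen.mem_nhds hy] with z hz
  have hz' := hS.zeroSection_mem hz
  have h1 : ParNear 1 S (body (zeroSection Sum.inl Sum.inl : D.cot.Coord → D.Fn) z) :=
    .of_forall hS.odd
  exact res_mem (hS.smooth_hess hz' A B) ((h1.pd (hS.smooth _ hz') (mom A)
    (by rw [par_mom])).pd ((hS.smooth _ hz').pd _) (mom B) (by rw [par_mom]))

/-- A point of the zero section of the cotangent bundle. -/
def zeroCovector (y : D.ev → ℝ) : D.cot.ev → ℝ := Sum.elim y 0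

theorem extCot_injective_at {f g : D.Fn} {y : D.ev → ℝ}
    (h : extCot f (zeroCovector y) = extCot g (zeroCovector y)) : f y = g y :=
  ext_injective_at (D' := D.cot) (x := zeroCovector y) Sum.inl_injective h

/-- Graded symmetry is that of second derivatives; it is checked at a zero covector, since pullback
to the cotangent bundle is injective. -/
theorem IsQuadratic.hess_symm (hS : IsQuadratic S U) {y : D.ev → ℝ} (hy : y ∈ U)
    (A B : D.Coord) : hess S B A y = sgn (D.par A * D.par B) • hess S A B y := by
  have hx : zeroCovector y ∘ Sum.inl ∈ U := hy
  refine extCot_injective_at (g := sgn (D.par A * D.par B) • hess S A B) ?_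
  have h1 : extCot (sgn (D.par A * D.par B) • hess S A B) =
      sgn (D.par A * D.par B) • extCot (hess S A B) := ext_smul _ _ _ _
  rw [h1, Pi.smul_apply, hS.extCot_hess hx, hS.extCot_hess hx, pd_comm _ _ (hS.smooth _ hx),
    par_mom, par_mom]

variable {f g h : D.Fn} {y : D.ev → ℝ} {ε δ κ : ZMod 2}

theorem IsQuadratic.smoothAt_hamVec (hS : IsQuadratic S U) (hy : y ∈ U) (hf : SmoothAt f y)
    (B : D.Coord) : SmoothAt (hamVec S f B) y :=
  (SmoothAt.sum _ fun A _ => (hS.smoothAt_hess hy A B).mul ((hf.twist _).pd A)).neg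

theorem IsQuadratic.smoothAt_bracket (hS : IsQuadratic S U) (hy : y ∈ U) (hf : SmoothAt f y)
    (hg : SmoothAt g y) : SmoothAt (bracket S f g) y :=
  SmoothAt.sum _ fun B _ => (hS.smoothAt_hamVec hy hf B).mul (hg.pd B)

theorem ParNear.twist (hf : ParNear ε f y) (δ : ZMod 2) : ParNear ε (twist δ f) y := by
  filter_upwards [hf] with z hz
  rw [twist_apply]
  exact tw_mem_grPart _ hz

theorem IsQuadratic.hamVec_parNear (hS : IsQuadratic S U) (hy : y ∈ U) (hf : SmoothAt f y)
    (h : ParNear ε f y) (B : D.Coord) : ParNear (ε + 1 + D.par B) (hamVec S f B) y := by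
  refine (ParNear.sum _ fun A _ => (hS.hess_parNear hy A B).mul ((h.twist _).pd (hf.twist _) A)
    ?_).neg
  generalize D.par A = a; generalize D.par B = b; clear h; revert ε a b; decide

theorem IsQuadratic.bracket_parNear (hS : IsQuadratic S U) (hy : y ∈ U) (hf : SmoothAt f y)
    (hg : SmoothAt g y) (h : ParNear ε f y) (h' : ParNear δ g y)
    (hκ : κ = ε + δ + 1 := by rfl) : ParNear κ (bracket S f g) y := by
  refine ParNear.sum _ fun B _ => (hS.hamVec_parNear hy hf h B).mul (h'.pd hg B) ?_
  rw [hκ]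
  generalize D.par B = b; clear h h' hκ; revert ε δ b; decide

theorem hamVec_apply (S : D.cot.Fn) (f : D.Fn) (B : D.Coord) (y : D.ev → ℝ) :
    hamVec S f B y = -∑ A, hess S A B y * pd A (SuperGeom.twist (D.par B + 1) f) y := by
  simp [hamVec]

theorem bracket_apply (S : D.cot.Fn) (f g : D.Fn) (y : D.ev → ℝ) :
    bracket S f g y = ∑ B, hamVec S f B y * pd B g y := by
  simp [bracket]

theorem bracket_coord (S : D.cot.Fn) (f : D.Fn) (B : D.Coord) (y : D.ev → ℝ) :
    bracket S f (coord B) y = hamVec S f B y := by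
  classical
  rw [bracket_apply, Finset.sum_eq_single B]
  · rw [pd_coord, if_pos rfl, mul_one]
  · intro A _ hA
    rw [pd_coord, if_neg hA, mul_zero]
  · simp

theorem twist_eventuallyEq {f' : D.Fn} (ε : ZMod 2) (h : f =ᶠ[𝓝 y] f') :
    SuperGeom.twist ε f =ᶠ[𝓝 y] SuperGeom.twist ε f' := by
  filter_upwards [h] with z hz
  rw [twist_apply, twist_apply, hz]

theorem hamVec_congr {f' : D.Fn} (h : f =ᶠ[𝓝 y] f') (B : D.Coord) :
    hamVec S f B y = hamVec S f' B y := by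
  simp only [hamVec_apply, pd_congr _ (twist_eventuallyEq _ h)]

theorem bracket_congr {f' g' : D.Fn} (h : f =ᶠ[𝓝 y] f') (h' : g =ᶠ[𝓝 y] g') :
    bracket S f g y = bracket S f' g' y := by
  simp only [bracket_apply, hamVec_congr h, pd_congr _ h']

theorem bracket_eventuallyEq {f' g' : D.Fn} (h : f =ᶠ[𝓝 y] f') (h' : g =ᶠ[𝓝 y] g') :
    bracket S f g =ᶠ[𝓝 y] bracket S f' g' := by
  filter_upwards [eventually_eventually_nhds.2 h, eventually_eventually_nhds.2 h'] with z h1 h2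
  exact bracket_congr h1 h2

theorem twist_add (ε : ZMod 2) (f g : D.Fn) :
    SuperGeom.twist ε (f + g) = SuperGeom.twist ε f + SuperGeom.twist ε g := by
  ext1 z; simp [twist_apply]

theorem twist_smul (ε : ZMod 2) (c : ℝ) (f : D.Fn) :
    SuperGeom.twist ε (c • f) = c • SuperGeom.twist ε f := by
  ext1 z; simp [twist_apply]

theorem twist_mul (ε : ZMod 2) (f g : D.Fn) :
    SuperGeom.twist ε (f * g) = SuperGeom.twist ε f * SuperGeom.twist ε g := by
  ext1 z; simp [twist_apply]

theorem hamVec_add (hf : SmoothAt f y) (hg : SmoothAt g y) (B : D.Coord) :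
    hamVec S (f + g) B y = hamVec S f B y + hamVec S g B y := by
  simp only [hamVec_apply, twist_add, pd_add _ (hf.twist _) (hg.twist _), mul_add,
    Finset.sum_add_distrib, neg_add]

theorem hamVec_smul (c : ℝ) (hf : SmoothAt f y) (B : D.Coord) :
    hamVec S (c • f) B y = c • hamVec S f B y := by
  simp only [hamVec_apply, twist_smul, pd_smul _ _ (hf.twist _), mul_smul_comm,
    ← Finset.smul_sum, smul_neg]

theorem bracket_add_left (hf : SmoothAt f y) (hg : SmoothAt g y) :
    bracket S (f + g) h y = bracket S f h y + bracket S g h y := by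
  simp only [bracket_apply, hamVec_add hf hg, add_mul, Finset.sum_add_distrib]

theorem bracket_smul_left (c : ℝ) (hf : SmoothAt f y) :
    bracket S (c • f) h y = c • bracket S f h y := by
  simp only [bracket_apply, hamVec_smul c hf, smul_mul_assoc, Finset.smul_sum]

theorem bracket_add_right (hg : SmoothAt g y) (hh : SmoothAt h y) :
    bracket S f (g + h) y = bracket S f g y + bracket S f h y := by
  simp only [bracket_apply, pd_add _ hg hh, mul_add, Finset.sum_add_distrib]

theorem bracket_smul_right (c : ℝ) (hg : SmoothAt g y) :
    bracket S f (c • g) y = c • bracket S f g y := by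
  simp only [bracket_apply, pd_smul _ _ hg, mul_smul_comm, Finset.smul_sum]

/-- The dependence of `⟦f g, -⟧` on a factor `f`. -/
theorem IsQuadratic.hamVec_mul (hS : IsQuadratic S U) (hy : y ∈ U) (hf : SmoothAt f y)
    (hg : SmoothAt g y) (B : D.Coord) : hamVec S (f * g) B y =
      hamVec S f B y * tw (D.par B + 1) (g y) + f y * hamVec S g B y := by
  simp only [hamVec_apply, twist_mul, pd_mul _ (hf.twist _) (hg.twist _), neg_mul, mul_neg,
    Finset.sum_mul, Finset.mul_sum, ← neg_add, ← Finset.sum_add_distrib, mul_add, twist_apply]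
  congr 1
  refine Finset.sum_congr rfl fun A _ => ?_
  rw [← mul_assoc, ← mul_assoc, ← mul_assoc, mul_comm_tw (hS.hess_parNear hy A B).self
    (tw _ (tw _ (f y))), tw_tw, tw_tw]
  have : 1 + D.par A + D.par B + D.par A + (D.par B + 1) = 0 := by
    generalize D.par A = a; generalize D.par B = b; revert a b; decide
  rw [this, tw_zero]

/-- The Leibniz rule. -/
theorem IsQuadratic.bracket_mul (hS : IsQuadratic S U) (hy : y ∈ U) (hf : SmoothAt f y)
    (hg : SmoothAt g y) (hh : SmoothAt h y) (hε : ParNear ε f y) : bracket S f (g * h) y =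
      bracket S f g y * h y + tw (ε + 1) (g y) * bracket S f h y := by
  simp only [bracket_apply, pd_mul _ hg hh, Finset.sum_mul, Finset.mul_sum,
    ← Finset.sum_add_distrib]
  refine Finset.sum_congr rfl fun B _ => ?_
  rw [mul_add, mul_assoc, ← mul_assoc (hamVec S f B y) (tw _ _),
    mul_comm_tw (hS.hamVec_parNear hy hf hε B).self (tw _ _), tw_tw, mul_assoc]
  have : ε + 1 + D.par B + D.par B = ε + 1 := by rw [add_assoc, zmod_two_add_self, add_zero]
  rw [this]

theorem twist_pd_apply (hf : SmoothAt f y) (h : ParNear ε f y) (A : D.Coord) (κ : ZMod 2) :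
    pd A (SuperGeom.twist κ f) y = sgn (κ * ε) • pd A f y := by
  rw [← pd_smul _ _ hf]
  refine pd_congr _ ?_
  filter_upwards [h] with z hz
  rw [twist_apply, tw_of_mem hz, Pi.smul_apply]

/-- The Hessian is graded symmetric, so exchanging the two summation indices exchanges the
arguments. The shifted parities reflect that the bracket itself is odd. -/
theorem IsQuadratic.bracket_skew (hS : IsQuadratic S U) (hy : y ∈ U) (hf : SmoothAt f y)
    (hg : SmoothAt g y) (h : ParNear ε f y) (h' : ParNear δ g y) :
    bracket S f g y = -(sgn ((ε + 1) * (δ + 1)) • bracket S g f y) := by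
  simp only [bracket_apply, hamVec_apply, neg_mul, Finset.sum_neg_distrib, smul_neg, neg_neg,
    Finset.sum_mul, Finset.smul_sum]
  rw [Finset.sum_comm, ← Finset.sum_neg_distrib]
  refine Finset.sum_congr rfl fun A _ => ?_
  rw [← Finset.sum_neg_distrib]
  refine Finset.sum_congr rfl fun B _ => ?_
  rw [twist_pd_apply hf h, twist_pd_apply hg h', hS.hess_symm hy A B, mul_assoc, mul_assoc]
  simp only [smul_mul_assoc, mul_smul_comm]
  rw [mul_comm_sgn (h'.pd hg B).self (h.pd hf A).self, mul_smul_comm, neg_eq_sgn_one_smul]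
  simp only [sgn_smul_sgn_smul]
  congr 2
  generalize D.par A = a; generalize D.par B = b; clear h h'; revert a b ε δ; decide

/-! Comparison with the Poisson bracket. -/

theorem poisson_extCot {F : D.cot.Fn} {x : D.cot.ev → ℝ} (hF : SmoothAt F x)
    (hf : SmoothAt f (x ∘ Sum.inl)) : poisson F (extCot f) x =
      ∑ A, tw (D.par A) (pd (mom A) F x) * extCot (pd A f) x := by
  rw [poisson_apply hF, Fintype.sum_prod_type]
  refine Finset.sum_congr rfl fun A _ => ?_
  rw [Fintype.sum_bool]
  simp only [phase, conjugate, Bool.not_true, Bool.not_false, cond_true, cond_false]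
  rw [pd_mom_extCot hf, pd_pos_extCot hf]
  simp [phaseSign]

theorem IsQuadratic.poisson_extCot_eventually (hS : IsQuadratic S U) {x : D.cot.ev → ℝ}
    (hx : x ∘ Sum.inl ∈ U) (hf : SmoothAt f (x ∘ Sum.inl)) :
    poisson S (extCot f) =ᶠ[𝓝 x] ∑ A, pd (mom A) S * extCot (pd A f) := by
  have hc := (continuous_comp_left (D := D) (D' := D.cot) Sum.inl).continuousAt (x := x)
  filter_upwards [(hS.smooth x hx).eventually, hc.eventually hf.eventually] with z h1 h2
  rw [poisson_extCot h1 h2, Finset.sum_apply]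
  refine Finset.sum_congr rfl fun A _ => ?_
  have h3 : ParNear 1 S z := .of_forall hS.odd
  rw [tw_of_mem (h3.pd h1 (mom A)).self, par_mom, Pi.mul_apply]
  have : D.par A * (1 + D.par A) = 0 := by generalize D.par A = a; revert a; decide
  rw [this, sgn_zero, one_smul]

/-- Only momentum derivatives of `S` meet functions of the base, so both brackets together produce
the Hessian. The twist in `hamVec` stands for the sign that depends on the parity of `f`, which
keeps the formula valid for inhomogeneous `f`. -/
theorem IsQuadratic.schoutenBracket_eq (hS : IsQuadratic S U) {x : D.cot.ev → ℝ}
    (hx : x ∘ Sum.inl ∈ U) (hf : SmoothAt f (x ∘ Sum.inl)) (hg : SmoothAt g (x ∘ Sum.inl)) :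
    schoutenBracket S f g x = extCot (bracket S f g) x := by
  have hS1 := hS.smooth x hx
  have hf1 : SmoothAt (SuperGeom.twist 1 f) (x ∘ Sum.inl) := hf.twist 1
  have hp := hS.poisson_extCot_eventually hx hf1
  have hs : ∀ A, SmoothAt (extCot (pd A (SuperGeom.twist 1 f))) x := fun A =>
    SmoothAt.extCot (hf1.pd A)
  have hr : extCot (bracket S f g) x =
      -∑ B, ∑ A, pd (mom B) (pd (mom A) S) x *
        extCot (pd A (SuperGeom.twist (D.par B + 1) f)) x * extCot (pd B g) x := by
    unfold bracket hamVec extCot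
    simp only [ext_sum, ext_neg, ext_mul, Finset.sum_apply, Pi.mul_apply, Pi.neg_apply, neg_mul,
      Finset.sum_mul, Finset.sum_neg_distrib]
    congr 1
    refine Finset.sum_congr rfl fun B _ => Finset.sum_congr rfl fun A _ => ?_
    rw [← hS.extCot_hess hx]
    rfl
  have h3 : ParNear 1 S x := .of_forall hS.odd
  rw [schoutenBracket, Pi.neg_apply, poisson_extCot (hS1.poisson (SmoothAt.extCot hf1)) hg, hr]
  congr 1
  refine Finset.sum_congr rfl fun B _ => ?_
  rw [pd_congr _ hp, pd_sum _ _ fun A _ => (hS1.pd _).mul (hs A), map_sum, Finset.sum_mul]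
  refine Finset.sum_congr rfl fun A _ => ?_
  rw [pd_mul _ (hS1.pd _) (hs A), pd_mom_extCot (hf1.pd A), mul_zero, add_zero, map_mul]
  congr 1
  rw [tw_of_mem ((h3.pd hS1 (mom A)).pd (hS1.pd _) (mom B)).self, par_mom, par_mom]
  have h4 : tw (D.par B) (extCot (pd A (SuperGeom.twist 1 f)) x) =
      extCot (SuperGeom.twist (D.par B) (pd A (SuperGeom.twist 1 f))) x := by
    unfold extCot
    rw [ext_twist, twist_apply]
  have h5 : extCot (pd A (SuperGeom.twist (D.par B + 1) f)) x = sgn (D.par B * D.par A) •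
      extCot (SuperGeom.twist (D.par B) (pd A (SuperGeom.twist 1 f))) x := by
    have e : SuperGeom.twist (D.par B + 1) f =
        SuperGeom.twist (D.par B) (SuperGeom.twist 1 f) := by
      ext1 z; simp only [twist_apply, tw_tw]
    have : pd A (SuperGeom.twist (D.par B + 1) f) (x ∘ Sum.inl) = (sgn (D.par B * D.par A) •
        SuperGeom.twist (D.par B) (pd A (SuperGeom.twist 1 f))) (x ∘ Sum.inl) := by
      rw [e, pd_twist _ _ hf1, Pi.smul_apply, twist_apply]
    unfold extCot
    rw [ext_apply_congr _ _ this, ext_smul, Pi.smul_apply]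
  rw [h4, h5, smul_mul_assoc, mul_smul_comm]
  congr 2
  generalize D.par A = a; generalize D.par B = b; revert a b; decide

/-- The derivation `{S, -}` squares to zero. -/
theorem IsQuadratic.poisson_poisson_self (hS : IsQuadratic S U)
    (hSS : ∀ x : D.cot.ev → ℝ, x ∘ Sum.inl ∈ U → poisson S S x = 0) {x : D.cot.ev → ℝ}
    (hx : x ∘ Sum.inl ∈ U) {F : D.cot.Fn} (hF : SmoothAt F x) : poisson S (poisson S F) x = 0 := by
  have hS1 := hS.smooth x hx
  have h3 : ParNear 1 S x := .of_forall hS.odd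
  have h0 : poisson S S =ᶠ[𝓝 x] 0 := by
    filter_upwards [(continuous_comp_left (D := D) (D' := D.cot)
      Sum.inl).continuousAt.eventually (hS.isOpen.mem_nhds hx)] with z hz
    exact hSS z hz
  -- As `S` is odd, the Jacobi identity reads `{S,{S,F}} = {{S,S},F} - {S,{S,F}}`, so twice the
  -- iterated bracket is zero.
  have h1 := poisson_jacobi hS1 hS1 hF h3 h3
  have h2 : poisson (poisson S S) F x = 0 := by
    rw [poisson_congr h0 (Filter.EventuallyEq.refl _ F), poisson_apply (smoothAt_zero x)]
    simp [pd_zero]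
  rw [h2, zero_add, mul_one, sgn_one, neg_one_smul] at h1
  have h4 : (2 : ℝ) • poisson S (poisson S F) x = 0 := by
    rw [two_smul]
    nth_rewrite 1 [h1]
    exact neg_add_cancel _
  exact (smul_eq_zero.1 h4).resolve_left two_ne_zero

theorem IsQuadratic.extCot_bracket (hS : IsQuadratic S U) {x : D.cot.ev → ℝ}
    (hx : x ∘ Sum.inl ∈ U) (hf : SmoothAt f (x ∘ Sum.inl)) (hg : SmoothAt g (x ∘ Sum.inl))
    (h : ParNear ε f (x ∘ Sum.inl)) : extCot (bracket S f g) x =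
      sgn (ε + 1) • poisson (poisson S (extCot f)) (extCot g) x := by
  have h1 : extCot (SuperGeom.twist 1 f) =ᶠ[𝓝 x] sgn ε • extCot f := by
    have : SuperGeom.twist 1 f =ᶠ[𝓝 (x ∘ Sum.inl)] sgn ε • f := by
      filter_upwards [h] with z hz
      rw [twist_apply, tw_of_mem hz, one_mul, Pi.smul_apply]
    have h2 : extCot (sgn ε • f) = sgn ε • extCot f := ext_smul _ _ _ _
    rw [← h2]
    exact ext_eventuallyEq _ _ this
  have h3 : poisson S (extCot (SuperGeom.twist 1 f)) =ᶠ[𝓝 x] sgn ε • poisson S (extCot f) := by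
    filter_upwards [eventually_eventually_nhds.2 h1, (SmoothAt.extCot hf).eventually] with z h4 h5
    rw [poisson_congr (Filter.EventuallyEq.refl _ S) h4, poisson_smul_right _ h5, Pi.smul_apply]
  rw [← hS.schoutenBracket_eq hx hf hg, schoutenBracket, Pi.neg_apply,
    poisson_congr h3 (Filter.EventuallyEq.refl _ _),
    poisson_smul_left _ ((hS.smooth x hx).poisson (SmoothAt.extCot hf)), sgn_add, sgn_one]
  simp

/-- The Jacobi identity. -/
theorem IsQuadratic.bracket_jacobi (hS : IsQuadratic S U)
    (hSS : ∀ x : D.cot.ev → ℝ, x ∘ Sum.inl ∈ U → poisson S S x = 0) (hy : y ∈ U)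
    (hf : SmoothAt f y) (hg : SmoothAt g y) (hh : SmoothAt h y) (h1 : ParNear ε f y)
    (h2 : ParNear δ g y) :
    bracket S f (bracket S g h) y = bracket S (bracket S f g) h y +
      sgn ((ε + 1) * (δ + 1)) • bracket S g (bracket S f h) y := by
  have hx : zeroCovector y ∘ Sum.inl ∈ U := hy
  set x : D.cot.ev → ℝ := zeroCovector y with hxy
  have hS1 := hS.smooth x hx
  have hSp : ParNear 1 S x := .of_forall hS.odd
  have sf : SmoothAt (extCot f) x := SmoothAt.extCot hf
  have sg : SmoothAt (extCot g) x := SmoothAt.extCot hg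
  have sh : SmoothAt (extCot h) x := SmoothAt.extCot hh
  have hc := (continuous_comp_left (D := D) (D' := D.cot) Sum.inl).continuousAt (x := x)
  have pf : ParNear ε (extCot f) x := by
    filter_upwards [hc.eventually h1] with z hz
    exact ext_mem hz
  have pg : ParNear δ (extCot g) x := by
    filter_upwards [hc.eventually h2] with z hz
    exact ext_mem hz
  have ev : ∀ {f g : D.Fn} {ε : ZMod 2}, SmoothAt f y → SmoothAt g y → ParNear ε f y →
      extCot (bracket S f g) =ᶠ[𝓝 x]
        sgn (ε + 1) • poisson (poisson S (extCot f)) (extCot g) := by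
    intro f g ε h3 h4 h5
    filter_upwards [hc.eventually (hS.isOpen.mem_nhds hx), hc.eventually h3.eventually,
      hc.eventually h4.eventually, hc.eventually h5.eventually] with z z1 z2 z3 z4
    exact hS.extCot_bracket z1 z2 z3 z4
  have sX : SmoothAt (poisson S (extCot f)) x := hS1.poisson sf
  have sY : SmoothAt (poisson S (extCot g)) x := hS1.poisson sg
  have pX : ParNear (ε + 1) (poisson S (extCot f)) x := hSp.poisson hS1 sf pf (add_comm _ _)
  have pY : ParNear (δ + 1) (poisson S (extCot g)) x := hSp.poisson hS1 sg pg (add_comm _ _)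
  have refl := fun F : D.cot.Fn => Filter.EventuallyEq.refl (𝓝 x) F
  have e1 : extCot (bracket S f (bracket S g h)) x = (sgn (ε + 1) * sgn (δ + 1)) •
      poisson (poisson S (extCot f)) (poisson (poisson S (extCot g)) (extCot h)) x := by
    rw [hS.extCot_bracket hx hf (hS.smoothAt_bracket hy hg hh) h1,
      poisson_congr (refl _) (ev hg hh h2), poisson_smul_right _ (sY.poisson sh), smul_smul]
  have e2 : extCot (bracket S g (bracket S f h)) x = (sgn (ε + 1) * sgn (δ + 1)) •
      poisson (poisson S (extCot g)) (poisson (poisson S (extCot f)) (extCot h)) x := by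
    rw [hS.extCot_bracket hx hg (hS.smoothAt_bracket hy hf hh) h2,
      poisson_congr (refl _) (ev hf hh h1), poisson_smul_right _ (sX.poisson sh), smul_smul,
      mul_comm]
  -- Up to sign this is `{S, {S, f}}`, which vanishes because `{S, S} = 0`.
  have hz : poisson (poisson S (extCot f)) S =ᶠ[𝓝 x] 0 := by
    filter_upwards [hc.eventually (hS.isOpen.mem_nhds hx), sX.eventually, sf.eventually,
      pX.eventually] with z z1 z3 z5 z6
    have w2 : ParNear 1 S z := .of_forall hS.odd
    rw [poisson_skew z3 (hS.smooth z z1) z6 w2, hS.poisson_poisson_self hSS z1 z5, smul_zero,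
      neg_zero, Pi.zero_apply]
  -- The map `f ↦ {S, f}` takes the Schouten bracket to the Poisson bracket: in the Jacobi identity
  -- for `{S,f}`, `S`, `g` the term with `{{S,f},S}` is absent. What remains is the Jacobi identity
  -- for `{S,f}`, `{S,g}` and `h`.
  have e4 : poisson S (extCot (bracket S f g)) =ᶠ[𝓝 x]
      poisson (poisson S (extCot f)) (poisson S (extCot g)) := by
    filter_upwards [hc.eventually (hS.isOpen.mem_nhds hx), (ev hf hg h1).eventually_nhds,
      sX.eventually, sg.eventually, pX.eventually, hz.eventually_nhds]
      with z z1 z2 z3 z4 z6 z8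
    have w1 := hS.smooth z z1
    have w2 : ParNear 1 S z := .of_forall hS.odd
    have w3 : poisson (poisson (poisson S (extCot f)) S) (extCot g) z = 0 := by
      rw [poisson_congr z8 (Filter.EventuallyEq.refl _ (extCot g)),
        poisson_apply (smoothAt_zero z)]
      simp [pd_zero]
    rw [poisson_congr (Filter.EventuallyEq.refl _ S) z2, poisson_smul_right _ (z3.poisson z4),
      poisson_jacobi z3 w1 z4 z6 w2, w3, zero_add, mul_one]
  have e3 : extCot (bracket S (bracket S f g) h) x = (sgn (ε + 1) * sgn (δ + 1)) •
      poisson (poisson (poisson S (extCot f)) (poisson S (extCot g))) (extCot h) x := by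
    rw [hS.extCot_bracket hx (hS.smoothAt_bracket hy hf hg) hh
      (hS.bracket_parNear hy hf hg h1 h2), poisson_congr e4 (refl _), ← sgn_add]
    congr 2
    clear * -
    revert ε δ; decide
  refine extCot_injective_at (g := bracket S (bracket S f g) h +
      sgn ((ε + 1) * (δ + 1)) • bracket S g (bracket S f h)) ?_
  have e5 : extCot (bracket S (bracket S f g) h +
      sgn ((ε + 1) * (δ + 1)) • bracket S g (bracket S f h)) =
      extCot (bracket S (bracket S f g) h) +
      sgn ((ε + 1) * (δ + 1)) • extCot (bracket S g (bracket S f h)) := by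
    unfold extCot
    rw [ext_add, ext_smul]
  rw [e5, Pi.add_apply, Pi.smul_apply, e1, e2, e3, poisson_jacobi sX sY sh pX pY, smul_add,
    smul_comm]

end Bracket

end SuperGeom

end
noncomputable section
namespace SuperGeom

/-! ### Invariance of the Schouten bracket under changes of coordinates -/

section Invariance

variable {D : SuperDim} {M : Gluing D}

theorem Gluing.IsSchouten.isQuadratic (h : M.IsAtlas) {S : M.cot.Fam} (hS : M.IsSchouten S)
    (a : M.Idx) : IsQuadratic (S a) (M.dom a) where
  isOpen := h.isOpen_dom a
  smooth _ hx := hS.isFunction.smoothAt (isOpen_cot_dom h a) hx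
  odd := hS.odd a
  weight _ hx := hS.quadratic.weightNear (isOpen_cot_dom h a) hx

theorem pd_mom_cot_trans_pos (h : M.IsAtlas) {a b : M.Idx} {x : D.cot.ev → ℝ}
    (hx : x ∈ M.cot.ovl a b) (A B : D.Coord) :
    pd (mom A) (M.cot.trans a b (pos B)) x = 0 := by
  rw [cot_trans_pos]
  exact pd_mom_extCot (h.smoothAt hx B) A

/-- Momenta transform linearly with coefficients from the base; the derivative reaches the momentum
only after passing the coefficient, whence the sign. -/
theorem pd_mom_cot_trans_mom (h : M.IsAtlas) {a b : M.Idx} {x : D.cot.ev → ℝ}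
    (hx : x ∈ M.cot.ovl a b) (A B : D.Coord) :
    pd (mom A) (M.cot.trans a b (mom B)) x =
      sgn (D.par A * (D.par A + D.par B)) • extCot (M.jacInv a b B A) x := by
  classical
  have hs : ∀ C, SmoothAt (extCot (M.jacInv a b B C)) x := fun C =>
    SmoothAt.extCot (h.smoothAt_jacInv hx B C)
  have m : extCot (M.jacInv a b B A) x ∈ grPart D.cot (D.par B + D.par A) :=
    ext_mem (D := D) (D' := D.cot) (f := M.jacInv a b B A) (h.jacInv_mem hx B A)
  rw [cot_trans_mom, momTrans_eq, pd_sum _ _ fun C _ => (hs C).mul (smoothAt_coord _ _),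
    Finset.sum_eq_single A]
  · rw [pd_mul _ (hs A) (smoothAt_coord _ _), pd_mom_extCot (h.smoothAt_jacInv hx B A), zero_mul,
      zero_add, pd_coord, if_pos rfl, mul_one, par_mom,
      tw_of_mem m, add_comm (D.par B)]
  · intro C _ hC
    rw [pd_mul _ (hs C) (smoothAt_coord _ _), pd_mom_extCot (h.smoothAt_jacInv hx B C), zero_mul,
      zero_add, pd_coord, if_neg fun hAC => hC (mom_injective hAC).symm, mul_zero]
  · simp

/-- Position components of the transition map do not depend on the momenta, so the chain rule runs
over momenta only. -/
theorem pd_mom_subst (h : M.IsAtlas) {a b : M.Idx} {x : D.cot.ev → ℝ}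
    (hx : x ∈ M.cot.ovl a b) {F : D.cot.Fn} (hF : SmoothAt F (body (M.cot.trans a b) x))
    (A : D.Coord) : pd (mom A) (subst (M.cot.trans a b) F) x =
      ∑ B, sgn (D.par A * (D.par A + D.par B)) •
        (extCot (M.jacInv a b B A) x * subst (M.cot.trans a b) (pd (mom B) F) x) := by
  rw [pd_subst (cot_morAt h hx) hF]
  symm
  refine Fintype.sum_of_injective mom mom_injective _ _ ?_ ?_
  · intro Z hZ
    obtain ⟨B, rfl | rfl⟩ := cot_coord_cases Z
    · rw [pd_mom_cot_trans_pos h hx, zero_mul]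
    · exact absurd ⟨B, rfl⟩ hZ
  · intro B
    rw [pd_mom_cot_trans_mom h hx, smul_mul_assoc]

/-- The Hessian transforms as a contravariant two-tensor: the Jacobian factor produced by the first
momentum derivative is a base function, so the second derivative creates no inhomogeneous term. -/
theorem hess_compat (h : M.IsAtlas) {S : M.cot.Fam} (hS : M.IsSchouten S) {a b : M.Idx}
    {y : D.ev → ℝ} (hy : y ∈ M.ovl a b) (A C : D.Coord) :
    hess (S a) A C y = ∑ B, ∑ E, sgn (D.par A * (D.par C + D.par E)) •
      (subst (M.trans a b) (hess (S b) B E) y * (M.jacInv a b B A y * M.jacInv a b E C y)) := by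
  have hx : zeroCovector y ∈ M.cot.ovl a b := hy
  set x : D.cot.ev → ℝ := zeroCovector y with hxy
  have hc := (continuous_comp_left (D := D) (D' := D.cot) Sum.inl).continuousAt (x := x)
  have qa := hS.isQuadratic h a
  have qb := hS.isQuadratic h b
  have hb := body_cot_mem_dom h hx
  have hev : ∀ᶠ z in 𝓝 x, z ∈ M.cot.ovl a b := (isOpen_cot_ovl h a b).mem_nhds hx
  have sb : ∀ {z}, z ∈ M.cot.ovl a b → SmoothAt (S b) (body (M.cot.trans a b) z) := fun hz =>
    qb.smooth _ (body_cot_mem_dom h hz)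
  have sJ : ∀ B E, SmoothAt (extCot (M.jacInv a b B E)) x := fun B E =>
    SmoothAt.extCot (h.smoothAt_jacInv hy B E)
  have e0 : S a =ᶠ[𝓝 x] subst (M.cot.trans a b) (S b) := by
    filter_upwards [hev] with z hz
    exact hS.isFunction.compat a b z hz
  have sP : ∀ B, SmoothAt (subst (M.cot.trans a b) (pd (mom B) (S b))) x := fun B =>
    smoothAt_subst (cot_morAt h hx) ((sb hx).pd _)
  have e1 : pd (mom A) (S a) =ᶠ[𝓝 x] ∑ B, sgn (D.par A * (D.par A + D.par B)) •
      (extCot (M.jacInv a b B A) * subst (M.cot.trans a b) (pd (mom B) (S b))) := by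
    filter_upwards [pd_eventuallyEq (mom A) e0, hev] with z h1 h2
    rw [h1, pd_mom_subst h h2 (sb h2), Finset.sum_apply]
    rfl
  have sq : ∀ B E, SmoothAt (hess (S b) B E) (body (M.trans a b) y) := fun B E =>
    qb.smoothAt_hess (h.body_mem_dom hy) B E
  have e2 : ∀ B E, subst (M.cot.trans a b) (pd (mom E) (pd (mom B) (S b))) x =
      extCot (subst (M.trans a b) (hess (S b) B E)) x := by
    intro B E
    rw [← subst_extCot h hx (sq B E)]
    refine subst_congr ?_
    filter_upwards [(isOpen_cot_dom h b).mem_nhds hb] with z hz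
    exact (qb.extCot_hess hz B E).symm
  refine extCot_injective_at (g := ∑ B, ∑ E, sgn (D.par A * (D.par C + D.par E)) •
      (subst (M.trans a b) (hess (S b) B E) * (M.jacInv a b B A * M.jacInv a b E C))) ?_ |>.trans
      (by simp only [Finset.sum_apply, Pi.smul_apply, Pi.mul_apply])
  have e3 : extCot (∑ B, ∑ E, sgn (D.par A * (D.par C + D.par E)) •
      (subst (M.trans a b) (hess (S b) B E) * (M.jacInv a b B A * M.jacInv a b E C))) x =
      ∑ B, ∑ E, sgn (D.par A * (D.par C + D.par E)) •
      (extCot (subst (M.trans a b) (hess (S b) B E)) x *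
        (extCot (M.jacInv a b B A) x * extCot (M.jacInv a b E C) x)) := by
    unfold extCot
    simp only [ext_sum, ext_smul, ext_mul, Finset.sum_apply, Pi.smul_apply, Pi.mul_apply]
  rw [qa.extCot_hess (x := x) (h.ovl_subset a b hy), pd_congr _ e1, e3,
    pd_sum _ _ fun B _ => ((sJ B A).mul (sP B)).smul _]
  refine Finset.sum_congr rfl fun B _ => ?_
  -- This vanishing is the reason for tensoriality.
  have m0 : pd (mom C) (extCot (M.jacInv a b B A)) x = 0 :=
    pd_mom_extCot (x := x) (h.smoothAt_jacInv hy B A) C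
  rw [pd_smul _ _ ((sJ B A).mul (sP B)), pd_mul _ (sJ B A) (sP B), m0, zero_mul, zero_add,
    pd_mom_subst h hx ((sb hx).pd _), Finset.mul_sum, Finset.smul_sum]
  refine Finset.sum_congr rfl fun E _ => ?_
  have m1 : extCot (M.jacInv a b B A) x ∈ grPart D.cot (D.par B + D.par A) :=
    ext_mem (h.jacInv_mem hy B A)
  have m2 : extCot (M.jacInv a b E C) x ∈ grPart D.cot (D.par E + D.par C) :=
    ext_mem (h.jacInv_mem hy E C)
  have m3 : extCot (subst (M.trans a b) (hess (S b) B E)) x ∈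
      grPart D.cot (1 + D.par B + D.par E) :=
    ext_mem (subst_mem (h.morAt hy).parAt (sq B E) (qb.hess_parNear (h.body_mem_dom hy) B E))
  rw [tw_of_mem m1, par_mom, e2, mul_smul_comm, ← mul_assoc, smul_mul_assoc, smul_mul_assoc,
    mul_comm_sgn (mul_mem_grPart m1 m2 rfl) m3]
  simp only [sgn_smul_sgn_smul]
  congr 2
  generalize D.par A = a; generalize D.par B = b; generalize D.par C = c
  generalize D.par E = e
  clear * -
  revert a b c e; decide

theorem subst_pd_twist (h : M.IsAtlas) {a b : M.Idx} {y : D.ev → ℝ} (hy : y ∈ M.ovl a b)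
    {f : D.Fn} (hf : SmoothAt f (body (M.trans a b) y)) (ε : ZMod 2) (A : D.Coord) :
    subst (M.trans a b) (pd A (twist ε f)) y =
      ∑ C, M.jacInv a b A C y * pd C (twist ε (subst (M.trans a b) f)) y := by
  rw [h.subst_pd hy (hf.twist ε)]
  refine Finset.sum_congr rfl fun C _ => congrArg (M.jacInv a b A C y * ·) (pd_congr _ ?_)
  have hc := (continuousAt_body (h.morAt hy).smooth).eventually hf.eventually
  filter_upwards [hc, (h.morAt hy).parity] with z h1 h2
  rw [subst_twist h2 ε h1, twist_apply]

theorem subst_bracket (h : M.IsAtlas) {S : M.cot.Fam} (hS : M.IsSchouten S) {a b : M.Idx}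
    {y : D.ev → ℝ} (hy : y ∈ M.ovl a b) {f g : D.Fn}
    (hf : SmoothAt f (body (M.trans a b) y)) (hg : SmoothAt g (body (M.trans a b) y)) :
    subst (M.trans a b) (bracket (S b) f g) y = -∑ E, ∑ B, ∑ C, ∑ A,
      subst (M.trans a b) (hess (S b) B E) y *
        (M.jacInv a b B A y * pd A (twist (D.par E + 1) (subst (M.trans a b) f)) y) *
          (M.jacInv a b E C y * pd C (subst (M.trans a b) g) y) := by
  have hp := (h.morAt hy).parAt
  have qb := hS.isQuadratic h b
  have hb := h.body_mem_dom hy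
  have sq := fun A B => qb.smoothAt_hess hb A B
  have st := fun ε A => (hf.twist ε).pd A
  rw [bracket, subst_sum _ fun E _ => (qb.smoothAt_hamVec hb hf E).mul (hg.pd E),
    ← Finset.sum_neg_distrib]
  refine Finset.sum_congr rfl fun E _ => ?_
  rw [subst_mul hp (qb.smoothAt_hamVec hb hf E) (hg.pd E), hamVec,
    subst_neg (SmoothAt.sum _ fun B _ => (sq B E).mul (st _ B)),
    subst_sum _ fun B _ => (sq B E).mul (st _ B), neg_mul, Finset.sum_mul]
  refine congrArg Neg.neg (Finset.sum_congr rfl fun B _ => ?_)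
  rw [subst_mul hp (sq B E) (st _ B), subst_pd_twist h hy hf, h.subst_pd hy hg, Finset.mul_sum]
  refine Finset.sum_congr rfl fun C _ => ?_
  rw [Finset.mul_sum, Finset.sum_mul]

theorem bracket_eq_sum_jacInv (h : M.IsAtlas) {S : M.cot.Fam} (hS : M.IsSchouten S) {a b : M.Idx}
    {y : D.ev → ℝ} (hy : y ∈ M.ovl a b) (F G : D.Fn) :
    bracket (S a) F G y = -∑ C, ∑ A, ∑ B, ∑ E, sgn (D.par A * (D.par C + D.par E)) •
      (subst (M.trans a b) (hess (S b) B E) y * (M.jacInv a b B A y * M.jacInv a b E C y)) *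
        pd A (twist (D.par C + 1) F) y * pd C G y := by
  rw [bracket_apply, ← Finset.sum_neg_distrib]
  refine Finset.sum_congr rfl fun C _ => ?_
  rw [hamVec_apply, neg_mul, Finset.sum_mul]
  refine congrArg Neg.neg (Finset.sum_congr rfl fun A _ => ?_)
  rw [hess_compat h hS hy, Finset.sum_mul, Finset.sum_mul]
  refine Finset.sum_congr rfl fun B _ => ?_
  rw [Finset.sum_mul, Finset.sum_mul]

/-- Carrying the Jacobian entry to the other side changes the twist from the index `C` of one chart
to the index `E` of the other, which is the mismatch between the two formulas for the bracket. -/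
theorem mul_pd_twist_comm {F : D.Fn} {y : D.ev → ℝ} (hF : SmoothAt F y) {E C : D.Coord}
    {J : D.Gr} (hJ : J ∈ grPart D (D.par E + D.par C)) (A : D.Coord) :
    J * pd A (twist (D.par C + 1) F) y = sgn (D.par A * (D.par C + D.par E)) •
      (pd A (twist (D.par E + 1) F) y * J) := by
  have h1 : D.par E + D.par C + (D.par E + 1) = D.par C + 1 := by
    generalize D.par C = c; generalize D.par E = e
    clear * -
    revert c e; decide
  have h2 : twist (D.par C + 1) F = twist (D.par E + D.par C) (twist (D.par E + 1) F) := by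
    ext1 z
    rw [twist_apply, twist_apply, twist_apply, tw_tw, h1]
  rw [h2, pd_twist _ _ (hF.twist _), mul_comm_tw hJ, map_smul, tw_tw_self, smul_mul_assoc,
    mul_comm (D.par A), add_comm (D.par C)]

/-- Both sides become the same fourfold sum of one pulled-back Hessian entry, two Jacobian entries
and two derivatives. The left side gets its Jacobians from the derivatives of the functions, the
right side from the Hessian. -/
theorem bracket_compat (h : M.IsAtlas) {S : M.cot.Fam} (hS : M.IsSchouten S) {a b : M.Idx}
    {y : D.ev → ℝ} (hy : y ∈ M.ovl a b) {f g : D.Fn}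
    (hf : SmoothAt f (body (M.trans a b) y)) (hg : SmoothAt g (body (M.trans a b) y)) :
    subst (M.trans a b) (bracket (S b) f g) y =
      bracket (S a) (subst (M.trans a b) f) (subst (M.trans a b) g) y := by
  have sF : SmoothAt (subst (M.trans a b) f) y := smoothAt_subst (h.morAt hy) hf
  have e (q k p' g' : D.Gr) (E C A : D.Coord) : q * (k * p') * (M.jacInv a b E C y * g') =
      q * (k * (p' * M.jacInv a b E C y)) * g' := by
    simp only [mul_assoc]
  have e' (q k g' : D.Gr) (E C A : D.Coord) : sgn (D.par A * (D.par C + D.par E)) •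
      (q * (k * M.jacInv a b E C y)) * pd A (twist (D.par C + 1) (subst (M.trans a b) f)) y * g' =
      q * (k * (pd A (twist (D.par E + 1) (subst (M.trans a b) f)) y * M.jacInv a b E C y)) *
        g' := by
    rw [mul_assoc q, smul_mul_assoc, mul_assoc q, mul_assoc k,
      mul_pd_twist_comm sF (h.jacInv_mem hy E C) A, mul_smul_comm, mul_smul_comm,
      sgn_smul_sgn_smul, zmod_two_add_self, sgn_zero, one_smul, mul_assoc q]
  rw [subst_bracket h hS hy hf hg, bracket_eq_sum_jacInv h hS hy]
  refine congrArg Neg.neg ?_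
  -- The summations are permuted from the order `E, B, C, A` to `C, A, B, E`.
  rw [Finset.sum_comm_cycle]
  refine Finset.sum_congr rfl fun C _ => ?_
  rw [Finset.sum_comm_cycle]
  refine Finset.sum_congr rfl fun A _ => Finset.sum_comm.trans ?_
  refine Finset.sum_congr rfl fun B _ => Finset.sum_congr rfl fun E _ => ?_
  rw [e _ _ _ _ E C A, e']

end Invariance

end SuperGeom

end
noncomputable section
namespace SuperGeom

/-! ### The product of a supermanifold and the real line -/

section LineManifold

variable {D R : SuperDim} {M : Gluing D}

theorem body_line_time (a b : M.Idx) (x : D.line.ev → ℝ) :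
    body (M.line.trans a b) x (.inr ()) = x (.inr ()) := by
  change ExteriorAlgebra.algebraMapInv (algebraMap ℝ _ (x (.inr ()))) = _
  simp

/-- Every condition splits into the one for `M` and one for `t`, which all chart changes leave
fixed; only separation needs a separate argument for `t`. -/
theorem Gluing.IsSupermanifold.line (h : M.IsSupermanifold) : M.line.IsSupermanifold where
  isOpen_dom := h.isAtlas.line.isOpen_dom
  isOpen_ovl := h.isAtlas.line.isOpen_ovl
  ovl_subset := h.isAtlas.line.ovl_subset
  ovl_self := fun (a : M.Idx) => by
    ext x
    exact Set.ext_iff.1 (h.ovl_self a) (x ∘ Sum.inl)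
  smooth := h.isAtlas.line.smooth
  parity := h.isAtlas.line.parity
  maps := h.isAtlas.line.maps
  trans_self := fun (a : M.Idx) A x hx => by
    rcases line_coord_cases A with ⟨B, rfl⟩ | rfl
    · rw [line_trans_lineBase, ← extLine_coord]
      exact ext_apply_congr _ _ (h.trans_self a B _ hx)
    · rfl
  ovl_comp := fun (a b c : M.Idx) x hx hx' => by
    refine h.ovl_comp a b c (x ∘ Sum.inl) hx ?_
    rw [← body_line]
    exact hx'
  cocycle := fun (a b c : M.Idx) A x hx hx' => by
    have hx2 : body (M.trans a b) (x ∘ Sum.inl) ∈ M.ovl b c := by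
      rw [← body_line]
      exact hx'
    rcases line_coord_cases A with ⟨B, rfl⟩ | rfl
    · rw [line_trans_lineBase, line_trans_lineBase,
        subst_extLine h.isAtlas hx (h.isAtlas.smoothAt hx2 B)]
      exact ext_apply_congr _ _ (h.cocycle a b c B _ hx hx2)
    · rw [line_trans_lineTime, line_trans_lineTime, subst_coord (line_parAt h.isAtlas hx),
        line_trans_lineTime]
  hausdorff := fun (a b : M.Idx) x hx y hy hxy => by
    have hc : Continuous fun x : D.line.ev → ℝ => (x ∘ Sum.inl : D.ev → ℝ) :=
      continuous_comp_left (D := D) (D' := D.line) Sum.inl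
    have h1 := h.hausdorff a b _ hx _ hy fun U hU V hV => by
      obtain ⟨z, ⟨hz, hz'⟩, hz''⟩ := hxy _ (hc.continuousAt.preimage_mem_nhds hU) _
        (hc.continuousAt.preimage_mem_nhds hV)
      refine ⟨z ∘ Sum.inl, ⟨hz, hz'⟩, ?_⟩
      rw [← body_line]
      exact hz''
    refine ⟨h1.1, ?_⟩
    -- Disjoint neighbourhoods of different values of `t` would contradict the assumption, since a
    -- transition does not move `t`.
    have ht : x (.inr ()) = y (.inr ()) := by
      by_contra hne
      obtain ⟨U, V, hU, hV, hxU, hyV, hUV⟩ := t2_separation hne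
      have hct : Continuous fun z : D.line.ev → ℝ => z (.inr ()) := continuous_apply _
      obtain ⟨z, ⟨hz, _⟩, hz''⟩ := hxy _ (hct.continuousAt.preimage_mem_nhds (hU.mem_nhds hxU)) _
        (hct.continuousAt.preimage_mem_nhds (hV.mem_nhds hyV))
      have hz3 : body (M.line.trans a b) z (.inr ()) ∈ V := hz''
      rw [body_line_time] at hz3
      exact Set.disjoint_left.1 hUV hz hz3
    funext i
    rcases i with i | ⟨⟩
    · exact (congrFun (body_line a b x) i).trans (congrFun h1.2 i)
    · rw [body_line_time, ht]
  secondCountable := by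
    obtain ⟨C, hC, hC'⟩ := h.secondCountable
    exact ⟨C, hC, fun a x hx => hC' a _ hx⟩

theorem BundleGluing.IsBundle.smoothAt {E : BundleGluing M R} (h : E.IsBundle) {a b : M.Idx}
    {x : D.ev → ℝ} (hx : x ∈ M.ovl a b) (α β : R.Coord) : SmoothAt (E.G a b α β) x :=
  (h.smooth a b α β).smoothAt (h.base.isOpen_ovl a b) hx

theorem BundleGluing.IsBundle.pullbackLine {E : BundleGluing M R} (h : E.IsBundle) :
    E.pullbackLine.IsBundle where
  base := h.base.line
  smooth := fun (a b : M.Idx) α β => smoothOn_of_smoothAt fun x hx =>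
    SmoothAt.ext (D := D) (D' := D.line) (h.smoothAt hx α β)
  parity := fun (a b : M.Idx) α β x hx =>
    ext_mem (D := D) (D' := D.line) (h.parity a b α β _ hx)
  self := fun (a : M.Idx) α β x hx => by
    classical
    have h1 := h.self a α β _ hx
    have h2 : E.G a a α β (x ∘ Sum.inl) = (if α = β then (1 : D.Fn) else 0) (x ∘ Sum.inl) := by
      rw [apply_ite (fun f : D.Fn => f (x ∘ Sum.inl))]
      refine h1.trans ?_
      congr
    refine (ext_apply_congr (D := D) (D' := D.line) Sum.inl id h2).trans ?_
    split_ifs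
    · rw [ext_one]; rfl
    · rw [ext_zero]; rfl
  cocycle := fun (a b c : M.Idx) α β x hx hx' => by
    have hx2 : body (M.trans a b) (x ∘ Sum.inl) ∈ M.ovl b c := by
      rw [← body_line]
      exact hx'
    have h1 : E.G a c α β (x ∘ Sum.inl) =
        (∑ γ, subst (M.trans a b) (E.G b c α γ) * E.G a b γ β) (x ∘ Sum.inl) := by
      rw [Finset.sum_apply]
      exact h.cocycle a b c α β _ hx hx2
    refine (ext_apply_congr (D := D) (D' := D.line) Sum.inl id h1).trans ?_
    rw [ext_sum, Finset.sum_apply]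
    refine Finset.sum_congr rfl fun γ _ => ?_
    rw [ext_mul, Pi.mul_apply]
    exact congrArg (· * _) (subst_extLine h.base.isAtlas hx (h.smoothAt hx2 α γ)).symm

end LineManifold

/-! ### The total space of the parity-reversed dual bundle -/

section Antidual

variable {D R : SuperDim} {M : Gluing D}

/-- The base coordinates among the coordinates of `ΠE*`. -/
def fibBase (R : SuperDim) {D : SuperDim} (A : D.Coord) : (D.antidual R).Coord :=
  Sum.map Sum.inl Sum.inl A

theorem antidual_coord_cases (Z : (D.antidual R).Coord) :
    (∃ A : D.Coord, Z = fibBase R A) ∨ ∃ α : R.Coord, Z = eta D α := by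
  rcases Z with (i | i) | (j | j)
  · exact .inl ⟨.inl i, rfl⟩
  · exact .inr ⟨.inr i, rfl⟩
  · exact .inl ⟨.inr j, rfl⟩
  · exact .inr ⟨.inl j, rfl⟩

theorem par_fibBase (A : D.Coord) : (D.antidual R).par (fibBase R A) = D.par A := by
  rcases A with i | i <;> rfl

theorem par_eta (α : R.Coord) : (D.antidual R).par (eta D α) = R.par α + 1 := by
  rcases α with i | i <;> rfl

theorem eta_injective : Function.Injective (eta D : R.Coord → (D.antidual R).Coord) := by
  rintro (i | i) (j | j) h <;> simp_all [eta]

theorem eta_ne_fibBase (α : R.Coord) (A : D.Coord) : eta D α ≠ fibBase R A := by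
  rcases α with i | i <;> rcases A with j | j <;> simp [eta, fibBase]

variable (E : BundleGluing M R)

theorem antidual_trans_fibBase (a b : M.Idx) (A : D.Coord) :
    E.antidual.trans a b (fibBase R A) = extFib R (M.trans a b A) := by
  rcases A with i | i <;> rfl

theorem antidual_trans_eta (a b : M.Idx) (α : R.Coord) :
    E.antidual.trans a b (eta D α) = etaTrans E a b α := by
  rcases α with i | i <;> rfl

theorem extFib_coord (A : D.Coord) : extFib R (coord A) = coord (fibBase R A) := ext_coord _ _ A

theorem body_antidual (a b : M.Idx) (x : (D.antidual R).ev → ℝ) :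
    body (E.antidual.trans a b) x ∘ Sum.inl = body (M.trans a b) (x ∘ Sum.inl) :=
  body_ext (D := D) (D' := D) (D₁ := D.antidual R) (D₁' := D.antidual R)
    (o := Sum.inl) (o' := Sum.inl) fun A => congrFun (antidual_trans_fibBase E a b A) x

variable {E}

theorem etaTrans_mem (h : E.IsBundle) {a b : M.Idx} {x : (D.antidual R).ev → ℝ}
    (hx : x ∈ E.antidual.ovl a b) (α : R.Coord) :
    etaTrans E a b α x ∈ grPart (D.antidual R) (R.par α + 1) := by
  rw [etaTrans, Finset.sum_apply]
  refine Submodule.sum_mem _ fun β _ => mul_mem_grPart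
    (ext_mem (D := D) (D' := D.antidual R) (h.parity a b α β _ hx)) (coord_mem _ x) ?_
  rw [par_eta]
  generalize R.par α = p; generalize R.par β = q
  clear * -
  revert p q; decide

theorem antidual_parAt (h : E.IsBundle) {a b : M.Idx} {x : (D.antidual R).ev → ℝ}
    (hx : x ∈ E.antidual.ovl a b) : ParAt (E.antidual.trans a b) x := by
  intro Z
  rcases antidual_coord_cases Z with ⟨A, rfl⟩ | ⟨α, rfl⟩
  · rw [antidual_trans_fibBase, par_fibBase]
    exact ext_mem (D := D) (D' := D.antidual R) (h.base.parity a b A _ hx)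
  · rw [antidual_trans_eta, par_eta]
    exact etaTrans_mem h hx α

theorem subst_extFib (h : E.IsBundle) {a b : M.Idx} {x : (D.antidual R).ev → ℝ}
    (hx : x ∈ E.antidual.ovl a b) {g : D.Fn}
    (hg : SmoothAt g (body (M.trans a b) (x ∘ Sum.inl))) :
    subst (E.antidual.trans a b) (extFib R g) x = extFib R (subst (M.trans a b) g) x :=
  subst_ext (D := D) (D' := D) (D₁ := D.antidual R) (D₁' := D.antidual R) (o := Sum.inl)
    (o' := Sum.inl) Sum.inl_injective Sum.inl_injective
    (fun A => congrFun (antidual_trans_fibBase E a b A) x) (antidual_parAt h hx)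
    (h.base.isAtlas.morAt hx).parAt hg

theorem smoothAt_etaTrans (h : E.IsBundle) {a b : M.Idx} {x : (D.antidual R).ev → ℝ}
    (hx : x ∘ Sum.inl ∈ M.ovl a b) (α : R.Coord) : SmoothAt (etaTrans E a b α) x :=
  SmoothAt.sum _ fun β _ => (SmoothAt.ext (D := D) (D' := D.antidual R)
    (h.smoothAt hx α β)).mul (smoothAt_coord _ _)

/-- Fibre coordinates transform linearly by the frame matrices, so the two chart changes are inverse
because the matrices of `E` for `a`, `b`, `a` multiply to the identity. -/
theorem BundleGluing.IsBundle.antidual (h : E.IsBundle) : E.antidual.IsAtlas where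
  isOpen_dom := fun (a : M.Idx) => (h.base.isOpen_dom a).preimage
    (continuous_comp_left (D := D) (D' := D.antidual R) Sum.inl)
  isOpen_ovl := fun (a b : M.Idx) => (h.base.isOpen_ovl a b).preimage
    (continuous_comp_left (D := D) (D' := D.antidual R) Sum.inl)
  ovl_subset := fun (a b : M.Idx) x hx => h.base.ovl_subset a b hx
  smooth := fun (a b : M.Idx) Z => by
    refine smoothOn_of_smoothAt fun x hx => ?_
    rcases antidual_coord_cases Z with ⟨A, rfl⟩ | ⟨α, rfl⟩
    · rw [antidual_trans_fibBase]
      exact SmoothAt.ext (D := D) (D' := D.antidual R) (h.base.isAtlas.smoothAt hx A)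
    · rw [antidual_trans_eta]
      exact smoothAt_etaTrans h hx α
  parity := fun (a b : M.Idx) Z x hx => antidual_parAt h hx Z
  maps := fun (a b : M.Idx) x hx => by
    have := h.base.maps a b _ hx
    change body (E.antidual.trans a b) x ∘ Sum.inl ∈ M.ovl b a
    rwa [body_antidual]
  inverse := fun (a b : M.Idx) Z x hx => by
    classical
    have hx' := h.base.maps a b _ hx
    rcases antidual_coord_cases Z with ⟨A, rfl⟩ | ⟨α, rfl⟩
    · rw [antidual_trans_fibBase, subst_extFib h hx (h.base.isAtlas.smoothAt hx' A),
        ← extFib_coord]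
      exact ext_apply_congr (D := D) (D' := D.antidual R) _ _ (h.base.isAtlas.inverse a b A _ hx)
    · have hs : ∀ β, SmoothAt (extFib R (E.G b a α β)) (body (E.antidual.trans a b) x) :=
        fun β => SmoothAt.ext (D := D) (D' := D.antidual R) (by
          rw [body_antidual]; exact h.smoothAt hx' α β)
      have hp := antidual_parAt h hx
      -- The bundle cocycle closes up at the chart `a`, where the frame matrix is the identity.
      have hc : ∀ γ, (∑ β, subst (M.trans a b) (E.G b a α β) * E.G a b β γ) (x ∘ Sum.inl) =
          (if α = γ then (1 : D.Fn) else 0) (x ∘ Sum.inl) := by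
        intro γ
        have h1 := h.self a α γ _ (h.base.ovl_subset a b hx)
        rw [h.cocycle a b a α γ _ hx hx'] at h1
        rw [apply_ite (fun f : D.Fn => f (x ∘ Sum.inl)), Finset.sum_apply]
        refine h1.trans ?_
        congr
      rw [antidual_trans_eta, etaTrans, subst_sum _ fun β _ => (hs β).mul (smoothAt_coord _ _)]
      have h2 : ∀ β, subst (E.antidual.trans a b) (extFib R (E.G b a α β) * coord (eta D β)) x =
          ∑ γ, extFib R (subst (M.trans a b) (E.G b a α β) * E.G a b β γ) x *
            coord (eta D γ) x := by
        intro β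
        rw [subst_mul hp (hs β) (smoothAt_coord _ _), subst_coord hp, antidual_trans_eta,
          subst_extFib h hx (h.smoothAt hx' α β), etaTrans, Finset.sum_apply, Finset.mul_sum]
        refine Finset.sum_congr rfl fun γ _ => ?_
        unfold extFib
        rw [Pi.mul_apply, ext_mul, Pi.mul_apply, mul_assoc]
      simp only [h2]
      rw [Finset.sum_comm, Finset.sum_eq_single α]
      · rw [← Finset.sum_mul, ← Finset.sum_apply]
        unfold extFib
        rw [← ext_sum, ext_apply_congr _ _ (hc α), if_pos rfl, ext_one, Pi.one_apply, one_mul]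
      · intro γ _ hγ
        rw [← Finset.sum_mul, ← Finset.sum_apply]
        unfold extFib
        rw [← ext_sum, ext_apply_congr _ _ (hc γ), if_neg hγ.symm, ext_zero, Pi.zero_apply,
          zero_mul]
      · simp

end Antidual

end SuperGeom

end
noncomputable section
namespace SuperGeom

/-! ### Functions on `ΠE* × ℝ` -/

section Total

variable {D R : SuperDim} {M : Gluing D}

/-- The coordinates of `M × ℝ` among those of `ΠE* × ℝ`. -/
def baseCoord (R : SuperDim) {D : SuperDim} (A : D.line.Coord) : (D.antidual R).line.Coord :=
  Sum.map (Sum.map Sum.inl id) Sum.inl A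

/-- The fibre coordinates of `ΠE* × ℝ`. -/
abbrev fibCoord (D : SuperDim) {R : SuperDim} (α : R.Coord) : (D.antidual R).line.Coord :=
  lineBase (eta D α)

/-- The underlying point of `M × ℝ`. -/
def basePt (x : (D.antidual R).line.ev → ℝ) : D.line.ev → ℝ := x ∘ Sum.map Sum.inl id

/-- A point of `ΠE* × ℝ` over a given point of `M × ℝ`. -/
def zeroPt (R : SuperDim) {D : SuperDim} (y : D.line.ev → ℝ) : (D.antidual R).line.ev → ℝ :=
  body (zeroSection (D := D.line) (D' := (D.antidual R).line) (Sum.map Sum.inl id) Sum.inl) y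

/-- The weight of the coordinates of `ΠE* × ℝ`. -/
abbrev totalWeight (D R : SuperDim) : (D.antidual R).line.Coord → ℤ := lineWeight (etaWeight D R)

theorem sumMap_inl_id_injective : Function.Injective
    (Sum.map Sum.inl id : D.line.ev → (D.antidual R).line.ev) :=
  Sum.map_injective.2 ⟨Sum.inl_injective, Function.injective_id⟩

theorem basePt_zeroPt (y : D.line.ev → ℝ) : basePt (zeroPt R y) = y :=
  body_zeroSection sumMap_inl_id_injective Sum.inl_injective y

theorem continuous_basePt :
    Continuous (basePt : ((D.antidual R).line.ev → ℝ) → D.line.ev → ℝ) :=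
  continuous_comp_left (D := D.line) (D' := (D.antidual R).line) (Sum.map Sum.inl id)

theorem baseCoord_lineBase (A : D.Coord) : baseCoord R (lineBase A) = lineBase (fibBase R A) := by
  rcases A with i | i <;> rfl

theorem baseCoord_lineTime : baseCoord R (lineTime : D.line.Coord) = lineTime := rfl

theorem total_coord_cases (Z : (D.antidual R).line.Coord) :
    (∃ A, Z = baseCoord R A) ∨ ∃ α : R.Coord, Z = fibCoord D α := by
  rcases line_coord_cases Z with ⟨Z, rfl⟩ | rfl
  · rcases antidual_coord_cases Z with ⟨A, rfl⟩ | ⟨α, rfl⟩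
    · exact .inl ⟨lineBase A, (baseCoord_lineBase A).symm⟩
    · exact .inr ⟨α, rfl⟩
  · exact .inl ⟨lineTime, rfl⟩

theorem baseCoord_injective :
    Function.Injective (baseCoord R : D.line.Coord → (D.antidual R).line.Coord) :=
  Sum.map_injective.2 ⟨sumMap_inl_id_injective, Sum.inl_injective⟩

theorem fibCoord_injective :
    Function.Injective (fibCoord D : R.Coord → (D.antidual R).line.Coord) :=
  lineBase_injective.comp eta_injective

theorem fibCoord_ne_baseCoord (α : R.Coord) (A : D.line.Coord) :
    fibCoord D α ≠ baseCoord R A := by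
  rcases line_coord_cases A with ⟨A, rfl⟩ | rfl
  · rw [baseCoord_lineBase]
    exact fun h => eta_ne_fibBase α A (lineBase_injective h)
  · exact (lineTime_ne_lineBase _).symm

theorem fibCoord_notMem_range (α : R.Coord) : fibCoord D α ∉
    Set.range (Sum.map (Sum.map Sum.inl id) Sum.inl : D.line.Coord → (D.antidual R).line.Coord) :=
  fun ⟨A, hA⟩ => fibCoord_ne_baseCoord α A hA.symm

theorem par_baseCoord (A : D.line.Coord) :
    (D.antidual R).line.par (baseCoord R A) = D.line.par A := by
  rcases A with i | i <;> rfl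

theorem par_fibCoord (α : R.Coord) :
    (D.antidual R).line.par (fibCoord D α) = R.par α + 1 := by
  rcases α with i | i <;> rfl

theorem totalWeight_baseCoord (A : D.line.Coord) : totalWeight D R (baseCoord R A) = 0 := by
  rcases A with (i | i) | i <;> rfl

theorem totalWeight_fibCoord (α : R.Coord) : totalWeight D R (fibCoord D α) = 1 := by
  rcases α with i | i <;> rfl

theorem totalWeight_of_notMem (Z : (D.antidual R).line.Coord) (hZ : Z ∉
    Set.range (Sum.map (Sum.map Sum.inl id) Sum.inl : D.line.Coord → (D.antidual R).line.Coord)) :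
    totalWeight D R Z = 1 := by
  rcases total_coord_cases Z with ⟨A, rfl⟩ | ⟨α, rfl⟩
  · exact absurd ⟨A, rfl⟩ hZ
  · exact totalWeight_fibCoord α

variable {f g : D.line.Fn} {x : (D.antidual R).line.ev → ℝ}

theorem SmoothAt.extFibLine (hf : SmoothAt f (basePt x)) : SmoothAt (extFibLine R f) x :=
  SmoothAt.ext (D := D.line) (D' := (D.antidual R).line) hf

theorem extFibLine_congr (h : f (basePt x) = g (basePt x)) :
    SuperGeom.extFibLine R f x = SuperGeom.extFibLine R g x :=
  ext_apply_congr (D := D.line) (D' := (D.antidual R).line) _ _ h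

theorem extFibLine_injective_at
    (h : SuperGeom.extFibLine R f x = SuperGeom.extFibLine R g x) :
    f (basePt x) = g (basePt x) :=
  ext_injective_at (D := D.line) (D' := (D.antidual R).line) Sum.inl_injective h

theorem extFibLine_mem {ε : ZMod 2} (h : f (basePt x) ∈ grPart D.line ε) :
    SuperGeom.extFibLine R f x ∈ grPart (D.antidual R).line ε :=
  ext_mem (D := D.line) (D' := (D.antidual R).line) h

theorem weightNear_extFibLine (hf : SmoothAt f (basePt x)) :
    WeightNear (totalWeight D R) 0 (SuperGeom.extFibLine R f) x :=
  weightNear_ext_zero (D := D.line) (D' := (D.antidual R).line) sumMap_inl_id_injective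
    Sum.inl_injective totalWeight_baseCoord hf

theorem pd_baseCoord_extFibLine (hf : SmoothAt f (basePt x)) (A : D.line.Coord) :
    pd (baseCoord R A) (SuperGeom.extFibLine R f) x = SuperGeom.extFibLine R (pd A f) x :=
  pd_ext (D := D.line) (D' := (D.antidual R).line) sumMap_inl_id_injective Sum.inl_injective A hf

theorem pd_fibCoord_extFibLine (hf : SmoothAt f (basePt x)) (α : R.Coord) :
    pd (fibCoord D α) (SuperGeom.extFibLine R f) x = 0 :=
  pd_ext_of_notMem (D := D.line) (D' := (D.antidual R).line) (fibCoord_notMem_range α) hf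

/-! ### Functions linear in the fibre coordinates -/

/-- The function `c ^ α η_α`. -/
def linear (c : R.Coord → D.line.Fn) : (D.antidual R).line.Fn :=
  ∑ α, SuperGeom.extFibLine R (c α) * coord (fibCoord D α)

theorem linearFn_eq (E : BundleGluing M R) (u : E.pullbackLine.SFam) (a : M.Idx) :
    E.linearFn u a = linear (u a) := rfl

variable {c c' : R.Coord → D.line.Fn}

theorem linear_apply (c : R.Coord → D.line.Fn) (x : (D.antidual R).line.ev → ℝ) :
    linear c x = ∑ α, SuperGeom.extFibLine R (c α) x * coord (fibCoord D α) x := by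
  simp [linear]

theorem linear_congr (h : ∀ α, c α (basePt x) = c' α (basePt x)) : linear c x = linear c' x := by
  simp only [linear_apply]
  exact Finset.sum_congr rfl fun α _ => congrArg (· * _) (extFibLine_congr (h α))

theorem linear_add (c c' : R.Coord → D.line.Fn) : linear (c + c') = linear c + linear c' := by
  unfold linear SuperGeom.extFibLine
  simp only [Pi.add_apply, ext_add, add_mul, Finset.sum_add_distrib]

theorem linear_smul (r : ℝ) (c : R.Coord → D.line.Fn) : linear (r • c) = r • linear c := by
  unfold linear SuperGeom.extFibLine
  simp only [Pi.smul_apply, ext_smul, smul_mul_assoc, Finset.smul_sum]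

theorem linear_mul (f : D.line.Fn) (c : R.Coord → D.line.Fn) :
    linear (fun α => f * c α) = SuperGeom.extFibLine R f * linear c := by
  unfold linear SuperGeom.extFibLine
  simp only [ext_mul, mul_assoc, Finset.mul_sum]

theorem smoothAt_linear (hc : ∀ α, SmoothAt (c α) (basePt x)) : SmoothAt (linear c) x :=
  SmoothAt.sum _ fun α _ => (SmoothAt.extFibLine (hc α)).mul (smoothAt_coord _ _)

theorem linear_mem {ε : ZMod 2} (hc : ∀ α, c α (basePt x) ∈ grPart D.line (ε + R.par α)) :
    linear c x ∈ grPart (D.antidual R).line (ε + 1) := by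
  rw [linear_apply]
  refine Submodule.sum_mem _ fun α _ => mul_mem_grPart (extFibLine_mem (hc α)) (coord_mem _ x) ?_
  rw [par_fibCoord]
  generalize R.par α = p
  clear * -
  revert ε p; decide

theorem weightNear_linear (hc : ∀ α, SmoothAt (c α) (basePt x)) :
    WeightNear (totalWeight D R) 1 (linear c) x :=
  WeightNear.sum _ (fun α _ => (SmoothAt.extFibLine (hc α)).mul (smoothAt_coord _ _))
    fun α _ => WeightNear.mul (SmoothAt.extFibLine (hc α)) (smoothAt_coord _ _)
      (weightNear_extFibLine (hc α)) (weightNear_coord _ _ _)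
      (by rw [totalWeight_fibCoord]; rfl)

/-- The restriction to the zero section. -/
def resLine (R : SuperDim) {D : SuperDim} (F : (D.antidual R).line.Fn) : D.line.Fn :=
  res (D := D.line) (D' := (D.antidual R).line) (Sum.map Sum.inl id) Sum.inl F

/-- The coefficients of a function which is linear in the fibre coordinates. -/
def coeff (F : (D.antidual R).line.Fn) (α : R.Coord) : D.line.Fn :=
  resLine R (twist (R.par α + 1) (pd (fibCoord D α) F))

variable {F : (D.antidual R).line.Fn} {y : D.line.ev → ℝ}

theorem SmoothAt.resLine (hF : SmoothAt F (zeroPt R y)) : SmoothAt (resLine R F) y :=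
  SmoothAt.res hF

theorem SmoothAt.coeff (hF : SmoothAt F (zeroPt R y)) (α : R.Coord) : SmoothAt (coeff F α) y :=
  SmoothAt.resLine ((hF.pd _).twist _)

theorem resLine_congr {F' : (D.antidual R).line.Fn} (h : F =ᶠ[𝓝 (zeroPt R y)] F') :
    SuperGeom.resLine R F y = SuperGeom.resLine R F' y := subst_congr h

theorem coeff_congr {F' : (D.antidual R).line.Fn} (h : F =ᶠ[𝓝 (zeroPt R y)] F') (α : R.Coord) :
    SuperGeom.coeff F α y = SuperGeom.coeff F' α y :=
  resLine_congr (twist_eventuallyEq _ (pd_eventuallyEq _ h))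

theorem resLine_mem {ε : ZMod 2} (hF : SmoothAt F (zeroPt R y)) (h : ParNear ε F (zeroPt R y)) :
    SuperGeom.resLine R F y ∈ grPart D.line ε := res_mem hF h

theorem coeff_mem {ε κ : ZMod 2} (hF : SmoothAt F (zeroPt R y)) (h : ParNear ε F (zeroPt R y))
    (α : R.Coord) (hκ : κ = ε + (R.par α + 1)) : SuperGeom.coeff F α y ∈ grPart D.line κ :=
  resLine_mem ((hF.pd _).twist _) ((h.pd hF _ (by rw [hκ, par_fibCoord])).twist _)

theorem eq_extFibLine_resLine (hF : ∀ x', basePt x' = basePt x → SmoothAt F x')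
    (hk : ∀ x', basePt x' = basePt x → WeightNear (totalWeight D R) 0 F x') :
    F x = SuperGeom.extFibLine R (SuperGeom.resLine R F) x :=
  eq_ext_res (D := D.line) (D' := (D.antidual R).line) sumMap_inl_id_injective Sum.inl_injective
    totalWeight_baseCoord totalWeight_of_notMem hF hk

theorem eq_zero_of_totalWeight (hF : ∀ x', basePt x' = basePt x → SmoothAt F x')
    (hk : ∀ x', basePt x' = basePt x → WeightNear (totalWeight D R) (-1) F x') : F x = 0 :=
  eq_zero_of_weightNear (D := D.line) (D' := (D.antidual R).line) (e := Sum.map Sum.inl id)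
    (o := Sum.inl) totalWeight_baseCoord totalWeight_of_notMem hF hk

/-- Euler's identity in weight one writes `F` as the sum of `η_α ∂F/∂η_α`, and these derivatives
have weight zero, hence come from the base. Moving `η_α` to the right accounts for the twist in
`coeff`. -/
theorem eq_linear_coeff (hF : ∀ x', basePt x' = basePt x → SmoothAt F x')
    (hk : ∀ x', basePt x' = basePt x → WeightNear (totalWeight D R) 1 F x') :
    F x = linear (SuperGeom.coeff F) x := by
  have h1 := (hk x rfl).self_of_nhds
  rw [Int.cast_one, one_smul, euler_apply] at h1
  rw [← h1, linear_apply]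
  symm
  refine Fintype.sum_of_injective (fibCoord D) fibCoord_injective _ _ ?_ ?_
  · intro Z hZ
    rcases total_coord_cases Z with ⟨A, rfl⟩ | ⟨α, rfl⟩
    · rw [totalWeight_baseCoord]
      simp
    · exact absurd ⟨α, rfl⟩ hZ
  · intro α
    rw [totalWeight_fibCoord, Int.cast_one, one_smul, mul_comm_tw (coord_mem _ x), par_fibCoord]
    congr 1
    rw [← twist_apply]
    refine (eq_extFibLine_resLine (fun x' hx' => ((hF x' hx').pd _).twist _)
      fun x' hx' => ?_).symm
    exact WeightNear.twist _ ((hF x' hx').pd _) (WeightNear.pd (hF x' hx') (hk x' hx') _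
      (by rw [totalWeight_fibCoord]; rfl))

theorem pd_fibCoord_linear (hc : ∀ α, SmoothAt (c α) (basePt x)) (α : R.Coord) :
    pd (fibCoord D α) (linear c) x = tw (R.par α + 1) (SuperGeom.extFibLine R (c α) x) := by
  classical
  have hs := fun α => SmoothAt.extFibLine (hc α)
  rw [linear, pd_sum _ _ fun β _ => (hs β).mul (smoothAt_coord _ _), Finset.sum_eq_single α]
  · rw [pd_mul _ (hs α) (smoothAt_coord _ _), pd_fibCoord_extFibLine (hc α), zero_mul, zero_add,
      pd_coord, if_pos rfl, mul_one, par_fibCoord]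
  · intro β _ hβ
    rw [pd_mul _ (hs β) (smoothAt_coord _ _), pd_fibCoord_extFibLine (hc β), zero_mul, zero_add,
      pd_coord, if_neg fun h => hβ (fibCoord_injective h).symm, mul_zero]
  · simp

theorem resLine_extFibLine (hf : SmoothAt f y) :
    SuperGeom.resLine R (SuperGeom.extFibLine R f) y = f y :=
  res_ext (D := D.line) (D' := (D.antidual R).line) sumMap_inl_id_injective Sum.inl_injective hf

/-- The left derivative by `η_α` passes the coefficient and twists it; the twist in `coeff` undoes
this. So a linear function determines its section. -/
theorem coeff_linear (hc : ∀ α, SmoothAt (c α) y) (α : R.Coord) :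
    SuperGeom.coeff (linear c) α y = c α y := by
  rw [SuperGeom.coeff, ← resLine_extFibLine (R := R) (hc α)]
  refine resLine_congr ?_
  have hb := (continuous_basePt (D := D) (R := R)).continuousAt (x := zeroPt R y)
  rw [ContinuousAt, basePt_zeroPt] at hb
  filter_upwards [hb.eventually (Filter.eventually_all.2 fun α => (hc α).eventually)] with z hz
  rw [twist_apply, pd_fibCoord_linear hz, tw_tw_self]

/-! Changes of coordinates. -/

variable {E : BundleGluing M R} {a b : M.Idx}

theorem total_trans_baseCoord (E : BundleGluing M R) (a b : M.Idx) (A : D.line.Coord) :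
    E.antidual.line.trans a b (baseCoord R A) =
      SuperGeom.extFibLine R (M.line.trans a b A) := by
  rcases line_coord_cases A with ⟨A, rfl⟩ | rfl
  · rw [baseCoord_lineBase]
    refine (line_trans_lineBase (M := E.antidual) a b _).trans ?_
    rw [antidual_trans_fibBase, line_trans_lineBase]
    unfold extLine extFib SuperGeom.extFibLine
    rw [ext_ext, ext_ext]
    rfl
  · rw [baseCoord_lineTime, line_trans_lineTime]
    exact (ext_coord (D := D.line) (D' := (D.antidual R).line) (Sum.map Sum.inl id) Sum.inl
      lineTime).symm

theorem total_trans_fibCoord (E : BundleGluing M R) (a b : M.Idx) (α : R.Coord) :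
    E.antidual.line.trans a b (fibCoord D α) = linear (E.pullbackLine.G a b α) := by
  refine (line_trans_lineBase (M := E.antidual) a b _).trans ?_
  rw [antidual_trans_eta]
  unfold extLine etaTrans extFib linear SuperGeom.extFibLine BundleGluing.pullbackLine extLine
  rw [ext_sum]
  refine Finset.sum_congr rfl fun β _ => ?_
  rw [ext_mul, ext_ext]
  dsimp only
  rw [ext_ext]
  congr 1
  exact extLine_coord (eta D β)

theorem basePt_body (E : BundleGluing M R) (a b : M.Idx) (x : (D.antidual R).line.ev → ℝ) :
    basePt (body (E.antidual.line.trans a b) x) = body (M.line.trans a b) (basePt x) :=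
  body_ext (D := D.line) (D' := D.line) (D₁ := (D.antidual R).line) (D₁' := (D.antidual R).line)
    (o := Sum.inl) (o' := Sum.inl) fun A => congrFun (total_trans_baseCoord E a b A) x

theorem subst_extFibLine (h : E.IsBundle) (hx : x ∈ E.antidual.line.ovl a b)
    (hf : SmoothAt f (body (M.line.trans a b) (basePt x))) :
    subst (E.antidual.line.trans a b) (SuperGeom.extFibLine R f) x =
      SuperGeom.extFibLine R (subst (M.line.trans a b) f) x :=
  subst_ext (D := D.line) (D' := D.line) (D₁ := (D.antidual R).line)
    (D₁' := (D.antidual R).line) (o := Sum.inl) (o' := Sum.inl) sumMap_inl_id_injective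
    Sum.inl_injective (fun A => congrFun (total_trans_baseCoord E a b A) x)
    (line_parAt h.antidual hx) (line_parAt (x := basePt x) h.base.isAtlas hx) hf

/-- The coefficients that result on the right are exactly those in the transformation law of
sections, which is why sections and linear functions correspond globally. -/
theorem subst_linear (h : E.IsBundle) (hx : x ∈ E.antidual.line.ovl a b)
    (hc : ∀ α, SmoothAt (c α) (body (M.line.trans a b) (basePt x))) :
    subst (E.antidual.line.trans a b) (linear c) x =
      linear (fun β => ∑ α, subst (M.line.trans a b) (c α) * E.pullbackLine.G a b α β) x := by
  have hp := line_parAt h.antidual hx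
  have hs : ∀ α, SmoothAt (SuperGeom.extFibLine R (c α)) (body (E.antidual.line.trans a b) x) :=
    fun α => SmoothAt.extFibLine (by rw [basePt_body]; exact hc α)
  have h1 : ∀ α, subst (E.antidual.line.trans a b)
      (SuperGeom.extFibLine R (c α) * coord (fibCoord D α)) x =
      ∑ β, SuperGeom.extFibLine R (subst (M.line.trans a b) (c α) *
        E.pullbackLine.G a b α β) x * coord (fibCoord D β) x := by
    intro α
    rw [subst_mul hp (hs α) (smoothAt_coord _ _), subst_coord hp, subst_extFibLine h hx (hc α),
      total_trans_fibCoord, linear_apply, Finset.mul_sum]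
    refine Finset.sum_congr rfl fun β _ => ?_
    unfold SuperGeom.extFibLine
    rw [ext_mul, Pi.mul_apply, mul_assoc]
  rw [linear, subst_sum _ fun α _ => (hs α).mul (smoothAt_coord _ _), linear_apply]
  simp only [h1]
  rw [Finset.sum_comm]
  refine Finset.sum_congr rfl fun β _ => ?_
  rw [← Finset.sum_mul, ← Finset.sum_apply]
  unfold SuperGeom.extFibLine
  rw [ext_sum]

end Total

end SuperGeom

end
noncomputable section
namespace SuperGeom

/-! ### The local Lie algebroid structure -/

section WeightedBracket

variable {D : SuperDim} {S : D.cot.Fn} {U : Set (D.ev → ℝ)} {w : D.Coord → ℤ} {k l m n : ℤ}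
  {f g : D.Fn} {y : D.ev → ℝ}

/-- Momenta carry the opposite weights of their coordinates, so a derivative by a momentum raises
the weight by that of the coordinate. -/
theorem IsQuadratic.weightNear_hess (hS : IsQuadratic S U)
    (hw : ∀ x : D.cot.ev → ℝ, x ∘ Sum.inl ∈ U → WeightNear (cotWeight w) k S x) (hy : y ∈ U)
    (A B : D.Coord) : WeightNear w (k + w A + w B) (hess S A B) y := by
  filter_upwards [hS.isOpen.mem_nhds hy] with z hz
  have hx : zeroCovector z ∘ Sum.inl ∈ U := hz
  have hs := hS.smoothAt_hess hz A B
  refine extCot_injective_at (g := ((k + w A + w B : ℤ) : ℝ) • hess S A B) ?_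
  have h1 : euler (cotWeight w) (extCot (hess S A B)) (zeroCovector z) =
      extCot (euler w (hess S A B)) (zeroCovector z) :=
    euler_ext (D := D) (D' := D.cot) Sum.inl_injective Sum.inl_injective
      (fun A => by rw [← pos_eq_map, cotWeight_pos]) hs
  have h2 : extCot (hess S A B) =ᶠ[𝓝 (zeroCovector z)] pd (mom B) (pd (mom A) S) := by
    filter_upwards [(continuous_comp_left (D := D) (D' := D.cot)
      Sum.inl).continuousAt.eventually (hS.isOpen.mem_nhds hx)] with v hv
    exact hS.extCot_hess hv A B
  have h3 : WeightNear (cotWeight w) (k + w A + w B) (pd (mom B) (pd (mom A) S))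
      (zeroCovector z) :=
    WeightNear.pd ((hS.smooth _ hx).pd _) (WeightNear.pd (l := k + w A) (hS.smooth _ hx) (hw _ hx) _
      (by rw [cotWeight_mom]; ring)) _ (by rw [cotWeight_mom]; ring)
  have h4 : extCot (((k + w A + w B : ℤ) : ℝ) • hess S A B) =
      ((k + w A + w B : ℤ) : ℝ) • extCot (hess S A B) := ext_smul _ _ _ _
  rw [← h1, euler_congr _ h2, h3.self_of_nhds, h4, Pi.smul_apply, h2.self_of_nhds]

/-- The weights which the Hessian gains from its two indices are lost again in the two derivatives;
only the weight of `S` is added. -/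
theorem IsQuadratic.weightNear_bracket (hS : IsQuadratic S U)
    (hw : ∀ x : D.cot.ev → ℝ, x ∘ Sum.inl ∈ U → WeightNear (cotWeight w) k S x) (hy : y ∈ U)
    (hf : SmoothAt f y) (hg : SmoothAt g y) (hl : WeightNear w l f y) (hm : WeightNear w m g y)
    (hn : n = k + l + m) : WeightNear w n (bracket S f g) y := by
  refine WeightNear.sum _ (fun B _ => (hS.smoothAt_hamVec hy hf B).mul (hg.pd B)) fun B _ => ?_
  refine WeightNear.mul (k := k + l + w B) (hS.smoothAt_hamVec hy hf B) (hg.pd B) ?_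
    (WeightNear.pd hg hm B) (by rw [hn]; ring)
  have hs := fun A => (hf.twist (D.par B + 1)).pd A
  refine WeightNear.neg (SmoothAt.sum _ fun A _ => (hS.smoothAt_hess hy A B).mul (hs A))
    (WeightNear.sum _ (fun A _ => (hS.smoothAt_hess hy A B).mul (hs A)) fun A _ => ?_)
  exact WeightNear.mul (hS.smoothAt_hess hy A B) (hs A) (hS.weightNear_hess hw hy A B)
    (WeightNear.pd (hf.twist _) (hl.twist _ hf) A) (by ring)

end WeightedBracket

/-! ### Bracket and anchor of local sections -/

section LocalAlgebroid

variable {D R : SuperDim}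

/-- The function `S` is a Schouten structure of weight minus one on `ΠE* × ℝ` over `U`. -/
structure IsSchoutenOver (S : (D.antidual R).line.cot.Fn) (U : Set (D.line.ev → ℝ)) : Prop where
  isOpen : IsOpen U
  isQuadratic : IsQuadratic S (basePt ⁻¹' U)
  self_commutes : ∀ x : (D.antidual R).line.cot.ev → ℝ, x ∘ Sum.inl ∈ basePt ⁻¹' U →
    poisson S S x = 0
  weight : ∀ x : (D.antidual R).line.cot.ev → ℝ, x ∘ Sum.inl ∈ basePt ⁻¹' U →
    WeightNear (cotWeight (totalWeight D R)) (-1) S x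

/-- The components of a local section are smooth. -/
def SmoothSection (U : Set (D.line.ev → ℝ)) (u : R.Coord → D.line.Fn) : Prop :=
  ∀ α, ∀ y ∈ U, SmoothAt (u α) y

/-- The parity of a local section. -/
def ParSection (U : Set (D.line.ev → ℝ)) (ε : ZMod 2) (u : R.Coord → D.line.Fn) : Prop :=
  ∀ α, ∀ y ∈ U, u α y ∈ grPart D.line (ε + R.par α)

/-- The bracket of local sections. -/
def localBr (S : (D.antidual R).line.cot.Fn) (u v : R.Coord → D.line.Fn) (α : R.Coord) :
    D.line.Fn := coeff (bracket S (linear u) (linear v)) α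

/-- The anchor of a local section. -/
def localAn (S : (D.antidual R).line.cot.Fn) (u : R.Coord → D.line.Fn) (A : D.line.Coord) :
    D.line.Fn := resLine R (bracket S (linear u) (coord (baseCoord R A)))

variable {S : (D.antidual R).line.cot.Fn} {U : Set (D.line.ev → ℝ)}
  {u v w u' v' : R.Coord → D.line.Fn} {f : D.line.Fn} {y : D.line.ev → ℝ}
  {x : (D.antidual R).line.ev → ℝ} {ε δ κ : ZMod 2}

theorem SmoothSection.linear (hu : SmoothSection U u) (hx : basePt x ∈ U) :
    SmoothAt (linear u) x := smoothAt_linear fun α => hu α _ hx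

theorem ParSection.linear (hu : ParSection U ε u) (hU : IsOpen U) (hx : basePt x ∈ U) :
    ParNear (ε + 1) (SuperGeom.linear u) x := by
  filter_upwards [(hU.preimage continuous_basePt).mem_nhds hx] with z hz
  exact linear_mem fun α => hu α _ hz

theorem zeroPt_mem (hy : y ∈ U) : basePt (zeroPt R y) ∈ U := by
  rw [basePt_zeroPt]; exact hy

/-- The weight is `-1 + 1 + 1 = 1`, and functions of weight one are linear along the fibres. -/
theorem IsSchoutenOver.bracket_eq_linear (hS : IsSchoutenOver S U) (hu : SmoothSection U u)
    (hv : SmoothSection U v) (hx : basePt x ∈ U) :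
    bracket S (linear u) (linear v) x = linear (localBr S u v) x := by
  refine eq_linear_coeff (fun x' hx' => ?_) fun x' hx' => ?_
  · exact hS.isQuadratic.smoothAt_bracket (hx' ▸ hx :) (hu.linear (hx' ▸ hx)) (hv.linear (hx' ▸ hx))
  · exact hS.isQuadratic.weightNear_bracket hS.weight (hx' ▸ hx :) (hu.linear (hx' ▸ hx))
      (hv.linear (hx' ▸ hx)) (weightNear_linear fun α => hu α _ (hx' ▸ hx))
      (weightNear_linear fun α => hv α _ (hx' ▸ hx)) (by norm_num)

theorem IsSchoutenOver.bracket_eventuallyEq_linear (hS : IsSchoutenOver S U)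
    (hu : SmoothSection U u) (hv : SmoothSection U v) (hx : basePt x ∈ U) :
    bracket S (linear u) (linear v) =ᶠ[𝓝 x] linear (localBr S u v) := by
  filter_upwards [(hS.isOpen.preimage continuous_basePt).mem_nhds hx] with z hz
  exact hS.bracket_eq_linear hu hv hz

/-- The weight is `-1 + 1 + 0 = 0`, so the components of the anchor live on the base. -/
theorem IsSchoutenOver.bracket_coord_eq (hS : IsSchoutenOver S U) (hu : SmoothSection U u)
    (hx : basePt x ∈ U) (A : D.line.Coord) :
    bracket S (linear u) (coord (baseCoord R A)) x = extFibLine R (localAn S u A) x := by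
  refine eq_extFibLine_resLine (fun x' hx' => ?_) fun x' hx' => ?_
  · exact hS.isQuadratic.smoothAt_bracket (hx' ▸ hx :) (hu.linear (hx' ▸ hx)) (smoothAt_coord _ _)
  · exact hS.isQuadratic.weightNear_bracket hS.weight (hx' ▸ hx :) (hu.linear (hx' ▸ hx))
      (smoothAt_coord _ _) (weightNear_linear fun α => hu α _ (hx' ▸ hx))
      (weightNear_coord _ _ _) (by rw [totalWeight_baseCoord]; rfl)

/-- The weight is `-1 + 0 + 0`, and there are no nonzero functions of weight -1. The anchor owes its
linearity over functions to this. -/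
theorem IsSchoutenOver.bracket_extFibLine_coord (hS : IsSchoutenOver S U)
    (hf : ∀ y ∈ U, SmoothAt f y) (hx : basePt x ∈ U) (A : D.line.Coord) :
    bracket S (extFibLine R f) (coord (baseCoord R A)) x = 0 := by
  refine eq_zero_of_totalWeight (fun x' hx' => ?_) fun x' hx' => ?_
  · exact hS.isQuadratic.smoothAt_bracket (hx' ▸ hx :) (SmoothAt.extFibLine (hf _ (hx' ▸ hx)))
      (smoothAt_coord _ _)
  · exact hS.isQuadratic.weightNear_bracket hS.weight (hx' ▸ hx :)
      (SmoothAt.extFibLine (hf _ (hx' ▸ hx))) (smoothAt_coord _ _)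
      (weightNear_extFibLine (hf _ (hx' ▸ hx))) (weightNear_coord _ _ _)
      (by rw [totalWeight_baseCoord]; rfl)

/-- The anchor is the Schouten bracket with functions on the base. -/
theorem IsSchoutenOver.bracket_extFibLine (hS : IsSchoutenOver S U) (hu : SmoothSection U u)
    (hx : basePt x ∈ U) (hf : SmoothAt f (basePt x)) :
    bracket S (linear u) (extFibLine R f) x =
      extFibLine R (∑ A, localAn S u A * pd A f) x := by
  have h1 : extFibLine R (∑ A, localAn S u A * pd A f) x =
      ∑ A, extFibLine R (localAn S u A) x * extFibLine R (pd A f) x := by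
    unfold extFibLine
    simp only [ext_sum, ext_mul, Finset.sum_apply, Pi.mul_apply]
  rw [h1, bracket_apply]
  symm
  refine Fintype.sum_of_injective (baseCoord R) baseCoord_injective _ _ ?_ ?_
  · intro Z hZ
    rcases total_coord_cases Z with ⟨A, rfl⟩ | ⟨α, rfl⟩
    · exact absurd ⟨A, rfl⟩ hZ
    · rw [pd_fibCoord_extFibLine hf, mul_zero]
  · intro A
    rw [pd_baseCoord_extFibLine hf, ← bracket_coord, hS.bracket_coord_eq hu hx]

theorem IsSchoutenOver.smoothAt_localBr (hS : IsSchoutenOver S U) (hu : SmoothSection U u)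
    (hv : SmoothSection U v) : SmoothSection U (localBr S u v) := fun α _ hy =>
  SmoothAt.coeff (hS.isQuadratic.smoothAt_bracket (zeroPt_mem hy) (hu.linear (zeroPt_mem hy))
    (hv.linear (zeroPt_mem hy))) α

theorem IsSchoutenOver.smoothAt_localAn (hS : IsSchoutenOver S U) (hu : SmoothSection U u)
    (hy : y ∈ U) (A : D.line.Coord) : SmoothAt (localAn S u A) y :=
  SmoothAt.resLine (hS.isQuadratic.smoothAt_bracket (zeroPt_mem hy) (hu.linear (zeroPt_mem hy))
    (smoothAt_coord _ _))

/-- The bracket is determined by the associated linear function. -/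
theorem IsSchoutenOver.localBr_eq (hS : IsSchoutenOver S U) (hw : SmoothSection U w)
    (h : ∀ x, basePt x ∈ U → bracket S (linear u) (linear v) x = linear w x) (hy : y ∈ U)
    (α : R.Coord) : localBr S u v α y = w α y := by
  refine (coeff_congr ?_ α).trans (coeff_linear (fun α => hw α y hy) α)
  filter_upwards [(hS.isOpen.preimage continuous_basePt).mem_nhds (zeroPt_mem hy)] with z hz
  exact h z hz

theorem IsSchoutenOver.localAn_eq (_ : IsSchoutenOver S U) {A : D.line.Coord}
    (h : ∀ x, basePt x ∈ U →
      extFibLine R (localAn S u A) x = extFibLine R f x) (hy : y ∈ U) :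
    localAn S u A y = f y := by
  have h1 := extFibLine_injective_at (h (zeroPt R y) (zeroPt_mem hy))
  rwa [basePt_zeroPt] at h1

theorem linear_eventuallyEq (hU : IsOpen U) (h : ∀ α, ∀ y ∈ U, u α y = u' α y)
    (hx : basePt x ∈ U) : linear u =ᶠ[𝓝 x] linear u' := by
  filter_upwards [(hU.preimage continuous_basePt).mem_nhds hx] with z hz
  exact linear_congr fun α => h α _ hz

theorem IsSchoutenOver.localBr_congr (hS : IsSchoutenOver S U)
    (hu : ∀ α, ∀ y ∈ U, u α y = u' α y) (hv : ∀ α, ∀ y ∈ U, v α y = v' α y) (hy : y ∈ U)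
    (α : R.Coord) : localBr S u v α y = localBr S u' v' α y :=
  coeff_congr (bracket_eventuallyEq (linear_eventuallyEq hS.isOpen hu (zeroPt_mem hy))
    (linear_eventuallyEq hS.isOpen hv (zeroPt_mem hy))) α

theorem IsSchoutenOver.localBr_mem (hS : IsSchoutenOver S U) (hu : SmoothSection U u)
    (hv : SmoothSection U v) (hε : ParSection U ε u) (hδ : ParSection U δ v) :
    ParSection U (ε + δ) (localBr S u v) := by
  intro α y hy
  have hx := zeroPt_mem (R := R) hy
  refine coeff_mem (hS.isQuadratic.smoothAt_bracket hx (hu.linear hx) (hv.linear hx))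
    (hS.isQuadratic.bracket_parNear hx (hu.linear hx) (hv.linear hx) (hε.linear hS.isOpen hx)
      (hδ.linear hS.isOpen hx)) α ?_
  generalize R.par α = p
  clear * -
  revert ε δ p; decide

theorem IsSchoutenOver.localAn_mem (hS : IsSchoutenOver S U) (hu : SmoothSection U u)
    (hε : ParSection U ε u) (hy : y ∈ U) (A : D.line.Coord) :
    localAn S u A y ∈ grPart D.line (ε + D.line.par A) := by
  have hx := zeroPt_mem (R := R) hy
  refine resLine_mem (hS.isQuadratic.smoothAt_bracket hx (hu.linear hx) (smoothAt_coord _ _))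
    (hS.isQuadratic.bracket_parNear hx (hu.linear hx) (smoothAt_coord _ _)
      (hε.linear hS.isOpen hx) (.of_forall (coord_mem _)) ?_)
  rw [par_baseCoord]
  generalize D.line.par A = p
  clear * -
  revert ε p; decide

theorem SmoothSection.add (hu : SmoothSection U u) (hv : SmoothSection U v) :
    SmoothSection U (u + v) := fun α y hy => (hu α y hy).add (hv α y hy)

theorem SmoothSection.smul (r : ℝ) (hu : SmoothSection U u) : SmoothSection U (r • u) :=
  fun α y hy => (hu α y hy).smul r

theorem SmoothSection.mul (hf : ∀ y ∈ U, SmoothAt f y) (hu : SmoothSection U u) :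
    SmoothSection U (fun α => f * u α) := fun α y hy => (hf y hy).mul (hu α y hy)

theorem IsSchoutenOver.localBr_add_left (hS : IsSchoutenOver S U) (hu : SmoothSection U u)
    (hv : SmoothSection U v) (hw : SmoothSection U w) (hy : y ∈ U) (α : R.Coord) :
    localBr S (u + v) w α y = localBr S u w α y + localBr S v w α y := by
  refine hS.localBr_eq (w := localBr S u w + localBr S v w)
    ((hS.smoothAt_localBr hu hw).add (hS.smoothAt_localBr hv hw)) (fun x hx => ?_) hy α
  rw [linear_add, linear_add, bracket_add_left (hu.linear hx) (hv.linear hx), Pi.add_apply,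
    hS.bracket_eq_linear hu hw hx, hS.bracket_eq_linear hv hw hx]

theorem IsSchoutenOver.localBr_add_right (hS : IsSchoutenOver S U) (hu : SmoothSection U u)
    (hv : SmoothSection U v) (hw : SmoothSection U w) (hy : y ∈ U) (α : R.Coord) :
    localBr S u (v + w) α y = localBr S u v α y + localBr S u w α y := by
  refine hS.localBr_eq (w := localBr S u v + localBr S u w)
    ((hS.smoothAt_localBr hu hv).add (hS.smoothAt_localBr hu hw)) (fun x hx => ?_) hy α
  rw [linear_add, linear_add, bracket_add_right (hv.linear hx) (hw.linear hx), Pi.add_apply,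
    hS.bracket_eq_linear hu hv hx, hS.bracket_eq_linear hu hw hx]

theorem IsSchoutenOver.localBr_smul_left (hS : IsSchoutenOver S U) (r : ℝ)
    (hu : SmoothSection U u) (hv : SmoothSection U v) (hy : y ∈ U) (α : R.Coord) :
    localBr S (r • u) v α y = r • localBr S u v α y := by
  refine hS.localBr_eq (w := r • localBr S u v) ((hS.smoothAt_localBr hu hv).smul r)
    (fun x hx => ?_) hy α
  rw [linear_smul, linear_smul, bracket_smul_left _ (hu.linear hx), Pi.smul_apply,
    hS.bracket_eq_linear hu hv hx]

theorem IsSchoutenOver.localBr_smul_right (hS : IsSchoutenOver S U) (r : ℝ)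
    (hu : SmoothSection U u) (hv : SmoothSection U v) (hy : y ∈ U) (α : R.Coord) :
    localBr S u (r • v) α y = r • localBr S u v α y := by
  refine hS.localBr_eq (w := r • localBr S u v) ((hS.smoothAt_localBr hu hv).smul r)
    (fun x hx => ?_) hy α
  rw [linear_smul, linear_smul, bracket_smul_right _ (hv.linear hx), Pi.smul_apply,
    hS.bracket_eq_linear hu hv hx]

theorem IsSchoutenOver.localAn_add (hS : IsSchoutenOver S U) (hu : SmoothSection U u)
    (hv : SmoothSection U v) (hy : y ∈ U) (A : D.line.Coord) :
    localAn S (u + v) A y = localAn S u A y + localAn S v A y := by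
  refine hS.localAn_eq (f := localAn S u A + localAn S v A) (fun x hx => ?_) hy
  have h1 : extFibLine R (localAn S u A + localAn S v A) =
      extFibLine R (localAn S u A) + extFibLine R (localAn S v A) := ext_add _ _ _ _
  rw [← hS.bracket_coord_eq (hu.add hv) hx, linear_add,
    bracket_add_left (hu.linear hx) (hv.linear hx), h1, Pi.add_apply,
    hS.bracket_coord_eq hu hx, hS.bracket_coord_eq hv hx]

/-- In the Leibniz rule for the first argument the term that differentiates `f` is the bracket of
two functions of the base and vanishes by weight. -/
theorem IsSchoutenOver.localAn_mul (hS : IsSchoutenOver S U) (hf : ∀ y ∈ U, SmoothAt f y)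
    (hu : SmoothSection U u) (hy : y ∈ U) (A : D.line.Coord) :
    localAn S (fun α => f * u α) A y = f y * localAn S u A y := by
  refine hS.localAn_eq (f := f * localAn S u A) (fun x hx => ?_) hy
  have h1 : extFibLine R (f * localAn S u A) =
      extFibLine R f * extFibLine R (localAn S u A) := ext_mul _ _ _ _
  rw [← hS.bracket_coord_eq (hu.mul hf) hx, linear_mul, bracket_coord,
    hS.isQuadratic.hamVec_mul hx (SmoothAt.extFibLine (hf _ hx)) (hu.linear hx),
    ← bracket_coord, ← bracket_coord, hS.bracket_extFibLine_coord hf hx, zero_mul, zero_add, h1,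
    Pi.mul_apply, hS.bracket_coord_eq hu hx]

/-- Passing from a section to its linear function shifts the parity by one, and the odd bracket
shifts it once more; the two shifts cancel in the sign. -/
theorem IsSchoutenOver.localBr_skew (hS : IsSchoutenOver S U) (hu : SmoothSection U u)
    (hv : SmoothSection U v) (hε : ParSection U ε u) (hδ : ParSection U δ v) (hy : y ∈ U)
    (α : R.Coord) : localBr S u v α y = -(sgn (ε * δ) • localBr S v u α y) := by
  have h1 : -(sgn (ε * δ) • localBr S v u α y) = ((-sgn (ε * δ)) • localBr S v u) α y :=
    (neg_smul _ _).symm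
  rw [h1]
  refine hS.localBr_eq ((hS.smoothAt_localBr hv hu).smul _) (fun x hx => ?_) hy α
  rw [linear_smul, Pi.smul_apply, neg_smul, hS.isQuadratic.bracket_skew hx (hu.linear hx)
    (hv.linear hx) (hε.linear hS.isOpen hx) (hδ.linear hS.isOpen hx),
    hS.bracket_eq_linear hv hu hx]
  congr 3
  clear * -
  revert ε δ; decide

/-- Inner brackets are replaced by the Schouten brackets of linear functions, with which they agree
near every point over `U`; then the identity for functions applies. -/
theorem IsSchoutenOver.localBr_jacobi (hS : IsSchoutenOver S U) (hu : SmoothSection U u)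
    (hv : SmoothSection U v) (hw : SmoothSection U w) (hε : ParSection U ε u)
    (hδ : ParSection U δ v) (hy : y ∈ U) (α : R.Coord) :
    localBr S u (localBr S v w) α y = localBr S (localBr S u v) w α y +
      sgn (ε * δ) • localBr S v (localBr S u w) α y := by
  have huv := hS.smoothAt_localBr hu hv
  have huw := hS.smoothAt_localBr hu hw
  have hvw := hS.smoothAt_localBr hv hw
  refine hS.localBr_eq (w := localBr S (localBr S u v) w +
    sgn (ε * δ) • localBr S v (localBr S u w)) ((hS.smoothAt_localBr huv hw).add
    ((hS.smoothAt_localBr hv huw).smul _)) (fun x hx => ?_) hy α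
  have refl := fun F : (D.antidual R).line.Fn => Filter.EventuallyEq.refl (𝓝 x) F
  rw [linear_add, linear_smul, Pi.add_apply, Pi.smul_apply, ← hS.bracket_eq_linear huv hw hx,
    ← hS.bracket_eq_linear hv huw hx,
    ← bracket_congr (refl _) (hS.bracket_eventuallyEq_linear hv hw hx),
    ← bracket_congr (hS.bracket_eventuallyEq_linear hu hv hx) (refl _),
    ← bracket_congr (refl _) (hS.bracket_eventuallyEq_linear hu hw hx),
    hS.isQuadratic.bracket_jacobi hS.self_commutes hx (hu.linear hx) (hv.linear hx)
    (hw.linear hx) (hε.linear hS.isOpen hx) (hδ.linear hS.isOpen hx)]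
  congr 3
  clear * -
  revert ε δ; decide

/-- The linear function of `u` has parity `ε + 1`, so the sign `tw (ε + 1 + 1)` of the odd bracket
becomes the sign of `ε` acting on `f`. -/
theorem IsSchoutenOver.localBr_leibniz (hS : IsSchoutenOver S U) (hu : SmoothSection U u)
    (hv : SmoothSection U v) (hf : ∀ y ∈ U, SmoothAt f y) (hε : ParSection U ε u)
    (hδ : ∀ y ∈ U, f y ∈ grPart D.line δ) (hy : y ∈ U) (α : R.Coord) :
    localBr S u (fun α => f * v α) α y = (∑ A, localAn S u A * pd A f) y * v α y +
      sgn (ε * δ) • (f y * localBr S u v α y) := by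
  have ha : ∀ y ∈ U, SmoothAt (∑ A, localAn S u A * pd A f) y := fun y hy =>
    SmoothAt.sum _ fun A _ => (hS.smoothAt_localAn hu hy A).mul ((hf y hy).pd A)
  refine hS.localBr_eq (w := (fun α => (∑ A, localAn S u A * pd A f) * v α) +
    sgn (ε * δ) • fun α => f * localBr S u v α) ((hv.mul ha).add
    (((hS.smoothAt_localBr hu hv).mul hf).smul _)) (fun x hx => ?_) hy α
  have h1 : tw (ε + 1 + 1) (extFibLine R f x) = sgn (ε * δ) • extFibLine R f x := by
    rw [tw_of_mem (extFibLine_mem (hδ _ hx))]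
    congr 2
    clear * -
    revert ε δ; decide
  rw [linear_add, linear_smul, linear_mul, linear_mul, linear_mul, Pi.add_apply, Pi.smul_apply,
    Pi.mul_apply, Pi.mul_apply, hS.isQuadratic.bracket_mul hx (hu.linear hx)
    (SmoothAt.extFibLine (hf _ hx)) (hv.linear hx) (hε.linear hS.isOpen hx),
    hS.bracket_extFibLine hu hx (hf _ hx), hS.bracket_eq_linear hu hv hx, h1, smul_mul_assoc]

end LocalAlgebroid

end SuperGeom

end
noncomputable section
namespace SuperGeom

/-! ### The Lie algebroid of a Schouten structure of weight minus one -/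

section Algebroid

variable {D R : SuperDim} {M : Gluing D} {E : BundleGluing M R}

/-- The Lie bracket of sections of `proj* E`. -/
def algebroidBr (S : E.antidual.line.cot.Fam) (u v : E.pullbackLine.SFam) :
    E.pullbackLine.SFam :=
  fun (a : M.Idx) α => (M.line.dom a).indicator (localBr (S a) (u a) (v a) α)

/-- The anchor of `proj* E`. -/
def algebroidAn (S : E.antidual.line.cot.Fam) (u : E.pullbackLine.SFam) : M.line.VFam :=
  fun (a : M.Idx) A => (M.line.dom a).indicator (localAn (S a) (u a) A)

/-- Comparison of two charts takes place over their overlap, which is smaller than either domain. -/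
theorem IsSchoutenOver.mono {S : (D.antidual R).line.cot.Fn} {U V : Set (D.line.ev → ℝ)}
    (h : IsSchoutenOver S U) (hV : IsOpen V) (hVU : V ⊆ U) : IsSchoutenOver S V where
  isOpen := hV
  isQuadratic :=
    { isOpen := hV.preimage continuous_basePt
      smooth := fun x hx => h.isQuadratic.smooth x (hVU hx)
      odd := h.isQuadratic.odd
      weight := fun x hx => h.isQuadratic.weight x (hVU hx) }
  self_commutes x hx := h.self_commutes x (hVU hx)
  weight x hx := h.weight x (hVU hx)

theorem Gluing.IsSchouten.isSchoutenOver (h : E.IsBundle) {S : E.antidual.line.cot.Fam}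
    (hS : E.antidual.line.IsSchouten S)
    (hw : E.antidual.line.cot.HasWeight (cotWeight (totalWeight D R)) (-1) S) (a : M.Idx) :
    IsSchoutenOver (S a) (M.line.dom a) where
  isOpen := h.base.isAtlas.line.isOpen_dom a
  isQuadratic := hS.isQuadratic h.antidual.line a
  self_commutes x hx := hS.self_commutes a x hx
  weight _ hx := hw.weightNear (isOpen_cot_dom h.antidual.line a) hx

theorem BundleGluing.IsSection.smoothSection (h : E.IsBundle) {u : E.pullbackLine.SFam}
    (hu : E.pullbackLine.IsSection u) (a : M.Idx) : SmoothSection (M.line.dom a) (u a) :=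
  fun α _ hy => (hu.smooth a α).smoothAt (h.base.isAtlas.line.isOpen_dom a) hy

theorem BundleGluing.SHasParity.parSection {ε : ZMod 2} {u : E.pullbackLine.SFam}
    (hu : E.pullbackLine.SHasParity ε u) (a : M.Idx) (U : Set (D.line.ev → ℝ)) :
    ParSection U ε (u a) := fun α y _ => hu a α y

theorem linear_compat (h : E.IsBundle) {u : E.pullbackLine.SFam}
    (hu : E.pullbackLine.IsSection u) {a b : M.Idx} {x : (D.antidual R).line.ev → ℝ}
    (hx : x ∈ E.antidual.line.ovl a b) :
    subst (E.antidual.line.trans a b) (linear (u b)) x = linear (u a) x := by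
  rw [subst_linear h hx fun α => hu.smoothSection h b α _
    (h.base.isAtlas.line.body_mem_dom (x := basePt x) hx)]
  refine linear_congr fun β => ?_
  refine Eq.trans ?_ (hu.compat a b β (basePt x) hx).symm
  simp only [Finset.sum_apply, Pi.mul_apply]

theorem indicator_eventuallyEq {U : Set (D.ev → ℝ)} (hU : IsOpen U) (f : D.Fn) {y : D.ev → ℝ}
    (hy : y ∈ U) : f =ᶠ[𝓝 y] U.indicator f := by
  filter_upwards [hU.mem_nhds hy] with z hz
  rw [Set.indicator_of_mem hz]

theorem smoothOn_indicator {U : Set (D.ev → ℝ)} (hU : IsOpen U) {f : D.Fn}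
    (hf : ∀ y ∈ U, SmoothAt f y) : SmoothOn (U.indicator f) U :=
  smoothOn_of_smoothAt fun y hy => (hf y hy).congr (indicator_eventuallyEq hU f hy)

theorem indicator_mem {U : Set (D.ev → ℝ)} {f : D.Fn} {ε : ZMod 2}
    (hf : ∀ y ∈ U, f y ∈ grPart D ε) (y : D.ev → ℝ) : U.indicator f y ∈ grPart D ε := by
  by_cases hy : y ∈ U
  · rw [Set.indicator_of_mem hy]
    exact hf y hy
  · rw [Set.indicator_of_notMem hy]
    exact Submodule.zero_mem _

variable {S : E.antidual.line.cot.Fam}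

theorem bracket_linear_compat (h : E.IsBundle) (hS : E.antidual.line.IsSchouten S)
    {u : E.pullbackLine.SFam} (hu : E.pullbackLine.IsSection u) {a b : M.Idx}
    {x : (D.antidual R).line.ev → ℝ} (hx : x ∈ E.antidual.line.ovl a b)
    {g : (D.antidual R).line.Fn} (hg : SmoothAt g (body (E.antidual.line.trans a b) x)) :
    subst (E.antidual.line.trans a b) (bracket (S b) (linear (u b)) g) x =
      bracket (S a) (linear (u a)) (subst (E.antidual.line.trans a b) g) x := by
  have hb : basePt (body (E.antidual.line.trans a b) x) ∈ M.line.dom b :=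
    h.antidual.line.body_mem_dom hx
  refine (bracket_compat h.antidual.line hS hx ((hu.smoothSection h b).linear hb) hg).trans ?_
  refine bracket_congr ?_ (Filter.EventuallyEq.refl _ _)
  filter_upwards [(h.antidual.line.isOpen_ovl a b).mem_nhds hx] with z hz
  exact linear_compat h hu hz

/-- Components are compared through their linear functions: the bracket is invariant under the chart
change by `bracket_linear_compat`, and linear functions transform as sections. -/
theorem algebroidBr_isSection (h : E.IsBundle) (hS : E.antidual.line.IsSchouten S)
    (hw : E.antidual.line.cot.HasWeight (cotWeight (totalWeight D R)) (-1) S)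
    {u v : E.pullbackLine.SFam} (hu : E.pullbackLine.IsSection u)
    (hv : E.pullbackLine.IsSection v) : E.pullbackLine.IsSection (algebroidBr S u v) where
  smooth := fun (a : M.Idx) α => smoothOn_indicator (h.base.isAtlas.line.isOpen_dom a)
    ((hS.isSchoutenOver h hw a).smoothAt_localBr (hu.smoothSection h a) (hv.smoothSection h a) α)
  zero_off := fun (a : M.Idx) α y hy => Set.indicator_of_notMem hy _
  compat := fun (a b : M.Idx) β y hy => by
    have hA := h.base.isAtlas.line
    have ha := hA.ovl_subset a b hy
    have hSa := hS.isSchoutenOver h hw a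
    have hSb := hS.isSchoutenOver h hw b
    have hub := hu.smoothSection h b
    have hvb := hv.smoothSection h b
    have hsb := hSb.smoothAt_localBr hub hvb
    set ψ := M.line.trans a b with hψ
    have h1 : localBr (S a) (u a) (v a) β y =
        (fun β => ∑ α, subst ψ (localBr (S b) (u b) (v b) α) * E.pullbackLine.G a b α β) β y := by
      -- Restricted to the overlap, the transformed components form a smooth section with the
      -- required linear function, and coefficients are unique.
      refine (hSa.mono (hA.isOpen_ovl a b) (hA.ovl_subset a b)).localBr_eq (u := u a) (v := v a)
        (w := fun β => ∑ α, subst ψ (localBr (S b) (u b) (v b) α) * E.pullbackLine.G a b α β)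
        ?_ (fun x hx => ?_) hy β
      · intro β y hy
        exact SmoothAt.sum _ fun α _ => (smoothAt_subst (hA.morAt hy)
          (hsb α _ (hA.body_mem_dom hy))).mul (h.pullbackLine.smoothAt hy α β)
      · have hx' : x ∈ E.antidual.line.ovl a b := hx
        have hb : basePt (body (E.antidual.line.trans a b) x) ∈ M.line.dom b :=
          h.antidual.line.body_mem_dom hx'
        have h2 := bracket_linear_compat h hS hu hx' (hvb.linear hb)
        have h3 : subst (E.antidual.line.trans a b) (linear (v b)) =ᶠ[𝓝 x] linear (v a) := by
          filter_upwards [(h.antidual.line.isOpen_ovl a b).mem_nhds hx'] with z hz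
          exact linear_compat h hv hz
        rw [bracket_congr (Filter.EventuallyEq.refl _ _) h3] at h2
        rw [← h2, subst_congr (hSb.bracket_eventuallyEq_linear hub hvb hb)]
        refine subst_linear h hx' fun α => hsb α _ ?_
        exact hA.body_mem_dom (x := basePt x) hx
    have h4 : ∀ α, subst ψ (algebroidBr S u v b α) y =
        subst ψ (localBr (S b) (u b) (v b) α) y := fun α =>
      subst_congr (indicator_eventuallyEq (hA.isOpen_dom b) _ (hA.body_mem_dom hy)).symm
    refine (Set.indicator_of_mem ha _).trans (h1.trans ((Finset.sum_apply y _ _).trans ?_))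
    exact Finset.sum_congr rfl fun α _ =>
      congrArg (fun z : D.line.Gr => z * E.pullbackLine.G a b α β y) (h4 α).symm

/-- The anchor applied to the coordinates of the second chart is computed in both charts; the
bracket of a linear with a basic function yields the transformation law of vector fields. -/
theorem algebroidAn_isVectorField (h : E.IsBundle) (hS : E.antidual.line.IsSchouten S)
    (hw : E.antidual.line.cot.HasWeight (cotWeight (totalWeight D R)) (-1) S)
    {u : E.pullbackLine.SFam} (hu : E.pullbackLine.IsSection u) :
    M.line.IsVectorField (algebroidAn S u) where
  smooth := fun (a : M.Idx) A => smoothOn_indicator (h.base.isAtlas.line.isOpen_dom a)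
    fun y hy => (hS.isSchoutenOver h hw a).smoothAt_localAn (hu.smoothSection h a) hy A
  zero_off := fun (a : M.Idx) A y hy => Set.indicator_of_notMem hy _
  compat := fun (a b : M.Idx) A y hy => by
    have hA := h.base.isAtlas.line
    have ha := hA.ovl_subset a b hy
    have hSa := hS.isSchoutenOver h hw a
    have hSb := hS.isSchoutenOver h hw b
    have hub := hu.smoothSection h b
    set ψ := M.line.trans a b with hψ
    -- One point of the fibre suffices, since the pullback of base functions is injective at every
    -- point.
    have hx : basePt (zeroPt R y) ∈ M.line.ovl a b := zeroPt_mem hy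
    have hx' : zeroPt R y ∈ E.antidual.line.ovl a b := hx
    have hb : basePt (body (E.antidual.line.trans a b) (zeroPt R y)) ∈ M.line.dom b :=
      h.antidual.line.body_mem_dom hx'
    have h1 : subst ψ (localAn (S b) (u b) A) y =
        (∑ B, localAn (S a) (u a) B * pd B (ψ A)) y := by
      have h2 : extFibLine R (subst ψ (localAn (S b) (u b) A)) (zeroPt R y) =
          extFibLine R (∑ B, localAn (S a) (u a) B * pd B (ψ A)) (zeroPt R y) := by
        rw [← hSa.bracket_extFibLine (hu.smoothSection h a) (hA.ovl_subset a b hx)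
            (hA.smoothAt hx A), ← subst_extFibLine h hx'
            (hSb.smoothAt_localAn hub (hA.body_mem_dom hx) A)]
        have h3 : extFibLine R (localAn (S b) (u b) A)
            =ᶠ[𝓝 (body (E.antidual.line.trans a b) (zeroPt R y))]
            bracket (S b) (linear (u b)) (coord (baseCoord R A)) := by
          filter_upwards [(hSb.isOpen.preimage continuous_basePt).mem_nhds hb] with z hz
          exact (hSb.bracket_coord_eq hub hz A).symm
        rw [subst_congr h3, bracket_linear_compat h hS hu hx' (smoothAt_coord _ _)]
        refine bracket_congr (Filter.EventuallyEq.refl _ _) ?_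
        filter_upwards [(h.antidual.line.isOpen_ovl a b).mem_nhds hx'] with z hz
        rw [subst_coord (line_parAt h.antidual hz)]
        exact congrFun (total_trans_baseCoord E a b A) z
      have h4 := extFibLine_injective_at h2
      rwa [basePt_zeroPt] at h4
    have h5 : subst ψ (algebroidAn S u b A) y = subst ψ (localAn (S b) (u b) A) y :=
      subst_congr (indicator_eventuallyEq (hA.isOpen_dom b) _ (hA.body_mem_dom hy)).symm
    refine h5.trans (h1.trans ?_)
    rw [Finset.sum_apply]
    exact Finset.sum_congr rfl fun B _ =>
      congrArg (fun z : D.line.Gr => z * pd B (ψ A) y) (Set.indicator_of_mem ha _).symm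

/-- Two sections which vanish outside of the domains agree if they agree on the domains. -/
theorem algebroidBr_ext {s : E.pullbackLine.SFam} {u v : E.pullbackLine.SFam}
    (h : ∀ a : M.Idx, ∀ α, ∀ y ∈ M.line.dom a, localBr (S a) (u a) (v a) α y = s a α y)
    (h0 : ∀ a : M.Idx, ∀ α, ∀ y ∉ M.line.dom a, s a α y = 0) : algebroidBr S u v = s := by
  funext (a : M.Idx) α y
  by_cases hy : y ∈ M.line.dom a
  · exact (Set.indicator_of_mem hy _).trans (h a α y hy)
  · exact (Set.indicator_of_notMem hy _).trans (h0 a α y hy).symm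

theorem algebroidAn_ext {X : M.line.VFam} {u : E.pullbackLine.SFam}
    (h : ∀ a : M.Idx, ∀ A, ∀ y ∈ M.line.dom a, localAn (S a) (u a) A y = X a A y)
    (h0 : ∀ a : M.Idx, ∀ A, ∀ y ∉ M.line.dom a, X a A y = 0) : algebroidAn S u = X := by
  funext (a : M.Idx) A y
  by_cases hy : y ∈ M.line.dom a
  · exact (Set.indicator_of_mem hy _).trans (h a A y hy)
  · exact (Set.indicator_of_notMem hy _).trans (h0 a A y hy).symm

theorem algebroidBr_of_mem (u v : E.pullbackLine.SFam) {a : M.Idx} {y : D.line.ev → ℝ}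
    (hy : y ∈ M.line.dom a) (α : R.Coord) :
    algebroidBr S u v a α y = localBr (S a) (u a) (v a) α y := Set.indicator_of_mem hy _

theorem algebroidBr_of_notMem (u v : E.pullbackLine.SFam) {a : M.Idx} {y : D.line.ev → ℝ}
    (hy : y ∉ M.line.dom a) (α : R.Coord) :
    algebroidBr S u v a α y = 0 := Set.indicator_of_notMem hy _

theorem algebroidAn_of_mem (u : E.pullbackLine.SFam) {a : M.Idx} {y : D.line.ev → ℝ}
    (hy : y ∈ M.line.dom a) (A : D.line.Coord) :
    algebroidAn S u a A y = localAn (S a) (u a) A y := Set.indicator_of_mem hy _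

theorem algebroidAn_of_notMem (u : E.pullbackLine.SFam) {a : M.Idx} {y : D.line.ev → ℝ}
    (hy : y ∉ M.line.dom a) (A : D.line.Coord) :
    algebroidAn S u a A y = 0 := Set.indicator_of_notMem hy _

theorem act_algebroidAn_of_mem (u : E.pullbackLine.SFam) (f : M.line.Fam) {a : M.Idx}
    {y : D.line.ev → ℝ} (hy : y ∈ M.line.dom a) :
    M.line.act (algebroidAn S u) f a y = (∑ A, localAn (S a) (u a) A * pd A (f a)) y := by
  rw [Finset.sum_apply]
  refine (Finset.sum_apply y _ _).trans ?_
  exact Finset.sum_congr rfl fun A _ =>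
    congrArg (fun z : D.line.Gr => z * pd A (f a) y) (algebroidAn_of_mem u hy A)

/-- The extension by zero changes nothing on the open chart domain, and the local bracket depends
only on values there. -/
theorem localBr_algebroidBr_right (h : E.IsBundle) (hS : E.antidual.line.IsSchouten S)
    (hw : E.antidual.line.cot.HasWeight (cotWeight (totalWeight D R)) (-1) S)
    (u v w : E.pullbackLine.SFam) {a : M.Idx} {y : D.line.ev → ℝ} (hy : y ∈ M.line.dom a)
    (α : R.Coord) : localBr (S a) (u a) (algebroidBr S v w a) α y =
      localBr (S a) (u a) (localBr (S a) (v a) (w a)) α y :=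
  (hS.isSchoutenOver h hw a).localBr_congr (fun _ _ _ => rfl)
    (fun α _ hz => algebroidBr_of_mem v w hz α) hy α

theorem localBr_algebroidBr_left (h : E.IsBundle) (hS : E.antidual.line.IsSchouten S)
    (hw : E.antidual.line.cot.HasWeight (cotWeight (totalWeight D R)) (-1) S)
    (u v w : E.pullbackLine.SFam) {a : M.Idx} {y : D.line.ev → ℝ} (hy : y ∈ M.line.dom a)
    (α : R.Coord) : localBr (S a) (algebroidBr S u v a) (w a) α y =
      localBr (S a) (localBr (S a) (u a) (v a)) (w a) α y :=
  (hS.isSchoutenOver h hw a).localBr_congr (fun α _ hz => algebroidBr_of_mem u v hz α)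
    (fun _ _ _ => rfl) hy α

theorem algebroidBr_mem (h : E.IsBundle) (hS : E.antidual.line.IsSchouten S)
    (hw : E.antidual.line.cot.HasWeight (cotWeight (totalWeight D R)) (-1) S) {ε δ : ZMod 2}
    {u v : E.pullbackLine.SFam} (hu : E.pullbackLine.IsSection u)
    (hv : E.pullbackLine.IsSection v) (hε : E.pullbackLine.SHasParity ε u)
    (hδ : E.pullbackLine.SHasParity δ v) :
    E.pullbackLine.SHasParity (ε + δ) (algebroidBr S u v) :=
  fun (a : M.Idx) α y => indicator_mem ((hS.isSchoutenOver h hw a).localBr_mem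
    (hu.smoothSection h a) (hv.smoothSection h a) (hε.parSection a _) (hδ.parSection a _) α) y

theorem algebroidBr_skew (h : E.IsBundle) (hS : E.antidual.line.IsSchouten S)
    (hw : E.antidual.line.cot.HasWeight (cotWeight (totalWeight D R)) (-1) S) {ε δ : ZMod 2}
    {u v : E.pullbackLine.SFam} (hu : E.pullbackLine.IsSection u)
    (hv : E.pullbackLine.IsSection v) (hε : E.pullbackLine.SHasParity ε u)
    (hδ : E.pullbackLine.SHasParity δ v) :
    algebroidBr S u v = -(sgn (ε * δ) • algebroidBr S v u) := by
  refine algebroidBr_ext (fun a α y hy => ?_) fun a α y hy => ?_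
  · refine ((hS.isSchoutenOver h hw a).localBr_skew (hu.smoothSection h a) (hv.smoothSection h a)
      (hε.parSection a _) (hδ.parSection a _) hy α).trans ?_
    rw [← algebroidBr_of_mem v u hy]
    rfl
  · change -(sgn (ε * δ) • algebroidBr S v u a α y) = 0
    rw [algebroidBr_of_notMem v u hy, smul_zero, neg_zero]

theorem algebroidBr_smul_right (h : E.IsBundle) (hS : E.antidual.line.IsSchouten S)
    (hw : E.antidual.line.cot.HasWeight (cotWeight (totalWeight D R)) (-1) S) (r : ℝ)
    {u v : E.pullbackLine.SFam} (hu : E.pullbackLine.IsSection u)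
    (hv : E.pullbackLine.IsSection v) :
    algebroidBr S u (r • v) = r • algebroidBr S u v := by
  refine algebroidBr_ext (fun a α y hy => ?_) fun a α y hy => ?_
  · refine ((hS.isSchoutenOver h hw a).localBr_smul_right r (hu.smoothSection h a)
      (hv.smoothSection h a) hy α).trans ?_
    rw [← algebroidBr_of_mem u v hy]
    rfl
  · change r • algebroidBr S u v a α y = 0
    rw [algebroidBr_of_notMem u v hy, smul_zero]

theorem algebroidBr_jacobi (h : E.IsBundle) (hS : E.antidual.line.IsSchouten S)
    (hw : E.antidual.line.cot.HasWeight (cotWeight (totalWeight D R)) (-1) S) {ε δ : ZMod 2}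
    {u v w : E.pullbackLine.SFam} (hu : E.pullbackLine.IsSection u)
    (hv : E.pullbackLine.IsSection v) (hw' : E.pullbackLine.IsSection w)
    (hε : E.pullbackLine.SHasParity ε u) (hδ : E.pullbackLine.SHasParity δ v) :
    algebroidBr S u (algebroidBr S v w) = algebroidBr S (algebroidBr S u v) w +
      sgn (ε * δ) • algebroidBr S v (algebroidBr S u w) := by
  refine algebroidBr_ext (fun a α y hy => ?_) fun a α y hy => ?_
  · change _ = algebroidBr S (algebroidBr S u v) w a α y +
      sgn (ε * δ) • algebroidBr S v (algebroidBr S u w) a α y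
    rw [localBr_algebroidBr_right h hS hw u v w hy, algebroidBr_of_mem _ _ hy,
      algebroidBr_of_mem _ _ hy, localBr_algebroidBr_right h hS hw v u w hy,
      localBr_algebroidBr_left h hS hw u v w hy]
    exact (hS.isSchoutenOver h hw a).localBr_jacobi (hu.smoothSection h a)
      (hv.smoothSection h a) (hw'.smoothSection h a) (hε.parSection a _) (hδ.parSection a _) hy α
  · change algebroidBr S (algebroidBr S u v) w a α y +
      sgn (ε * δ) • algebroidBr S v (algebroidBr S u w) a α y = 0
    rw [algebroidBr_of_notMem _ _ hy, algebroidBr_of_notMem _ _ hy, smul_zero, add_zero]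

/-- On chart domains each axiom is its local counterpart; outside, both sides vanish by the
extension by zero. -/
theorem isLieAlgebroid (h : E.IsBundle) (hS : E.antidual.line.IsSchouten S)
    (hw : E.antidual.line.cot.HasWeight (cotWeight (totalWeight D R)) (-1) S) :
    E.pullbackLine.IsLieAlgebroid (algebroidBr S) (algebroidAn S) where
  isBundle := h.pullbackLine
  isSection u v hu hv := algebroidBr_isSection h hS hw hu hv
  isVectorField u hu := algebroidAn_isVectorField h hS hw hu
  br_parity ε δ u v hu hv hε hδ := algebroidBr_mem h hS hw hu hv hε hδ
  an_parity ε u hu hε := fun (a : M.Idx) A y => indicator_mem (fun _ hz =>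
    (hS.isSchoutenOver h hw a).localAn_mem (hu.smoothSection h a) (hε.parSection a _) hz A) y
  br_add_left u v w hu hv hw' := by
    refine algebroidBr_ext (fun a α y hy => ?_) fun a α y hy => ?_
    · change _ = algebroidBr S u w a α y + algebroidBr S v w a α y
      rw [algebroidBr_of_mem _ _ hy, algebroidBr_of_mem _ _ hy]
      exact (hS.isSchoutenOver h hw a).localBr_add_left (hu.smoothSection h a)
        (hv.smoothSection h a) (hw'.smoothSection h a) hy α
    · change algebroidBr S u w a α y + algebroidBr S v w a α y = 0
      rw [algebroidBr_of_notMem _ _ hy, algebroidBr_of_notMem _ _ hy, add_zero]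
  br_add_right u v w hu hv hw' := by
    refine algebroidBr_ext (fun a α y hy => ?_) fun a α y hy => ?_
    · change _ = algebroidBr S u v a α y + algebroidBr S u w a α y
      rw [algebroidBr_of_mem _ _ hy, algebroidBr_of_mem _ _ hy]
      exact (hS.isSchoutenOver h hw a).localBr_add_right (hu.smoothSection h a)
        (hv.smoothSection h a) (hw'.smoothSection h a) hy α
    · change algebroidBr S u v a α y + algebroidBr S u w a α y = 0
      rw [algebroidBr_of_notMem _ _ hy, algebroidBr_of_notMem _ _ hy, add_zero]
  br_smul_left r u v hu hv := by
    refine algebroidBr_ext (fun a α y hy => ?_) fun a α y hy => ?_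
    · change _ = r • algebroidBr S u v a α y
      rw [algebroidBr_of_mem _ _ hy]
      exact (hS.isSchoutenOver h hw a).localBr_smul_left r (hu.smoothSection h a)
        (hv.smoothSection h a) hy α
    · change r • algebroidBr S u v a α y = 0
      rw [algebroidBr_of_notMem _ _ hy, smul_zero]
  br_smul_right r u v hu hv := algebroidBr_smul_right h hS hw r hu hv
  an_add u v hu hv := by
    refine algebroidAn_ext (fun a A y hy => ?_) fun a A y hy => ?_
    · change _ = algebroidAn S u a A y + algebroidAn S v a A y
      rw [algebroidAn_of_mem _ hy, algebroidAn_of_mem _ hy]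
      exact (hS.isSchoutenOver h hw a).localAn_add (hu.smoothSection h a)
        (hv.smoothSection h a) hy A
    · change algebroidAn S u a A y + algebroidAn S v a A y = 0
      rw [algebroidAn_of_notMem _ hy, algebroidAn_of_notMem _ hy, add_zero]
  an_smul f u hf hu := by
    refine algebroidAn_ext (fun a A y hy => ?_) fun a A y hy => ?_
    · change _ = f a y * algebroidAn S u a A y
      rw [algebroidAn_of_mem _ hy]
      exact (hS.isSchoutenOver h hw a).localAn_mul
        (fun z hz => hf.smoothAt (h.base.isAtlas.line.isOpen_dom a) hz) (hu.smoothSection h a) hy A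
    · change f a y * algebroidAn S u a A y = 0
      rw [algebroidAn_of_notMem _ hy, mul_zero]
  skew ε δ u v hu hv hε hδ := algebroidBr_skew h hS hw hu hv hε hδ
  jacobi ε δ κ u v w hu hv hw' hε hδ hκ := by
    have huv := algebroidBr_isSection h hS hw hu hv
    have huw := algebroidBr_isSection h hS hw hu hw'
    -- The cyclic form of the Jacobi identity follows from its derivation form: skew symmetry
    -- rewrites `[w,u]` and the outer bracket `[w,[u,v]]`, after which all terms cancel in pairs.
    rw [algebroidBr_skew h hS hw hw' hu hκ hε, ← neg_smul,
      algebroidBr_smul_right h hS hw _ hv huw,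
      algebroidBr_skew h hS hw hw' huv hκ (algebroidBr_mem h hS hw hu hv hε hδ),
      algebroidBr_jacobi h hS hw hu hv hw' hε hδ, smul_add, smul_neg, smul_smul, smul_smul,
      smul_smul, mul_neg, neg_smul, ← sgn_add, ← sgn_add, ← sgn_add]
    have e1 : κ * δ + κ * (ε + δ) = ε * κ := by clear * -; revert ε δ κ; decide
    have e2 : ε * κ + ε * δ = δ * ε + κ * ε := by clear * -; revert ε δ κ; decide
    rw [e1, e2]
    abel
  leibniz ε δ u f v hu hf hv hε hδ := by
    refine algebroidBr_ext (fun a α y hy => ?_) fun a α y hy => ?_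
    · change _ = M.line.act (algebroidAn S u) f a y * v a α y +
        sgn (ε * δ) • (f a y * algebroidBr S u v a α y)
      rw [algebroidBr_of_mem _ _ hy, act_algebroidAn_of_mem u f hy]
      exact (hS.isSchoutenOver h hw a).localBr_leibniz (hu.smoothSection h a)
        (hv.smoothSection h a) (fun z hz => hf.smoothAt (h.base.isAtlas.line.isOpen_dom a) hz)
        (hε.parSection a _) (fun z _ => hδ a z) hy α
    · change M.line.act (algebroidAn S u) f a y * v a α y +
        sgn (ε * δ) • (f a y * algebroidBr S u v a α y) = 0
      rw [algebroidBr_of_notMem _ _ hy, hv.zero_off a α y hy, mul_zero, mul_zero, smul_zero,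
        add_zero]

theorem extCot_linearFn_algebroidBr (h : E.IsBundle) (hS : E.antidual.line.IsSchouten S)
    (hw : E.antidual.line.cot.HasWeight (cotWeight (totalWeight D R)) (-1) S)
    {u v : E.pullbackLine.SFam} (hu : E.pullbackLine.IsSection u)
    (hv : E.pullbackLine.IsSection v) {a : M.Idx} {x : (D.antidual R).line.cot.ev → ℝ}
    (hx : x ∈ E.antidual.line.cot.dom a) :
    extCot (E.linearFn (algebroidBr S u v) a) x =
      schoutenBracket (S a) (E.linearFn u a) (E.linearFn v a) x := by
  have hSa := hS.isSchoutenOver h hw a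
  have hua := hu.smoothSection h a
  have hva := hv.smoothSection h a
  have hx' : basePt (x ∘ Sum.inl) ∈ M.line.dom a := hx
  rw [linearFn_eq, linearFn_eq, linearFn_eq, hSa.isQuadratic.schoutenBracket_eq hx
    (hua.linear hx') (hva.linear hx')]
  refine ext_apply_congr (D := (D.antidual R).line) (D' := (D.antidual R).line.cot) _ _ ?_
  rw [hSa.bracket_eq_linear hua hva hx']
  exact linear_congr fun α => algebroidBr_of_mem u v hx' α

/-- The bracket with a base function is a derivation in that function, so its values on the
coordinates, which are the components of the anchor, determine it
(`IsSchoutenOver.bracket_extFibLine`). -/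
theorem extCot_pullFn_algebroidAn (h : E.IsBundle) (hS : E.antidual.line.IsSchouten S)
    (hw : E.antidual.line.cot.HasWeight (cotWeight (totalWeight D R)) (-1) S)
    {u : E.pullbackLine.SFam} {f : M.line.Fam} (hu : E.pullbackLine.IsSection u)
    (hf : M.line.IsFunction f) {a : M.Idx} {x : (D.antidual R).line.cot.ev → ℝ}
    (hx : x ∈ E.antidual.line.cot.dom a) :
    extCot (E.pullFn (M.line.act (algebroidAn S u) f) a) x =
      schoutenBracket (S a) (E.linearFn u a) (E.pullFn f a) x := by
  have hSa := hS.isSchoutenOver h hw a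
  have hua := hu.smoothSection h a
  have hx' : basePt (x ∘ Sum.inl) ∈ M.line.dom a := hx
  have hfa : SmoothAt (f a) (basePt (x ∘ Sum.inl)) :=
    hf.smoothAt (h.base.isAtlas.line.isOpen_dom a) hx'
  have h1 : ∀ g : M.line.Fam, E.pullFn g a = extFibLine R (g a) := fun _ => rfl
  rw [linearFn_eq, h1, h1, hSa.isQuadratic.schoutenBracket_eq hx (hua.linear hx')
    (SmoothAt.extFibLine hfa)]
  refine ext_apply_congr (D := (D.antidual R).line) (D' := (D.antidual R).line.cot) _ _ ?_
  rw [hSa.bracket_extFibLine hua hx' hfa]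
  refine extFibLine_congr ?_
  exact act_algebroidAn_of_mem u f hx'

end Algebroid

end SuperGeom

end

open SuperGeom

theorem mainTheorem11 {D R : SuperDim} {M : Gluing D} (E : BundleGluing M R)
    (S : E.antidual.cot.Fam) (Q : E.antidual.VFam) (h : E.IsJacobiAlgebroid S Q) :
    (E.antidual.line.IsSchouten (E.antidual.schoutenization S Q) ∧
      E.antidual.line.cot.HasWeight (cotWeight (lineWeight (etaWeight D R))) (-1)
        (E.antidual.schoutenization S Q)) ∧
    ∃ (br : E.pullbackLine.SFam → E.pullbackLine.SFam → E.pullbackLine.SFam)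
      (an : E.pullbackLine.SFam → M.line.VFam),
      E.pullbackLine.IsLieAlgebroid br an ∧
      (∀ u v, E.pullbackLine.IsSection u → E.pullbackLine.IsSection v →
        ∀ a, ∀ x ∈ E.antidual.line.cot.dom a,
          extCot (E.linearFn (br u v) a) x =
            schoutenBracket (E.antidual.schoutenization S Q a) (E.linearFn u a)
              (E.linearFn v a) x) ∧
      (∀ u f, E.pullbackLine.IsSection u → M.line.IsFunction f →
        ∀ a, ∀ x ∈ E.antidual.line.cot.dom a,
          extCot (E.pullFn (M.line.act (an u) f) a) x =
            schoutenBracket (E.antidual.schoutenization S Q a) (E.linearFn u a)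
              (E.pullFn f a) x) := by
  have hw := schoutenization_cotWeight h.isBundle.antidual h.isOddJacobi h.weight_S h.weight_Q
  have hS := schoutenization_isSchouten h.isBundle.antidual h.isOddJacobi
  exact ⟨⟨hS, hw⟩, algebroidBr _, algebroidAn _, isLieAlgebroid h.isBundle hS hw,
    fun u v hu hv a x hx => extCot_linearFn_algebroidBr h.isBundle hS hw hu hv hx,
    fun u f hu hf a x hx => extCot_pullFn_algebroidAn h.isBundle hS hw hu hf hx⟩
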